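/- Let $V=\mathbb{C}^2$ with standard basis $e_1,e_2$, and $V_n=\mathrm{Sym}^n V$, realised as the symmetric tensors in $V^{\otimes n}$. A \emph{spin network} is a graph drawn in a horizontal strip of the plane, possibly with crossings of edges. It has trivalent vertices, free ends at the bottom or the top of the strip, and possibly closed curves without vertices (which also count as edges). Its edges are labelled by integers $n\ge 0$ (the representation $V_n$ of $\mathrm{SL}(2,\mathbb{C})$), and the labels $a,b,c$ at each vertex are admissible: $a+b+c$ is even and the triangle inequalities hold. The drawing is in general position: it is a stack of horizontal slices, each consisting of vertical edges and exactly one cup (local minimum), cap (local maximum), crossing of two edges, or vertex, where a vertex has two of its edges on one side (above or below) and the third on the other side. A spin network $\mathsf{T}$ with free ends labelled $a_1,\dots,a_r$ at the bottom and $b_1,\dots,b_s$ at the top is read as a linear map $V_{a_1}\otimes\cdots\otimes V_{a_r}\to V_{b_1}\otimes\cdots\otimes V_{b_s}$, the composition of the maps of its slices from bottom to top. For the map of a slice, replace each edge labelled $n$ by $n$ parallel strands, and join the strands at a vertex with labels $a,b,c$ without crossings, $(b+c-a)/2$ of them running between the edges $b$ and $c$, and similarly for the other pairs. Read a single-strand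 cup as $e_1\otimes e_2-e_2\otimes e_1$, a single-strand cap as $v\otimes w\mapsto\det[v\;w]$, a crossing as the exchange of factors, and objects side by side as tensor products. Then symmetrize the strands of each edge. An \emph{expansion} $D$ of $\mathsf{T}$ is a diagram of strands obtained in this way from the whole of $\mathsf{T}$ when in each symmetrizer one permutation is chosen (between any two slices, and at the bottom and top, there is a symmetrizer on each edge). A strand of $D$ runs through the vertices of $\mathsf{T}$, and is either closed or has two free ends. The number $k(D)$ of \emph{kinks} is the sum over all strands of the number of superfluous pairs of a maximum and a minimum: $\lfloor E/2\rfloor$ for a strand with free ends and $E$ local extrema, and $E/2-1$ for a closed strand. The number $x(D)$ of \emph{crossed extrema} is the number of places where a strand, after turning back, crosses itself. Two spin networks $\mathsf{T}_1,\mathsf{T}_2$ with the same labelled free ends are \emph{topologically equivalent} if there is an isomorphism $\varphi$ (a homeomorphism up to isotopy) between their underlying graphs that preserves the position of each free end and the label of each edge. Expansions $D_1$ of $\mathsf{T}_1$ and $D_2$ of $\mathsf{T}_2$ \emph{correspond} under $\varphi$ if there is a bijection between the segments into which the vertices cut the strands of $D_1$ and those of $D_2$ that lies over $\varphi$ on edges,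 preserves the free ends of strands, and preserves which segments are joined at each vertex between each pair of its edge ends. \textbf{Proposition.} Let $\mathsf{T}_1$ and $\mathsf{T}_2$ be topologically equivalent spin networks, by an equivalence $\varphi$ that respects the position of free ends and the labels on edges. Then there are expansions $D_1$ of $\mathsf{T}_1$ and $D_2$ of $\mathsf{T}_2$ that correspond under $\varphi$, and for all such $D_1,D_2$ $$\mathsf{T}_1=(-1)^{k+x}\,\mathsf{T}_2\quad\text{as linear maps},\qquad k=k(D_1)+k(D_2),\quad x=x(D_1)+x(D_2).$$ -/

import Mathlib

/-!
Spin networks as generic plane drawings, read from bottom to top in horizontal slices, their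
functions, their expansions into strands, and topological equivalence.

An edge label `n` stands for the irreducible representation `V_n = Sym^n (ℂ²)` of `SL(2, ℂ)`,
realised as the symmetric tensors in `(ℂ²)^{⊗ n}`.
-/

namespace Spin

/-! ### Pieces and slices of a drawing -/

/-- `thru a b c = (b + c - a) / 2` is the number of strands that run between the edges labelled
`b` and `c` when a vertex with the admissible triple of labels `a, b, c` is expanded. -/
def thru (a b c : ℕ) : ℕ := (b + c - a) / 2

/-- The admissible triples: the sum is even and the triangle inequalities hold. -/
def AdmissibleTriple (a b c : ℕ) : Prop :=
  Even (a + b + c) ∧ a ≤ b + c ∧ b ≤ a + c ∧ c ≤ a + b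

/-- The elementary pieces of a drawing. The Boolean names a horizontal line that bounds the piece:
`false` is the line below it, `true` the line above it.
* `turn true n` is a cup, `turn false n` a cap, on an edge labelled `n`;
* `cross a b` is a crossing of two edges, `a` on the left and `b` on the right at the bottom;
* `vertex s a b c` is a trivalent vertex with the edges `a`, `b` (left, right) attached on the
  side `s`, and the edge `c` on the other side. -/
inductive Piece : Type
  | turn (s : Bool) (n : ℕ)
  | cross (a b : ℕ)
  | vertex (s : Bool) (a b c : ℕ)

/-- The labels of the edges of a piece that end on the line `t`, from left to right. -/
def Piece.ends : Piece → Bool → List ℕ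
  | .turn s n, t => if t = s then [n, n] else []
  | .cross a b, t => if t = false then [a, b] else [b, a]
  | .vertex s a b c, t => if t = s then [a, b] else [c]

/-- The labels around a vertex have to form an admissible triple. -/
def Piece.Admissible : Piece → Prop
  | .vertex _ a b c => AdmissibleTriple a b c
  | _ => True

/-- Whether the piece is a vertex. -/
def Piece.IsVertex : Piece → Prop
  | .vertex _ _ _ _ => True
  | _ => False

/-- A horizontal slice of a drawing in general position: one piece, with vertical edges (given by
their labels) to the left and to the right of it. -/
structure Slice : Type where
  left : List ℕ
  piece : Piece
  right : List ℕ

/-- The labels of the edges that meet the bottom line (`false`) or the top line (`true`). -/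
def Slice.ends (s : Slice) (t : Bool) : List ℕ := s.left ++ s.piece.ends t ++ s.right

/-- A spin network with free ends labelled `A` at the bottom and `B` at the top (from left to
right): a stack of slices, read from bottom to top, with admissible vertices. -/
inductive SpinNet : List ℕ → List ℕ → Type
  | nil (A : List ℕ) : SpinNet A A
  | cons {B : List ℕ} (s : Slice) (hs : s.piece.Admissible) (T : SpinNet (s.ends true) B) :
      SpinNet (s.ends false) B

/-! ### Arcs

Everything that is drawn between two consecutive horizontal lines is a list of arcs. An arc is given
by its two end points, each of them a line (`false`: lower, `true`: upper) and a place on it.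
The places on a line are numbered `j = 0, 1, …` for edges, and `(j, i)` for the `i`-th strand of
the `j`-th edge; the order from left to right is lexicographic. An arc between the two lines is
monotone and is listed with its lower end first; an arc with both ends on one line is a single cup or
cap and is listed with its left end first. -/

/-- Arcs between two consecutive lines. -/
abbrev Arc (α : Type) : Type := (Bool × α) × (Bool × α)

/-- The monotone arc from the place `p` on the line `s` to the place `q` on the other line. -/
def legArc {α : Type} (s : Bool) (p q : α) : Arc α :=
  if s then ((false, q), (true, p)) else ((false, p), (true, q))

/-- The strands of a piece that has `l` edges to the left of it. Each edge labelled `n` is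
expanded into `n` parallel strands; at a vertex the strands are joined without crossings. -/
def Piece.strandArcs (l : ℕ) : Piece → List (Arc (ℕ × ℕ))
  | .turn s n => (List.range n).map fun i => ((s, (l, i)), (s, (l + 1, n - 1 - i)))
  | .cross a b =>
      ((List.range a).map fun i => ((false, (l, i)), (true, (l + 1, i)))) ++
      ((List.range b).map fun i => ((false, (l + 1, i)), (true, (l, i))))
  | .vertex s a b c =>
      ((List.range (thru b a c)).map fun i => legArc s (l, i) (l, i)) ++
      ((List.range (thru c a b)).map fun i =>
        ((s, (l, thru b a c + i)), (s, (l + 1, thru c a b - 1 - i)))) ++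
      ((List.range (thru a b c)).map fun i =>
        legArc s (l + 1, thru c a b + i) (l, thru b a c + i))

/-- The edges of a piece that has `l` edges to the left of it; three edges end at a vertex, which
is not itself part of an edge. -/
def Piece.edgeArcs (l : ℕ) : Piece → List (Arc ℕ)
  | .turn s _ => [((s, l), (s, l + 1))]
  | .cross _ _ => [((false, l), (true, l + 1)), ((false, l + 1), (true, l))]
  | .vertex _ _ _ _ => []

/-- The edges that pass vertically through a slice to the left and to the right of its piece. -/
def Slice.sideEdgeArcs (s : Slice) : List (Arc ℕ) :=
  ((List.range s.left.length).map fun j => ((false, j), (true, j))) ++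
  ((List.range s.right.length).map fun j =>
    ((false, s.left.length + (s.piece.ends false).length + j),
      (true, s.left.length + (s.piece.ends true).length + j)))

/-- The strands of these vertical edges. -/
def Slice.sideStrandArcs (s : Slice) : List (Arc (ℕ × ℕ)) :=
  ((List.range s.left.length).flatMap fun j =>
    (List.range (s.left.getD j 0)).map fun i => ((false, (j, i)), (true, (j, i)))) ++
  ((List.range s.right.length).flatMap fun j =>
    (List.range (s.right.getD j 0)).map fun i =>
      ((false, (s.left.length + (s.piece.ends false).length + j, i)),
        (true, (s.left.length + (s.piece.ends true).length + j, i))))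

/-- The edges in a slice. -/
def Slice.edgeArcs (s : Slice) : List (Arc ℕ) :=
  s.sideEdgeArcs ++ s.piece.edgeArcs s.left.length

/-- The strands in a slice. -/
def Slice.strandArcs (s : Slice) : List (Arc (ℕ × ℕ)) :=
  s.sideStrandArcs ++ s.piece.strandArcs s.left.length

/-! ### The function of a spin network -/

/-- The standard basis of the tensor product of the spaces `(ℂ²)^{⊗ n}`, `n` in `A`: one of the two
basis vectors of `ℂ²` for every strand. -/
abbrev Word (A : List ℕ) : Type := (j : Fin A.length) → Fin A[j] → Fin 2

/-- The letter of a word on the `i`-th strand of the `j`-th edge. -/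
def Word.letter {A : List ℕ} (x : Word A) (p : ℕ × ℕ) : Fin 2 :=
  if h : p.1 < A.length then
    if h' : p.2 < A[p.1] then x ⟨p.1, h⟩ ⟨p.2, h'⟩ else 0
  else 0

/-- A permutation of the strands within each edge. -/
abbrev EdgePerm (A : List ℕ) : Type := (j : Fin A.length) → Equiv.Perm (Fin A[j])

/-- The word with permuted strands. -/
def Word.permute {A : List ℕ} (σ : EdgePerm A) (x : Word A) : Word A := fun j i => x j (σ j i)

/-- `det [e_u, e_v]` for the standard basis of `ℂ²`, so `1` for `(0, 1)`, `-1` for `(1, 0)` and `0`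
for equal indices. It is the matrix of the single-strand cap `v ⊗ w ↦ det [v, w]` and the
coefficient of `e_u ⊗ e_v` in the single-strand cup `e_1 ⊗ e_2 - e_2 ⊗ e_1`. -/
def eps (u v : Fin 2) : ℂ := (v.val : ℂ) - (u.val : ℂ)

/-- The matrix entry of a single arc between the letters at its ends. -/
def arcWeight {A B : List ℕ} (x : Word A) (y : Word B) (a : Arc (ℕ × ℕ)) : ℂ :=
  let u := if a.1.1 then y.letter a.1.2 else x.letter a.1.2
  let v := if a.2.1 then y.letter a.2.2 else x.letter a.2.2
  if a.1.1 = a.2.1 then eps u v else if u = v then 1 else 0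

/-- The linear map of the strands in a slice, from the tensors below it to the tensors above it. A
tensor is given by its coordinates in the basis `Word`; arcs side by side are tensored. -/
noncomputable def Slice.strandMap (s : Slice) :
    (Word (s.ends false) → ℂ) →ₗ[ℂ] (Word (s.ends true) → ℂ) :=
  Matrix.mulVecLin (Matrix.of fun y x => (s.strandArcs.map (arcWeight x y)).prod)

/-- The tensor product of the representations `V_n`, `n` in `A`: the tensors that are symmetric in
the strands of each edge. -/
def SymTensor (A : List ℕ) : Submodule ℂ (Word A → ℂ) where
  carrier := {f | ∀ (σ : EdgePerm A) (x : Word A), f (x.permute σ) = f x}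
  add_mem' := by
    intro f g hf hg σ x
    simp [hf σ x, hg σ x]
  zero_mem' := by
    intro σ x
    rfl
  smul_mem' := by
    intro c f hf σ x
    simp [hf σ x]

/-- Symmetrization on every edge: the average over all permutations of the strands of each edge. -/
noncomputable def symmetrize (A : List ℕ) : (Word A → ℂ) →ₗ[ℂ] SymTensor A where
  toFun f :=
    ⟨fun x => (Fintype.card (EdgePerm A) : ℂ)⁻¹ * ∑ σ : EdgePerm A, f (x.permute σ), by
      intro τ x
      have h : ∑ σ : EdgePerm A, f ((x.permute τ).permute σ) = ∑ σ : EdgePerm A, f (x.permute σ) :=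
        Fintype.sum_equiv (Equiv.mulLeft τ) (fun σ => f ((x.permute τ).permute σ))
          (fun σ => f (x.permute σ)) (fun σ => rfl)
      simp only [h]⟩
  map_add' := by
    intro f g
    ext x
    simp [Finset.sum_add_distrib, mul_add]
  map_smul' := by
    intro c f
    ext x
    simp [← Finset.mul_sum, mul_left_comm]

/-- The function of a slice: expand every edge into strands, and symmetrize the strands of every
edge. -/
noncomputable def Slice.fn (s : Slice) :
    SymTensor (s.ends false) →ₗ[ℂ] SymTensor (s.ends true) :=
  symmetrize (s.ends true) ∘ₗ s.strandMap ∘ₗ (SymTensor (s.ends false)).subtype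

/-- The function of a spin network: the composition of the functions of its slices. -/
noncomputable def SpinNet.fn : {A B : List ℕ} → SpinNet A B → (SymTensor A →ₗ[ℂ] SymTensor B)
  | _, _, .nil _ => LinearMap.id
  | _, _, .cons s _ T => T.fn ∘ₗ s.fn

/-! ### Lines and layers

Between any two slices, and at the two ends, there is a layer that contains only the vertical edges;
in an expansion of the network it contains the permutations that come from the symmetrizers. So
the layer `h`, between the lines `h` and `h + 1`, is a permutation layer if `h` is even and a slice
if `h` is odd. -/

/-- The labels on the lines `0, 1, 2, …`. -/
def SpinNet.lines : {A B : List ℕ} → SpinNet A B → List (List ℕ)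
  | _, _, .nil A => [A, A]
  | _, _, .cons s _ T => s.ends false :: s.ends false :: T.lines

/-- The number of the top line. -/
def SpinNet.topLine {A B : List ℕ} (T : SpinNet A B) : ℕ := T.lines.length - 1

/-- The slice in the layer `h`, if there is one. -/
def SpinNet.sliceAt : {A B : List ℕ} → SpinNet A B → ℕ → Option Slice
  | _, _, .nil _, _ => none
  | _, _, .cons _ _ _, 0 => none
  | _, _, .cons s _ _, 1 => some s
  | _, _, .cons _ _ T, h + 2 => T.sliceAt h

/-- Vertical edges. -/
def vertEdgeArcs (A : List ℕ) : List (Arc ℕ) :=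
  (List.range A.length).map fun j => ((false, j), (true, j))

/-- The edges in each layer. -/
def SpinNet.edgeLayers : {A B : List ℕ} → SpinNet A B → List (List (Arc ℕ))
  | _, _, .nil A => [vertEdgeArcs A]
  | _, _, .cons s _ T => vertEdgeArcs (s.ends false) :: s.edgeArcs :: T.edgeLayers

/-- An expansion of a spin network into strands: a choice of a permutation of the strands of each
edge in each permutation layer, that is, of a term in each symmetrizer. -/
def SpinNet.Expansion : {A B : List ℕ} → SpinNet A B → Type
  | _, _, .nil A => EdgePerm A
  | _, _, .cons s _ T => EdgePerm (s.ends false) × T.Expansion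

/-- The strands of a permutation layer. -/
def permArcs {A : List ℕ} (σ : EdgePerm A) : List (Arc (ℕ × ℕ)) :=
  (List.finRange A.length).flatMap fun j : Fin A.length =>
    (List.finRange A[j]).map fun i : Fin A[j] =>
      ((false, (j.val, i.val)), (true, (j.val, (σ j i).val)))

/-- The strands in each layer of the expanded diagram. -/
def SpinNet.strandLayers :
    {A B : List ℕ} → (T : SpinNet A B) → T.Expansion → List (List (Arc (ℕ × ℕ)))
  | _, _, .nil _, σ => [permArcs σ]
  | _, _, .cons s _ T, σ => permArcs σ.1 :: s.strandArcs :: T.strandLayers σ.2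

open Classical in
/-- The strands in each layer of the expanded diagram, cut open at the vertices of the network. -/
noncomputable def SpinNet.segmentLayers :
    {A B : List ℕ} → (T : SpinNet A B) → T.Expansion → List (List (Arc (ℕ × ℕ)))
  | _, _, .nil _, σ => [permArcs σ]
  | _, _, .cons s _ T, σ =>
      permArcs σ.1 :: (if s.piece.IsVertex then s.sideStrandArcs else s.strandArcs) ::
        T.segmentLayers σ.2

/-- The position, as a pair (line, place), of an end of an arc in the layer `h`. -/
def position {α : Type} (h : ℕ) (e : Bool × α) : ℕ × α := (h + e.1.toNat, e.2)

/-- Two positions are the ends of an arc. -/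
def Linked {α : Type} (layers : List (List (Arc α))) (p q : ℕ × α) : Prop :=
  ∃ h : ℕ, ∃ a ∈ layers.getD h [], p = position h a.1 ∧ q = position h a.2

/-! ### The underlying labelled graph -/

section Graph

variable {A B : List ℕ}

/-- The label of the edge at the position `p` (a line, and a place on it). -/
def SpinNet.label (T : SpinNet A B) (p : ℕ × ℕ) : ℕ := (T.lines.getD p.1 []).getD p.2 0

/-- The intersection points of the edges with the lines. -/
def SpinNet.EdgePoint (T : SpinNet A B) : Type :=
  {p : ℕ × ℕ // p.2 < (T.lines.getD p.1 []).length}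

/-- The edges of the network: the classes of points that are connected within the drawing without
passing through a vertex. A closed curve without vertices counts as an edge. -/
def SpinNet.Edge (T : SpinNet A B) : Type :=
  Quot fun p q : T.EdgePoint => Linked T.edgeLayers p.1 q.1

/-- The edge through a point. -/
def SpinNet.edgeOf (T : SpinNet A B) (p : T.EdgePoint) : T.Edge := Quot.mk _ p

/-- The edge `e` passes through the position `p`. -/
def SpinNet.EdgeThrough (T : SpinNet A B) (e : T.Edge) (p : ℕ × ℕ) : Prop :=
  ∃ q : T.EdgePoint, q.1 = p ∧ T.edgeOf q = e

/-- The vertices of the network. -/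
@[ext]
structure SpinNet.Vertex (T : SpinNet A B) : Type where
  layer : ℕ
  slice : Slice
  sliceAt_eq : T.sliceAt layer = some slice
  isVertex : slice.piece.IsVertex

/-- The places where the three edges at a vertex end in its layer; these three ends are numbered
by `Fin 3`. -/
def Slice.corner (s : Slice) (c : Fin 3) : Bool × ℕ :=
  match s.piece with
  | .vertex t _ _ _ => ![(t, s.left.length), (t, s.left.length + 1), (!t, s.left.length)] c
  | _ => (false, 0)

/-- The edge `e` is attached to the vertex `v` at its corner `c`. -/
def SpinNet.Incident (T : SpinNet A B) (v : T.Vertex) (c : Fin 3) (e : T.Edge) : Prop :=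
  T.EdgeThrough e (position v.layer (v.slice.corner c))

/-- A topological equivalence of spin networks with the same free ends: an isomorphism (that is, up
to isotopy, a homeomorphism) of the underlying graphs, which respects the free ends and the labels of
the edges. -/
structure TopEquiv (T₁ T₂ : SpinNet A B) : Type where
  vertex : T₁.Vertex ≃ T₂.Vertex
  edge : T₁.Edge ≃ T₂.Edge
  corner : T₁.Vertex → Equiv.Perm (Fin 3)
  incident : ∀ v c e, T₁.Incident v c e → T₂.Incident (vertex v) (corner v c) (edge e)
  bottom : ∀ j e, T₁.EdgeThrough e (0, j) → T₂.EdgeThrough (edge e) (0, j)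
  top : ∀ j e, T₁.EdgeThrough e (T₁.topLine, j) → T₂.EdgeThrough (edge e) (T₂.topLine, j)
  label : ∀ p q, edge (T₁.edgeOf p) = T₂.edgeOf q → T₁.label p.1 = T₂.label q.1

/-! ### Expanded diagrams -/

/-- The intersection points of the strands with the lines. -/
def SpinNet.StrandPoint (T : SpinNet A B) : Type :=
  {p : ℕ × ℕ × ℕ // p.2.1 < (T.lines.getD p.1 []).length ∧ p.2.2 < T.label (p.1, p.2.1)}

/-- The point of the edge that contains a point of a strand. -/
def SpinNet.StrandPoint.toEdgePoint {T : SpinNet A B} (p : T.StrandPoint) : T.EdgePoint :=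
  ⟨(p.1.1, p.1.2.1), p.2.1⟩

/-- The strands of the expanded diagram, which run through the vertices of the network. -/
def SpinNet.Strand (T : SpinNet A B) (σ : T.Expansion) : Type :=
  Quot fun p q : T.StrandPoint => Linked (T.strandLayers σ) p.1 q.1

/-- The strand `C` passes through the position `p`. -/
def SpinNet.StrandThrough (T : SpinNet A B) (σ : T.Expansion) (C : T.Strand σ)
    (p : ℕ × ℕ × ℕ) : Prop :=
  ∃ q : T.StrandPoint, q.1 = p ∧ (Quot.mk _ q : T.Strand σ) = C

/-- The segments of strands: the pieces into which the vertices of the network cut the strands. -/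
def SpinNet.Segment (T : SpinNet A B) (σ : T.Expansion) : Type :=
  Quot fun p q : T.StrandPoint => Linked (T.segmentLayers σ) p.1 q.1

/-- The segment through a point. -/
def SpinNet.segmentOf (T : SpinNet A B) (σ : T.Expansion) (p : T.StrandPoint) : T.Segment σ :=
  Quot.mk _ p

/-- The segment `S` passes through the position `p`. -/
def SpinNet.SegmentThrough (T : SpinNet A B) (σ : T.Expansion) (S : T.Segment σ)
    (p : ℕ × ℕ × ℕ) : Prop :=
  ∃ q : T.StrandPoint, q.1 = p ∧ T.segmentOf σ q = S

/-- At the vertex `v`, the end of the segment `S` at the corner `c` is joined to the end of the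
segment `S'` at the corner `c'`. -/
def SpinNet.Joined (T : SpinNet A B) (σ : T.Expansion) (v : T.Vertex) (c c' : Fin 3)
    (S S' : T.Segment σ) : Prop :=
  ∃ p p' : Bool × ℕ × ℕ,
    ((p, p') ∈ v.slice.piece.strandArcs v.slice.left.length ∨
      (p', p) ∈ v.slice.piece.strandArcs v.slice.left.length) ∧
    (p.1, p.2.1) = v.slice.corner c ∧ (p'.1, p'.2.1) = v.slice.corner c' ∧
    T.SegmentThrough σ S (position v.layer p) ∧ T.SegmentThrough σ S' (position v.layer p')

/-- A topological equivalence of the expanded diagrams that lies over a topological equivalence `φ`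
of the networks: it takes the segments of strands in each edge to the segments of strands in the
corresponding edge, and respects the free ends of strands and the way in which the segments are joined
at the vertices. -/
structure TopEquiv.Lift {T₁ T₂ : SpinNet A B} (φ : TopEquiv T₁ T₂)
    (σ₁ : T₁.Expansion) (σ₂ : T₂.Expansion) : Type where
  segment : T₁.Segment σ₁ ≃ T₂.Segment σ₂
  edge_eq : ∀ p q, segment (T₁.segmentOf σ₁ p) = T₂.segmentOf σ₂ q →
    φ.edge (T₁.edgeOf p.toEdgePoint) = T₂.edgeOf q.toEdgePoint
  bottom : ∀ j i S, T₁.SegmentThrough σ₁ S (0, j, i) → T₂.SegmentThrough σ₂ (segment S) (0, j, i)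
  top : ∀ j i S, T₁.SegmentThrough σ₁ S (T₁.topLine, j, i) →
    T₂.SegmentThrough σ₂ (segment S) (T₂.topLine, j, i)
  joined : ∀ v c c' S S', T₁.Joined σ₁ v c c' S S' ↔
    T₂.Joined σ₂ (φ.vertex v) (φ.corner v c) (φ.corner v c') (segment S) (segment S')

/-! ### Kinks and crossed extrema -/

/-- The number of local extrema (maxima and minima) of a strand. -/
noncomputable def SpinNet.extrema (T : SpinNet A B) (σ : T.Expansion) (C : T.Strand σ) : ℕ :=
  {x : ℕ × Arc (ℕ × ℕ) | x.2 ∈ (T.strandLayers σ).getD x.1 [] ∧ x.2.1.1 = x.2.2.1 ∧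
    T.StrandThrough σ C (position x.1 x.2.1)}.ncard

/-- A strand without free ends. -/
def SpinNet.IsClosed (T : SpinNet A B) (σ : T.Expansion) (C : T.Strand σ) : Prop :=
  ∀ p : ℕ × ℕ, ¬ T.StrandThrough σ C (0, p) ∧ ¬ T.StrandThrough σ C (T.topLine, p)

open Classical in
/-- The number of kinks of a strand. A kink is a superfluous pair of a maximum and a minimum: a
strand without kinks has no extremum if it runs from the bottom to the top, one extremum if both its
ends are at the top or both at the bottom, and one maximum and one minimum if it is closed. -/
noncomputable def SpinNet.strandKinks (T : SpinNet A B) (σ : T.Expansion) (C : T.Strand σ) : ℕ :=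
  if T.IsClosed σ C then T.extrema σ C / 2 - 1 else T.extrema σ C / 2

/-- The number of kinks in the expanded diagram. -/
noncomputable def SpinNet.kinks (T : SpinNet A B) (σ : T.Expansion) : ℕ :=
  ∑ᶠ C : T.Strand σ, T.strandKinks σ C

/-- The place `p` lies to the left of the place `q`. -/
def LeftOf (p q : ℕ × ℕ) : Prop := p.1 < q.1 ∨ (p.1 = q.1 ∧ p.2 < q.2)

/-- The arcs `a` and `b` run from the lower to the upper line and cross, with `a` on the left of `b`
below the crossing and on the right of `b` above it. -/
def Crosses (a b : Arc (ℕ × ℕ)) : Prop :=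
  a.1.1 = false ∧ a.2.1 = true ∧ b.1.1 = false ∧ b.2.1 = true ∧
    LeftOf a.1.2 b.1.2 ∧ LeftOf b.2.2 a.2.2

/-- The number of crossed extrema in the expanded diagram: the places where a strand, after turning
back, crosses itself. -/
noncomputable def SpinNet.crossedExtrema (T : SpinNet A B) (σ : T.Expansion) : ℕ :=
  {x : ℕ × Arc (ℕ × ℕ) × Arc (ℕ × ℕ) |
    x.2.1 ∈ (T.strandLayers σ).getD x.1 [] ∧ x.2.2 ∈ (T.strandLayers σ).getD x.1 [] ∧
    Crosses x.2.1 x.2.2 ∧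
    ∃ C : T.Strand σ, T.StrandThrough σ C (position x.1 x.2.1.1) ∧
      T.StrandThrough σ C (position x.1 x.2.2.1)}.ncard

end Graph

end Spin

/-! Read a letter on a strand as a direction: `0` for upwards, `1` for downwards. A monotone arc
transmits the letter, a cup or cap needs two different letters, so the terms of a fully expanded
diagram are the orientations of its strands. A cup or cap contributes `-1` exactly when its left end
runs downwards. The sign of an orientation is therefore the parity of the number of such turns,
`Drawing.downTurns`.

State sum. In the orthonormal basis of weight vectors the entries of a slice depend only on the
number of downward strands on each edge. These numbers are conserved along edges, so that the
function of a network is a sum over flows: for each edge, the number of strands directed each way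
(`SpinNet.stateAmp_eq`, `SpinNet.coeff_fn_eq_sum_flow`). The amplitude of a flow is the sign of the
cups and caps of the edges times one factor per vertex. Up to a parity that depends on the way the
vertex is drawn and up to norms, the factor is the sum `vertexSum`, which knows only the cyclic
order of the three corners.

Comparison with a reference. An orientation of the strands of an expansion has a flow and a sign of
its own. The difference of two flows is constant along each edge, hence the parities of their cups
and caps differ by something that is read off at the ends of edges (`turnDowns_eq`). At a vertex the
drawing-dependent parities of the flow and of the reference combine in the same way
(`vertexParity_eq`). So the amplitude of a flow times the sign of the reference depends only on the
graph, the flow and the passage of the reference through the vertices (`flowAmp_mul`), and this is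
invariant under every permutation of the corners of a vertex (`vertexSum_symm`).

Sign of the reference. Whitney's relation between rotation number and self-crossings, modulo two and
for curves drawn in layers, says that the sign of an oriented strand has the parity of its kinks
plus its self-crossings plus a term from its two free ends (`Drawing.whitney`). A correspondence of
expansions transports orientations and preserves the last term. Therefore corresponding flows have
the same amplitude times `(-1) ^ (k + x)` on the two sides (`Lift.flowAmp_eq`), and matching the
flows term by term gives the equality of the functions (`Lift.fn_eq`).

Existence of corresponding expansions. If each symmetrizer contributes the identity or the reversal
of an edge, the strands of an edge can be numbered consistently along it, with either order
prescribed independently at each end. At a vertex the joining rule is cyclic in the corners, and a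
reflection of the corners is compensated by reversing the numbering at all three
(`TopEquiv.exists_lift`). -/

namespace Spin

/-! ### Paths and cycles: orientations and walks -/

/-- A disjoint union of paths and cycles, whose points are matched perfectly by `a` and partially
by `b`; the fixed points of `b` are the ends of the paths. -/
structure Wiring (X : Type) where
  a : X → X
  b : X → X
  a_a : ∀ p, a (a p) = p
  b_b : ∀ p, b (b p) = p
  a_ne : ∀ p, a p ≠ p

namespace Wiring

variable {X : Type} (W : Wiring X)

/-- Two points lie on the same component. -/
def Conn : X → X → Prop := Relation.ReflTransGen fun p q => q = W.a p ∨ q = W.b p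

/-- A colouring of the points that changes along each of the matched pairs; an orientation. -/
structure Coloring (o : X → Bool) : Prop where
  a : ∀ p, o (W.a p) = !o p
  b : ∀ p, W.b p ≠ p → o (W.b p) = !o p

variable {W}

theorem conn_a (p : X) : W.Conn p (W.a p) := .single (.inl rfl)

theorem conn_b (p : X) : W.Conn p (W.b p) := .single (.inr rfl)

theorem Conn.refl (p : X) : W.Conn p p := Relation.ReflTransGen.refl

theorem Conn.trans {p q r : X} (h : W.Conn p q) (h' : W.Conn q r) : W.Conn p r :=
  Relation.ReflTransGen.trans h h'

theorem Conn.symm {p q : X} (h : W.Conn p q) : W.Conn q p := by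
  induction h with
  | refl => exact .refl _
  | tail _ h ih =>
    rcases h with rfl | rfl
    · exact .head (.inl (W.a_a _).symm) ih
    · exact .head (.inr (W.b_b _).symm) ih

theorem Coloring.not {o : X → Bool} (ho : W.Coloring o) : W.Coloring fun p => !o p :=
  ⟨fun p => by simp [ho.a p], fun p hp => by simp [ho.b p hp]⟩

/-- One representative is marked in each two-element orbit of the involution. -/
theorem exists_selection {Q : Type*} (f : Q → Q) (hf : ∀ q, f (f q) = q) (hne : ∀ q, f q ≠ q) :
    ∃ s : Q → Bool, ∀ q, s (f q) = !s q := by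
  classical
  let r : Setoid Q :=
    { r := fun x y => y = x ∨ y = f x
      iseqv :=
        { refl := fun x => .inl rfl
          symm := by
            rintro x y (rfl | rfl)
            · exact .inl rfl
            · exact .inr (hf x).symm
          trans := by
            rintro x y z (rfl | rfl) (rfl | rfl)
            · exact .inl rfl
            · exact .inr rfl
            · exact .inr rfl
            · exact .inl (hf x) } }
  refine ⟨fun q => decide ((Quotient.mk r q).out = q), fun q => ?_⟩
  have h1 : Quotient.mk r (f q) = Quotient.mk r q := Quotient.sound (.inr (hf q).symm)
  have h2 : q = (Quotient.mk r q).out ∨ q = f (Quotient.mk r q).out :=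
    Quotient.exact (Quotient.out_eq (Quotient.mk r q))
  change decide ((Quotient.mk r (f q)).out = f q) = !decide ((Quotient.mk r q).out = q)
  rw [h1]
  generalize (Quotient.mk r q).out = z at h2
  rcases h2 with rfl | rfl
  · simp [(hne q).symm]
  · simp [hf, (hne z).symm]

/-- Two copies of each path, glued at the ends, form a cycle: on `X × Bool` the map `B` changes the
sheet where `b` is fixed, so that neither `A` nor `B` has a fixed point. Conjugation by `A` inverts
`c = A * B`, so `A` acts on the cycles of `c`, and it fixes none of them. Selecting one cycle from
each pair and restricting to one sheet gives the colouring. -/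
theorem exists_coloring (W : Wiring X) : ∃ o, W.Coloring o := by
  classical
  let A : Equiv.Perm (X × Bool) := Function.Involutive.toPerm (fun p => (W.a p.1, p.2))
    (fun p => by simp [W.a_a])
  let B : Equiv.Perm (X × Bool) := Function.Involutive.toPerm
    (fun p => if W.b p.1 = p.1 then (p.1, !p.2) else (W.b p.1, p.2)) (fun p => by
      by_cases h : W.b p.1 = p.1
      · simp [h]
      · simp [h, W.b_b, Ne.symm h])
  have hBv : ∀ x, B x = if W.b x.1 = x.1 then (x.1, !x.2) else (W.b x.1, x.2) := fun x => rfl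
  have hA : ∀ x, A (A x) = x := (Function.Involutive.toPerm _ _).symm_apply_apply
  have hB : ∀ x, B (B x) = x := fun x => (Function.Involutive.toPerm _ _).symm_apply_apply x
  have hAne : ∀ x, A x ≠ x := fun x h => W.a_ne x.1 (congrArg Prod.fst h)
  have hBne : ∀ x, B x ≠ x := fun x h => by
    by_cases h' : W.b x.1 = x.1
    · have := congrArg Prod.snd h
      simp [hBv, h'] at this
    · have := congrArg Prod.fst h
      simp [hBv, h'] at this
  set c := A * B with hc
  have hAinv : A⁻¹ = A := by ext1 x; rw [Equiv.Perm.inv_eq_iff_eq, hA]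
  have hBinv : B⁻¹ = B := by ext1 x; rw [Equiv.Perm.inv_eq_iff_eq, hB]
  have hconj : A * c * A⁻¹ = c⁻¹ := by
    rw [hc, mul_inv_rev, hAinv, hBinv, ← mul_assoc]
    have : A * A = 1 := by ext1 x; exact hA x
    rw [this, one_mul]
  have hconjz : ∀ i : ℤ, ∀ x, A ((c ^ i) x) = (c ^ (-i)) (A x) := by
    intro i x
    have : A * c ^ i * A⁻¹ = c ^ (-i) := by
      rw [zpow_neg, ← inv_zpow, ← hconj, conj_zpow]
    rw [← this]
    simp [hAinv, hA]
  -- If `x` and `A x` were on one cycle, the point half-way between them would be fixed by `A` or by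
  -- `B`, according to the parity of the distance.
  have key : ∀ x, ¬ c.SameCycle x (A x) := by
    rintro x ⟨i, hi⟩
    rcases Int.even_or_odd' i with ⟨j, rfl | rfl⟩
    · apply hAne ((c ^ j) x)
      rw [hconjz, ← hi, ← Equiv.Perm.mul_apply, ← zpow_add]
      congr 2
      ring
    · apply hBne ((c ^ j) x)
      have h1 : c ((c ^ j) x) = A ((c ^ j) x) := by
        rw [hconjz, ← hi, ← Equiv.Perm.mul_apply, ← Equiv.Perm.mul_apply, ← zpow_add,
          ← zpow_one_add]
        congr 2
        ring
      rw [hc] at h1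
      exact A.injective h1
  let s := Equiv.Perm.SameCycle.setoid c
  let f : Quotient s → Quotient s := Quotient.map A (by
    rintro x y ⟨i, hi⟩
    exact ⟨-i, by rw [← hconjz, hi]⟩)
  obtain ⟨t, ht⟩ := exists_selection f
    (by rintro ⟨x⟩; exact congrArg _ (hA x))
    (by
      rintro ⟨x⟩ h
      exact key x (Quotient.exact h).symm)
  have hta : ∀ x, t (Quotient.mk s (A x)) = !t (Quotient.mk s x) := fun x => ht (Quotient.mk s x)
  -- Since `c (B x) = A x`, the points `B x` and `A x` lie on the same cycle.
  have htb : ∀ x, t (Quotient.mk s (B x)) = !t (Quotient.mk s x) := fun x => by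
    rw [← hta]
    congr 1
    refine Quotient.sound ?_
    have h1 : c (B x) = A x := by simp [hc, hB]
    exact ⟨1, by simpa using h1⟩
  refine ⟨fun p => t (Quotient.mk s (p, false)), fun p => hta (p, false), fun p hp => ?_⟩
  have := htb (p, false)
  simpa [hBv, hp] using this

/-- The relation `R` follows the orientation: along `a` from points coloured `true`, along `b` from
the others. From the source `A` it reaches the whole component, because a step against the
orientation only undoes the last one. A further end can be entered only along `a`, and so has the
colour `false`. -/
theorem Coloring.end_of_source {o : X → Bool} (ho : W.Coloring o) {A B : X} (hA : W.b A = A)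
    (hB : W.b B = B) (hne : A ≠ B) (h : W.Conn A B) (hoA : o A = true) : o B = false := by
  let R : X → X → Prop := fun p q => (o p = true ∧ q = W.a p) ∨ (o p = false ∧ W.b p ≠ p ∧ q = W.b p)
  have key : ∀ q, W.Conn A q → Relation.ReflTransGen R A q := by
    intro q hq
    induction hq with
    | refl => exact .refl
    | @tail q q' _ hstep ih =>
      rcases hstep with rfl | rfl
      · cases hq : o q
        · rcases Relation.ReflTransGen.cases_tail ih with rfl | ⟨r, hr, ⟨h1, rfl⟩ | ⟨h1, h2, rfl⟩⟩
          · simp [hoA] at hq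
          · rwa [W.a_a]
          · simp [ho.b r h2, h1] at hq
        · exact ih.tail (.inl ⟨hq, rfl⟩)
      · by_cases hb : W.b q = q
        · rwa [hb]
        · cases hq : o q
          · exact ih.tail (.inr ⟨hq, hb, rfl⟩)
          · rcases Relation.ReflTransGen.cases_tail ih with rfl | ⟨r, hr, ⟨h1, rfl⟩ | ⟨h1, h2, rfl⟩⟩
            · exact absurd hA hb
            · simp [ho.a, h1] at hq
            · rwa [W.b_b]
  rcases Relation.ReflTransGen.cases_tail (key B h) with h | ⟨r, hr, ⟨h1, rfl⟩ | ⟨h1, h2, rfl⟩⟩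
  · exact absurd h.symm hne
  · simp [ho.a, h1]
  · rw [W.b_b] at hB
    exact absurd hB.symm h2

theorem Coloring.ends_ne {o : X → Bool} (ho : W.Coloring o) {A B : X} (hA : W.b A = A)
    (hB : W.b B = B) (hne : A ≠ B) (h : W.Conn A B) : o A ≠ o B := by
  cases hoA : o A
  · have := ho.not.end_of_source hA hB hne h (by simp [hoA])
    simpa using this
  · rw [ho.end_of_source hA hB hne h hoA]
    simp

/-- The points in the order of a walk that starts at `p` along `a`. -/
def walk (W : Wiring X) (p : X) (i : ℕ) : X :=
  if i % 2 = 0 then (fun q => W.b (W.a q))^[i / 2] p else W.a ((fun q => W.b (W.a q))^[i / 2] p)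

theorem walk_zero (p : X) : W.walk p 0 = p := by simp [walk]

theorem walk_even (p : X) (k : ℕ) : W.walk p (2 * k) = (fun q => W.b (W.a q))^[k] p := by
  simp [walk]

theorem walk_odd (p : X) (k : ℕ) : W.walk p (2 * k + 1) = W.a (W.walk p (2 * k)) := by
  have h1 : (2 * k + 1) % 2 = 1 := by omega
  have h2 : (2 * k + 1) / 2 = k := by omega
  simp [walk, h1, h2]

theorem walk_even_succ (p : X) (k : ℕ) : W.walk p (2 * k + 2) = W.b (W.walk p (2 * k + 1)) := by
  rw [walk_odd, show 2 * k + 2 = 2 * (k + 1) by ring, walk_even, walk_even,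
    Function.iterate_succ_apply']

theorem conn_walk (p : X) (i : ℕ) : W.Conn p (W.walk p i) := by
  induction i with
  | zero => rw [walk_zero]; exact .refl p
  | succ i ih =>
    obtain ⟨k, rfl | rfl⟩ := Nat.even_or_odd' i
    · rw [walk_odd]; exact ih.trans (conn_a _)
    · rw [walk_even_succ]; exact ih.trans (conn_b _)

theorem iterate_injective : Function.Injective fun q => W.b (W.a q) := fun x y h => by
  have h1 := congrArg W.b h
  simp only [W.b_b] at h1
  have h2 := congrArg W.a h1
  simpa only [W.a_a] using h2

/-- The listed points are closed under `a`, and under `b` except at the first and the last of them;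
the two hypotheses take care of these. -/
theorem walk_cover {p : X} {n : ℕ} (hn : 0 < n)
    (h0 : ∃ i < 2 * n, W.walk p i = W.b p)
    (h1 : ∃ i < 2 * n, W.walk p i = W.walk p (2 * n)) {q : X} (hq : W.Conn p q) :
    ∃ i < 2 * n, W.walk p i = q := by
  induction hq with
  | refl => exact ⟨0, by omega, walk_zero p⟩
  | @tail q q' _ hstep ih =>
    obtain ⟨i, hi, rfl⟩ := ih
    obtain ⟨k, rfl | rfl⟩ := Nat.even_or_odd' i
    · rcases hstep with rfl | rfl
      · exact ⟨2 * k + 1, by omega, walk_odd p k⟩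
      · cases k with
        | zero => simpa [walk_zero] using h0
        | succ k =>
          exact ⟨2 * k + 1, by omega, by
            rw [show 2 * (k + 1) = 2 * k + 2 by ring, walk_even_succ, W.b_b]⟩
    · rcases hstep with rfl | rfl
      · exact ⟨2 * k, by omega, by rw [walk_odd, W.a_a]⟩
      · by_cases hk : k + 1 < n
        · exact ⟨2 * k + 2, by omega, walk_even_succ p k⟩
        · rw [← walk_even_succ, show 2 * k + 2 = 2 * n by omega]
          exact h1

/-- Even and odd positions have different colours. On even positions the walk iterates an injective
map, so a repetition could be shifted back to a return to `p`. -/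
theorem walk_injOn {p : X} {n : ℕ} {o : X → Bool} (ho : W.Coloring o)
    (hev : ∀ k < n, o (W.walk p (2 * k)) = true)
    (hne : ∀ k < n, 0 < k → W.walk p (2 * k) ≠ p) {i j : ℕ} (hi : i < 2 * n) (hj : j < 2 * n)
    (h : W.walk p i = W.walk p j) : i = j := by
  have key : ∀ k l, k < l → l < n → W.walk p (2 * k) ≠ W.walk p (2 * l) := by
    intro k l hkl hl h
    rw [walk_even, walk_even, show l = k + (l - k) by omega, Function.iterate_add_apply] at h
    have := iterate_injective.iterate k h
    exact hne (l - k) (by omega) (by omega) (by rw [walk_even]; exact this.symm)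
  have key' : ∀ k l, k < n → l < n → W.walk p (2 * k) = W.walk p (2 * l) → k = l := by
    intro k l hk hl h
    rcases lt_trichotomy k l with h' | h' | h'
    · exact absurd h (key _ _ h' hl)
    · exact h'
    · exact absurd h.symm (key _ _ h' hk)
  obtain ⟨k, rfl | rfl⟩ := Nat.even_or_odd' i <;> obtain ⟨l, rfl | rfl⟩ := Nat.even_or_odd' j
  · rw [key' k l (by omega) (by omega) h]
  · have := hev k (by omega)
    rw [h, walk_odd, ho.a, hev l (by omega)] at this
    simp at this
  · have := hev l (by omega)
    rw [← h, walk_odd, ho.a, hev k (by omega)] at this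
    simp at this
  · rw [walk_odd, walk_odd] at h
    have := congrArg W.a h
    rw [W.a_a, W.a_a] at this
    rw [key' k l (by omega) (by omega) this]

/-- On a finite set `p` is a periodic point of the injective map `b ∘ a`; the walk is one minimal
period. -/
theorem exists_closed_walk [Finite X] {o : X → Bool} (ho : W.Coloring o) {p : X} (hp : o p = true)
    (hcl : ∀ q, W.Conn p q → W.b q ≠ q) :
    ∃ n > 0, W.walk p (2 * n) = p ∧ (∀ k, o (W.walk p (2 * k)) = true) ∧
      (∀ i j, i < 2 * n → j < 2 * n → W.walk p i = W.walk p j → i = j) ∧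
      ∀ q, W.Conn p q → ∃ i < 2 * n, W.walk p i = q := by
  have hev : ∀ k, o (W.walk p (2 * k)) = true := by
    intro k
    induction k with
    | zero => simpa [walk_zero] using hp
    | succ k ih =>
      rw [show 2 * (k + 1) = 2 * k + 2 by ring, walk_even_succ, ho.b _ (hcl _ (conn_walk _ _)),
        walk_odd, ho.a, ih]
      rfl
  have hper : p ∈ Function.periodicPts fun q => W.b (W.a q) :=
    iterate_injective.mem_periodicPts p
  set n := Function.minimalPeriod (fun q => W.b (W.a q)) p with hn
  have hn0 : 0 < n := Function.minimalPeriod_pos_of_mem_periodicPts hper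
  have hret : W.walk p (2 * n) = p := by
    rw [walk_even]; exact Function.isPeriodicPt_minimalPeriod _ _
  refine ⟨n, hn0, hret, hev, fun i j hi hj h => walk_injOn ho (fun k _ => hev k) ?_ hi hj h,
    fun q hq => walk_cover hn0 ⟨2 * n - 1, by omega, ?_⟩ ⟨0, by omega, by rw [hret, walk_zero]⟩ hq⟩
  · intro k hk hk0 h
    rw [walk_even] at h
    exact absurd (Function.IsPeriodicPt.minimalPeriod_le hk0 h) (by omega)
  · have h2 := walk_even_succ (W := W) p (n - 1)
    rw [show 2 * (n - 1) + 2 = 2 * n by omega, show 2 * (n - 1) + 1 = 2 * n - 1 by omega, hret] at h2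
    have := congrArg W.b h2
    rw [W.b_b] at this
    exact this.symm

/-- The walk stops at the first odd position that is fixed by `b`. Continued beyond it, the walk
would be reflected and run back. -/
theorem exists_open_walk [Finite X] {o : X → Bool} (ho : W.Coloring o) {p : X} (hp : o p = true)
    (hend : W.b p = p) :
    ∃ n > 0, W.b (W.walk p (2 * n - 1)) = W.walk p (2 * n - 1) ∧
      (∀ k < n, o (W.walk p (2 * k)) = true) ∧
      (∀ k, k + 1 < n → W.b (W.walk p (2 * k + 1)) ≠ W.walk p (2 * k + 1)) ∧
      (∀ i j, i < 2 * n → j < 2 * n → W.walk p i = W.walk p j → i = j) ∧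
      ∀ q, W.Conn p q → ∃ i < 2 * n, W.walk p i = q := by
  classical
  have hret : ∀ m, 0 < m → W.walk p (2 * m) = p →
      W.b (W.walk p (2 * (m - 1) + 1)) = W.walk p (2 * (m - 1) + 1) := by
    intro m hm h
    have h2 := walk_even_succ (W := W) p (m - 1)
    rw [show 2 * (m - 1) + 2 = 2 * m by omega, h] at h2
    have h3 := congrArg W.b h2
    rw [W.b_b, hend] at h3
    rw [← h3, hend]
  -- The point `p` is periodic, and as `b p = p`, the position before a return to `p` is `p` again.
  -- This is an odd position fixed by `b`.
  have hex : ∃ k, W.b (W.walk p (2 * k + 1)) = W.walk p (2 * k + 1) := by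
    have hper : p ∈ Function.periodicPts fun q => W.b (W.a q) :=
      iterate_injective.mem_periodicPts p
    obtain ⟨m, hm, h⟩ := hper
    exact ⟨m - 1, hret m hm (by rw [walk_even]; exact h)⟩
  set l := Nat.find hex with hl
  have hmin : ∀ k < l, W.b (W.walk p (2 * k + 1)) ≠ W.walk p (2 * k + 1) :=
    fun k hk => Nat.find_min hex hk
  have hlast : W.b (W.walk p (2 * l + 1)) = W.walk p (2 * l + 1) := Nat.find_spec hex
  have hev : ∀ k < l + 1, o (W.walk p (2 * k)) = true := by
    intro k
    induction k with
    | zero => intro _; simpa [walk_zero] using hp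
    | succ k ih =>
      intro hk
      rw [show 2 * (k + 1) = 2 * k + 2 by ring, walk_even_succ, ho.b _ (hmin k (by omega)),
        walk_odd, ho.a, ih (by omega)]
      rfl
  refine ⟨l + 1, by omega, hlast, hev, fun k hk => hmin k (by omega),
    fun i j hi hj h => walk_injOn ho hev ?_ hi hj h,
    fun q hq => walk_cover (by omega) ⟨0, by omega, by rw [walk_zero, hend]⟩
      ⟨2 * l + 1, by omega, by
        rw [show 2 * (l + 1) = 2 * l + 2 by ring, walk_even_succ, hlast]⟩ hq⟩
  intro k hk hk0 h
  exact hmin (k - 1) (by omega) (hret k hk0 h)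

end Wiring

end Spin

/-! ### Sums over pairs, and crossings of two arcs modulo two -/

namespace Spin

open Finset

section PairSums

variable {R : Type*} [CommRing R]

/-- The sum of `g` over all pairs of entries of two different blocks `{2k, 2k+1}`. -/
def pairSum (g : ℕ → ℕ → R) (n : ℕ) : R :=
  ∑ l ∈ range n, ∑ k ∈ range l,
    (g (2 * k) (2 * l) + g (2 * k) (2 * l + 1) + g (2 * k + 1) (2 * l) + g (2 * k + 1) (2 * l + 1))

/-- The sum of `g` over all ordered pairs below `m`. -/
def triSum (g : ℕ → ℕ → R) (m : ℕ) : R := ∑ b ∈ range m, ∑ a ∈ range b, g a b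

theorem sum_range_two_mul (f : ℕ → R) (n : ℕ) :
    ∑ i ∈ range (2 * n), f i = ∑ k ∈ range n, (f (2 * k) + f (2 * k + 1)) := by
  induction n with
  | zero => simp
  | succ n ih =>
    rw [show 2 * (n + 1) = 2 * n + 1 + 1 by ring, sum_range_succ, sum_range_succ, sum_range_succ, ih]
    ring

/-- Two indices below `2 * n` lie in different blocks or are the two entries of one block. -/
theorem pairSum_add (g : ℕ → ℕ → R) (n : ℕ) :
    pairSum g n + ∑ k ∈ range n, g (2 * k) (2 * k + 1) = triSum g (2 * n) := by
  induction n with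
  | zero => simp [pairSum, triSum]
  | succ n ih =>
    have h : triSum g (2 * (n + 1)) = triSum g (2 * n) + ∑ a ∈ range (2 * n), g a (2 * n) +
        (∑ a ∈ range (2 * n), g a (2 * n + 1) + g (2 * n) (2 * n + 1)) := by
      rw [triSum, show 2 * (n + 1) = 2 * n + 1 + 1 by ring, sum_range_succ, sum_range_succ,
        sum_range_succ _ (2 * n), triSum]
    rw [h, ← ih, pairSum, sum_range_succ, sum_range_succ, sum_range_two_mul, sum_range_two_mul,
      pairSum]
    simp only [sum_add_distrib]
    ring

theorem triSum_succ_left (g : ℕ → ℕ → R) (m : ℕ) :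
    triSum g (m + 1) = triSum (fun a b => g (a + 1) (b + 1)) m + ∑ b ∈ range m, g 0 (b + 1) := by
  rw [triSum, sum_range_succ', triSum, ← sum_add_distrib]
  simp [sum_range_succ']

theorem triSum_succ (g : ℕ → ℕ → R) (m : ℕ) :
    triSum g (m + 1) = triSum g m + ∑ a ∈ range m, g a m := by
  rw [triSum, sum_range_succ, triSum]

/-- The square splits into pairs from different blocks, in both orders, and the four pairs inside
each block. -/
theorem sum_square (f : ℕ → ℕ → R) (n : ℕ) :
    ∑ i ∈ range (2 * n), ∑ j ∈ range (2 * n), f i j =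
      pairSum (fun i j => f i j + f j i) n +
        ∑ k ∈ range n, (f (2 * k) (2 * k) + f (2 * k) (2 * k + 1) + f (2 * k + 1) (2 * k) +
          f (2 * k + 1) (2 * k + 1)) := by
  induction n with
  | zero => simp [pairSum]
  | succ n ih =>
    rw [show 2 * (n + 1) = 2 * n + 1 + 1 by ring]
    simp only [sum_range_succ, sum_add_distrib] at ih ⊢
    rw [ih, sum_range_two_mul (fun i => f i (2 * n)), sum_range_two_mul (fun i => f i (2 * n + 1)),
      sum_range_two_mul (fun j => f (2 * n) j), sum_range_two_mul (fun j => f (2 * n + 1) j),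
      pairSum, pairSum, sum_range_succ]
    simp only [sum_add_distrib]
    ring

theorem pairSum_congr {g g' : ℕ → ℕ → R} {n : ℕ}
    (h : ∀ k l, k < l → l < n → g (2 * k) (2 * l) + g (2 * k) (2 * l + 1) + g (2 * k + 1) (2 * l) +
      g (2 * k + 1) (2 * l + 1) = g' (2 * k) (2 * l) + g' (2 * k) (2 * l + 1) +
        g' (2 * k + 1) (2 * l) + g' (2 * k + 1) (2 * l + 1)) :
    pairSum g n = pairSum g' n :=
  sum_congr rfl fun l hl => sum_congr rfl fun k hk => h k l (mem_range.1 hk) (mem_range.1 hl)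

end PairSums

/-- A wiring whose points are drawn on the lines `0, …, top`, with the arcs between two consecutive
lines. -/
structure Drawing (X : Type) extends Wiring X where
  line : X → ℕ
  lt : X → X → Prop
  top : ℕ
  top_odd : top % 2 = 1
  lt_iff : ∀ p q, line p = line q → p ≠ q → (lt p q ↔ ¬ lt q p)
  lt_irrefl : ∀ p, ¬ lt p p
  a_even : ∀ p, line p % 2 = 0 → line (a p) = line p + 1
  a_odd : ∀ p, line p % 2 = 1 → line (a p) + 1 = line p
  b_odd : ∀ p, line p % 2 = 1 → line (b p) = line p ∨ line (b p) = line p + 1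
  b_even : ∀ p, line p % 2 = 0 → line (b p) = line p ∨ line (b p) + 1 = line p
  end_iff : ∀ p, b p = p ↔ line p = 0 ∨ line p = top
  -- Cups and caps in one layer are nested or disjoint, and a monotone arc never starts under one: a
  -- point between `p` and `b p` is the end of a turn that lies entirely between them.
  planar : ∀ p q, b p ≠ p → line (b p) = line p → line q = line p → q ≠ p → q ≠ b p →
    ((lt p q ↔ lt (b p) q) ∧ (line (b q) = line q → (lt p (b q) ↔ lt (b p) (b q)))) ∨
    (line (b q) = line q ∧ (lt p q ↔ ¬ lt (b p) q) ∧ (lt p (b q) ↔ ¬ lt (b p) (b q)))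

namespace Drawing

variable {X : Type} (D : Drawing X)

open Classical in
/-- The indicator of `p` being to the left of `q` on the same line. -/
noncomputable def B (p q : X) : ZMod 2 := if D.line p = D.line q ∧ D.lt p q then 1 else 0

/-- The left end of a cup or a cap. -/
def TurnL (p : X) : Prop := D.b p ≠ p ∧ D.line (D.b p) = D.line p ∧ D.lt p (D.b p)

open Classical in
/-- The other end of the arc above a point. -/
noncomputable def up (p : X) : X := if D.line p % 2 = 0 then D.a p else D.b p

/-- The arcs that leave `p` and `q` upwards cross. -/
def Cr (p q : X) : Prop :=
  D.line p = D.line q ∧ D.lt p q ∧ D.line (D.up p) = D.line p + 1 ∧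
    D.line (D.up q) = D.line q + 1 ∧ D.lt (D.up q) (D.up p)

/-- Whether a strand with the orientation `o` runs downwards at `p`. -/
def down (o : X → Bool) (p : X) : Bool := o p == decide (D.line p % 2 = 1)

variable {D}

theorem B_add_swap {p q : X} (h : p ≠ q) :
    D.B p q + D.B q p = if D.line p = D.line q then 1 else 0 := by
  unfold B
  by_cases hl : D.line p = D.line q
  · have := D.lt_iff p q hl h
    by_cases h1 : D.lt p q <;> by_cases h2 : D.lt q p <;> simp_all
  · simp [hl, Ne.symm hl]

theorem B_of_line_ne {p q : X} (h : D.line p ≠ D.line q) : D.B p q = 0 := by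
  simp [B, h]

theorem B_a (p : X) : D.B p (D.a p) = 0 := by
  apply B_of_line_ne
  rcases Nat.mod_two_eq_zero_or_one (D.line p) with h | h
  · rw [D.a_even p h]; omega
  · have := D.a_odd p h; omega

theorem two_eq_zero_zmod : (2 : ZMod 2) = 0 := rfl

open Classical in
theorem B_of_line_eq {p q : X} (h : D.line p = D.line q) :
    D.B p q = if D.lt p q then 1 else 0 := by
  simp [B, h]

/-- A turn encloses both ends of another turn or neither, and no end of a monotone arc. In each case
the four indicators cancel in pairs modulo two. This makes a turn behave like an arc that crosses
nothing. -/
theorem B_turn {p q : X} (h : D.b p ≠ p) (hl : D.line (D.b p) = D.line p) (h1 : q ≠ p)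
    (h2 : q ≠ D.b p) :
    D.B p q + D.B p (D.b q) + D.B (D.b p) q + D.B (D.b p) (D.b q) = 0 := by
  have key : ∀ q, q ≠ p → q ≠ D.b p → D.line q = D.line p →
      D.B p q + D.B p (D.b q) + D.B (D.b p) q + D.B (D.b p) (D.b q) = 0 := by
    intro q h1 h2 hq
    have h3 := D.planar p q h hl hq h1 h2
    by_cases hbq : D.line (D.b q) = D.line q
    · have e1 : D.line p = D.line q := hq.symm
      have e2 : D.line p = D.line (D.b q) := by omega
      have e3 : D.line (D.b p) = D.line q := by omega
      have e4 : D.line (D.b p) = D.line (D.b q) := by omega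
      rw [B_of_line_eq e1, B_of_line_eq e2, B_of_line_eq e3, B_of_line_eq e4]
      simp only [hbq, true_and, forall_const] at h3
      by_cases a1 : D.lt p q <;> by_cases a2 : D.lt p (D.b q) <;>
        by_cases a3 : D.lt (D.b p) q <;> by_cases a4 : D.lt (D.b p) (D.b q) <;>
        simp [a1, a2, a3, a4] at h3 ⊢ <;> rfl
    · rw [B_of_line_ne (p := p) (q := D.b q) (by omega),
        B_of_line_ne (p := D.b p) (q := D.b q) (by omega)]
      have h4 : (D.lt p q ↔ D.lt (D.b p) q) := by
        rcases h3 with h3 | h3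
        · exact h3.1
        · exact absurd h3.1 hbq
      have e1 : D.line p = D.line q := hq.symm
      have e3 : D.line (D.b p) = D.line q := by omega
      rw [B_of_line_eq e1, B_of_line_eq e3]
      by_cases h5 : D.lt p q
      · rw [if_pos h5, if_pos (h4.1 h5)]
        rfl
      · rw [if_neg h5, if_neg fun h => h5 (h4.2 h)]
        rfl
  by_cases hq : D.line q = D.line p
  · exact key q h1 h2 hq
  · by_cases hq' : D.line (D.b q) = D.line p
    · have := key (D.b q) (fun h => h2 (by rw [← h, D.b_b]))
        (fun h => h1 (by rw [← D.b_b q, h, D.b_b])) hq'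
      rw [D.b_b] at this
      linear_combination this
    · rw [B_of_line_ne (p := p) (q := q) (by omega), B_of_line_ne (p := D.b p) (q := q) (by omega),
        B_of_line_ne (p := p) (q := D.b q) (by omega),
        B_of_line_ne (p := D.b p) (q := D.b q) (by omega)]
      rfl

open Classical in
-- Monotone arcs in the same layer cross exactly when the order of their lower ends differs from
-- that of their upper ends. The two summands are the cases of which arc is on the left below.
theorem cross_add (p p' q q' : X) (hpp : D.line p' = D.line p + 1) (hqq : D.line q' = D.line q + 1)
    (hpq : p ≠ q) (hpq' : p' ≠ q') :
    ((if D.line p = D.line q ∧ D.lt p q ∧ D.lt q' p' then (1 : ZMod 2) else 0) +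
      if D.line q = D.line p ∧ D.lt q p ∧ D.lt p' q' then 1 else 0) = D.B p q + D.B p' q' := by
  unfold B
  by_cases hl : D.line p = D.line q
  · have h1 := D.lt_iff p q hl hpq
    have h2 := D.lt_iff p' q' (by omega) hpq'
    have hl' : D.line p' = D.line q' := by omega
    by_cases h3 : D.lt q p <;> by_cases h4 : D.lt q' p' <;> simp [hl, hl', h1, h2, h3, h4] <;> rfl
  · have hl' : D.line p' ≠ D.line q' := by omega
    simp [hl, hl', Ne.symm hl]

open Classical in
/-- The crossings in the layers with an even number. -/
noncomputable def crA (D : Drawing X) (p q : X) : ZMod 2 :=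
  if D.line p % 2 = 0 ∧ D.Cr p q then 1 else 0

open Classical in
/-- The crossings in the layers with an odd number. -/
noncomputable def crB (D : Drawing X) (p q : X) : ZMod 2 :=
  if D.line p % 2 = 1 ∧ D.Cr p q then 1 else 0

theorem crA_eq_zero {p q : X} (h : D.line p % 2 = 1 ∨ D.line q % 2 = 1) : D.crA p q = 0 := by
  unfold crA
  rw [if_neg]
  rintro ⟨h1, h2, -⟩
  omega

theorem crB_eq_zero {p q : X} (h : D.line p % 2 = 0 ∨ D.line q % 2 = 0) : D.crB p q = 0 := by
  unfold crB
  rw [if_neg]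
  rintro ⟨h1, h2, -⟩
  omega

open Classical in
theorem crA_eq {p q : X} (h : D.line p % 2 = 0) : D.crA p q =
    if D.line p = D.line q ∧ D.lt p q ∧ D.lt (D.a q) (D.a p) then 1 else 0 := by
  unfold crA Cr up
  congr 1
  by_cases hl : D.line p = D.line q
  · have h' : D.line q % 2 = 0 := by omega
    simp [h', hl, D.a_even q h', D.a_even p h]
  · simp [hl]

open Classical in
theorem crB_eq {p q : X} (h : D.line p % 2 = 1) (hp : D.line (D.b p) = D.line p + 1)
    (hq : D.line (D.b q) = D.line q + 1) : D.crB p q =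
    if D.line p = D.line q ∧ D.lt p q ∧ D.lt (D.b q) (D.b p) then 1 else 0 := by
  unfold crB Cr up
  congr 1
  by_cases hl : D.line p = D.line q
  · have h' : D.line q % 2 = 1 := by omega
    simp [h', hl, hp, hq]
  · simp [hl]

theorem crB_eq_zero_of_line_b {p q : X} (h : D.line (D.b p) = D.line p ∨ D.line (D.b q) = D.line q) :
    D.crB p q = 0 := by
  unfold crB Cr up
  rw [if_neg]
  rintro ⟨h1, h2, -, h3, h4, -⟩
  rw [if_neg (by omega)] at h3 h4
  omega

/-- Of the eight crossing terms only the two at the lower ends can be non-zero, and of the four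
indicators those between a lower and an upper end vanish. What remains is `cross_add`. -/
theorem crA_block {p q : X} (h1 : q ≠ p) (h2 : q ≠ D.a p) :
    (D.crA p q + D.crA q p) + (D.crA p (D.a q) + D.crA (D.a q) p) +
      (D.crA (D.a p) q + D.crA q (D.a p)) + (D.crA (D.a p) (D.a q) + D.crA (D.a q) (D.a p)) =
    D.B p q + D.B p (D.a q) + D.B (D.a p) q + D.B (D.a p) (D.a q) := by
  -- it is enough to consider the lower ends of the two arcs
  have key : ∀ p q, D.line p % 2 = 0 → D.line q % 2 = 0 → q ≠ p →
      (D.crA p q + D.crA q p) + (D.crA p (D.a q) + D.crA (D.a q) p) +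
      (D.crA (D.a p) q + D.crA q (D.a p)) + (D.crA (D.a p) (D.a q) + D.crA (D.a q) (D.a p)) =
      D.B p q + D.B p (D.a q) + D.B (D.a p) q + D.B (D.a p) (D.a q) := by
    intro p q hp hq hne
    have hp' := D.a_even p hp
    have hq' := D.a_even q hq
    have hp1 : D.line (D.a p) % 2 = 1 := by omega
    have hq1 : D.line (D.a q) % 2 = 1 := by omega
    rw [crA_eq_zero (.inr hq1), crA_eq_zero (.inl hq1), crA_eq_zero (.inl hp1),
      crA_eq_zero (.inr hp1), crA_eq_zero (.inl hp1), crA_eq_zero (.inr hp1),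
      B_of_line_ne (p := p) (q := D.a q) (by omega), B_of_line_ne (p := D.a p) (q := q) (by omega),
      crA_eq hp, crA_eq hq]
    have := cross_add (D := D) p (D.a p) q (D.a q) hp' hq' hne.symm
      (fun h => hne (by rw [← D.a_a q, ← h, D.a_a]))
    simp only [add_zero, this]
  have h3 : D.a q ≠ p := fun h => h2 (by rw [← h, D.a_a])
  have h4 : D.a q ≠ D.a p := fun h => h1 (by rw [← D.a_a q, h, D.a_a])
  rcases Nat.mod_two_eq_zero_or_one (D.line p) with hp | hp <;>
    rcases Nat.mod_two_eq_zero_or_one (D.line q) with hq | hq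
  · exact key p q hp hq h1
  · have hq' := D.a_odd q hq
    have := key p (D.a q) hp (by omega) h3
    rw [D.a_a] at this
    linear_combination this
  · have hp' := D.a_odd p hp
    have := key (D.a p) q (by omega) hq h2
    rw [D.a_a] at this
    linear_combination this
  · have hp' := D.a_odd p hp
    have hq' := D.a_odd q hq
    have := key (D.a p) (D.a q) (by omega) (by omega) h4
    rw [D.a_a, D.a_a] at this
    linear_combination this

/-- For two monotone arcs this is `cross_add` again. If one of the arcs is a turn, there is no
crossing, and the indicators add up to zero by `B_turn`. -/
theorem crB_block {p q : X} (hpb : D.b p ≠ p) (hqb : D.b q ≠ q) (h1 : q ≠ p) (h2 : q ≠ D.b p) :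
    (D.crB p q + D.crB q p) + (D.crB p (D.b q) + D.crB (D.b q) p) +
      (D.crB (D.b p) q + D.crB q (D.b p)) + (D.crB (D.b p) (D.b q) + D.crB (D.b q) (D.b p)) =
    D.B p q + D.B p (D.b q) + D.B (D.b p) q + D.B (D.b p) (D.b q) := by
  have h3 : D.b q ≠ p := fun h => h2 (by rw [← h, D.b_b])
  have h4 : D.b q ≠ D.b p := fun h => h1 (by rw [← D.b_b q, h, D.b_b])
  by_cases hp : D.line (D.b p) = D.line p
  · have hp' : D.line (D.b (D.b p)) = D.line (D.b p) := by rw [D.b_b, hp]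
    rw [crB_eq_zero_of_line_b (.inl hp), crB_eq_zero_of_line_b (.inr hp),
      crB_eq_zero_of_line_b (.inl hp), crB_eq_zero_of_line_b (.inr hp),
      crB_eq_zero_of_line_b (.inl hp'), crB_eq_zero_of_line_b (.inr hp'),
      crB_eq_zero_of_line_b (.inl hp'), crB_eq_zero_of_line_b (.inr hp'), B_turn hpb hp h1 h2]
    rfl
  by_cases hq : D.line (D.b q) = D.line q
  · have hq' : D.line (D.b (D.b q)) = D.line (D.b q) := by rw [D.b_b, hq]
    rw [crB_eq_zero_of_line_b (.inr hq), crB_eq_zero_of_line_b (.inl hq),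
      crB_eq_zero_of_line_b (.inr hq'), crB_eq_zero_of_line_b (.inl hq'),
      crB_eq_zero_of_line_b (.inr hq), crB_eq_zero_of_line_b (.inl hq),
      crB_eq_zero_of_line_b (.inr hq'), crB_eq_zero_of_line_b (.inl hq')]
    have e1 := B_turn hqb hq h1.symm h3.symm
    have f1 := B_add_swap (D := D) h1
    have f2 := B_add_swap (D := D) h3
    have f3 := B_add_swap (D := D) h2
    have f4 := B_add_swap (D := D) h4
    rw [hq] at f2 f4
    linear_combination e1 - f1 - f2 - f3 - f4 +
      -((if D.line q = D.line p then 1 else 0) +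
        if D.line q = D.line (D.b p) then 1 else 0) * two_eq_zero_zmod
  have key : ∀ p q, D.b p ≠ p → D.b q ≠ q → D.line p % 2 = 1 → D.line q % 2 = 1 →
      ¬ D.line (D.b p) = D.line p → ¬ D.line (D.b q) = D.line q → q ≠ p →
      (D.crB p q + D.crB q p) + (D.crB p (D.b q) + D.crB (D.b q) p) +
      (D.crB (D.b p) q + D.crB q (D.b p)) + (D.crB (D.b p) (D.b q) + D.crB (D.b q) (D.b p)) =
      D.B p q + D.B p (D.b q) + D.B (D.b p) q + D.B (D.b p) (D.b q) := by
    intro p q hpb hqb hp hq hpl hql hne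
    have hp' := (D.b_odd p hp).resolve_left hpl
    have hq' := (D.b_odd q hq).resolve_left hql
    have hp1 : D.line (D.b p) % 2 = 0 := by omega
    have hq1 : D.line (D.b q) % 2 = 0 := by omega
    rw [crB_eq_zero (.inr hq1), crB_eq_zero (.inl hq1), crB_eq_zero (.inl hp1),
      crB_eq_zero (.inr hp1), crB_eq_zero (.inl hp1), crB_eq_zero (.inr hp1),
      B_of_line_ne (p := p) (q := D.b q) (by omega), B_of_line_ne (p := D.b p) (q := q) (by omega),
      crB_eq hp hp' hq', crB_eq hq hq' hp']
    have := cross_add (D := D) p (D.b p) q (D.b q) hp' hq' hne.symm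
      (fun h => hne (by rw [← D.b_b q, ← h, D.b_b]))
    simp only [add_zero, this]
  have hp' : ¬ D.line (D.b (D.b p)) = D.line (D.b p) := by rw [D.b_b]; exact Ne.symm hp
  have hq' : ¬ D.line (D.b (D.b q)) = D.line (D.b q) := by rw [D.b_b]; exact Ne.symm hq
  have hpb' : D.b (D.b p) ≠ D.b p := by rw [D.b_b]; exact hpb.symm
  have hqb' : D.b (D.b q) ≠ D.b q := by rw [D.b_b]; exact hqb.symm
  rcases Nat.mod_two_eq_zero_or_one (D.line p) with hpe | hpo <;>
    rcases Nat.mod_two_eq_zero_or_one (D.line q) with hqe | hqo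
  · have e1 := (D.b_even p hpe).resolve_left hp
    have e2 := (D.b_even q hqe).resolve_left hq
    have := key (D.b p) (D.b q) hpb' hqb' (by omega) (by omega) hp' hq' h4
    rw [D.b_b, D.b_b] at this
    linear_combination this
  · have e1 := (D.b_even p hpe).resolve_left hp
    have := key (D.b p) q hpb' hqb (by omega) hqo hp' hq h2
    rw [D.b_b] at this
    linear_combination this
  · have e2 := (D.b_even q hqe).resolve_left hq
    have := key p (D.b q) hpb hqb' hpo (by omega) hp hq' h3
    rw [D.b_b] at this
    linear_combination this
  · exact key p q hpb hqb hpo hqo hp hq h1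

end Drawing

end Spin

/-! ### Sums over one component -/

namespace Spin

open Finset

namespace Drawing

variable {X : Type} [Fintype X] {D : Drawing X}

open Classical in
/-- The points on the component of `p`. -/
noncomputable def comp (D : Drawing X) (p : X) : Finset X := univ.filter fun q => D.Conn p q

theorem mem_comp {p q : X} : q ∈ D.comp p ↔ D.Conn p q := by simp [comp]

theorem a_mem_comp {p q : X} : D.a q ∈ D.comp p ↔ q ∈ D.comp p := by
  rw [mem_comp, mem_comp]
  exact ⟨fun h => h.trans (Wiring.conn_a q).symm, fun h => h.trans (Wiring.conn_a q)⟩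

theorem b_mem_comp {p q : X} : D.b q ∈ D.comp p ↔ q ∈ D.comp p := by
  rw [mem_comp, mem_comp]
  exact ⟨fun h => h.trans (Wiring.conn_b q).symm, fun h => h.trans (Wiring.conn_b q)⟩

theorem sum_comp_b {R : Type*} [AddCommMonoid R] (p : X) (f : X → R) :
    ∑ q ∈ D.comp p, f (D.b q) = ∑ q ∈ D.comp p, f q :=
  sum_bij' (fun q _ => D.b q) (fun q _ => D.b q) (fun q hq => b_mem_comp.2 hq)
    (fun q hq => b_mem_comp.2 hq) (fun q _ => D.b_b q) (fun q _ => D.b_b q) (fun q _ => rfl)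

theorem sum_comp_a {R : Type*} [AddCommMonoid R] (p : X) (f : X → R) :
    ∑ q ∈ D.comp p, f (D.a q) = ∑ q ∈ D.comp p, f q :=
  sum_bij' (fun q _ => D.a q) (fun q _ => D.a q) (fun q hq => a_mem_comp.2 hq)
    (fun q hq => a_mem_comp.2 hq) (fun q _ => D.a_a q) (fun q _ => D.a_a q) (fun q _ => rfl)

theorem sum_comp_eq {R : Type*} [AddCommMonoid R] {p : X} {n : ℕ} {e : ℕ → X} (f : X → R)
    (hmem : ∀ i, D.Conn p (e i)) (hinj : ∀ i j, i < n → j < n → e i = e j → i = j)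
    (hcov : ∀ q, D.Conn p q → ∃ i < n, e i = q) :
    ∑ q ∈ D.comp p, f q = ∑ i ∈ range n, f (e i) := by
  symm
  refine sum_bij (fun i _ => e i) (fun i _ => mem_comp.2 (hmem i))
    (fun i hi j hj h => hinj i j (mem_range.1 hi) (mem_range.1 hj) h) (fun q hq => ?_)
    (fun _ _ => rfl)
  obtain ⟨i, hi, rfl⟩ := hcov q (mem_comp.1 hq)
  exact ⟨i, mem_range.2 hi, rfl⟩

open Classical in
/-- The number of points of a component on a line, modulo two. -/
noncomputable def lineCount (D : Drawing X) (p : X) (h : ℕ) : ZMod 2 :=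
  ∑ q ∈ D.comp p, if D.line q = h then 1 else 0

/-- The arcs `a` match the lines `2 * i` and `2 * i + 1`, and `b` matches the points on the lines `2
* i + 1` and `2 * i + 2` among themselves without fixed points. The induction starts at the line
`0`, which a component without ends does not meet. -/
theorem lineCount_eq_zero {p : X} (hcl : ∀ q, D.Conn p q → D.b q ≠ q) (h : ℕ) :
    D.lineCount p h = 0 := by
  classical
  have hodd : ∀ i, D.lineCount p (2 * i) = D.lineCount p (2 * i + 1) := by
    intro i
    unfold lineCount
    rw [← sum_comp_a]
    refine sum_congr rfl fun q _ => ?_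
    congr 1
    rcases Nat.mod_two_eq_zero_or_one (D.line q) with h | h
    · have := D.a_even q h
      simp only [eq_iff_iff]; omega
    · have := D.a_odd q h
      simp only [eq_iff_iff]; omega
  have heven : ∀ i, D.lineCount p (2 * i + 1) + D.lineCount p (2 * i + 2) = 0 := by
    intro i
    unfold lineCount
    rw [← sum_add_distrib]
    have : ∀ q, ((if D.line q = 2 * i + 1 then 1 else 0) +
        (if D.line q = 2 * i + 2 then 1 else 0) : ZMod 2) =
        if D.line q = 2 * i + 1 ∨ D.line q = 2 * i + 2 then 1 else 0 := by
      intro q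
      by_cases h1 : D.line q = 2 * i + 1
      · simp [h1]
      · by_cases h2 : D.line q = 2 * i + 2 <;> simp [h1, h2]
    simp only [this]
    refine sum_involution (fun q _ => D.b q) (fun q hq => ?_)
      (fun q hq _ => hcl q (mem_comp.1 hq)) (fun q hq => b_mem_comp.2 hq) (fun q _ => D.b_b q)
    have : (D.line (D.b q) = 2 * i + 1 ∨ D.line (D.b q) = 2 * i + 2) ↔
        (D.line q = 2 * i + 1 ∨ D.line q = 2 * i + 2) := by
      rcases Nat.mod_two_eq_zero_or_one (D.line q) with h | h
      · have := D.b_even q h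
        omega
      · have := D.b_odd q h
        omega
    simp only [this]
    split_ifs <;> rfl
  have h0 : ∀ i, D.lineCount p (2 * i) = 0 := by
    intro i
    induction i with
    | zero =>
      refine sum_eq_zero fun q hq => if_neg fun h => hcl q (mem_comp.1 hq) ?_
      exact (D.end_iff q).2 (.inl (by simpa using h))
    | succ i ih =>
      have := heven i
      rw [← hodd, ih, zero_add] at this
      exact this
  obtain ⟨i, rfl | rfl⟩ := Nat.even_or_odd' h
  · exact h0 i
  · rw [← hodd, h0]

open Classical in
/-- The number of crossings of a component with itself. -/
noncomputable def crossings (D : Drawing X) (p : X) : ℕ :=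
  ((D.comp p ×ˢ D.comp p).filter fun q => D.Cr q.1 q.2).card

open Classical in
/-- The number of cups and caps in a component whose left end has a property. -/
noncomputable def turns (D : Drawing X) (P : X → Prop) (p : X) : ℕ :=
  ((D.comp p).filter fun q => D.TurnL q ∧ P q).card

open Classical in
/-- The number of pairs of ends of a component on the same line such that the strand runs downwards
at the left one. -/
noncomputable def endPairs (D : Drawing X) (o : X → Bool) (p : X) : ℕ :=
  ((D.comp p ×ˢ D.comp p).filter fun q => D.b q.1 = q.1 ∧ D.b q.2 = q.2 ∧
    D.line q.1 = D.line q.2 ∧ D.lt q.1 q.2 ∧ D.down o q.1 = true).card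

theorem crossings_cast (p : X) : (D.crossings p : ZMod 2) =
    ∑ q ∈ D.comp p, ∑ r ∈ D.comp p, D.crA q r + ∑ q ∈ D.comp p, ∑ r ∈ D.comp p, D.crB q r := by
  classical
  rw [crossings, card_filter, Nat.cast_sum, sum_product, ← sum_add_distrib]
  refine sum_congr rfl fun q _ => ?_
  rw [← sum_add_distrib]
  refine sum_congr rfl fun r _ => ?_
  unfold crA crB
  rcases Nat.mod_two_eq_zero_or_one (D.line q) with h | h <;> simp [h]

open Classical in
theorem B_b {o : X → Bool} (q : X) (ho : o q = false) (hq : D.b q ≠ q) :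
    D.B q (D.b q) = if o q = false ∧ D.TurnL q then 1 else 0 := by
  unfold B TurnL
  congr 1
  simp [ho, hq, eq_comm]

/-- The blocks `{2 * k, 2 * k + 1}` of the walk are the arcs `a`. The pairs inside a block can be
added for free, since the two ends of such an arc are on different lines. -/
theorem sum_crA_walk {n : ℕ} {e : ℕ → X} (ha : ∀ k, e (2 * k + 1) = D.a (e (2 * k)))
    (hinj : ∀ i j, i < 2 * n → j < 2 * n → e i = e j → i = j) :
    ∑ i ∈ range (2 * n), ∑ j ∈ range (2 * n), D.crA (e i) (e j) =
      triSum (fun i j => D.B (e i) (e j)) (2 * n) := by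
  rw [sum_square fun i j => D.crA (e i) (e j), ← pairSum_add, sum_eq_zero, sum_eq_zero]
  · congr 1
    refine pairSum_congr fun k l hkl hl => ?_
    simp only [ha]
    refine crA_block (fun h => ?_) (fun h => ?_)
    · have := hinj _ _ (by omega) (by omega) h
      omega
    · rw [← ha] at h
      have := hinj _ _ (by omega) (by omega) h
      omega
  · intro k _
    rw [ha, B_a]
  · intro k _
    rw [ha]
    have h1 : ∀ q, D.crA q q = 0 := fun q => by
      unfold crA Cr
      rw [if_neg]
      exact fun h => D.lt_irrefl _ h.2.2.1
    rw [h1, h1]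
    have h2 : D.line (e (2 * k)) % 2 = 1 ∨ D.line (D.a (e (2 * k))) % 2 = 1 := by
      rcases Nat.mod_two_eq_zero_or_one (D.line (e (2 * k))) with h | h
      · have := D.a_even _ h
        omega
      · exact .inl h
    rw [crA_eq_zero h2, crA_eq_zero h2.symm]
    simp

/-- Now the blocks are arcs `b`, whose ends are on the same line if the arc is a turn. The pairs
inside blocks are therefore subtracted. -/
theorem sum_crB_walk {n : ℕ} {e : ℕ → X} (hb : ∀ k < n, e (2 * k + 1) = D.b (e (2 * k)))
    (hne : ∀ k < n, D.b (e (2 * k)) ≠ e (2 * k))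
    (hinj : ∀ i j, i < 2 * n → j < 2 * n → e i = e j → i = j) :
    ∑ i ∈ range (2 * n), ∑ j ∈ range (2 * n), D.crB (e i) (e j) =
      triSum (fun i j => D.B (e i) (e j)) (2 * n) -
        ∑ k ∈ range n, D.B (e (2 * k)) (D.b (e (2 * k))) := by
  rw [sum_square fun i j => D.crB (e i) (e j), ← pairSum_add, add_sub_assoc]
  congr 1
  · refine pairSum_congr fun k l hkl hl => ?_
    simp only [hb k (by omega), hb l hl]
    refine crB_block (hne k (by omega)) (hne l hl) (fun h => ?_) (fun h => ?_)
    · have := hinj _ _ (by omega) (by omega) h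
      omega
    · rw [← hb k (by omega)] at h
      have := hinj _ _ (by omega) (by omega) h
      omega
  · rw [← sum_sub_distrib]
    refine sum_congr rfl fun k hk => ?_
    rw [hb k (mem_range.1 hk)]
    have h1 : ∀ q, D.crB q q = 0 := fun q => by
      unfold crB Cr
      rw [if_neg]
      exact fun h => D.lt_irrefl _ h.2.2.1
    have h2 : ∀ q, D.b q ≠ q → D.crB q (D.b q) = 0 := by
      intro q hq
      rcases Nat.mod_two_eq_zero_or_one (D.line q) with h | h
      · exact crB_eq_zero (.inl h)
      · rcases D.b_odd q h with h' | h'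
        · exact crB_eq_zero_of_line_b (.inl h')
        · exact crB_eq_zero (.inr (by omega))
    have h3 := h2 (D.b (e (2 * k))) (by
      rw [D.b_b]; exact (hne k (mem_range.1 hk)).symm)
    rw [D.b_b] at h3
    rw [h1, h1, h2 _ (hne k (mem_range.1 hk)), h3]
    simp

end Drawing

end Spin

/-! ### Whitney's formula modulo two -/

namespace Spin

open Finset

namespace Drawing

variable {X : Type} [Fintype X] {D : Drawing X}

open Classical in
/-- The indicator of the left ends of cups and caps that are passed from left to right. -/
noncomputable def rightTurn (D : Drawing X) (o : X → Bool) (q : X) : ZMod 2 :=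
  if o q = false ∧ D.TurnL q then 1 else 0

/-- Both kinds of crossings become sums of `B` over the pairs of points in the order of the walk,
which starts at position `0` for the arcs `a` and at position `1` for the arcs `b`. The sums differ
only in the pairs that contain `p`, which comes first in one of them and last in the other. These
pairs count the other points on the line of `p`, an odd number. The subtracted pairs inside the
blocks of `b` are the turns passed from left to right. -/
theorem crossings_closed {o : X → Bool} (ho : D.Coloring o) {p : X} (hp : o p = true)
    (hcl : ∀ q, D.Conn p q → D.b q ≠ q) :
    (D.crossings p : ZMod 2) = ∑ q ∈ D.comp p, D.rightTurn o q + 1 := by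
  classical
  obtain ⟨n, hn, hret, hev, hinj, hcov⟩ := Wiring.exists_closed_walk ho hp hcl
  set e := D.walk p with he
  have hconn : ∀ i, D.Conn p (e i) := Wiring.conn_walk p
  have he0 : e 0 = p := Wiring.walk_zero p
  -- The walk shifted by one position; its last entry is `p` again.
  have hinj' : ∀ i j, i < 2 * n → j < 2 * n → e (i + 1) = e (j + 1) → i = j := by
    have key : ∀ i < 2 * n, ∃ i' < 2 * n, e (i + 1) = e i' ∧
        (i + 1 = i' ∨ (i + 1 = 2 * n ∧ i' = 0)) := by
      intro i hi
      by_cases h : i + 1 < 2 * n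
      · exact ⟨i + 1, h, rfl, .inl rfl⟩
      · exact ⟨0, by omega, by rw [show i + 1 = 2 * n by omega, hret, he0], .inr ⟨by omega, rfl⟩⟩
    intro i j hi hj h
    obtain ⟨i', hi', hi1, hi2⟩ := key i hi
    obtain ⟨j', hj', hj1, hj2⟩ := key j hj
    have := hinj i' j' hi' hj' (by rw [← hi1, ← hj1, h])
    omega
  have hcov' : ∀ q, D.Conn p q → ∃ i < 2 * n, e (i + 1) = q := by
    intro q hq
    obtain ⟨i, hi, rfl⟩ := hcov q hq
    cases i with
    | zero => exact ⟨2 * n - 1, by omega, by rw [show 2 * n - 1 + 1 = 2 * n by omega, hret, he0]⟩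
    | succ i => exact ⟨i, by omega, rfl⟩
  have hA : ∑ q ∈ D.comp p, ∑ r ∈ D.comp p, D.crA q r =
      triSum (fun i j => D.B (e i) (e j)) (2 * n) := by
    rw [← sum_crA_walk (Wiring.walk_odd p) hinj, sum_comp_eq _ hconn hinj hcov]
    exact sum_congr rfl fun i _ => sum_comp_eq _ hconn hinj hcov
  have hB : ∑ q ∈ D.comp p, ∑ r ∈ D.comp p, D.crB q r =
      triSum (fun i j => D.B (e (i + 1)) (e (j + 1))) (2 * n) -
        ∑ k ∈ range n, D.B (e (2 * k + 1)) (D.b (e (2 * k + 1))) := by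
    rw [← sum_crB_walk (e := fun i => e (i + 1)) (fun k _ => Wiring.walk_even_succ p k)
      (fun k _ => hcl _ (hconn _)) hinj', sum_comp_eq _ (fun i => hconn (i + 1)) hinj' hcov']
    exact sum_congr rfl fun i _ => sum_comp_eq _ (fun i => hconn (i + 1)) hinj' hcov'
  have hS : ∑ q ∈ D.comp p, D.rightTurn o q =
      ∑ k ∈ range n, D.B (e (2 * k + 1)) (D.b (e (2 * k + 1))) := by
    rw [sum_comp_eq _ (fun i => hconn (i + 1)) hinj' hcov', sum_range_two_mul]
    refine sum_congr rfl fun k _ => ?_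
    have h1 : o (e (2 * k + 1)) = false := by
      rw [he, Wiring.walk_odd, ho.a, hev]
      rfl
    rw [B_b _ h1 (hcl _ (hconn _))]
    have h2 : o (e (2 * k + 1 + 1)) = true := by
      have := hev (k + 1)
      rwa [show 2 * (k + 1) = 2 * k + 1 + 1 by ring] at this
    simp [rightTurn, h2]
  rw [crossings_cast, hA, hB, hS]
  obtain ⟨m, hm⟩ : ∃ m, 2 * n = m + 1 := ⟨2 * n - 1, by omega⟩
  rw [hm, triSum_succ_left, triSum_succ (fun i j => D.B (e (i + 1)) (e (j + 1)))]
  have hlast : ∑ b ∈ range m, D.B (e 0) (e (b + 1)) + ∑ a ∈ range m, D.B (e (a + 1)) (e (m + 1))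
      = 1 := by
    rw [← sum_add_distrib]
    have h1 : ∀ b ∈ range m, D.B (e 0) (e (b + 1)) + D.B (e (b + 1)) (e (m + 1)) =
        if D.line (e (b + 1)) = D.line p then 1 else 0 := by
      intro b hb
      have hb := mem_range.1 hb
      rw [← hm, hret, he0, B_add_swap]
      · simp only [eq_comm]
      · intro h
        have := hinj 0 (b + 1) (by omega) (by omega) (by rw [he0, h])
        omega
    rw [sum_congr rfl h1]
    -- The even number of points on this line includes `p` itself.
    have h2 := lineCount_eq_zero hcl (D.line p)
    unfold lineCount at h2
    rw [sum_comp_eq _ hconn hinj hcov, hm, sum_range_succ', he0, if_pos rfl] at h2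
    linear_combination h2 - two_eq_zero_zmod
  linear_combination hlast + (triSum (fun i j => D.B (e (i + 1)) (e (j + 1))) m -
    ∑ k ∈ range n, D.B (e (2 * k + 1)) (D.b (e (2 * k + 1)))) * two_eq_zero_zmod

/-- As for closed components, but the blocks of `b` are now the positions `1, …, 2 * m`, without the
two ends. The pairs that contain an end are left over. Interior points are never on the bottom or
top line, so only the pair of the two ends counts, and it gives `B p z` in place of `1`. -/
theorem crossings_open {o : X → Bool} (ho : D.Coloring o) {p : X} (hp : o p = true)
    (hend : D.b p = p) :
    ∃ z, D.Conn p z ∧ D.b z = z ∧ o z = false ∧ (∀ q, D.Conn p q → D.b q = q → q = p ∨ q = z) ∧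
      (D.crossings p : ZMod 2) = ∑ q ∈ D.comp p, D.rightTurn o q + D.B p z := by
  classical
  obtain ⟨n, hn, hlast, hev, hmid, hinj, hcov⟩ := Wiring.exists_open_walk ho hp hend
  set e := D.walk p with he
  have hconn : ∀ i, D.Conn p (e i) := Wiring.conn_walk p
  have he0 : e 0 = p := Wiring.walk_zero p
  obtain ⟨m, rfl⟩ : ∃ m, n = m + 1 := ⟨n - 1, by omega⟩
  rw [show 2 * (m + 1) - 1 = 2 * m + 1 by omega] at hlast
  have hne : ∀ i < 2 * m, D.b (e (i + 1)) ≠ e (i + 1) := by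
    intro i hi
    obtain ⟨k, rfl | rfl⟩ := Nat.even_or_odd' i
    · exact hmid k (by omega)
    · have h1 : e (2 * k + 1 + 1) = D.b (e (2 * k + 1)) := Wiring.walk_even_succ p k
      rw [h1, D.b_b]
      exact (hmid k (by omega)).symm
  have hz : o (e (2 * m + 1)) = false := by
    rw [he, Wiring.walk_odd, ho.a, hev m (by omega)]
    rfl
  refine ⟨e (2 * m + 1), hconn _, hlast, hz, fun q hq hqb => ?_, ?_⟩
  · obtain ⟨i, hi, rfl⟩ := hcov q hq
    cases i with
    | zero => exact .inl he0
    | succ i =>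
      by_cases h : i < 2 * m
      · exact absurd hqb (hne i h)
      · rw [show i = 2 * m by omega]
        exact .inr rfl
  have hA : ∑ q ∈ D.comp p, ∑ r ∈ D.comp p, D.crA q r =
      triSum (fun i j => D.B (e i) (e j)) (2 * (m + 1)) := by
    rw [← sum_crA_walk (Wiring.walk_odd p) hinj, sum_comp_eq _ hconn hinj hcov]
    exact sum_congr rfl fun i _ => sum_comp_eq _ hconn hinj hcov
  have hzero : ∀ q, D.b q = q → ∀ r, D.crB q r = 0 ∧ D.crB r q = 0 := fun q hq r =>
    ⟨crB_eq_zero_of_line_b (.inl (by rw [hq])), crB_eq_zero_of_line_b (.inr (by rw [hq]))⟩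
  have hb0 : D.b (e 0) = e 0 := by rw [he0, hend]
  have hB : ∑ q ∈ D.comp p, ∑ r ∈ D.comp p, D.crB q r =
      triSum (fun i j => D.B (e (i + 1)) (e (j + 1))) (2 * m) -
        ∑ k ∈ range m, D.B (e (2 * k + 1)) (D.b (e (2 * k + 1))) := by
    rw [← sum_crB_walk (e := fun i => e (i + 1)) (fun k _ => Wiring.walk_even_succ p k)
      (fun k hk => hne (2 * k) (by omega))
      (fun i j hi hj h => by
        have := hinj (i + 1) (j + 1) (by omega) (by omega) h
        omega), sum_comp_eq _ hconn hinj hcov]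
    have h1 : ∀ q, ∑ r ∈ D.comp p, D.crB q r = ∑ j ∈ range (2 * m), D.crB q (e (j + 1)) := by
      intro q
      rw [sum_comp_eq _ hconn hinj hcov, show 2 * (m + 1) = 2 * m + 1 + 1 by ring, sum_range_succ,
        sum_range_succ', (hzero _ hb0 q).2, (hzero _ hlast q).2, add_zero, add_zero]
    simp only [h1]
    rw [show 2 * (m + 1) = 2 * m + 1 + 1 by ring, sum_range_succ, sum_range_succ']
    simp only [(hzero _ hb0 _).1, (hzero _ hlast _).1, sum_const_zero, add_zero]
  have hS : ∑ q ∈ D.comp p, D.rightTurn o q =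
      ∑ k ∈ range m, D.B (e (2 * k + 1)) (D.b (e (2 * k + 1))) := by
    have h0 : ∀ q, D.b q = q → D.rightTurn o q = 0 := fun q hq => by
      simp [rightTurn, TurnL, hq]
    rw [sum_comp_eq _ hconn hinj hcov, show 2 * (m + 1) = 2 * m + 1 + 1 by ring, sum_range_succ,
        sum_range_succ', h0 _ hb0, h0 _ hlast, add_zero, add_zero, sum_range_two_mul]
    refine sum_congr rfl fun k hk => ?_
    have hk := mem_range.1 hk
    have h1 : o (e (2 * k + 1)) = false := by
      rw [he, Wiring.walk_odd, ho.a, hev k (by omega)]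
      rfl
    rw [B_b _ h1 (hne (2 * k) (by omega))]
    have h2 : o (e (2 * k + 1 + 1)) = true := by
      have := hev (k + 1) (by omega)
      rwa [show 2 * (k + 1) = 2 * k + 1 + 1 by ring] at this
    simp [rightTurn, h2]
  have hBz : ∀ q r, D.b q = q → D.b r ≠ r → D.B q r = 0 ∧ D.B r q = 0 := by
    intro q r hq hr
    have : D.line q ≠ D.line r := by
      intro h
      have := (D.end_iff q).1 hq
      rw [h] at this
      exact hr ((D.end_iff r).2 this)
    exact ⟨B_of_line_ne this, B_of_line_ne this.symm⟩
  rw [crossings_cast, hA, hB, hS, show 2 * (m + 1) = 2 * m + 1 + 1 by ring, triSum_succ_left,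
    triSum_succ (fun i j => D.B (e (i + 1)) (e (j + 1))), sum_range_succ,
    sum_eq_zero fun a ha => (hBz _ _ hlast (hne a (mem_range.1 ha))).2,
    sum_eq_zero fun a ha => (hBz _ _ hb0 (hne a (mem_range.1 ha))).1, he0]
  linear_combination (triSum (fun i j => D.B (e (i + 1)) (e (j + 1))) (2 * m) -
    ∑ k ∈ range m, D.B (e (2 * k + 1)) (D.b (e (2 * k + 1)))) * two_eq_zero_zmod

theorem line_a_mod (q : X) : (D.line (D.a q) % 2 = 0) ↔ ¬ D.line q % 2 = 0 := by
  rcases Nat.mod_two_eq_zero_or_one (D.line q) with h | h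
  · have := D.a_even q h; omega
  · have := D.a_odd q h; omega

theorem turnL_b {q : X} (hq : D.b q ≠ q) (hl : D.line (D.b q) = D.line q) :
    D.TurnL (D.b q) ↔ ¬ D.TurnL q := by
  have h1 := D.lt_iff _ _ hl hq
  have h2 : D.line (D.b q) = D.line (D.b (D.b q)) := by rw [D.b_b, hl]
  have h3 : q ≠ D.b q := Ne.symm hq
  simp only [TurnL, D.b_b]
  tauto

open Classical in
/-- The number of ends of a component that have a property. -/
noncomputable def ends (D : Drawing X) (P : X → Prop) (p : X) : ℕ :=
  ((D.comp p).filter fun q => D.b q = q ∧ P q).card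

/-- Twice the number of cups of a component minus the number of its caps is the number of its ends
on odd lines minus the number of its ends on even lines. -/
theorem two_mul_caps (D : Drawing X) (p : X) :
    2 * D.turns (fun q => D.line q % 2 = 1) p +
        D.ends (fun q => D.line q % 2 = 1) p =
      2 * D.turns (fun q => D.line q % 2 = 0) p +
        D.ends (fun q => D.line q % 2 = 0) p := by
  classical
  -- This sign changes along the arcs `a` and along the monotone arcs `b`. In the sum of `s q + s (b
  -- q)` only the turns and the ends survive.
  let s : X → ℤ := fun q => if D.line q % 2 = 0 then 1 else -1
  have h1 : ∑ q ∈ D.comp p, s q = 0 := by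
    have h := sum_comp_a (D := D) p s
    have h' : ∀ q, s (D.a q) = - s q := fun q => by
      simp only [s, line_a_mod]
      split_ifs <;> rfl
    simp only [h', sum_neg_distrib] at h
    omega
  have h2 : ∑ q ∈ D.comp p, (s q + s (D.b q)) = 0 := by
    rw [sum_add_distrib, sum_comp_b, h1, add_zero]
  let t : X → ℤ := fun q => if D.TurnL q then s q else 0
  have h3 : ∀ q, s q + s (D.b q) = 2 * (if D.b q = q then s q else 0) + 2 * (t q + t (D.b q)) := by
    intro q
    by_cases hq : D.b q = q
    · have : ¬ D.TurnL q := fun h => h.1 hq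
      simp only [t, hq, this, if_true, if_false]
      ring
    · by_cases hl : D.line (D.b q) = D.line q
      · have h4 := turnL_b hq hl
        have h5 : s (D.b q) = s q := by simp only [s, hl]
        simp only [t, hq, h4, h5, if_false]
        split_ifs <;> ring
      · have h4 : ¬ D.TurnL q := fun h => hl h.2.1
        have h5 : ¬ D.TurnL (D.b q) := fun h => hl (by have := h.2.1; rw [D.b_b] at this; exact this.symm)
        simp only [t, hq, h4, h5, if_false, s]
        have h6 : (D.line (D.b q) % 2 = 0) ↔ ¬ D.line q % 2 = 0 := by
          rcases Nat.mod_two_eq_zero_or_one (D.line q) with h | h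
          · have := D.b_even q h; omega
          · have := D.b_odd q h; omega
        simp only [h6]
        split_ifs <;> rfl
  simp only [h3] at h2
  rw [sum_add_distrib, ← mul_sum, ← mul_sum, sum_add_distrib, sum_comp_b] at h2
  have h4 : ∀ P : X → Prop, ∑ q ∈ D.comp p, (if P q then s q else 0) =
      ((D.comp p).filter fun q => P q ∧ D.line q % 2 = 0).card -
        ((D.comp p).filter fun q => P q ∧ D.line q % 2 = 1).card := by
    intro P
    rw [card_filter, card_filter, Nat.cast_sum, Nat.cast_sum, ← sum_sub_distrib]
    refine sum_congr rfl fun q _ => ?_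
    rcases Nat.mod_two_eq_zero_or_one (D.line q) with h | h <;> by_cases h' : P q <;>
      simp [s, h, h']
  simp only [t] at h2
  have h5 : ∑ q ∈ D.comp p, (if D.TurnL q then s q else 0) =
      D.turns (fun q => D.line q % 2 = 0) p - D.turns (fun q => D.line q % 2 = 1) p :=
    (h4 _).trans (by unfold turns; congr!)
  have h6 : ∑ q ∈ D.comp p, (if D.b q = q then s q else 0) =
      D.ends (fun q => D.line q % 2 = 0) p - D.ends (fun q => D.line q % 2 = 1) p :=
    (h4 fun q => D.b q = q).trans (by unfold ends; congr!)
  rw [h5, h6] at h2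
  omega

theorem turns_add (D : Drawing X) (p : X) :
    D.turns (fun q => D.line q % 2 = 0) p + D.turns (fun q => D.line q % 2 = 1) p =
      D.turns (fun _ => True) p := by
  classical
  unfold turns
  rw [card_filter, card_filter, card_filter, ← sum_add_distrib]
  refine sum_congr rfl fun q _ => ?_
  rcases Nat.mod_two_eq_zero_or_one (D.line q) with h | h <;> simp [h]

/-- A cap either runs downwards at its left end or is passed from left to right, but not both. For a
cup the two properties are equivalent, so that it counts twice or not at all. -/
theorem turns_down {o : X → Bool} (p : X) :
    (D.turns (fun q => D.down o q = true) p : ZMod 2) + ∑ q ∈ D.comp p, D.rightTurn o q =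
      D.turns (fun q => D.line q % 2 = 1) p := by
  classical
  unfold turns rightTurn
  rw [card_filter, card_filter, Nat.cast_sum, Nat.cast_sum, ← sum_add_distrib]
  refine sum_congr rfl fun q _ => ?_
  unfold down
  rcases Nat.mod_two_eq_zero_or_one (D.line q) with h | h <;> by_cases h' : D.TurnL q <;>
    cases ho : o q <;> simp [h, h', ho] <;> rfl

theorem comp_eq {p q : X} (h : D.Conn p q) : D.comp p = D.comp q := by
  ext r
  rw [mem_comp, mem_comp]
  exact ⟨fun h' => h.symm.trans h', fun h' => h.trans h'⟩

open Classical in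
/-- The number of superfluous pairs of a cup and a cap in a component. -/
noncomputable def kinks (D : Drawing X) (p : X) : ℕ :=
  if ∀ q ∈ D.comp p, D.b q ≠ q then D.turns (fun _ => True) p / 2 - 1
  else D.turns (fun _ => True) p / 2

/-- At a highest point of the component the arc `b` cannot change the line. The lemma ensures that
the subtraction of `1` in the number of kinks of a closed strand is not truncated. -/
theorem exists_cap {p : X} (hcl : ∀ q, D.Conn p q → D.b q ≠ q) :
    0 < D.turns (fun _ => True) p := by
  classical
  obtain ⟨q, hq, hmax⟩ := exists_max_image (D.comp p) D.line ⟨p, mem_comp.2 (Wiring.Conn.refl p)⟩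
  have hb := hcl q (mem_comp.1 hq)
  have hl : D.line (D.b q) = D.line q := by
    rcases Nat.mod_two_eq_zero_or_one (D.line q) with h | h
    · have := D.a_even q h
      have := hmax _ (a_mem_comp.2 hq)
      omega
    · have := D.b_odd q h
      have := hmax _ (b_mem_comp.2 hq)
      omega
  unfold turns
  rw [card_pos]
  by_cases h : D.TurnL q
  · exact ⟨q, by simp [hq, h]⟩
  · exact ⟨D.b q, by simp [b_mem_comp.2 hq, (turnL_b hb hl).2 h]⟩

/-- There is one more cap than there are kinks, and the crossings differ from the right turns by `1`
modulo two. The two units cancel, and there are no ends. -/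
theorem whitney_closed {o : X → Bool} (ho : D.Coloring o) {p : X} (hp : o p = true)
    (hcl : ∀ q, D.Conn p q → D.b q ≠ q) :
    (D.turns (fun q => D.down o q = true) p : ZMod 2) =
      D.kinks p + D.crossings p + D.endPairs o p := by
  classical
  have h1 := crossings_closed ho hp hcl
  have h2 := turns_down (D := D) (o := o) p
  have h3 := D.two_mul_caps p
  have h4 := D.turns_add p
  have h5 := exists_cap hcl
  have h6 : ∀ q ∈ D.comp p, D.b q ≠ q := fun q hq => hcl q (mem_comp.1 hq)
  have h7 : ∀ P : X → Prop, D.ends P p = 0 := fun P => by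
    rw [ends, card_eq_zero, filter_eq_empty_iff]
    exact fun q hq h => h6 q hq h.1
  rw [h7, h7, add_zero, add_zero] at h3
  have h8 : D.endPairs o p = 0 := by
    unfold endPairs
    rw [card_eq_zero, filter_eq_empty_iff]
    exact fun q hq h => h6 _ (mem_product.1 hq).1 h.1
  have h9 : D.kinks p + 1 = D.turns (fun q => D.line q % 2 = 1) p := by
    unfold kinks
    rw [if_pos h6]
    omega
  have h10 := congrArg (Nat.cast : ℕ → ZMod 2) h9
  push_cast at h10
  rw [h8, h1]
  push_cast
  linear_combination h2 - h10 - (∑ q ∈ D.comp p, D.rightTurn o q) * two_eq_zero_zmod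

/-- The number of caps equals the number of kinks, except for a strand with both ends at the bottom,
where it is larger by one. In that case the end pair is counted exactly when `B p z` is `0`, and
this absorbs the unit. If both ends are at the top, the end pair is counted exactly when `B p z` is
`1`. If the ends are on different lines, both terms vanish. -/
theorem whitney_open {o : X → Bool} (ho : D.Coloring o) {p : X} (hp : o p = true)
    (hend : D.b p = p) :
    (D.turns (fun q => D.down o q = true) p : ZMod 2) =
      D.kinks p + D.crossings p + D.endPairs o p := by
  classical
  obtain ⟨z, hz, hzb, hoz, hends, h1⟩ := crossings_open ho hp hend
  have h2 := turns_down (D := D) (o := o) p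
  have h3 := D.two_mul_caps p
  have h4 := D.turns_add p
  have hpz : p ≠ z := fun h => by rw [h, hoz] at hp; simp at hp
  have hfil : ((D.comp p).filter fun q => D.b q = q) = {p, z} := by
    ext q
    simp only [mem_filter, mem_comp, mem_insert, mem_singleton]
    constructor
    · exact fun h => hends q h.1 h.2
    · rintro (rfl | rfl)
      · exact ⟨Wiring.Conn.refl _, hend⟩
      · exact ⟨hz, hzb⟩
  have h7 : ∀ P : X → Prop, D.ends P p =
      (if P p then 1 else 0) + if P z then 1 else 0 := fun P => by
    rw [ends, ← filter_filter, hfil, card_filter, sum_pair hpz]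
  have h8 : D.endPairs o p =
      (if D.line p = D.line z ∧ D.lt p z ∧ D.down o p = true then 1 else 0) +
        if D.line z = D.line p ∧ D.lt z p ∧ D.down o z = true then 1 else 0 := by
    have : ((D.comp p ×ˢ D.comp p).filter fun q => D.b q.1 = q.1 ∧ D.b q.2 = q.2 ∧
        D.line q.1 = D.line q.2 ∧ D.lt q.1 q.2 ∧ D.down o q.1 = true) =
        (({p, z} : Finset X) ×ˢ {p, z}).filter fun q =>
          D.line q.1 = D.line q.2 ∧ D.lt q.1 q.2 ∧ D.down o q.1 = true := by
      rw [← hfil]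
      ext q
      simp only [mem_filter, mem_product]
      tauto
    unfold endPairs
    rw [this, card_filter, sum_product, sum_pair hpz, sum_pair hpz, sum_pair hpz]
    simp [D.lt_irrefl]
  have h6 : ¬ ∀ q ∈ D.comp p, D.b q ≠ q := fun h => h p (mem_comp.2 (Wiring.Conn.refl p)) hend
  have h9 : D.kinks p = D.turns (fun _ => True) p / 2 := if_neg h6
  rw [h7, h7] at h3
  rw [h8, h1]
  have hlz : ∀ q, D.b q = q → D.line q = 0 ∨ D.line q = D.top := fun q h => (D.end_iff q).1 h
  have hB := B_add_swap (D := D) hpz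
  have ht := D.top_odd
  have key : ∀ t k s η β : ZMod 2, ∀ c : ℕ, t + s = c → (c : ZMod 2) + β + η = k →
      t = k + (s + β) + η := by
    intro t k s η β c h h'
    linear_combination h + h' - (s + β + η) * two_eq_zero_zmod
  refine key _ _ _ _ _ _ h2 ?_
  rw [h9]
  rcases hlz p hend with lp | lp <;> rcases hlz z hzb with lz | lz
  · rw [show D.turns (fun q => D.line q % 2 = 1) p = D.turns (fun _ => True) p / 2 + 1 by
      simp [lp, lz] at h3; omega]
    have hBz : D.B z p = if D.lt z p then 1 else 0 := by simp [B, lp, lz]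
    rw [hBz] at hB
    simp only [lp, lz, down, hp, hoz, if_true] at hB ⊢
    push_cast
    simp only [true_and]
    simp
    linear_combination hB + two_eq_zero_zmod
  · rw [show D.turns (fun q => D.line q % 2 = 1) p = D.turns (fun _ => True) p / 2 by
      simp [lp, lz, ht] at h3; omega]
    have : D.top ≠ 0 := by omega
    rw [B_of_line_ne (by omega)]
    simp [lp, lz, this, this.symm]
  · rw [show D.turns (fun q => D.line q % 2 = 1) p = D.turns (fun _ => True) p / 2 by
      simp [lp, lz, ht] at h3; omega]
    have : D.top ≠ 0 := by omega
    rw [B_of_line_ne (by omega)]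
    simp [lp, lz, this, this.symm]
  · rw [show D.turns (fun q => D.line q % 2 = 1) p = D.turns (fun _ => True) p / 2 by
      simp [lp, lz, ht] at h3; omega]
    have hBz : D.B p z = if D.lt p z then 1 else 0 := by simp [B, lp, lz]
    rw [hBz]
    simp only [lp, lz, down, hp, hoz, ht]
    push_cast
    simp
    linear_combination (if D.lt p z then 1 else 0) * two_eq_zero_zmod

/-- The parity of the number of extrema whose left end is directed downwards, in a component. -/
theorem whitney {o : X → Bool} (ho : D.Coloring o) (p : X) :
    (D.turns (fun q => D.down o q = true) p : ZMod 2) =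
      D.kinks p + D.crossings p + D.endPairs o p := by
  -- All terms depend only on the component, so the starting point can be chosen on it.
  have move : ∀ q, D.Conn p q → ((D.turns (fun q => D.down o q = true) q : ZMod 2) =
      D.kinks q + D.crossings q + D.endPairs o q) →
      (D.turns (fun q => D.down o q = true) p : ZMod 2) =
        D.kinks p + D.crossings p + D.endPairs o p := by
    intro q hq h
    unfold turns kinks crossings endPairs turns at h ⊢
    rwa [comp_eq hq]
  by_cases hcl : ∀ q, D.Conn p q → D.b q ≠ q
  · cases hp : o p
    · refine move (D.a p) (Wiring.conn_a p) (whitney_closed ho (by rw [ho.a, hp]; rfl) ?_)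
      exact fun q hq => hcl q ((Wiring.conn_a p).trans hq)
    · exact whitney_closed ho hp hcl
  · push Not at hcl
    obtain ⟨q, hq, hqb⟩ := hcl
    cases hoq : o q
    -- If `q` has the colour `false`, the other end of the path has the colour `true` and is taken
    -- as the starting point.
    · obtain ⟨z, hz, hzb, hoz, -⟩ := crossings_open ho.not (p := q) (by simp [hoq]) hqb
      exact move z (hq.trans hz) (whitney_open ho (by simpa using hoz) hzb)
    · exact move q hq (whitney_open ho hoq hqb)

end Drawing

end Spin

namespace Spin

/-! ### The arcs in a slice as an involution -/

namespace Slice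

variable (s : Slice)

/-- The label of the edge at a place on one of the two lines that bound a slice. -/
def lab (t : Bool) (j : ℕ) : ℕ := (s.ends t).getD j 0

/-- The number of edges that a piece has on one of its sides. -/
def width (t : Bool) : ℕ := (s.piece.ends t).length

theorem ends_length (t : Bool) :
    (s.ends t).length = s.left.length + s.width t + s.right.length := by
  simp [ends, width, Nat.add_assoc]

theorem lab_left {t : Bool} {j : ℕ} (h : j < s.left.length) : s.lab t j = s.left.getD j 0 := by
  rw [lab, ends, List.append_assoc, List.getD_append _ _ _ _ h]

theorem lab_piece {t : Bool} {j : ℕ} (h : j < s.width t) :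
    s.lab t (s.left.length + j) = (s.piece.ends t).getD j 0 := by
  rw [lab, ends, List.append_assoc, List.getD_append_right _ _ _ _ (by omega),
    List.getD_append _ _ _ _ (by rw [width] at h; omega)]
  congr 1
  omega

theorem lab_right {t : Bool} {j : ℕ} :
    s.lab t (s.left.length + s.width t + j) = s.right.getD j 0 := by
  rw [lab, ends, List.append_assoc, List.getD_append_right _ _ _ _ (by omega),
    List.getD_append_right _ _ _ _ (by rw [width]; omega)]
  congr 1
  rw [width]; omega

/-- Whether an edge ends at a vertex, in the slice. -/
def IsCorner (e : Bool × ℕ) : Prop :=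
  s.piece.IsVertex ∧ s.left.length ≤ e.2 ∧ e.2 < s.left.length + s.width e.1

/-- The other end of the arc of an edge; the ends at a vertex are fixed. -/
def edgeMate (e : Bool × ℕ) : Bool × ℕ :=
  if e.2 < s.left.length then (!e.1, e.2)
  else if s.left.length + s.width e.1 ≤ e.2 then (!e.1, e.2 - s.width e.1 + s.width (!e.1))
  else match s.piece with
    | .turn _ _ => (e.1, if e.2 = s.left.length then e.2 + 1 else e.2 - 1)
    | .cross _ _ => (!e.1, if e.2 = s.left.length then e.2 + 1 else e.2 - 1)
    | .vertex _ _ _ _ => e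

/-- The other end of the arc of a strand at a vertex with `l` edges to the left of it. -/
def vertexMate (l : ℕ) (t : Bool) (a b c : ℕ) (e : Bool × ℕ × ℕ) : Bool × ℕ × ℕ :=
  if e.1 = t then
    if e.2.1 = l then
      if e.2.2 < thru b a c then (!t, l, e.2.2) else (t, l + 1, a - 1 - e.2.2)
    else if e.2.2 < thru c a b then (t, l, a - 1 - e.2.2)
      else (!t, l, thru b a c + (e.2.2 - thru c a b))
  else if e.2.2 < thru b a c then (t, l, e.2.2)
    else (t, l + 1, thru c a b + (e.2.2 - thru b a c))

open Classical in
/-- The other end of the arc of a strand that does not run through a vertex. -/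
noncomputable def segmentMate (e : Bool × ℕ × ℕ) : Bool × ℕ × ℕ :=
  if s.IsCorner (e.1, e.2.1) then e else
    ((s.edgeMate (e.1, e.2.1)).1, (s.edgeMate (e.1, e.2.1)).2,
      if (s.edgeMate (e.1, e.2.1)).1 = e.1 then s.lab e.1 e.2.1 - 1 - e.2.2 else e.2.2)

open Classical in
/-- The other end of the arc of a strand. -/
noncomputable def strandMate (e : Bool × ℕ × ℕ) : Bool × ℕ × ℕ :=
  if s.IsCorner (e.1, e.2.1) then
    match s.piece with
    | .vertex t a b c => vertexMate s.left.length t a b c e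
    | _ => e
  else s.segmentMate e

/-- The places on the two lines that bound a slice. -/
def EdgeValid (e : Bool × ℕ) : Prop := e.2 < (s.ends e.1).length

/-- The places of strands on the two lines that bound a slice. -/
def StrandValid (e : Bool × ℕ × ℕ) : Prop := s.EdgeValid (e.1, e.2.1) ∧ e.2.2 < s.lab e.1 e.2.1

theorem mem_sideEdgeArcs (x : Arc ℕ) : x ∈ s.sideEdgeArcs ↔
    (∃ j < s.left.length, x = ((false, j), (true, j))) ∨
    ∃ j < s.right.length, x = ((false, s.left.length + s.width false + j),
      (true, s.left.length + s.width true + j)) := by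
  simp [sideEdgeArcs, width, eq_comm]

theorem mem_sideStrandArcs (x : Arc (ℕ × ℕ)) : x ∈ s.sideStrandArcs ↔
    (∃ j < s.left.length, ∃ i < s.left.getD j 0, x = ((false, (j, i)), (true, (j, i)))) ∨
    ∃ j < s.right.length, ∃ i < s.right.getD j 0,
      x = ((false, (s.left.length + s.width false + j, i)),
        (true, (s.left.length + s.width true + j, i))) := by
  simp only [sideStrandArcs, width, List.mem_append, List.mem_flatMap, List.mem_range, List.mem_map,
    eq_comm (a := x)]

/-- The properties of the two ends of an arc of an edge. -/
structure EdgeArcProp (x : Arc ℕ) : Prop where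
  valid_fst : s.EdgeValid x.1
  valid_snd : s.EdgeValid x.2
  mate_fst : s.edgeMate x.1 = x.2
  mate_snd : s.edgeMate x.2 = x.1
  ne : x.1 ≠ x.2
  lab_eq : s.lab x.1.1 x.1.2 = s.lab x.2.1 x.2.2
  lt : x.1.1 = x.2.1 → x.1.2 < x.2.2
  up : x.1.1 ≠ x.2.1 → x.1.1 = false
  notCorner_fst : ¬ s.IsCorner x.1
  notCorner_snd : ¬ s.IsCorner x.2

theorem sideEdgeArcs_prop {x : Arc ℕ} (hx : x ∈ s.sideEdgeArcs) :
    s.EdgeArcProp x ∧ x.1.1 = false ∧ x.2.1 = true := by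
  rw [mem_sideEdgeArcs] at hx
  rcases hx with ⟨j, hj, rfl⟩ | ⟨j, hj, rfl⟩
  · refine ⟨⟨?_, ?_, ?_, ?_, ?_, ?_, ?_, ?_, ?_, ?_⟩, rfl, rfl⟩ <;>
      simp [EdgeValid, ends_length, edgeMate, hj, lab_left, IsCorner] <;> omega
  · have hn : ∀ w, ¬ s.left.length + w + j < s.left.length := fun w => by omega
    have hm : ∀ w w', s.left.length + w + j - w + w' = s.left.length + w' + j := fun w w' => by
      omega
    refine ⟨⟨?_, ?_, ?_, ?_, ?_, ?_, ?_, ?_, ?_, ?_⟩, rfl, rfl⟩ <;>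
      simp [EdgeValid, ends_length, edgeMate, hj, lab_right, IsCorner, hn, hm]

theorem edgeArcs_prop {x : Arc ℕ} (hx : x ∈ s.edgeArcs) : s.EdgeArcProp x := by
  rw [edgeArcs, List.mem_append] at hx
  rcases hx with hx | hx
  · exact (s.sideEdgeArcs_prop hx).1
  obtain ⟨L, P, R⟩ := s
  have e0 := fun t => lab_piece (s := ⟨L, P, R⟩) (t := t) (j := 0)
  have e1 := fun t => lab_piece (s := ⟨L, P, R⟩) (t := t) (j := 1)
  cases P with
  | turn t n =>
    simp only [Piece.edgeArcs, List.mem_singleton] at hx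
    subst hx
    have h0 := e0 t
    have h1 := e1 t
    simp [width, Piece.ends] at h0 h1
    refine ⟨?_, ?_, ?_, ?_, ?_, ?_, ?_, ?_, ?_, ?_⟩ <;>
      simp [EdgeValid, ends_length, edgeMate, IsCorner, width, Piece.ends, Piece.IsVertex, h0, h1] <;>
      omega
  | cross a b =>
    simp only [Piece.edgeArcs, List.mem_cons, List.not_mem_nil, or_false] at hx
    have h0 := e0 false
    have h1 := e1 false
    have h2 := e0 true
    have h3 := e1 true
    simp [width, Piece.ends] at h0 h1 h2 h3
    rcases hx with rfl | rfl <;>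
    refine ⟨?_, ?_, ?_, ?_, ?_, ?_, ?_, ?_, ?_, ?_⟩ <;>
      simp [EdgeValid, ends_length, edgeMate, IsCorner, width, Piece.ends, Piece.IsVertex, h0, h1,
        h2, h3] <;> omega
  | vertex t a b c => simp [Piece.edgeArcs] at hx

theorem edgeMate_mem {e : Bool × ℕ} (he : s.EdgeValid e) :
    (s.IsCorner e ∧ s.edgeMate e = e) ∨
      (e, s.edgeMate e) ∈ s.edgeArcs ∨ (s.edgeMate e, e) ∈ s.edgeArcs := by
  obtain ⟨t, j⟩ := e
  simp only [EdgeValid, ends_length] at he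
  by_cases h1 : j < s.left.length
  · right
    simp only [edgeArcs, List.mem_append, mem_sideEdgeArcs, edgeMate, h1, if_true]
    cases t
    · exact .inl (.inl (.inl ⟨j, h1, rfl⟩))
    · exact .inr (.inl (.inl ⟨j, h1, rfl⟩))
  · by_cases h2 : s.left.length + s.width t ≤ j
    · right
      simp only [edgeArcs, List.mem_append, mem_sideEdgeArcs, edgeMate, h1, h2, if_false, if_true]
      cases t
      · refine .inl (.inl (.inr ⟨j - (s.left.length + s.width false), by omega, ?_⟩))
        ext <;> simp <;> omega
      · refine .inr (.inl (.inr ⟨j - (s.left.length + s.width true), by omega, ?_⟩))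
        ext <;> simp <;> omega
    · obtain ⟨L, P, R⟩ := s
      simp only [edgeMate, h1, h2, if_false, edgeArcs, List.mem_append]
      cases P with
      | turn t' n =>
        right
        by_cases h : t = t'
        · subst h
          simp only [width, Piece.ends, if_true, List.length_cons, List.length_nil] at h2
          obtain rfl | rfl : j = L.length ∨ j = L.length + 1 := by simp at h1; omega
          · simp [Piece.edgeArcs]
          · simp [Piece.edgeArcs]
        · simp [width, Piece.ends, h] at h1 h2
          omega
      | cross a b =>
        right
        have : j = L.length ∨ j = L.length + 1 := by
          cases t <;> simp [width, Piece.ends] at h1 h2 <;> omega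
        obtain rfl | rfl := this <;> cases t <;> simp [Piece.edgeArcs]
      | vertex t a b c =>
        left
        refine ⟨⟨trivial, ?_, ?_⟩, rfl⟩ <;> simp at h1 h2 ⊢ <;> omega

end Slice

end Spin

/-! ### Strands in a slice: mates and planarity -/

namespace Spin

theorem AdmissibleTriple.thru_add {a b c : ℕ} (h : AdmissibleTriple a b c) :
    thru b a c + thru c a b = a ∧ thru c a b + thru a b c = b ∧ thru b a c + thru a b c = c := by
  obtain ⟨⟨k, hk⟩, h1, h2, h3⟩ := h
  unfold thru
  omega

/-- The `i`-th of the `n` parallel strands along the arc of an edge. -/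
def strandOf (n i : ℕ) (y : Arc ℕ) : Arc (ℕ × ℕ) :=
  ((y.1.1, y.1.2, i), (y.2.1, y.2.2, if y.1.1 = y.2.1 then n - 1 - i else i))

namespace Slice

variable (s : Slice)

open Classical in
/-- The arcs of the strands that do not run through a vertex. -/
noncomputable def segmentArcs : List (Arc (ℕ × ℕ)) :=
  if s.piece.IsVertex then s.sideStrandArcs else s.strandArcs

theorem lab_piece_zero {t : Bool} (h : 0 < s.width t) :
    s.lab t s.left.length = (s.piece.ends t).getD 0 0 := by
  simpa using s.lab_piece h

theorem mem_sideStrandArcs_iff (x : Arc (ℕ × ℕ)) : x ∈ s.sideStrandArcs ↔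
    ∃ y ∈ s.sideEdgeArcs, ∃ i < s.lab y.1.1 y.1.2, x = strandOf (s.lab y.1.1 y.1.2) i y := by
  rw [mem_sideStrandArcs]
  simp only [mem_sideEdgeArcs]
  constructor
  · rintro (⟨j, hj, i, hi, rfl⟩ | ⟨j, hj, i, hi, rfl⟩)
    · exact ⟨_, .inl ⟨j, hj, rfl⟩, i, by simpa [lab_left, hj] using hi, by simp [strandOf]⟩
    · exact ⟨_, .inr ⟨j, hj, rfl⟩, i, by simpa [lab_right] using hi, by simp [strandOf]⟩
  · rintro ⟨y, ⟨j, hj, rfl⟩ | ⟨j, hj, rfl⟩, i, hi, rfl⟩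
    · exact .inl ⟨j, hj, i, by simpa [lab_left, hj] using hi, by simp [strandOf]⟩
    · exact .inr ⟨j, hj, i, by simpa [lab_right] using hi, by simp [strandOf]⟩

/-- Away from vertices a strand is a parallel copy of its edge; along a turn the copies are nested,
hence the reversed index in `strandOf`. Facts about segments are thereby reduced to facts about
edges. -/
theorem mem_segmentArcs_iff (x : Arc (ℕ × ℕ)) : x ∈ s.segmentArcs ↔
    ∃ y ∈ s.edgeArcs, ∃ i < s.lab y.1.1 y.1.2, x = strandOf (s.lab y.1.1 y.1.2) i y := by
  by_cases hv : s.piece.IsVertex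
  · rw [segmentArcs, if_pos hv, mem_sideStrandArcs_iff]
    have : s.edgeArcs = s.sideEdgeArcs := by
      obtain ⟨L, P, R⟩ := s
      cases P <;> simp_all [Piece.IsVertex, edgeArcs, Piece.edgeArcs]
    rw [this]
  · rw [segmentArcs, if_neg hv, strandArcs, edgeArcs, List.mem_append, mem_sideStrandArcs_iff]
    simp only [List.mem_append, or_and_right, exists_or]
    refine or_congr_right ?_
    obtain ⟨L, P, R⟩ := s
    have e0 := fun t => lab_piece_zero (s := ⟨L, P, R⟩) (t := t)
    have e1 := fun t => lab_piece (s := ⟨L, P, R⟩) (t := t) (j := 1)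
    cases P with
    | turn t n =>
      have h0 := e0 t
      have h1 := e1 t
      simp [width, Piece.ends] at h0 h1
      simp [Piece.edgeArcs, Piece.strandArcs, h0, strandOf, eq_comm]
    | cross a b =>
      have h0 := e0 false
      have h1 := e1 false
      simp [width, Piece.ends] at h0 h1
      simp [Piece.edgeArcs, Piece.strandArcs, h0, h1, strandOf, eq_comm]
    | vertex t a b c => simp [Piece.IsVertex] at hv

theorem mem_vertexArcs (l : ℕ) (t : Bool) (a b c : ℕ) (x : Arc (ℕ × ℕ)) :
    x ∈ (Piece.vertex t a b c).strandArcs l ↔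
      (∃ i < thru b a c, x = legArc t (l, i) (l, i)) ∨
      (∃ i < thru c a b, x = ((t, (l, thru b a c + i)), (t, (l + 1, thru c a b - 1 - i)))) ∨
      ∃ i < thru a b c, x = legArc t (l + 1, thru c a b + i) (l, thru b a c + i) := by
  simp [Piece.strandArcs, or_assoc, eq_comm]

theorem strandMate_of_not_isCorner {e : Bool × ℕ × ℕ} (h : ¬ s.IsCorner (e.1, e.2.1)) :
    s.strandMate e = s.segmentMate e := by
  rw [strandMate, if_neg h]

/-- The properties of the two ends of an arc of a strand. -/
structure StrandArcProp (x : Arc (ℕ × ℕ)) : Prop where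
  valid_fst : s.StrandValid x.1
  valid_snd : s.StrandValid x.2
  mate_fst : s.strandMate x.1 = x.2
  mate_snd : s.strandMate x.2 = x.1
  ne : x.1 ≠ x.2
  lt : x.1.1 = x.2.1 → LeftOf x.1.2 x.2.2
  up : x.1.1 ≠ x.2.1 → x.1.1 = false

theorem segmentArcs_prop {x : Arc (ℕ × ℕ)} (hx : x ∈ s.segmentArcs) :
    s.StrandArcProp x ∧ s.segmentMate x.1 = x.2 ∧ s.segmentMate x.2 = x.1 := by
  rw [mem_segmentArcs_iff] at hx
  obtain ⟨y, hy, i, hi, rfl⟩ := hx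
  have h := s.edgeArcs_prop hy
  have hm1 : s.segmentMate (strandOf (s.lab y.1.1 y.1.2) i y).1 =
      (strandOf (s.lab y.1.1 y.1.2) i y).2 := by
    have h1 : ¬ s.IsCorner (y.1.1, y.1.2) := h.notCorner_fst
    have h2 : s.edgeMate (y.1.1, y.1.2) = y.2 := h.mate_fst
    simp only [segmentMate, strandOf, h1, h2, if_false]
    simp [eq_comm]
  have hm2 : s.segmentMate (strandOf (s.lab y.1.1 y.1.2) i y).2 =
      (strandOf (s.lab y.1.1 y.1.2) i y).1 := by
    have h1 : ¬ s.IsCorner (y.2.1, y.2.2) := h.notCorner_snd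
    have h2 : s.edgeMate (y.2.1, y.2.2) = y.1 := h.mate_snd
    simp only [segmentMate, strandOf, h1, h2, if_false, ← h.lab_eq]
    ext <;> simp
    split_ifs <;> omega
  refine ⟨⟨⟨h.valid_fst, hi⟩, ⟨h.valid_snd, ?_⟩, ?_, ?_, ?_, ?_, ?_⟩, hm1, hm2⟩
  · have := h.lab_eq
    simp only [strandOf]
    rw [← this]
    split_ifs <;> omega
  · exact (s.strandMate_of_not_isCorner h.notCorner_fst).trans hm1
  · exact (s.strandMate_of_not_isCorner h.notCorner_snd).trans hm2
  · intro h'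
    simp only [strandOf, Prod.ext_iff] at h'
    exact h.ne (Prod.ext h'.1 h'.2.1)
  · intro h'
    exact .inl (h.lt h')
  · exact h.up

theorem vertex_lab {t : Bool} {a b c : ℕ} (hs : s.piece = .vertex t a b c) :
    s.lab t s.left.length = a ∧ s.lab t (s.left.length + 1) = b ∧ s.lab (!t) s.left.length = c ∧
      s.width t = 2 ∧ s.width (!t) = 1 := by
  have h0 := fun t => s.lab_piece_zero (t := t)
  have h1 := s.lab_piece (t := t) (j := 1)
  simp only [width, hs] at h0 h1 ⊢
  have h2 := h0 t
  have h3 := h0 (!t)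
  simp [Piece.ends] at h1 h2 h3 ⊢
  exact ⟨h2, h1, h3⟩

theorem mem_strandArcs_of_vertex {t : Bool} {a b c : ℕ} (hs : s.piece = .vertex t a b c)
    (x : Arc (ℕ × ℕ)) : x ∈ s.strandArcs ↔
      x ∈ s.segmentArcs ∨ x ∈ (Piece.vertex t a b c).strandArcs s.left.length := by
  rw [strandArcs, segmentArcs, if_pos (by rw [hs]; trivial), hs, List.mem_append]

theorem strandArcs_eq_of_not_isVertex (hs : ¬ s.piece.IsVertex) : s.strandArcs = s.segmentArcs := by
  rw [segmentArcs, if_neg hs]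

theorem vertexArcs_prop {t : Bool} {a b c : ℕ} (hs : s.piece = .vertex t a b c)
    (hadm : AdmissibleTriple a b c) {x : Arc (ℕ × ℕ)}
    (hx : x ∈ (Piece.vertex t a b c).strandArcs s.left.length) :
    s.StrandArcProp x ∧ s.IsCorner (x.1.1, x.1.2.1) ∧ s.IsCorner (x.2.1, x.2.2.1) := by
  obtain ⟨la, lb, lc, w1, w2⟩ := s.vertex_lab hs
  obtain ⟨e1, e2, e3⟩ := hadm.thru_add
  have hv : s.piece.IsVertex := by rw [hs]; trivial
  have c1 : s.IsCorner (t, s.left.length) := ⟨hv, le_refl _, by simp [w1]⟩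
  have c2 : s.IsCorner (t, s.left.length + 1) := ⟨hv, by simp, by simp [w1]⟩
  have c3 : s.IsCorner (!t, s.left.length) := ⟨hv, le_refl _, by simp [w2]⟩
  have v1 : s.EdgeValid (t, s.left.length) := by simp [EdgeValid, ends_length, w1]; omega
  have v2 : s.EdgeValid (t, s.left.length + 1) := by simp [EdgeValid, ends_length, w1]; omega
  have v3 : s.EdgeValid (!t, s.left.length) := by simp [EdgeValid, ends_length, w2]; omega
  have hm : ∀ e : Bool × ℕ × ℕ, s.IsCorner (e.1, e.2.1) →
      s.strandMate e = vertexMate s.left.length t a b c e := by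
    intro e he
    rw [strandMate, if_pos he, hs]
  have hleg : ∀ p q : ℕ × ℕ, s.StrandValid (t, p) → s.StrandValid (!t, q) →
      s.IsCorner (t, p.1) → s.IsCorner (!t, q.1) → vertexMate s.left.length t a b c (t, p) = (!t, q) →
      vertexMate s.left.length t a b c (!t, q) = (t, p) →
      s.StrandArcProp (legArc t p q) ∧ s.IsCorner ((legArc t p q).1.1, (legArc t p q).1.2.1) ∧
        s.IsCorner ((legArc t p q).2.1, (legArc t p q).2.2.1) := by
    intro p q hp hq hp' hq' h h'
    have h1 := (hm (t, p) hp').trans h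
    have h2 := (hm (!t, q) hq').trans h'
    cases t
    · exact ⟨⟨hp, hq, h1, h2, by simp [legArc], by simp [legArc], by simp [legArc]⟩, hp', hq'⟩
    · exact ⟨⟨hq, hp, h2, h1, by simp [legArc], by simp [legArc], by simp [legArc]⟩, hq', hp'⟩
  rw [mem_vertexArcs] at hx
  rcases hx with ⟨i, hi, rfl⟩ | ⟨i, hi, rfl⟩ | ⟨i, hi, rfl⟩
  · refine hleg _ _ ⟨v1, ?_⟩ ⟨v3, ?_⟩ c1 c3 ?_ ?_
    · simp only [la]; omega
    · simp only [lc]; omega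
    · simp [vertexMate, hi]
    · simp [vertexMate, hi]
  · have hm1 : vertexMate s.left.length t a b c (t, s.left.length, thru b a c + i) =
        (t, s.left.length + 1, thru c a b - 1 - i) := by
      simp [vertexMate]
      omega
    have hm2 : vertexMate s.left.length t a b c (t, s.left.length + 1, thru c a b - 1 - i) =
        (t, s.left.length, thru b a c + i) := by
      have : thru c a b - 1 - i < thru c a b := by omega
      simp [vertexMate, this]
      omega
    refine ⟨⟨⟨v1, ?_⟩, ⟨v2, ?_⟩, (hm _ c1).trans hm1, (hm _ c2).trans hm2, ?_, ?_, ?_⟩, c1, c2⟩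
    · simp only [la]; omega
    · simp only [lb]; omega
    · simp
    · intro _
      left
      simp
    · simp
  · refine hleg _ _ ⟨v2, ?_⟩ ⟨v3, ?_⟩ c2 c3 ?_ ?_
    · simp only [lb]; omega
    · simp only [lc]; omega
    · simp [vertexMate]
    · simp [vertexMate]

theorem strandArcs_prop (hadm : s.piece.Admissible) {x : Arc (ℕ × ℕ)} (hx : x ∈ s.strandArcs) :
    s.StrandArcProp x := by
  by_cases hv : s.piece.IsVertex
  · cases hs : s.piece with
    | vertex t a b c =>
      rw [s.mem_strandArcs_of_vertex hs] at hx
      rw [hs] at hadm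
      rcases hx with hx | hx
      · exact (s.segmentArcs_prop hx).1
      · exact (s.vertexArcs_prop hs hadm hx).1
    | _ => rw [hs] at hv; exact hv.elim
  · rw [s.strandArcs_eq_of_not_isVertex hv] at hx
    exact (s.segmentArcs_prop hx).1

theorem segmentMate_mem {e : Bool × ℕ × ℕ} (he : s.StrandValid e) :
    (s.IsCorner (e.1, e.2.1) ∧ s.segmentMate e = e) ∨
      (e, s.segmentMate e) ∈ s.segmentArcs ∨ (s.segmentMate e, e) ∈ s.segmentArcs := by
  obtain ⟨t, j, i⟩ := e
  obtain ⟨he1, he2⟩ := he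
  simp only at he1 he2
  by_cases hc : s.IsCorner (t, j)
  · exact .inl ⟨hc, by rw [segmentMate, if_pos hc]⟩
  right
  simp only [mem_segmentArcs_iff, segmentMate, hc, if_false]
  rcases s.edgeMate_mem he1 with h | h | h
  · exact absurd h.1 hc
  · exact .inl ⟨_, h, i, he2, by simp [strandOf, eq_comm]⟩
  · right
    have hp := (s.edgeArcs_prop h).lab_eq
    simp only at hp
    refine ⟨_, h, if (s.edgeMate (t, j)).1 = t then s.lab t j - 1 - i else i, ?_, ?_⟩
    · simp only [hp]
      split_ifs <;> omega
    · simp only [hp, strandOf]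
      ext <;> simp
      split_ifs <;> omega

theorem strandMate_mem (hadm : s.piece.Admissible) {e : Bool × ℕ × ℕ} (he : s.StrandValid e) :
    (e, s.strandMate e) ∈ s.strandArcs ∨ (s.strandMate e, e) ∈ s.strandArcs := by
  by_cases hc : s.IsCorner (e.1, e.2.1)
  · have hv := hc.1
    cases hs : s.piece with
    | vertex t a b c =>
      obtain ⟨la, lb, lc, w1, w2⟩ := s.vertex_lab hs
      rw [hs] at hadm
      obtain ⟨e1, e2, e3⟩ := AdmissibleTriple.thru_add hadm
      have hm : s.strandMate e = vertexMate s.left.length t a b c e := by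
        rw [strandMate, if_pos hc, hs]
      simp only [s.mem_strandArcs_of_vertex hs, mem_vertexArcs, hm]
      obtain ⟨t', j, i⟩ := e
      obtain ⟨-, hc1, hc2⟩ := hc
      have hi : i < s.lab t' j := he.2
      simp only at hc1 hc2
      by_cases ht : t' = t
      · subst ht
        obtain rfl | rfl : j = s.left.length ∨ j = s.left.length + 1 := by omega
        · rw [la] at hi
          by_cases h : i < thru b a c
          · cases t' <;> simp [vertexMate, h, legArc]
          · refine .inl (.inr (.inr (.inl ⟨i - thru b a c, by omega, ?_⟩)))
            ext <;> simp [vertexMate, h] <;> omega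
        · rw [lb] at hi
          by_cases h : i < thru c a b
          · refine .inr (.inr (.inr (.inl ⟨thru c a b - 1 - i, by omega, ?_⟩)))
            ext <;> simp [vertexMate, h] <;> omega
          · have : ∃ k < thru a b c, i = thru c a b + k := ⟨i - thru c a b, by omega, by omega⟩
            obtain ⟨k, hk, rfl⟩ := this
            cases t' <;> simp [vertexMate, legArc, hk]
      · obtain rfl : t' = !t := by cases t <;> cases t' <;> simp_all
        obtain rfl : j = s.left.length := by omega
        rw [lc] at hi
        by_cases h : i < thru b a c
        · cases t <;> simp [vertexMate, h, legArc]
        · have : ∃ k < thru a b c, i = thru b a c + k := ⟨i - thru b a c, by omega, by omega⟩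
          obtain ⟨k, hk, rfl⟩ := this
          cases t <;> simp [vertexMate, legArc, hk]
    | _ => rw [hs] at hv; exact hv.elim
  · have h : s.strandMate e = s.segmentMate e := by rw [strandMate, if_neg hc]
    have hsub : ∀ x, x ∈ s.segmentArcs → x ∈ s.strandArcs := by
      intro x hx
      unfold segmentArcs at hx
      split_ifs at hx
      · exact List.mem_append_left _ hx
      · exact hx
    rw [h]
    rcases s.segmentMate_mem he with h | h | h
    · exact absurd h.1 hc
    · exact .inl (hsub _ h)
    · exact .inr (hsub _ h)

/-- All turns of a slice belong to one nested family. It has `o = 0` and `z = n` for a cup or cap of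
an edge, `o = thru b a c` and `z = thru c a b` for a vertex, and it is absent for a crossing. Every
other strand end on the line `t` lies outside the family. -/
theorem turn_form (hadm : s.piece.Admissible) :
    (∀ e, s.StrandValid e → (s.strandMate e).1 ≠ e.1) ∨
    ∃ t l o z, ∀ e, s.StrandValid e →
      ((s.strandMate e).1 = e.1 ∧ e.1 = t ∧ ∃ i < z,
        (e.2 = (l, o + i) ∧ (s.strandMate e).2 = (l + 1, z - 1 - i)) ∨
        (e.2 = (l + 1, z - 1 - i) ∧ (s.strandMate e).2 = (l, o + i))) ∨
      ((s.strandMate e).1 ≠ e.1 ∧ (e.1 = t → e.2.1 < l ∨ l + 1 < e.2.1 ∨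
        (e.2.1 = l ∧ e.2.2 < o) ∨ (e.2.1 = l + 1 ∧ z ≤ e.2.2))) := by
  have side : ∀ e g : Bool × ℕ × ℕ, ((e, g) ∈ s.sideStrandArcs ∨ (g, e) ∈ s.sideStrandArcs) →
      g.1 ≠ e.1 ∧ (e.2.1 < s.left.length ∨ s.left.length + s.width e.1 ≤ e.2.1) := by
    intro e g h
    simp only [mem_sideStrandArcs] at h
    rcases h with (⟨j, hj, i, hi, h⟩ | ⟨j, hj, i, hi, h⟩) | (⟨j, hj, i, hi, h⟩ | ⟨j, hj, i, hi, h⟩) <;>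
      obtain ⟨rfl, rfl⟩ := Prod.ext_iff.1 h <;> simp [hj]
  have hmem : ∀ e, s.StrandValid e →
      ((e, s.strandMate e) ∈ s.sideStrandArcs ∨ (s.strandMate e, e) ∈ s.sideStrandArcs) ∨
      ((e, s.strandMate e) ∈ s.piece.strandArcs s.left.length ∨
        (s.strandMate e, e) ∈ s.piece.strandArcs s.left.length) := by
    intro e he
    have := s.strandMate_mem hadm he
    simp only [strandArcs, List.mem_append] at this
    tauto
  cases hs : s.piece with
  | cross a b =>
    left
    intro e he
    have h := hmem e he
    clear hmem he
    generalize s.strandMate e = g at h ⊢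
    rcases h with h | h
    · exact (side _ _ h).1
    · simp only [hs, Piece.strandArcs, List.mem_append, List.mem_map, List.mem_range,
        Prod.mk.injEq] at h
      rcases h with (⟨i, hi, rfl, rfl⟩ | ⟨i, hi, rfl, rfl⟩) | (⟨i, hi, rfl, rfl⟩ | ⟨i, hi, rfl, rfl⟩) <;>
        simp
  | turn t n =>
    right
    refine ⟨t, s.left.length, 0, n, fun e he => ?_⟩
    have h := hmem e he
    clear hmem he
    generalize s.strandMate e = g at h ⊢
    rcases h with h | h
    · refine .inr ⟨(side _ _ h).1, fun ht => ?_⟩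
      have := (side _ _ h).2
      simp [width, hs, Piece.ends, ht] at this
      omega
    · simp only [hs, Piece.strandArcs, List.mem_map, List.mem_range, Prod.mk.injEq] at h
      left
      rcases h with ⟨i, hi, rfl, rfl⟩ | ⟨i, hi, rfl, rfl⟩ <;>
        exact ⟨rfl, rfl, i, hi, by simp⟩
  | vertex t a b c =>
    right
    refine ⟨t, s.left.length, thru b a c, thru c a b, fun e he => ?_⟩
    have h := hmem e he
    clear hmem he
    generalize s.strandMate e = g at h ⊢
    rcases h with h | h
    · refine .inr ⟨(side _ _ h).1, fun ht => ?_⟩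
      have := (side _ _ h).2
      simp [width, hs, Piece.ends, ht] at this
      omega
    · simp only [hs, mem_vertexArcs] at h
      rcases h with (⟨i, hi, h⟩ | ⟨i, hi, h⟩ | ⟨i, hi, h⟩) | (⟨i, hi, h⟩ | ⟨i, hi, h⟩ | ⟨i, hi, h⟩)
      · cases t <;> simp only [legArc, Prod.mk.injEq] at h <;> obtain ⟨rfl, rfl⟩ := h <;> simp [hi]
      · simp only [Prod.mk.injEq] at h
        obtain ⟨rfl, rfl⟩ := h
        exact .inl ⟨rfl, rfl, i, hi, by simp⟩
      · cases t <;> simp only [legArc, Prod.mk.injEq] at h <;> obtain ⟨rfl, rfl⟩ := h <;> simp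
      · cases t <;> simp only [legArc, Prod.mk.injEq] at h <;> obtain ⟨rfl, rfl⟩ := h <;> simp [hi]
      · simp only [Prod.mk.injEq] at h
        obtain ⟨rfl, rfl⟩ := h
        exact .inl ⟨rfl, rfl, i, hi, by simp⟩
      · cases t <;> simp only [legArc, Prod.mk.injEq] at h <;> obtain ⟨rfl, rfl⟩ := h <;> simp

/-- In the normal form of `turn_form`, two turns are nested according to their indices, and a
monotone arc ends to the left or to the right of all turns. -/
theorem strand_planar (hadm : s.piece.Admissible) {e f : Bool × ℕ × ℕ} (he : s.StrandValid e)
    (hf : s.StrandValid f) (hturn : (s.strandMate e).1 = e.1) (hfe : f.1 = e.1) (h1 : f ≠ e)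
    (h2 : f ≠ s.strandMate e) :
    ((LeftOf e.2 f.2 ↔ LeftOf (s.strandMate e).2 f.2) ∧ ((s.strandMate f).1 = f.1 →
      (LeftOf e.2 (s.strandMate f).2 ↔ LeftOf (s.strandMate e).2 (s.strandMate f).2))) ∨
    ((s.strandMate f).1 = f.1 ∧ (LeftOf e.2 f.2 ↔ ¬ LeftOf (s.strandMate e).2 f.2) ∧
      (LeftOf e.2 (s.strandMate f).2 ↔ ¬ LeftOf (s.strandMate e).2 (s.strandMate f).2)) := by
  rcases s.turn_form hadm with h | ⟨t, l, o, z, h⟩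
  · exact absurd hturn (h e he)
  have h2' : f.2 ≠ (s.strandMate e).2 := fun h => h2 (Prod.ext (hfe.trans hturn.symm) h)
  have h1' : f.2 ≠ e.2 := fun h => h1 (Prod.ext hfe h)
  rcases h e he with ⟨-, het, i, hi, hei⟩ | ⟨hne, -⟩
  swap
  · exact absurd hturn hne
  rcases h f hf with ⟨hft, -, k, hk, hfk⟩ | ⟨hne, hpos⟩
  · have hik : i ≠ k := by
      rintro rfl
      rcases hei with ⟨a1, a2⟩ | ⟨a1, a2⟩ <;> rcases hfk with ⟨b1, b2⟩ | ⟨b1, b2⟩ <;> simp_all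
    unfold LeftOf
    rcases hei with ⟨a1, a2⟩ | ⟨a1, a2⟩ <;> rcases hfk with ⟨b1, b2⟩ | ⟨b1, b2⟩ <;>
      simp only [a1, a2, b1, b2, hft, true_and] <;> omega
  · left
    refine ⟨?_, fun h => absurd h hne⟩
    have := hpos (hfe.trans het)
    unfold LeftOf
    rcases hei with ⟨a1, a2⟩ | ⟨a1, a2⟩ <;> simp only [a1, a2] <;> omega

end Slice

end Spin

/-! ### The layers of a network as wirings -/

namespace Spin

/-- The other line that bounds the same permutation layer. -/
def oppLine (h : ℕ) : ℕ := if h % 2 = 0 then h + 1 else h - 1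

/-- The layer of the slice that meets a line. -/
def sliceLayer (h : ℕ) : ℕ := if h % 2 = 1 then h else h - 1

/-- A permutation of the strands of each edge, as a function on places. -/
def EdgePerm.app {A : List ℕ} (σ : EdgePerm A) (p : ℕ × ℕ) : ℕ :=
  if h : p.1 < A.length then
    if h' : p.2 < A[p.1] then (σ ⟨p.1, h⟩ ⟨p.2, h'⟩ : Fin _).val else p.2
  else p.2

theorem EdgePerm.app_of_lt {A : List ℕ} (σ : EdgePerm A) {j i : ℕ} (h : j < A.length)
    (h' : i < A[j]) : σ.app (j, i) = (σ ⟨j, h⟩ ⟨i, h'⟩ : Fin _).val := by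
  simp [app, h, h']

theorem EdgePerm.app_lt {A : List ℕ} (σ : EdgePerm A) {j i : ℕ} (h : j < A.length)
    (h' : i < A.getD j 0) : σ.app (j, i) < A.getD j 0 := by
  have h2 : A.getD j 0 = A[j] := by simp [h]
  rw [h2] at h' ⊢
  rw [app_of_lt σ h h']
  exact (σ ⟨j, h⟩ ⟨i, h'⟩).isLt

theorem EdgePerm.app_inv {A : List ℕ} (σ : EdgePerm A) {j i : ℕ} (h : j < A.length)
    (h' : i < A.getD j 0) : EdgePerm.app σ⁻¹ (j, EdgePerm.app σ (j, i)) = i := by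
  have h2 : A.getD j 0 = A[j] := by simp [h]
  have h3 := σ.app_lt h h'
  rw [h2] at h' h3
  rw [app_of_lt _ h h3]
  simp [app_of_lt σ h h']

theorem mem_permArcs {A : List ℕ} (σ : EdgePerm A) (x : Arc (ℕ × ℕ)) : x ∈ permArcs σ ↔
    ∃ j < A.length, ∃ i < A.getD j 0, x = ((false, (j, i)), (true, (j, EdgePerm.app σ (j, i)))) := by
  simp only [permArcs, List.mem_flatMap, List.mem_map, List.mem_finRange, true_and]
  constructor
  · rintro ⟨j, i, rfl⟩
    exact ⟨j, j.2, i, by simp, by rw [EdgePerm.app_of_lt σ j.2 i.2]⟩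
  · rintro ⟨j, hj, i, hi, rfl⟩
    have hi' : i < A[j] := by simpa [hj] using hi
    exact ⟨⟨j, hj⟩, ⟨i, hi'⟩, by rw [EdgePerm.app_of_lt σ hj hi']⟩

namespace SpinNet

variable {A B : List ℕ}

theorem lines_ne_nil : ∀ {A B : List ℕ} (T : SpinNet A B), T.lines ≠ []
  | _, _, .nil _ => by simp [lines]
  | _, _, .cons _ _ _ => by simp [lines]

theorem lines_length (T : SpinNet A B) : T.lines.length = T.topLine + 1 := by
  have := List.length_pos_iff.2 T.lines_ne_nil
  unfold topLine
  omega

theorem topLine_nil (A : List ℕ) : (SpinNet.nil A).topLine = 1 := rfl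

theorem topLine_cons {s : Slice} {hs : s.piece.Admissible} (T : SpinNet (s.ends true) B) :
    (SpinNet.cons s hs T).topLine = T.topLine + 2 := by
  simp [topLine, lines]
  have := T.lines_length
  omega

theorem topLine_odd (T : SpinNet A B) : T.topLine % 2 = 1 := by
  induction T with
  | nil A => rfl
  | cons s hs T ih => rw [topLine_cons]; omega

theorem line_zero (T : SpinNet A B) : T.lines.getD 0 [] = A := by
  cases T <;> simp [lines]

theorem line_top (T : SpinNet A B) : T.lines.getD T.topLine [] = B := by
  induction T with
  | nil A => rfl
  | cons s hs T ih => rw [topLine_cons]; simpa [lines] using ih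

theorem line_of_gt (T : SpinNet A B) {h : ℕ} (hh : T.topLine < h) : T.lines.getD h [] = [] :=
  List.getD_eq_default _ _ (by rw [lines_length]; omega)

theorem line_even (T : SpinNet A B) {h : ℕ} (hh : h % 2 = 0) :
    T.lines.getD (h + 1) [] = T.lines.getD h [] := by
  induction T generalizing h with
  | nil A =>
    rcases h with _ | _ | h
    · rfl
    · omega
    · rfl
  | cons s hs T ih =>
    rcases h with _ | _ | h
    · rfl
    · omega
    · exact ih (by omega)

theorem sliceAt_of_even (T : SpinNet A B) {h : ℕ} (hh : h % 2 = 0) : T.sliceAt h = none := by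
  induction T generalizing h with
  | nil A => rfl
  | cons s hs T ih =>
    rcases h with _ | _ | h
    · rfl
    · omega
    · exact ih (by omega)

theorem exists_sliceAt (T : SpinNet A B) {h : ℕ} (hh : h % 2 = 1) (ht : h < T.topLine) :
    ∃ s, T.sliceAt h = some s := by
  induction T generalizing h with
  | nil A => rw [topLine_nil] at ht; omega
  | cons s hs T ih =>
    rw [topLine_cons] at ht
    rcases h with _ | _ | h
    · omega
    · exact ⟨s, rfl⟩
    · exact ih (by omega) (by omega)

theorem sliceAt_admissible (T : SpinNet A B) {h : ℕ} {s : Slice} (hs : T.sliceAt h = some s) :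
    s.piece.Admissible := by
  induction T generalizing h with
  | nil A => cases hs
  | cons s' hs' T ih =>
    rcases h with _ | _ | h
    · cases hs
    · cases hs
      exact hs'
    · exact ih hs

theorem sliceAt_lt (T : SpinNet A B) {h : ℕ} {s : Slice} (hs : T.sliceAt h = some s) :
    h % 2 = 1 ∧ h + 2 ≤ T.topLine := by
  induction T generalizing h with
  | nil A => cases hs
  | cons s' hs' T ih =>
    have := T.topLine_odd
    rw [topLine_cons]
    rcases h with _ | _ | h
    · cases hs
    · omega
    · have := ih (h := h) hs
      omega

theorem line_slice (T : SpinNet A B) {h : ℕ} {s : Slice} (hs : T.sliceAt h = some s) (t : Bool) :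
    T.lines.getD (h + t.toNat) [] = s.ends t := by
  induction T generalizing h with
  | nil A => cases hs
  | cons s' hs' T ih =>
    rcases h with _ | _ | h
    · cases hs
    · cases hs
      cases t
      · rfl
      · exact T.line_zero
    · have := ih (h := h) hs
      rw [← this, show h + 1 + 1 + t.toNat = h + t.toNat + 1 + 1 by omega]
      rfl

theorem edgeLayers_slice (T : SpinNet A B) {h : ℕ} {s : Slice} (hs : T.sliceAt h = some s) :
    T.edgeLayers.getD h [] = s.edgeArcs := by
  induction T generalizing h with
  | nil A => cases hs
  | cons s' hs' T ih =>
    rcases h with _ | _ | h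
    · cases hs
    · cases hs
      rfl
    · exact ih (h := h) hs

theorem strandLayers_slice (T : SpinNet A B) (σ : T.Expansion) {h : ℕ} {s : Slice}
    (hs : T.sliceAt h = some s) : (T.strandLayers σ).getD h [] = s.strandArcs := by
  induction T generalizing h with
  | nil A => cases hs
  | cons s' hs' T ih =>
    rcases h with _ | _ | h
    · cases hs
    · cases hs
      rfl
    · exact ih σ.2 (h := h) hs

theorem segmentLayers_slice (T : SpinNet A B) (σ : T.Expansion) {h : ℕ} {s : Slice}
    (hs : T.sliceAt h = some s) : (T.segmentLayers σ).getD h [] = s.segmentArcs := by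
  induction T generalizing h with
  | nil A => cases hs
  | cons s' hs' T ih =>
    rcases h with _ | _ | h
    · cases hs
    · cases hs
      rfl
    · exact ih σ.2 (h := h) hs

theorem layer_none (T : SpinNet A B) (σ : T.Expansion) {h : ℕ} (hh : h % 2 = 1)
    (hs : T.sliceAt h = none) : T.edgeLayers.getD h [] = [] ∧
      (T.strandLayers σ).getD h [] = [] ∧ (T.segmentLayers σ).getD h [] = [] := by
  induction T generalizing h with
  | nil A =>
    rcases h with _ | h
    · omega
    · exact ⟨rfl, rfl, rfl⟩
  | cons s' hs' T ih =>
    rcases h with _ | _ | h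
    · omega
    · cases hs
    · exact ih σ.2 (h := h) (by omega) hs

/-- The permutations in the layer `h`. -/
def permAt : {A B : List ℕ} → (T : SpinNet A B) → T.Expansion → (h : ℕ) → EdgePerm (T.lines.getD h [])
  | _, _, .nil _, σ, 0 => σ
  | _, _, .nil _, _, _ + 1 => 1
  | _, _, .cons _ _ _, σ, 0 => σ.1
  | _, _, .cons _ _ _, _, 1 => 1
  | _, _, .cons _ _ T, σ, h + 2 => permAt T σ.2 h

/-- The expansion with given permutations in each layer. -/
def ofPerms : {A B : List ℕ} → (T : SpinNet A B) → ((h : ℕ) → EdgePerm (T.lines.getD h [])) →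
    T.Expansion
  | _, _, .nil _, f => f 0
  | _, _, .cons _ _ T, f => (f 0, ofPerms T fun h => f (h + 2))

theorem permAt_ofPerms (T : SpinNet A B) (f : (h : ℕ) → EdgePerm (T.lines.getD h [])) {h : ℕ}
    (hh : h % 2 = 0) (ht : h < T.topLine) : T.permAt (T.ofPerms f) h = f h := by
  induction T generalizing h with
  | nil A =>
    rw [topLine_nil] at ht
    obtain rfl : h = 0 := by omega
    rfl
  | cons s' hs' T ih =>
    rw [topLine_cons] at ht
    rcases h with _ | _ | h
    · rfl
    · omega
    · exact ih (fun h => f (h + 2)) (h := h) (by omega) (by omega)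

theorem layer_even (T : SpinNet A B) (σ : T.Expansion) {h : ℕ} (hh : h % 2 = 0) :
    T.edgeLayers.getD h [] = vertEdgeArcs (T.lines.getD h []) ∧
      (T.strandLayers σ).getD h [] = permArcs (T.permAt σ h) ∧
      (T.segmentLayers σ).getD h [] = permArcs (T.permAt σ h) := by
  induction T generalizing h with
  | nil A =>
    rcases h with _ | _ | h
    · exact ⟨rfl, rfl, rfl⟩
    · omega
    · exact ⟨rfl, rfl, rfl⟩
  | cons s' hs' T ih =>
    rcases h with _ | _ | h
    · exact ⟨rfl, rfl, rfl⟩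
    · omega
    · exact ih σ.2 (h := h) (by omega)

/-- The other end of the arc in a slice, given the ends in each slice. -/
def sliceMate {α : Type} (T : SpinNet A B) (f : Slice → Bool × α → Bool × α) (p : ℕ × α) : ℕ × α :=
  match T.sliceAt (sliceLayer p.1) with
  | none => p
  | some s => position (sliceLayer p.1) (f s (decide (p.1 % 2 = 0), p.2))

theorem eq_position {α : Type} (T : SpinNet A B) {p : ℕ × α} {s : Slice}
    (hs : T.sliceAt (sliceLayer p.1) = some s) :
    p = position (sliceLayer p.1) (decide (p.1 % 2 = 0), p.2) := by
  have h1 := T.sliceAt_lt hs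
  have h2 := h1.1
  unfold sliceLayer at h2
  refine Prod.ext ?_ rfl
  rcases Nat.mod_two_eq_zero_or_one p.1 with hh | hh
  · have h3 : p.1 ≠ 0 := by
      intro h0
      simp [h0] at h2
    simp [position, sliceLayer, hh]
    omega
  · simp [position, sliceLayer, hh]

theorem sliceLayer_position {α : Type} {h : ℕ} (hh : h % 2 = 1) (e : Bool × α) :
    sliceLayer (position h e).1 = h ∧ decide ((position h e).1 % 2 = 0) = e.1 := by
  obtain ⟨t, x⟩ := e
  cases t
  · simp [position, sliceLayer, hh]
  · have h2 : (h + 1) % 2 = 0 := by omega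
    simp [position, sliceLayer, h2]

theorem sliceMate_position {α : Type} (T : SpinNet A B) (f : Slice → Bool × α → Bool × α) {h : ℕ}
    {s : Slice} (hs : T.sliceAt h = some s) (e : Bool × α) :
    T.sliceMate f (position h e) = position h (f s e) := by
  obtain ⟨h1, h2⟩ := sliceLayer_position (T.sliceAt_lt hs).1 e
  unfold sliceMate
  rw [h1, hs, h2]
  rfl

theorem sliceMate_none {α : Type} (T : SpinNet A B) (f : Slice → Bool × α → Bool × α) {p : ℕ × α}
    (hs : T.sliceAt (sliceLayer p.1) = none) : T.sliceMate f p = p := by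
  unfold sliceMate
  rw [hs]

/-- Everything that is needed to describe the arcs in all layers as two involutions. -/
structure Layout (T : SpinNet A B) (α : Type) where
  P : ℕ × α → Prop
  layers : List (List (Arc α))
  am : ℕ × α → ℕ × α
  f : Slice → Bool × α → Bool × α
  arcs : Slice → List (Arc α)
  V : Slice → Bool × α → Prop
  am_P : ∀ {p}, P p → P (am p)
  am_am : ∀ {p}, P p → am (am p) = p
  am_fst : ∀ p, (am p).1 = oppLine p.1
  layer_even : ∀ {h x}, h % 2 = 0 → x ∈ layers.getD h [] → am (position h x.1) = position h x.2
  am_mem : ∀ {p}, P p → p.1 % 2 = 0 → Linked layers p (am p)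
  layer_slice : ∀ {h s}, T.sliceAt h = some s → layers.getD h [] = arcs s
  layer_none : ∀ {h}, h % 2 = 1 → T.sliceAt h = none → layers.getD h [] = []
  P_iff : ∀ {h s e}, T.sliceAt h = some s → (P (position h e) ↔ V s e)
  arcs_f : ∀ {s x}, s.piece.Admissible → x ∈ arcs s →
    V s x.1 ∧ V s x.2 ∧ f s x.1 = x.2 ∧ f s x.2 = x.1
  f_arcs : ∀ {s e}, s.piece.Admissible → V s e →
    f s e = e ∨ (e, f s e) ∈ arcs s ∨ (f s e, e) ∈ arcs s

namespace Layout

variable {T : SpinNet A B} {α : Type} (Λ : T.Layout α)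

theorem f_prop {s : Slice} {e : Bool × α} (hs : s.piece.Admissible) (he : Λ.V s e) :
    Λ.V s (Λ.f s e) ∧ Λ.f s (Λ.f s e) = e := by
  rcases Λ.f_arcs hs he with h | h | h
  · exact ⟨by rwa [h], by rw [h, h]⟩
  · obtain ⟨-, h1, -, h2⟩ := Λ.arcs_f hs h
    exact ⟨h1, h2⟩
  · obtain ⟨h1, -, h2, -⟩ := Λ.arcs_f hs h
    exact ⟨h1, h2⟩

theorem sliceMate_prop {p : ℕ × α} (hp : Λ.P p) :
    Λ.P (T.sliceMate Λ.f p) ∧ T.sliceMate Λ.f (T.sliceMate Λ.f p) = p := by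
  cases hs : T.sliceAt (sliceLayer p.1) with
  | none =>
    rw [T.sliceMate_none _ hs, T.sliceMate_none _ hs]
    exact ⟨hp, rfl⟩
  | some s =>
    have h := T.eq_position hs
    generalize sliceLayer p.1 = l at h hs
    rw [h, Λ.P_iff hs] at hp
    rw [h, T.sliceMate_position _ hs, T.sliceMate_position _ hs, Λ.P_iff hs]
    have := Λ.f_prop (T.sliceAt_admissible hs) hp
    exact ⟨this.1, by rw [this.2]⟩

theorem oppLine_ne (h : ℕ) : oppLine h ≠ h := by
  unfold oppLine
  split_ifs <;> omega

/-- The wiring of the points on the lines. -/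
def wiring : Wiring {p : ℕ × α // Λ.P p} where
  a p := ⟨Λ.am p.1, Λ.am_P p.2⟩
  b p := ⟨T.sliceMate Λ.f p.1, (Λ.sliceMate_prop p.2).1⟩
  a_a p := Subtype.ext (Λ.am_am p.2)
  b_b p := Subtype.ext (Λ.sliceMate_prop p.2).2
  a_ne p := fun h => oppLine_ne p.1.1 (by rw [← Λ.am_fst]; exact congrArg (fun q => q.1.1) h)

theorem linked_a_or_b {p q : ℕ × α} (h : Linked Λ.layers p q) :
    q = Λ.am p ∨ q = T.sliceMate Λ.f p := by
  obtain ⟨l, x, hx, rfl, rfl⟩ := h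
  rcases Nat.mod_two_eq_zero_or_one l with hl | hl
  · exact .inl (Λ.layer_even hl hx).symm
  · right
    cases hs : T.sliceAt l with
    | none => rw [Λ.layer_none hl hs] at hx; simp at hx
    | some s =>
      rw [Λ.layer_slice hs] at hx
      rw [T.sliceMate_position _ hs, (Λ.arcs_f (T.sliceAt_admissible hs) hx).2.2.1]

theorem a_linked {p : ℕ × α} (hp : Λ.P p) :
    Linked Λ.layers p (Λ.am p) ∨ Linked Λ.layers (Λ.am p) p := by
  by_cases h : p.1 % 2 = 0
  · exact .inl (Λ.am_mem hp h)
  · right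
    have := Λ.am_mem (Λ.am_P hp) (by rw [Λ.am_fst, oppLine, if_neg h]; omega)
    rwa [Λ.am_am hp] at this

theorem b_linked {p : ℕ × α} (hp : Λ.P p) : T.sliceMate Λ.f p = p ∨
    Linked Λ.layers p (T.sliceMate Λ.f p) ∨ Linked Λ.layers (T.sliceMate Λ.f p) p := by
  cases hs : T.sliceAt (sliceLayer p.1) with
  | none => exact .inl (T.sliceMate_none _ hs)
  | some s =>
    have h := T.eq_position hs
    generalize sliceLayer p.1 = l at h hs
    rw [h, Λ.P_iff hs] at hp
    rw [h, T.sliceMate_position _ hs]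
    rcases Λ.f_arcs (T.sliceAt_admissible hs) hp with h | h | h
    · exact .inl (by rw [h])
    · exact .inr (.inl ⟨l, _, by rwa [Λ.layer_slice hs], rfl, rfl⟩)
    · exact .inr (.inr ⟨l, _, by rwa [Λ.layer_slice hs], rfl, rfl⟩)

/-- The arcs and the two involutions generate the same equivalence relation. Edges, segments and
strands, which are quotients by `Linked`, thus become the components of wirings. -/
theorem quot_eq_iff {p q : {p : ℕ × α // Λ.P p}} :
    Quot.mk (fun p q : {p : ℕ × α // Λ.P p} => Linked Λ.layers p.1 q.1) p = Quot.mk _ q ↔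
      Λ.wiring.Conn p q := by
  constructor
  · intro h
    rw [Quot.eq] at h
    induction h with
    | rel x y h =>
      rcases Λ.linked_a_or_b h with h | h
      · rw [show y = Λ.wiring.a x from Subtype.ext h]
        exact Λ.wiring.conn_a x
      · rw [show y = Λ.wiring.b x from Subtype.ext h]
        exact Λ.wiring.conn_b x
    | refl x => exact Wiring.Conn.refl x
    | symm x y _ ih => exact ih.symm
    | trans x y z _ _ ih1 ih2 => exact ih1.trans ih2
  · intro h
    unfold Wiring.Conn at h
    induction h with
    | refl => rfl
    | @tail y z h1 h2 ih =>
      rw [ih]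
      rcases h2 with rfl | rfl
      · rcases Λ.a_linked y.2 with h | h
        · exact Quot.sound h
        · exact (Quot.sound (a := Λ.wiring.a y) (b := y) h).symm
      · rcases Λ.b_linked y.2 with h | h | h
        · rw [show Λ.wiring.b y = y from Subtype.ext h]
        · exact Quot.sound h
        · exact (Quot.sound (a := Λ.wiring.b y) (b := y) h).symm

end Layout

theorem lines_oppLine (T : SpinNet A B) (h : ℕ) :
    T.lines.getD (oppLine h) [] = T.lines.getD h [] := by
  unfold oppLine
  split_ifs with hh
  · exact T.line_even hh
  · obtain ⟨k, rfl⟩ : ∃ k, h = k + 1 := ⟨h - 1, by omega⟩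
    exact (T.line_even (by omega)).symm

theorem oppLine_oppLine (h : ℕ) : oppLine (oppLine h) = h := by
  unfold oppLine
  split_ifs <;> omega

theorem edgeValid_iff (T : SpinNet A B) {h : ℕ} {s : Slice} (hs : T.sliceAt h = some s)
    (e : Bool × ℕ) :
    (position h e).2 < (T.lines.getD (position h e).1 []).length ↔ s.EdgeValid e := by
  rw [show (position h e).1 = h + e.1.toNat from rfl, T.line_slice hs]
  rfl

/-- The edges as a layout. -/
def edgeLayout (T : SpinNet A B) (σ : T.Expansion) : T.Layout ℕ where
  P p := p.2 < (T.lines.getD p.1 []).length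
  layers := T.edgeLayers
  am p := (oppLine p.1, p.2)
  f := Slice.edgeMate
  arcs := Slice.edgeArcs
  V s := s.EdgeValid
  am_P := by
    intro p hp
    simpa only [lines_oppLine] using hp
  am_am := by
    intro p _
    simp [oppLine_oppLine]
  am_fst p := rfl
  layer_even := by
    intro h x hh hx
    rw [(T.layer_even σ hh).1, vertEdgeArcs, List.mem_map] at hx
    obtain ⟨j, -, rfl⟩ := hx
    simp [position, oppLine, hh]
  am_mem := by
    intro p hp hh
    refine ⟨p.1, ((false, p.2), (true, p.2)), ?_, rfl, ?_⟩
    · rw [(T.layer_even σ hh).1, vertEdgeArcs, List.mem_map]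
      exact ⟨p.2, by simpa using hp, rfl⟩
    · simp [position, oppLine, hh]
  layer_slice hs := T.edgeLayers_slice hs
  layer_none hh hs := (T.layer_none σ hh hs).1
  P_iff hs := T.edgeValid_iff hs _
  arcs_f := fun {s x} _ hx =>
    have h := s.edgeArcs_prop hx
    ⟨h.valid_fst, h.valid_snd, h.mate_fst, h.mate_snd⟩
  f_arcs := fun {s e} _ he => by
    rcases s.edgeMate_mem he with h | h
    · exact .inl h.2
    · exact .inr h

/-- The places of strands. -/
def IsPlace (T : SpinNet A B) (p : ℕ × ℕ × ℕ) : Prop :=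
  p.2.1 < (T.lines.getD p.1 []).length ∧ p.2.2 < T.label (p.1, p.2.1)

/-- The inverse of the permutations in the layer `h`, as a function on places. -/
def invAt (T : SpinNet A B) (σ : T.Expansion) (h : ℕ) (p : ℕ × ℕ) : ℕ :=
  EdgePerm.app (T.permAt σ h)⁻¹ p

/-- The other end of the arc of a strand in a permutation layer. -/
def permMate (T : SpinNet A B) (σ : T.Expansion) (p : ℕ × ℕ × ℕ) : ℕ × ℕ × ℕ :=
  (oppLine p.1, p.2.1, if p.1 % 2 = 0 then EdgePerm.app (T.permAt σ p.1) p.2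
    else T.invAt σ (p.1 - 1) p.2)

theorem label_oppLine (T : SpinNet A B) (h j : ℕ) : T.label (oppLine h, j) = T.label (h, j) := by
  simp only [label, lines_oppLine]

theorem line_sub_one (T : SpinNet A B) {h : ℕ} (hh : ¬ h % 2 = 0) :
    T.lines.getD (h - 1) [] = T.lines.getD h [] := by
  have := T.lines_oppLine h
  rwa [oppLine, if_neg hh] at this

theorem permMate_prop (T : SpinNet A B) (σ : T.Expansion) {p : ℕ × ℕ × ℕ} (hp : T.IsPlace p) :
    T.IsPlace (T.permMate σ p) ∧ T.permMate σ (T.permMate σ p) = p := by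
  obtain ⟨h, j, i⟩ := p
  obtain ⟨h1, h2⟩ := hp
  simp only at h1 h2
  constructor
  · refine ⟨by simpa only [permMate, lines_oppLine] using h1, ?_⟩
    simp only [permMate, label_oppLine]
    split_ifs with hh
    · exact EdgePerm.app_lt _ h1 h2
    · unfold label at h2 ⊢
      simp only at h2 ⊢
      rw [← T.line_sub_one hh] at h1 h2 ⊢
      exact EdgePerm.app_lt _ h1 h2
  · simp only [permMate, oppLine_oppLine]
    by_cases hh : h % 2 = 0
    · have h3 : ¬ oppLine h % 2 = 0 := by rw [oppLine, if_pos hh]; omega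
      have h4 : oppLine h - 1 = h := by rw [oppLine, if_pos hh]; omega
      simp only [hh, if_true, h3, if_false]
      rw [h4, invAt, EdgePerm.app_inv _ h1 h2]
    · have h3 : oppLine h % 2 = 0 := by rw [oppLine, if_neg hh]; omega
      have h4 : oppLine h = h - 1 := by rw [oppLine, if_neg hh]
      simp only [h3, if_true, hh, if_false]
      unfold label at h2
      simp only at h2
      rw [← T.line_sub_one hh] at h1 h2
      have := EdgePerm.app_inv (T.permAt σ (h - 1))⁻¹ h1 h2
      rw [inv_inv] at this
      rw [h4, invAt, this]

theorem permMate_linked (T : SpinNet A B) (σ : T.Expansion) {h : ℕ} {x : Arc (ℕ × ℕ)} (hh : h % 2 = 0)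
    (hx : x ∈ permArcs (T.permAt σ h)) : T.permMate σ (position h x.1) = position h x.2 := by
  rw [mem_permArcs] at hx
  obtain ⟨j, hj, i, hi, rfl⟩ := hx
  simp [position, permMate, hh, oppLine]

theorem mem_permMate (T : SpinNet A B) (σ : T.Expansion) {p : ℕ × ℕ × ℕ} (hp : T.IsPlace p)
    (hh : p.1 % 2 = 0) : ∃ x ∈ permArcs (T.permAt σ p.1), p = position p.1 x.1 ∧
      T.permMate σ p = position p.1 x.2 := by
  refine ⟨((false, p.2), (true, (p.2.1, EdgePerm.app (T.permAt σ p.1) p.2))), ?_, rfl, ?_⟩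
  · rw [mem_permArcs]
    exact ⟨p.2.1, hp.1, p.2.2, hp.2, rfl⟩
  · simp [permMate, position, oppLine, hh]

theorem isPlace_iff (T : SpinNet A B) {h : ℕ} {s : Slice} (hs : T.sliceAt h = some s)
    (e : Bool × ℕ × ℕ) : T.IsPlace (position h e) ↔ s.StrandValid e := by
  unfold IsPlace label
  rw [show (position h e).1 = h + e.1.toNat from rfl]
  simp only [T.line_slice hs]
  rfl

/-- The segments as a layout. -/
noncomputable def segmentLayout (T : SpinNet A B) (σ : T.Expansion) : T.Layout (ℕ × ℕ) where
  P := T.IsPlace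
  layers := T.segmentLayers σ
  am := T.permMate σ
  f := Slice.segmentMate
  arcs := Slice.segmentArcs
  V s := s.StrandValid
  am_P hp := (T.permMate_prop σ hp).1
  am_am hp := (T.permMate_prop σ hp).2
  am_fst p := rfl
  layer_even := by
    intro h x hh hx
    rw [(T.layer_even σ hh).2.2] at hx
    exact T.permMate_linked σ hh hx
  am_mem := by
    intro p hp hh
    obtain ⟨x, hx, h1, h2⟩ := T.mem_permMate σ hp hh
    exact ⟨p.1, x, by rwa [(T.layer_even σ hh).2.2], h1, h2⟩
  layer_slice hs := T.segmentLayers_slice σ hs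
  layer_none hh hs := (T.layer_none σ hh hs).2.2
  P_iff hs := T.isPlace_iff hs _
  arcs_f := fun {s x} _ hx =>
    have h := s.segmentArcs_prop hx
    ⟨h.1.valid_fst, h.1.valid_snd, h.2⟩
  f_arcs := fun {s e} _ he => by
    rcases s.segmentMate_mem he with h | h
    · exact .inl h.2
    · exact .inr h

/-- The strands as a layout. -/
noncomputable def strandLayout (T : SpinNet A B) (σ : T.Expansion) : T.Layout (ℕ × ℕ) where
  P := T.IsPlace
  layers := T.strandLayers σ
  am := T.permMate σ
  f := Slice.strandMate
  arcs := Slice.strandArcs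
  V s := s.StrandValid
  am_P hp := (T.permMate_prop σ hp).1
  am_am hp := (T.permMate_prop σ hp).2
  am_fst p := rfl
  layer_even := by
    intro h x hh hx
    rw [(T.layer_even σ hh).2.1] at hx
    exact T.permMate_linked σ hh hx
  am_mem := by
    intro p hp hh
    obtain ⟨x, hx, h1, h2⟩ := T.mem_permMate σ hp hh
    exact ⟨p.1, x, by rwa [(T.layer_even σ hh).2.1], h1, h2⟩
  layer_slice hs := T.strandLayers_slice σ hs
  layer_none hh hs := (T.layer_none σ hh hs).2.1
  P_iff hs := T.isPlace_iff hs _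
  arcs_f := fun {s x} hadm hx =>
    have h := s.strandArcs_prop hadm hx
    ⟨h.valid_fst, h.valid_snd, h.mate_fst, h.mate_snd⟩
  f_arcs := fun {s e} hadm he => .inr (s.strandMate_mem hadm he)

end SpinNet

end Spin

/-! ### The drawing of the strands; kinks and crossed extrema -/

namespace Spin

open Finset

theorem toNat_injective : Function.Injective Bool.toNat := by
  intro a b
  cases a <;> cases b <;> simp

namespace Drawing

variable {X S : Type} [Fintype X] [Fintype S] {D : Drawing X}

open Classical in
-- The fibres of `π` are the components, and `rep` picks a point on each of them.
theorem sum_card_comp {π : X → S} (hπ : ∀ p q, π p = π q ↔ D.Conn p q) {rep : S → X}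
    (hrep : ∀ C, π (rep C) = C) (P : X → Prop) :
    ∑ C, ((D.comp (rep C)).filter P).card = (univ.filter P).card := by
  rw [card_eq_sum_card_fiberwise (f := π) (t := univ) (by simp)]
  refine sum_congr rfl fun C _ => congrArg card ?_
  ext q
  simp only [mem_filter, mem_comp, mem_univ, true_and, ← hπ, hrep]
  rw [and_comm, eq_comm]

open Classical in
theorem sum_card_comp_pairs {π : X → S} (hπ : ∀ p q, π p = π q ↔ D.Conn p q) {rep : S → X}
    (hrep : ∀ C, π (rep C) = C) (P : X × X → Prop) :
    ∑ C, ((D.comp (rep C) ×ˢ D.comp (rep C)).filter P).card =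
      (univ.filter fun q => D.Conn q.1 q.2 ∧ P q).card := by
  rw [card_eq_sum_card_fiberwise (s := univ.filter fun q => D.Conn q.1 q.2 ∧ P q)
    (f := fun q : X × X => π q.1) (t := univ) (by simp)]
  refine sum_congr rfl fun C _ => congrArg card ?_
  ext q
  simp only [mem_filter, mem_comp, mem_univ, true_and, ← hπ, hrep, mem_product]
  constructor
  · rintro ⟨⟨h1, h2⟩, h3⟩
    exact ⟨⟨h1.symm.trans h2, h3⟩, h1.symm⟩
  · rintro ⟨⟨h1, h2⟩, h3⟩
    exact ⟨⟨h3.symm, h3.symm.trans h1⟩, h2⟩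

open Classical in
/-- The number of cups and caps whose left end is directed downwards. -/
noncomputable def downTurns (D : Drawing X) (o : X → Bool) : ℕ :=
  (univ.filter fun q => D.TurnL q ∧ D.down o q = true).card

open Classical in
/-- The number of pairs of ends of one strand on the same line such that the strand runs downwards
at the left one. -/
noncomputable def allEndPairs (D : Drawing X) (o : X → Bool) : ℕ :=
  (univ.filter fun q : X × X => D.Conn q.1 q.2 ∧ D.b q.1 = q.1 ∧ D.b q.2 = q.2 ∧
    D.line q.1 = D.line q.2 ∧ D.lt q.1 q.2 ∧ D.down o q.1 = true).card

open Classical in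
-- The sum of `Drawing.whitney` over all components. A pair of points on the same component is
-- counted once, namely for that component.
theorem whitney_sum {o : X → Bool} (ho : D.Coloring o) {π : X → S}
    (hπ : ∀ p q, π p = π q ↔ D.Conn p q) {rep : S → X} (hrep : ∀ C, π (rep C) = C) :
    (D.downTurns o : ZMod 2) = (∑ C, D.kinks (rep C) : ℕ) +
      ((univ.filter fun q : X × X => D.Conn q.1 q.2 ∧ D.Cr q.1 q.2).card : ℕ) + D.allEndPairs o := by
  have h1 := sum_card_comp_pairs hπ hrep fun q => D.b q.1 = q.1 ∧ D.b q.2 = q.2 ∧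
    D.line q.1 = D.line q.2 ∧ D.lt q.1 q.2 ∧ D.down o q.1 = true
  have h2 := sum_card_comp_pairs hπ hrep fun q => D.Cr q.1 q.2
  have h3 := sum_card_comp hπ hrep fun q => D.TurnL q ∧ D.down o q = true
  have e1 : D.allEndPairs o = ∑ C, D.endPairs o (rep C) := by
    unfold allEndPairs endPairs
    convert h1.symm
  have e3 : D.downTurns o = ∑ C, D.turns (fun q => D.down o q = true) (rep C) := by
    unfold downTurns turns
    convert h3.symm
  have e2 : (univ.filter fun q : X × X => D.Conn q.1 q.2 ∧ D.Cr q.1 q.2).card =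
      ∑ C, D.crossings (rep C) := by
    unfold crossings
    convert h2.symm
  rw [e1, e3, e2]
  push_cast
  rw [← sum_add_distrib, ← sum_add_distrib]
  exact sum_congr rfl fun C _ => whitney ho (rep C)

end Drawing

namespace SpinNet

variable {A B : List ℕ} (T : SpinNet A B) (σ : T.Expansion)

theorem line_le {h j : ℕ} (hj : j < (T.lines.getD h []).length) : h ≤ T.topLine := by
  by_contra hh
  rw [T.line_of_gt (by omega)] at hj
  simp at hj

instance : Finite T.EdgePoint :=
  Finite.of_injective (fun p : T.EdgePoint =>
    (⟨⟨p.1.1, Nat.lt_succ_of_le (T.line_le p.2)⟩, ⟨p.1.2, p.2⟩⟩ :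
      Σ h : Fin (T.topLine + 1), Fin (T.lines.getD h.1 []).length)) fun p q h => by
    obtain ⟨⟨h, j⟩, hp⟩ := p
    obtain ⟨⟨h', j'⟩, hq⟩ := q
    simp only [Sigma.mk.injEq, Fin.mk.injEq] at h
    obtain ⟨rfl, h⟩ := h
    simp only [heq_eq_eq, Fin.mk.injEq] at h
    subst h
    rfl

instance : Finite T.StrandPoint :=
  Finite.of_injective (fun p : T.StrandPoint =>
    (⟨p.toEdgePoint, ⟨p.1.2.2, p.2.2⟩⟩ : Σ q : T.EdgePoint, Fin (T.label q.1))) fun p q h => by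
    obtain ⟨⟨h1, j, i⟩, hp⟩ := p
    obtain ⟨⟨h2, j', i'⟩, hq⟩ := q
    simp only [Sigma.mk.injEq, StrandPoint.toEdgePoint, EdgePoint, Subtype.mk.injEq,
      Prod.mk.injEq] at h
    obtain ⟨⟨rfl, rfl⟩, h⟩ := h
    simp only [heq_eq_eq, Fin.mk.injEq] at h
    subst h
    rfl

noncomputable instance : Fintype T.EdgePoint := Fintype.ofFinite _
noncomputable instance : Fintype T.StrandPoint := Fintype.ofFinite _

instance : Finite (T.Strand σ) := Quot.finite _
noncomputable instance : Fintype (T.Strand σ) := Fintype.ofFinite _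

theorem line_cases {h : ℕ} (hh : h ≤ T.topLine) :
    ((h = 0 ∨ h = T.topLine) ∧ T.sliceAt (sliceLayer h) = none) ∨
      (h ≠ 0 ∧ h ≠ T.topLine ∧ ∃ s, T.sliceAt (sliceLayer h) = some s) := by
  have ht := T.topLine_odd
  by_cases h0 : h = 0
  · exact .inl ⟨.inl h0, by subst h0; exact T.sliceAt_of_even rfl⟩
  by_cases h1 : h = T.topLine
  · refine .inl ⟨.inr h1, ?_⟩
    cases hs : T.sliceAt (sliceLayer h) with
    | none => rfl
    | some s =>
      have := T.sliceAt_lt hs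
      rw [sliceLayer, h1, if_pos ht] at this
      omega
  · refine .inr ⟨h0, h1, T.exists_sliceAt ?_ ?_⟩ <;> unfold sliceLayer <;> split_ifs <;> omega

/-- The wiring of the strands. -/
noncomputable def strandWiring : Wiring T.StrandPoint := (T.strandLayout σ).wiring

theorem strandWiring_slice {h : ℕ} {s : Slice} (hs : T.sliceAt h = some s) {p : T.StrandPoint}
    {e : Bool × ℕ × ℕ} (hp : p.1 = position h e) :
    ((T.strandWiring σ).b p).1 = position h (s.strandMate e) := by
  change T.sliceMate Slice.strandMate p.1 = _
  rw [hp, T.sliceMate_position _ hs]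

theorem exists_slice_position (p : T.StrandPoint)
    (hp : ¬ (p.1.1 = 0 ∨ p.1.1 = T.topLine)) : ∃ h s e, T.sliceAt h = some s ∧
      p.1 = position h e ∧ s.StrandValid e ∧ h % 2 = 1 ∧ s.piece.Admissible := by
  rcases T.line_cases (T.line_le p.2.1) with h | ⟨-, -, s, hs⟩
  · exact absurd h.1 hp
  · have h1 := T.eq_position hs
    refine ⟨_, s, _, hs, h1, ?_, (T.sliceAt_lt hs).1, T.sliceAt_admissible hs⟩
    have h2 : T.IsPlace p.1 := p.2
    rw [h1] at h2
    exact (T.isPlace_iff hs _).1 h2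

theorem strandWiring_end_iff (p : T.StrandPoint) :
    (T.strandWiring σ).b p = p ↔ p.1.1 = 0 ∨ p.1.1 = T.topLine := by
  constructor
  · intro hb
    by_contra hp
    obtain ⟨h, s, e, hs, he, hv, hh, hadm⟩ := T.exists_slice_position p hp
    have h1 := T.strandWiring_slice σ hs he
    rw [hb, he] at h1
    have h2 : e = s.strandMate e := by
      obtain ⟨h3, h4⟩ := Prod.ext_iff.1 h1
      refine Prod.ext ?_ h4
      simp only [position, Nat.add_left_cancel_iff] at h3
      exact toNat_injective h3
    rcases s.strandMate_mem hadm hv with h | h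
    · exact (s.strandArcs_prop hadm h).ne h2
    · exact (s.strandArcs_prop hadm h).ne h2.symm
  · intro hp
    refine Subtype.ext (T.sliceMate_none _ ?_)
    rcases T.line_cases (T.line_le p.2.1) with h | h
    · exact h.2
    · exact absurd hp (by tauto)

theorem leftOf_iff {p q : ℕ × ℕ} (h : p ≠ q) : LeftOf p q ↔ ¬ LeftOf q p := by
  have : p.1 ≠ q.1 ∨ p.2 ≠ q.2 := by
    by_contra! hh
    exact h (Prod.ext hh.1 hh.2)
  unfold LeftOf
  omega

/-- The drawing of the strands. -/
noncomputable def strandDrawing : Drawing T.StrandPoint where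
  toWiring := T.strandWiring σ
  line p := p.1.1
  lt p q := LeftOf p.1.2 q.1.2
  top := T.topLine
  top_odd := T.topLine_odd
  lt_iff p q h hpq := leftOf_iff fun h' => hpq (Subtype.ext (Prod.ext h h'))
  lt_irrefl p := by simp [LeftOf]
  a_even p hp := by
    change oppLine p.1.1 = _
    rw [oppLine, if_pos hp]
  a_odd p hp := by
    change oppLine p.1.1 + 1 = _
    rw [oppLine, if_neg (by omega)]
    omega
  b_odd p hp := by
    by_cases h0 : p.1.1 = 0 ∨ p.1.1 = T.topLine
    · left
      rw [(T.strandWiring_end_iff σ p).2 h0]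
    · obtain ⟨h, s, e, hs, he, hv, hh, hadm⟩ := T.exists_slice_position p h0
      have h1 := congrArg Prod.fst he
      have h2 := congrArg Prod.fst (T.strandWiring_slice σ hs he)
      rw [h1] at hp ⊢
      rw [h2]
      generalize s.strandMate e = g
      obtain ⟨t, x⟩ := e
      obtain ⟨t', x'⟩ := g
      cases t <;> cases t' <;> simp [position] at hp ⊢ <;> omega
  b_even p hp := by
    by_cases h0 : p.1.1 = 0 ∨ p.1.1 = T.topLine
    · left
      rw [(T.strandWiring_end_iff σ p).2 h0]
    · obtain ⟨h, s, e, hs, he, hv, hh, hadm⟩ := T.exists_slice_position p h0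
      have h1 := congrArg Prod.fst he
      have h2 := congrArg Prod.fst (T.strandWiring_slice σ hs he)
      rw [h1] at hp ⊢
      rw [h2]
      generalize s.strandMate e = g
      obtain ⟨t, x⟩ := e
      obtain ⟨t', x'⟩ := g
      cases t <;> cases t' <;> simp [position] at hp ⊢ <;> omega
  end_iff p := T.strandWiring_end_iff σ p
  planar p q h1 h2 h3 h4 h5 := by
    have hp0 := mt (T.strandWiring_end_iff σ p).2 h1
    obtain ⟨h, s, e, hs, he, hv, hh, hadm⟩ := T.exists_slice_position p hp0
    have hq : q.1 = position h (e.1, q.1.2) := by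
      refine Prod.ext ?_ rfl
      rw [h3, he]
      rfl
    have hqv : s.StrandValid (e.1, q.1.2) := by
      have : T.IsPlace q.1 := q.2
      rw [hq] at this
      exact (T.isPlace_iff hs _).1 this
    have e1 := T.strandWiring_slice σ hs he
    have e2 := T.strandWiring_slice σ hs hq
    have toNat : ∀ f g : Bool × ℕ × ℕ, (position h f).1 = (position h g).1 ↔ f.1 = g.1 := by
      intro f g
      simp only [position, Nat.add_left_cancel_iff]
      exact toNat_injective.eq_iff
    have := s.strand_planar hadm hv hqv ?_ rfl ?_ ?_
    · simp only [e1, e2, he]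
      rw [show ((position h (s.strandMate (e.1, q.1.2))).1 = q.1.1) ↔
        (s.strandMate (e.1, q.1.2)).1 = e.1 by
          rw [congrArg Prod.fst hq, toNat]]
      exact this
    · rwa [e1, he, toNat] at h2
    · intro h6
      refine h4 (Subtype.ext ?_)
      rw [hq, h6, he]
    · intro h6
      refine h5 (Subtype.ext ?_)
      rw [hq, h6, e1]

variable {T σ}

theorem strand_eq_iff {p q : T.StrandPoint} : (Quot.mk _ p : T.Strand σ) = Quot.mk _ q ↔
    (T.strandDrawing σ).Conn p q :=
  (T.strandLayout σ).quot_eq_iff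

/-- A monotone arc joins a point to the point above it. -/
theorem up_of_mem {h : ℕ} {x : Arc (ℕ × ℕ)} (hx : x ∈ (T.strandLayers σ).getD h [])
    (h1 : x.1.1 = false) (h2 : x.2.1 = true) {p : T.StrandPoint} (hp : p.1 = position h x.1) :
    p.1.1 = h ∧ ((T.strandDrawing σ).up p).1 = position h x.2 := by
  have h3 : p.1.1 = h := by rw [hp]; simp [position, h1]
  refine ⟨h3, ?_⟩
  have hline : (T.strandDrawing σ).line p = h := h3
  rw [Drawing.up, hline]
  rcases Nat.mod_two_eq_zero_or_one h with hh | hh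
  · rw [if_pos hh]
    change T.permMate σ p.1 = _
    rw [hp]
    exact (T.strandLayout σ).layer_even hh hx
  · rw [if_neg (by omega)]
    cases hs : T.sliceAt h with
    | none => rw [(T.layer_none σ hh hs).2.1] at hx; simp at hx
    | some s =>
      rw [T.strandLayers_slice σ hs] at hx
      refine (T.strandWiring_slice σ hs hp).trans ?_
      rw [(s.strandArcs_prop (T.sliceAt_admissible hs) hx).mate_fst]

theorem mem_of_up {p : T.StrandPoint}
    (h : (T.strandDrawing σ).line ((T.strandDrawing σ).up p) = (T.strandDrawing σ).line p + 1) :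
    ((false, p.1.2), (true, ((T.strandDrawing σ).up p).1.2)) ∈ (T.strandLayers σ).getD p.1.1 [] ∧
      ((T.strandDrawing σ).up p).1.1 = p.1.1 + 1 := by
  refine ⟨?_, h⟩
  unfold Drawing.up at h ⊢
  have hp : (T.strandDrawing σ).line p = p.1.1 := rfl
  rw [hp] at h ⊢
  split_ifs at h ⊢ with hh
  · obtain ⟨x, hx, h1, h2⟩ := T.mem_permMate σ (p := p.1) p.2 hh
    have h3 : ((T.strandDrawing σ).a p).1 = position p.1.1 x.2 := h2
    rw [(T.layer_even σ hh).2.1, h3, congrArg Prod.snd h1]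
    rw [mem_permArcs] at hx ⊢
    obtain ⟨j, hj, i, hi, rfl⟩ := hx
    exact ⟨j, hj, i, hi, rfl⟩
  · have h0 : ¬ (p.1.1 = 0 ∨ p.1.1 = T.topLine) := by
      intro h0
      rw [((T.strandDrawing σ).end_iff p).2 h0] at h
      omega
    obtain ⟨l, s, e, hs, he, hv, hl, hadm⟩ := T.exists_slice_position p h0
    have h2 : ((T.strandDrawing σ).b p).1 = _ := T.strandWiring_slice σ hs he
    have h3 : (T.strandDrawing σ).line ((T.strandDrawing σ).b p) = _ := congrArg Prod.fst h2
    have h4 := congrArg Prod.fst he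
    rw [h3, h4] at h
    rw [h4] at hh
    obtain ⟨t, y⟩ := e
    have ht : t = false := by
      cases t
      · rfl
      · simp [position] at hh; omega
    subst ht
    have hm : (s.strandMate (false, y)).1 = true := by
      cases hc : (s.strandMate (false, y)).1
      · simp [position, hc] at h
      · rfl
    have h5 : p.1.1 = l := by rw [h4]; simp [position]
    rw [h5, T.strandLayers_slice σ hs, h2, congrArg Prod.snd he]
    have h6 : ((false, (position l (false, y)).2), (true, (position l (s.strandMate (false, y))).2)) =
        ((false, y), s.strandMate (false, y)) := by
      refine Prod.ext rfl (Prod.ext hm.symm rfl)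
    rw [h6]
    rcases s.strandMate_mem hadm hv with h | h
    · exact h
    · have := (s.strandArcs_prop hadm h).up (by simp [hm])
      simp [hm] at this

theorem turnL_of_mem {h : ℕ} {x : Arc (ℕ × ℕ)} (hx : x ∈ (T.strandLayers σ).getD h [])
    (h1 : x.1.1 = x.2.1) {p : T.StrandPoint} (hp : p.1 = position h x.1) :
    (T.strandDrawing σ).TurnL p ∧ h = sliceLayer p.1.1 ∧ x.1.1 = decide (p.1.1 % 2 = 0) ∧
      ((T.strandDrawing σ).b p).1 = position h x.2 := by
  rcases Nat.mod_two_eq_zero_or_one h with hh | hh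
  · rw [(T.layer_even σ hh).2.1, mem_permArcs] at hx
    obtain ⟨j, hj, i, hi, rfl⟩ := hx
    simp at h1
  · cases hs : T.sliceAt h with
    | none => rw [(T.layer_none σ hh hs).2.1] at hx; simp at hx
    | some s =>
      rw [T.strandLayers_slice σ hs] at hx
      have hpr := s.strandArcs_prop (T.sliceAt_admissible hs) hx
      have hb : ((T.strandDrawing σ).b p).1 = position h x.2 := by
        refine (T.strandWiring_slice σ hs hp).trans ?_
        rw [hpr.mate_fst]
      obtain ⟨h2, h3⟩ := sliceLayer_position hh x.1
      rw [hp]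
      refine ⟨⟨fun h' => hpr.ne ?_, ?_, ?_⟩, h2.symm, h3.symm, hb⟩
      · rw [h', hp] at hb
        exact Prod.ext h1 (congrArg Prod.snd hb : (position h x.1).2 = (position h x.2).2)
      · change ((T.strandDrawing σ).b p).1.1 = p.1.1
        rw [hb, hp]
        simp [position, h1]
      · change LeftOf p.1.2 ((T.strandDrawing σ).b p).1.2
        rw [hb, hp]
        exact hpr.lt h1

theorem mem_of_turnL {p : T.StrandPoint} (h : (T.strandDrawing σ).TurnL p) :
    ∃ x ∈ (T.strandLayers σ).getD (sliceLayer p.1.1) [], x.1.1 = x.2.1 ∧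
      p.1 = position (sliceLayer p.1.1) x.1 := by
  obtain ⟨h1, h2, h3⟩ := h
  obtain ⟨l, s, e, hs, he, hv, hl, hadm⟩ := T.exists_slice_position p
    (mt (T.strandWiring_end_iff σ p).2 h1)
  have hb : ((T.strandDrawing σ).b p).1 = _ := T.strandWiring_slice σ hs he
  have h4 : e.1 = (s.strandMate e).1 := by
    change ((T.strandDrawing σ).b p).1.1 = p.1.1 at h2
    rw [hb, he] at h2
    simp only [position, Nat.add_left_cancel_iff] at h2
    exact (toNat_injective h2).symm
  have hll : sliceLayer p.1.1 = l := by rw [he]; exact (sliceLayer_position hl e).1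
  rw [hll]
  refine ⟨(e, s.strandMate e), ?_, h4, he⟩
  rw [T.strandLayers_slice σ hs]
  rcases s.strandMate_mem hadm hv with h | h
  · exact h
  · change LeftOf p.1.2 ((T.strandDrawing σ).b p).1.2 at h3
    have := (s.strandArcs_prop hadm h).lt h4.symm
    rw [hb, he] at h3
    unfold LeftOf position at *
    simp only at *
    omega

/-- A cup or cap is determined by its left end, which links the count of arcs with the count of
points. -/
theorem extrema_eq (p : T.StrandPoint) :
    T.extrema σ (Quot.mk _ p) = (T.strandDrawing σ).turns (fun _ => True) p := by
  classical
  unfold extrema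
  rw [Drawing.turns, ← Set.ncard_coe_finset]
  symm
  choose! g hg1 hg2 hg3 using fun (q : T.StrandPoint) (hq : (T.strandDrawing σ).TurnL q) =>
    mem_of_turnL hq
  refine Set.ncard_congr (fun q _ => (sliceLayer q.1.1, g q)) ?_ ?_ ?_
  · intro q hq
    simp only [coe_filter, Set.mem_ofPred_eq, Drawing.mem_comp, and_true] at hq
    exact ⟨hg1 q hq.2, hg2 q hq.2, q, hg3 q hq.2, (strand_eq_iff.2 hq.1).symm⟩
  · intro q r hq hr h
    simp only [coe_filter, Set.mem_ofPred_eq, and_true] at hq hr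
    rw [Prod.mk.injEq] at h
    refine Subtype.ext ?_
    rw [hg3 q hq.2, hg3 r hr.2, h.1, h.2]
  · rintro ⟨h, x⟩ ⟨hx, h1, q, hq, hC⟩
    obtain ⟨h2, h3, h4, h5⟩ := turnL_of_mem hx h1 hq
    refine ⟨q, ?_, ?_⟩
    · simp only [coe_filter, Set.mem_ofPred_eq, Drawing.mem_comp, and_true]
      exact ⟨strand_eq_iff.1 hC.symm, h2⟩
    · have h6 : x.1 = (g q).1 := by
        have e1 := hg3 q h2
        obtain ⟨-, -, h7, -⟩ := turnL_of_mem (hg1 q h2) (hg2 q h2) e1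
        refine Prod.ext (h4.trans h7.symm) ?_
        exact (congrArg Prod.snd hq).symm.trans (congrArg Prod.snd e1)
      have h8 := (turnL_of_mem (hg1 q h2) (hg2 q h2) (hg3 q h2)).2.2.2
      refine Prod.ext h3.symm (Prod.ext h6.symm (Prod.ext ?_ ?_))
      · change (g q).2.1 = x.2.1
        rw [← hg2 q h2, ← h1, h6]
      · change (g q).2.2 = x.2.2
        exact (congrArg Prod.snd h8).symm.trans (congrArg Prod.snd h5)

theorem isClosed_iff (p : T.StrandPoint) : T.IsClosed σ (Quot.mk _ p) ↔
    ∀ q ∈ (T.strandDrawing σ).comp p, (T.strandDrawing σ).b q ≠ q := by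
  simp only [Drawing.mem_comp, ne_eq, (T.strandDrawing σ).end_iff]
  constructor
  · intro h q hq hq'
    rcases hq' with hq' | hq'
    · exact (h q.1.2).1 ⟨q, Prod.ext hq' rfl, strand_eq_iff.2 hq.symm⟩
    · exact (h q.1.2).2 ⟨q, Prod.ext hq' rfl, strand_eq_iff.2 hq.symm⟩
  · intro h r
    constructor
    · rintro ⟨q, hq, hC⟩
      exact h q (strand_eq_iff.1 hC).symm (.inl (congrArg Prod.fst hq))
    · rintro ⟨q, hq, hC⟩
      exact h q (strand_eq_iff.1 hC).symm (.inr (congrArg Prod.fst hq))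

theorem strandKinks_eq (p : T.StrandPoint) :
    T.strandKinks σ (Quot.mk _ p) = (T.strandDrawing σ).kinks p := by
  classical
  unfold strandKinks
  rw [Drawing.kinks, extrema_eq]
  exact if_congr (isClosed_iff p) rfl rfl

open Classical in
-- A crossing is determined by the lower ends of its two arcs, since the upper ends are their mates.
theorem crossedExtrema_eq : T.crossedExtrema σ =
    (univ.filter fun q : T.StrandPoint × T.StrandPoint =>
      (T.strandDrawing σ).Conn q.1 q.2 ∧ (T.strandDrawing σ).Cr q.1 q.2).card := by
  rw [crossedExtrema, ← Set.ncard_coe_finset]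
  symm
  refine Set.ncard_congr (fun q _ => (q.1.1.1,
    (((false, q.1.1.2), (true, ((T.strandDrawing σ).up q.1).1.2)),
      ((false, q.2.1.2), (true, ((T.strandDrawing σ).up q.2).1.2))))) ?_ ?_ ?_
  · rintro ⟨p, q⟩ h
    simp only [coe_filter, Set.mem_ofPred_eq, mem_univ, true_and] at h
    obtain ⟨h1, h2, h3, h4, h5, h6⟩ := h
    have h7 : p.1.1 = q.1.1 := h2
    refine ⟨(mem_of_up h4).1, ?_, ⟨rfl, rfl, rfl, rfl, h3, h6⟩, Quot.mk _ p, ⟨p, rfl, rfl⟩,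
      q, ?_, (strand_eq_iff.2 h1).symm⟩
    · have := (mem_of_up h5).1
      rwa [← h7] at this
    · exact Prod.ext h7.symm rfl
  · rintro ⟨p, q⟩ ⟨p', q'⟩ h h' hh
    simp only [coe_filter, Set.mem_ofPred_eq, mem_univ, true_and] at h h'
    simp only [Prod.mk.injEq, true_and] at hh
    have h7 : p.1.1 = q.1.1 := h.2.1
    have h8 : p'.1.1 = q'.1.1 := h'.2.1
    obtain ⟨e1, ⟨e2, -⟩, e3, -⟩ := hh
    refine Prod.ext (Subtype.ext (Prod.ext e1 e2)) (Subtype.ext (Prod.ext ?_ e3))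
    exact h7.symm.trans (e1.trans h8)
  · rintro ⟨h, x, y⟩ ⟨hx, hy, ⟨c1, c2, c3, c4, c5, c6⟩, C, ⟨p, hp, hpC⟩, q, hq, hqC⟩
    simp only at hx hy c1 c2 c3 c4 c5 c6 hp hq
    obtain ⟨p1, p2⟩ := up_of_mem hx c1 c2 hp
    obtain ⟨q1, q2⟩ := up_of_mem hy c3 c4 hq
    refine ⟨(p, q), ?_, ?_⟩
    · simp only [coe_filter, Set.mem_ofPred_eq, mem_univ, true_and]
      refine ⟨strand_eq_iff.1 (hpC.trans hqC.symm), p1.trans q1.symm, ?_, ?_, ?_, ?_⟩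
      · change LeftOf p.1.2 q.1.2
        rw [hp, hq]
        exact c5
      · change ((T.strandDrawing σ).up p).1.1 = p.1.1 + 1
        rw [p2, p1]
        simp [position, c2]
      · change ((T.strandDrawing σ).up q).1.1 = q.1.1 + 1
        rw [q2, q1]
        simp [position, c4]
      · change LeftOf ((T.strandDrawing σ).up q).1.2 ((T.strandDrawing σ).up p).1.2
        rw [p2, q2]
        exact c6
    · refine Prod.ext p1 (Prod.ext (Prod.ext (Prod.ext c1.symm ?_) (Prod.ext c2.symm ?_))
        (Prod.ext (Prod.ext c3.symm ?_) (Prod.ext c4.symm ?_)))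
      · exact (congrArg Prod.snd hp : p.1.2 = (position h x.1).2)
      · exact (congrArg Prod.snd p2 : ((T.strandDrawing σ).up p).1.2 = (position h x.2).2)
      · exact (congrArg Prod.snd hq : q.1.2 = (position h y.1).2)
      · exact (congrArg Prod.snd q2 : ((T.strandDrawing σ).up q).1.2 = (position h y.2).2)

/-- The parity of the number of extrema of all strands whose left end is directed downwards. -/
theorem downTurns_eq {o : T.StrandPoint → Bool} (ho : (T.strandDrawing σ).Coloring o) :
    ((T.strandDrawing σ).downTurns o : ZMod 2) =
      T.kinks σ + T.crossedExtrema σ + (T.strandDrawing σ).allEndPairs o := by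
  rw [Drawing.whitney_sum (S := T.Strand σ) ho (π := fun p => (Quot.mk _ p : T.Strand σ))
    (fun p q => strand_eq_iff) (rep := Quot.out) (fun C => Quot.out_eq C), crossedExtrema_eq, kinks,
    finsum_eq_sum_of_fintype]
  have h : ∑ C : T.Strand σ, (T.strandDrawing σ).kinks (Quot.out C) =
      ∑ C : T.Strand σ, T.strandKinks σ C :=
    sum_congr rfl fun C _ => (strandKinks_eq _).symm.trans (congrArg _ (Quot.out_eq C))
  rw [h]

end SpinNet

end Spin

/-! ### Corners and ends of edges; orientations of equivalent networks -/

namespace Spin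

namespace Slice

variable (s : Slice)

theorem corner_eq {t : Bool} {a b c : ℕ} (hs : s.piece = .vertex t a b c) (k : Fin 3) :
    s.corner k = ![(t, s.left.length), (t, s.left.length + 1), (!t, s.left.length)] k := by
  unfold corner
  rw [hs]

theorem exists_vertex (hv : s.piece.IsVertex) : ∃ t a b c, s.piece = .vertex t a b c := by
  cases hs : s.piece with
  | vertex t a b c => exact ⟨t, a, b, c, rfl⟩
  | _ => rw [hs] at hv; exact hv.elim

theorem isCorner_iff {e : Bool × ℕ} : s.IsCorner e ↔ s.piece.IsVertex ∧ ∃ k, e = s.corner k := by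
  refine and_congr_right fun hv => ?_
  obtain ⟨t, a, b, c, hs⟩ := s.exists_vertex hv
  obtain ⟨-, -, -, w1, w2⟩ := s.vertex_lab hs
  obtain ⟨t', j⟩ := e
  simp only [s.corner_eq hs, Fin.exists_fin_succ, Matrix.cons_val_zero, Matrix.cons_val_succ,
    IsEmpty.exists_iff, or_false, Prod.mk.injEq]
  by_cases ht : t' = t
  · subst ht
    rw [w1]
    simp
    omega
  · obtain rfl : t' = !t := by cases t <;> cases t' <;> simp_all
    rw [w2]
    simp
    omega

theorem corner_injective (hv : s.piece.IsVertex) : Function.Injective s.corner := by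
  obtain ⟨t, a, b, c, hs⟩ := s.exists_vertex hv
  intro k k' h
  rw [s.corner_eq hs, s.corner_eq hs] at h
  fin_cases k <;> fin_cases k' <;> simp at h ⊢

theorem vertexArcs_corner_ne {l : ℕ} {t : Bool} {a b c : ℕ} {x : Arc (ℕ × ℕ)}
    (hx : x ∈ (Piece.vertex t a b c).strandArcs l) : (x.1.1, x.1.2.1) ≠ (x.2.1, x.2.2.1) := by
  rw [mem_vertexArcs] at hx
  rcases hx with ⟨i, hi, rfl⟩ | ⟨i, hi, rfl⟩ | ⟨i, hi, rfl⟩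
  · cases t <;> simp [legArc]
  · simp
  · cases t <;> simp [legArc]

end Slice

namespace SpinNet

variable {A B : List ℕ}

/-- The wiring of the edges. -/
def edgeWiring (T : SpinNet A B) : Wiring T.EdgePoint := (T.edgeLayout (T.ofPerms fun _ => 1)).wiring

/-- The wiring of the segments. -/
noncomputable def segmentWiring (T : SpinNet A B) (σ : T.Expansion) : Wiring T.StrandPoint :=
  (T.segmentLayout σ).wiring

variable {T : SpinNet A B} {σ : T.Expansion}

theorem edgeOf_eq_iff {p q : T.EdgePoint} : T.edgeOf p = T.edgeOf q ↔ T.edgeWiring.Conn p q :=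
  (T.edgeLayout (T.ofPerms fun _ => 1)).quot_eq_iff

theorem segmentOf_eq_iff {p q : T.StrandPoint} :
    T.segmentOf σ p = T.segmentOf σ q ↔ (T.segmentWiring σ).Conn p q :=
  (T.segmentLayout σ).quot_eq_iff

theorem edge_out (e : T.Edge) : ∃ p, T.edgeOf p = e := Quot.exists_rep e

theorem segment_out (S : T.Segment σ) : ∃ p, T.segmentOf σ p = S := Quot.exists_rep S

theorem toEdgePoint_a (p : T.StrandPoint) :
    ((T.segmentWiring σ).a p).toEdgePoint = T.edgeWiring.a p.toEdgePoint := rfl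

theorem segmentWiring_b (p : T.StrandPoint) :
    ((T.segmentWiring σ).b p).1 = T.sliceMate Slice.segmentMate p.1 := rfl

theorem edgeWiring_b (p : T.EdgePoint) : (T.edgeWiring.b p).1 = T.sliceMate Slice.edgeMate p.1 := rfl

theorem toEdgePoint_val (p : T.StrandPoint) : p.toEdgePoint.1 = (p.1.1, p.1.2.1) := rfl

theorem edgeMate_of_isCorner {s : Slice} {e : Bool × ℕ} (h : s.IsCorner e) : s.edgeMate e = e := by
  obtain ⟨hv, h1, h2⟩ := h
  obtain ⟨t, a, b, c, hs⟩ := s.exists_vertex hv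
  rw [Slice.edgeMate, if_neg (by omega), if_neg (by omega), hs]

/-- Segments run parallel to their edges. As the projection commutes with both involutions,
orientations and ends of segments are inherited from the edges. -/
theorem toEdgePoint_b (p : T.StrandPoint) :
    ((T.segmentWiring σ).b p).toEdgePoint = T.edgeWiring.b p.toEdgePoint := by
  refine Subtype.ext ?_
  rw [edgeWiring_b, toEdgePoint_val, toEdgePoint_val, segmentWiring_b]
  unfold sliceMate
  simp only
  cases T.sliceAt (sliceLayer p.1.1) with
  | none => rfl
  | some s =>
    simp only [position, Slice.segmentMate]
    by_cases h : s.IsCorner (decide (p.1.1 % 2 = 0), p.1.2.1)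
    · rw [if_pos h, edgeMate_of_isCorner h]
    · rw [if_neg h]

/-- The point of a strand over a point of an edge. -/
def strandPt (p : T.EdgePoint) (i : Fin (T.label p.1)) : T.StrandPoint :=
  ⟨(p.1.1, p.1.2, i.1), p.2, i.2⟩

theorem toEdgePoint_strandPt (p : T.EdgePoint) (i : Fin (T.label p.1)) :
    (strandPt p i).toEdgePoint = p := rfl

theorem strandPt_injective (p : T.EdgePoint) : Function.Injective (strandPt p) := by
  intro i j h
  exact Fin.ext (congrArg (fun q : T.StrandPoint => q.1.2.2) h)

theorem exists_strandPt (q : T.StrandPoint) : ∃ i, strandPt q.toEdgePoint i = q :=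
  ⟨⟨q.1.2.2, q.2.2⟩, rfl⟩

theorem segment_conn_edge {p q : T.StrandPoint} (h : (T.segmentWiring σ).Conn p q) :
    T.edgeWiring.Conn p.toEdgePoint q.toEdgePoint := by
  unfold Wiring.Conn at h
  induction h with
  | refl => exact Wiring.Conn.refl _
  | @tail y z h1 h2 ih =>
    refine ih.trans ?_
    rcases h2 with rfl | rfl
    · exact Wiring.conn_a _
    · rw [toEdgePoint_b]
      exact Wiring.conn_b _

theorem position_cases (p : T.EdgePoint) :
    ((p.1.1 = 0 ∨ p.1.1 = T.topLine) ∧ T.edgeWiring.b p = p) ∨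
    ∃ h s e, T.sliceAt h = some s ∧ p.1 = position h e ∧ s.EdgeValid e ∧ h % 2 = 1 ∧
      s.piece.Admissible ∧ p.1.1 ≠ 0 ∧ p.1.1 ≠ T.topLine := by
  rcases T.line_cases (T.line_le p.2) with h | ⟨h0, h1, s, hs⟩
  · exact .inl ⟨h.1, Subtype.ext (T.sliceMate_none _ h.2)⟩
  · have h1' := T.eq_position hs
    refine .inr ⟨_, s, _, hs, h1', ?_, (T.sliceAt_lt hs).1, T.sliceAt_admissible hs, h0, h1⟩
    have h2 := p.2
    rw [h1'] at h2
    exact (T.edgeValid_iff hs _).1 h2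

theorem corner_valid (v : T.Vertex) (c : Fin 3) : v.slice.EdgeValid (v.slice.corner c) := by
  obtain ⟨-, h1, h2⟩ := v.slice.isCorner_iff.2 ⟨v.isVertex, c, rfl⟩
  rw [Slice.EdgeValid, Slice.ends_length]
  omega

/-- The end of an edge at a corner of a vertex. -/
def cornerPt (v : T.Vertex) (c : Fin 3) : T.EdgePoint :=
  ⟨position v.layer (v.slice.corner c), (T.edgeValid_iff v.sliceAt_eq _).2 (corner_valid v c)⟩

/-- The free end at a place at the bottom. -/
def bottomPt (j : Fin A.length) : T.EdgePoint := ⟨(0, j), by rw [T.line_zero]; exact j.2⟩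

/-- The free end at a place at the top. -/
def topPt (j : Fin B.length) : T.EdgePoint := ⟨(T.topLine, j), by rw [T.line_top]; exact j.2⟩

variable (T) in
/-- The ends of the edges. -/
abbrev EndIdx : Type := (T.Vertex × Fin 3) ⊕ (Fin A.length ⊕ Fin B.length)

/-- The position of an end of an edge. -/
def endPt : T.EndIdx → T.EdgePoint :=
  Sum.elim (fun x => cornerPt x.1 x.2) (Sum.elim bottomPt topPt)

theorem Vertex.eq_of_layer {v w : T.Vertex} (h : v.layer = w.layer) : v = w := by
  refine Vertex.ext h ?_
  have h1 := v.sliceAt_eq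
  rw [h, w.sliceAt_eq] at h1
  exact (Option.some.inj h1).symm

instance : Finite T.Vertex :=
  Finite.of_injective (fun v : T.Vertex => (⟨v.layer, by
    have := T.sliceAt_lt v.sliceAt_eq; omega⟩ : Fin T.topLine)) fun v w h =>
      Vertex.eq_of_layer (by simpa using h)

noncomputable instance : Fintype T.Vertex := Fintype.ofFinite _

theorem position_injective {α : Type} {h h' : ℕ} {e e' : Bool × α} (hh : h % 2 = 1) (hh' : h' % 2 = 1)
    (H : position h e = position h' e') : h = h' ∧ e = e' := by
  have h1 := sliceLayer_position hh e
  have h2 := sliceLayer_position hh' e'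
  rw [H] at h1
  exact ⟨h1.1.symm.trans h2.1, Prod.ext (h1.2.symm.trans h2.2)
    (congrArg Prod.snd H : (position h e).2 = (position h' e').2)⟩

theorem vertex_odd (v : T.Vertex) : v.layer % 2 = 1 := (T.sliceAt_lt v.sliceAt_eq).1

theorem cornerPt_line (v : T.Vertex) (c : Fin 3) :
    (cornerPt v c).1.1 ≠ 0 ∧ (cornerPt v c).1.1 ≠ T.topLine := by
  have h1 := T.sliceAt_lt v.sliceAt_eq
  have h2 : (cornerPt v c).1.1 = v.layer + (v.slice.corner c).1.toNat := rfl
  have h3 := Bool.toNat_le (v.slice.corner c).1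
  omega

theorem cornerPt_injective {v w : T.Vertex} {c d : Fin 3} (h : cornerPt v c = cornerPt w d) :
    v = w ∧ c = d := by
  obtain ⟨h1, h2⟩ := position_injective (vertex_odd v) (vertex_odd w) (congrArg Subtype.val h)
  obtain rfl := Vertex.eq_of_layer h1
  exact ⟨rfl, v.slice.corner_injective v.isVertex h2⟩

theorem endPt_injective : Function.Injective (endPt (T := T)) := by
  have ht := T.topLine_odd
  rintro (⟨v, c⟩ | j | j) (⟨w, d⟩ | k | k) h
  · obtain ⟨rfl, rfl⟩ := cornerPt_injective h
    rfl
  · exact absurd (congrArg (fun p => p.1.1) h) (cornerPt_line v c).1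
  · exact absurd (congrArg (fun p => p.1.1) h) (cornerPt_line v c).2
  · exact absurd (congrArg (fun p => p.1.1) h).symm (cornerPt_line w d).1
  · obtain rfl : j = k := Fin.ext (congrArg (fun p => p.1.2) h)
    rfl
  · have : 0 = T.topLine := congrArg (fun p => p.1.1) h
    omega
  · exact absurd (congrArg (fun p => p.1.1) h).symm (cornerPt_line w d).2
  · have : T.topLine = 0 := congrArg (fun p => p.1.1) h
    omega
  · obtain rfl : j = k := Fin.ext (congrArg (fun p => p.1.2) h)
    rfl

theorem edge_end_iff (p : T.EdgePoint) : T.edgeWiring.b p = p ↔ ∃ x, endPt x = p := by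
  constructor
  · intro hb
    rcases position_cases p with ⟨h | h, -⟩ | ⟨h, s, e, hs, he, hv, hh, hadm, -, -⟩
    · have hj := p.2
      rw [h, T.line_zero] at hj
      exact ⟨.inr (.inl ⟨_, hj⟩), Subtype.ext (Prod.ext h.symm rfl)⟩
    · have hj := p.2
      rw [h, T.line_top] at hj
      exact ⟨.inr (.inr ⟨_, hj⟩), Subtype.ext (Prod.ext h.symm rfl)⟩
    · have h1 := congrArg Subtype.val hb
      rw [edgeWiring_b, he, T.sliceMate_position _ hs] at h1
      have h2 := (position_injective hh hh h1).2
      rcases s.edgeMate_mem hv with h3 | h3 | h3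
      · obtain ⟨hver, k, hk⟩ := s.isCorner_iff.1 h3.1
        refine ⟨.inl (⟨h, s, hs, hver⟩, k), Subtype.ext ?_⟩
        rw [he, hk]
        rfl
      · exact absurd h2.symm (s.edgeArcs_prop h3).ne
      · exact absurd h2 (s.edgeArcs_prop h3).ne
  · rintro ⟨⟨v, c⟩ | j | j, rfl⟩
    · refine Subtype.ext ?_
      rw [edgeWiring_b]
      change T.sliceMate _ (position v.layer (v.slice.corner c)) = position v.layer (v.slice.corner c)
      rw [T.sliceMate_position _ v.sliceAt_eq,
        edgeMate_of_isCorner (v.slice.isCorner_iff.2 ⟨v.isVertex, c, rfl⟩)]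
    · rcases position_cases (T := T) (bottomPt j) with h | ⟨h, s, e, -, -, -, -, -, h0, -⟩
      · exact h.2
      · exact absurd rfl h0
    · rcases position_cases (T := T) (topPt j) with h | ⟨h, s, e, -, -, -, -, -, -, h0⟩
      · exact h.2
      · exact absurd rfl h0

theorem segment_end_iff (p : T.StrandPoint) :
    (T.segmentWiring σ).b p = p ↔ ∃ x, endPt x = p.toEdgePoint := by
  rw [← edge_end_iff]
  constructor
  · intro h
    rw [← toEdgePoint_b (σ := σ), h]
  · intro h
    refine Subtype.ext ?_
    have h1 : T.edgeWiring.b p.toEdgePoint = p.toEdgePoint := h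
    rw [segmentWiring_b]
    unfold sliceMate
    cases hs : T.sliceAt (sliceLayer p.1.1) with
    | none => rfl
    | some s =>
      have h2 := congrArg Subtype.val h1
      rw [edgeWiring_b, toEdgePoint_val] at h2
      unfold sliceMate at h2
      simp only [hs] at h2
      have h3 := T.eq_position (p := p.1) hs
      have hh := (T.sliceAt_lt hs).1
      generalize sliceLayer p.1.1 = l at *
      have hv : s.StrandValid (decide (p.1.1 % 2 = 0), p.1.2) := by
        have h4 : T.IsPlace p.1 := p.2
        rw [h3] at h4
        exact (T.isPlace_iff hs _).1 h4
      have h5 : position l (s.edgeMate (decide (p.1.1 % 2 = 0), p.1.2.1)) =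
          position l (decide (p.1.1 % 2 = 0), p.1.2.1) := by
        rw [h2]
        exact Prod.ext (congrArg Prod.fst h3 : p.1.1 = (position l (decide (p.1.1 % 2 = 0), p.1.2)).1) rfl
      have h6 := (position_injective hh hh h5).2
      have hc : s.IsCorner (decide (p.1.1 % 2 = 0), p.1.2.1) := by
        rcases s.edgeMate_mem hv.1 with h7 | h7 | h7
        · exact h7.1
        · exact absurd h6.symm (s.edgeArcs_prop h7).ne
        · exact absurd h6 (s.edgeArcs_prop h7).ne
      change position l (s.segmentMate _) = p.1
      rw [Slice.segmentMate, if_pos hc, ← h3]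

theorem strand_b_eq (p : T.StrandPoint) (h : ∀ v c, cornerPt v c ≠ p.toEdgePoint) :
    (T.strandWiring σ).b p = (T.segmentWiring σ).b p := by
  refine Subtype.ext ?_
  change T.sliceMate Slice.strandMate p.1 = T.sliceMate Slice.segmentMate p.1
  unfold sliceMate
  cases hs : T.sliceAt (sliceLayer p.1.1) with
  | none => rfl
  | some s =>
    simp only
    rw [s.strandMate_of_not_isCorner]
    intro hc
    obtain ⟨hv, k, hk⟩ := s.isCorner_iff.1 hc
    refine h ⟨_, s, hs, hv⟩ k (Subtype.ext ?_)
    have h1 := T.eq_position (p := p.1) hs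
    change position _ (s.corner k) = (p.1.1, p.1.2.1)
    rw [← hk]
    exact Prod.ext (congrArg Prod.fst h1).symm rfl

theorem strand_b_corner {p : T.StrandPoint} {v : T.Vertex} {c : Fin 3}
    (h : p.toEdgePoint = cornerPt v c) : ∃ e e' : Bool × ℕ × ℕ,
      ((e, e') ∈ v.slice.piece.strandArcs v.slice.left.length ∨
        (e', e) ∈ v.slice.piece.strandArcs v.slice.left.length) ∧
      p.1 = position v.layer e ∧ ((T.strandWiring σ).b p).1 = position v.layer e' ∧
      (e.1, e.2.1) = v.slice.corner c ∧ ∃ c', c' ≠ c ∧ (e'.1, e'.2.1) = v.slice.corner c' := by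
  obtain ⟨t, a, b, d, hs⟩ := v.slice.exists_vertex v.isVertex
  have hadm := T.sliceAt_admissible v.sliceAt_eq
  have h1 := congrArg Subtype.val h
  have h2 : p.1 = position v.layer ((v.slice.corner c).1, ((v.slice.corner c).2, p.1.2.2)) := by
    refine Prod.ext ?_ (Prod.ext ?_ rfl)
    · exact (congrArg Prod.fst h1 : p.toEdgePoint.1.1 = _)
    · exact (congrArg Prod.snd h1 : p.toEdgePoint.1.2 = _)
  have hv : v.slice.StrandValid ((v.slice.corner c).1, ((v.slice.corner c).2, p.1.2.2)) := by
    have h3 : T.IsPlace p.1 := p.2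
    rw [h2] at h3
    exact (T.isPlace_iff v.sliceAt_eq _).1 h3
  have hcor : v.slice.IsCorner (v.slice.corner c) := v.slice.isCorner_iff.2 ⟨v.isVertex, c, rfl⟩
  generalize hE : ((v.slice.corner c).1, ((v.slice.corner c).2, p.1.2.2)) = e at h2 hv
  have he : (e.1, e.2.1) = v.slice.corner c := by rw [← hE]
  have hm : (e, v.slice.strandMate e) ∈ v.slice.piece.strandArcs v.slice.left.length ∨
      (v.slice.strandMate e, e) ∈ v.slice.piece.strandArcs v.slice.left.length := by
    have h4 := v.slice.strandMate_mem hadm hv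
    rw [v.slice.mem_strandArcs_of_vertex hs, v.slice.mem_strandArcs_of_vertex hs, ← hs] at h4
    -- Arcs of segments do not end at corners, so the arc at `e` is one of the strands of the
    -- vertex.
    have hno : ∀ e', ¬ ((e, e') ∈ v.slice.segmentArcs ∨ (e', e) ∈ v.slice.segmentArcs) := by
      rintro e' (h5 | h5) <;> rw [v.slice.mem_segmentArcs_iff] at h5 <;>
        obtain ⟨y, hy, i, hi, h6⟩ := h5
      · apply (v.slice.edgeArcs_prop hy).notCorner_fst
        have h7 : e = _ := congrArg Prod.fst h6
        rw [← he, h7] at hcor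
        exact hcor
      · apply (v.slice.edgeArcs_prop hy).notCorner_snd
        have h7 : e = _ := congrArg Prod.snd h6
        rw [← he, h7] at hcor
        exact hcor
    have := hno (v.slice.strandMate e)
    tauto
  have hb := T.strandWiring_slice σ v.sliceAt_eq h2
  refine ⟨e, v.slice.strandMate e, hm, h2, hb, he, ?_⟩
  rw [hs] at hm hadm
  rcases hm with hm | hm
  · have h5 := (v.slice.vertexArcs_prop hs hadm hm).2.2
    obtain ⟨-, k, hk⟩ := v.slice.isCorner_iff.1 h5
    refine ⟨k, ?_, hk⟩
    rintro rfl
    exact Slice.vertexArcs_corner_ne hm (he.trans hk.symm)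
  · have h5 := (v.slice.vertexArcs_prop hs hadm hm).2.1
    obtain ⟨-, k, hk⟩ := v.slice.isCorner_iff.1 h5
    refine ⟨k, ?_, hk⟩
    rintro rfl
    exact Slice.vertexArcs_corner_ne hm (hk.trans he.symm)

/-- A strand that enters a vertex leaves it at another corner. -/
theorem exists_corner_b {p : T.StrandPoint} {v : T.Vertex} {c : Fin 3}
    (h : p.toEdgePoint = cornerPt v c) :
    ∃ c', c' ≠ c ∧ ((T.strandWiring σ).b p).toEdgePoint = cornerPt v c' := by
  obtain ⟨e, e', -, -, h1, -, c', hc, h2⟩ := strand_b_corner (σ := σ) h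
  refine ⟨c', hc, Subtype.ext ?_⟩
  rw [toEdgePoint_val, h1]
  change _ = position v.layer (v.slice.corner c')
  rw [← h2]
  rfl

/-- Being joined at a vertex is expressed by the involution of the strands, the form in which the
condition of a lift is used. -/
theorem joined_iff {v : T.Vertex} {c c' : Fin 3} {S S' : T.Segment σ} :
    T.Joined σ v c c' S S' ↔ ∃ q : T.StrandPoint, q.toEdgePoint = cornerPt v c ∧
      ((T.strandWiring σ).b q).toEdgePoint = cornerPt v c' ∧ T.segmentOf σ q = S ∧
      T.segmentOf σ ((T.strandWiring σ).b q) = S' := by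
  constructor
  · rintro ⟨p, p', hpp, h1, h2, ⟨q, hq, hS⟩, ⟨q', hq', hS'⟩⟩
    have hb : (T.strandWiring σ).b q = q' := by
      refine Subtype.ext ?_
      obtain ⟨t, a, b, d, hs⟩ := v.slice.exists_vertex v.isVertex
      have hadm := T.sliceAt_admissible v.sliceAt_eq
      rw [T.strandWiring_slice σ v.sliceAt_eq hq, hq']
      rw [hs] at hpp hadm
      rcases hpp with h | h
      · have := (v.slice.vertexArcs_prop hs hadm h).1.mate_fst
        rw [this]
      · have := (v.slice.vertexArcs_prop hs hadm h).1.mate_snd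
        rw [this]
    have e1 : q.toEdgePoint = cornerPt v c := by
      refine Subtype.ext ?_
      rw [toEdgePoint_val, hq]
      change _ = position v.layer (v.slice.corner c)
      rw [← h1]
      rfl
    have e2 : q'.toEdgePoint = cornerPt v c' := by
      refine Subtype.ext ?_
      rw [toEdgePoint_val, hq']
      change _ = position v.layer (v.slice.corner c')
      rw [← h2]
      rfl
    exact ⟨q, e1, by rw [hb, e2], hS, by rw [hb, hS']⟩
  · rintro ⟨q, h1, h2, hS, hS'⟩
    obtain ⟨e, e', hm, he, he', hc, k, hk, hk'⟩ := strand_b_corner (σ := σ) h1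
    have h3 : ((T.strandWiring σ).b q).toEdgePoint = cornerPt v k := by
      refine Subtype.ext ?_
      rw [toEdgePoint_val, he']
      change _ = position v.layer (v.slice.corner k)
      rw [← hk']
      rfl
    obtain rfl := (cornerPt_injective (h2.symm.trans h3)).2
    exact ⟨e, e', hm, hc, hk', ⟨q, he, hS⟩, ⟨_, he', hS'⟩⟩

theorem edgeThrough_iff {e : T.Edge} {q : T.EdgePoint} {x : ℕ × ℕ} (hx : q.1 = x) :
    T.EdgeThrough e x ↔ T.edgeOf q = e := by
  constructor
  · rintro ⟨r, hr, hS⟩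
    obtain rfl : r = q := Subtype.ext (hr.trans hx.symm)
    exact hS
  · intro h
    exact ⟨q, hx, h⟩

end SpinNet

open SpinNet

variable {A B : List ℕ} {T₁ T₂ : SpinNet A B} (φ : TopEquiv T₁ T₂)

namespace TopEquiv

/-- The map of corners, and its inverse. -/
def cornerEquiv : T₁.Vertex × Fin 3 ≃ T₂.Vertex × Fin 3 where
  toFun x := (φ.vertex x.1, φ.corner x.1 x.2)
  invFun y := (φ.vertex.symm y.1, (φ.corner (φ.vertex.symm y.1)).symm y.2)
  left_inv x := by simp
  right_inv y := by simp

/-- The map of the ends of edges. -/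
def ends : T₁.EndIdx ≃ T₂.EndIdx := Equiv.sumCongr φ.cornerEquiv (Equiv.refl _)

theorem edgeOf_ends (x : T₁.EndIdx) :
    T₂.edgeOf (endPt (φ.ends x)) = φ.edge (T₁.edgeOf (endPt x)) := by
  rcases x with ⟨v, c⟩ | j | j
  · exact (edgeThrough_iff rfl).1 (φ.incident v c _ ((edgeThrough_iff rfl).2 rfl))
  · exact (edgeThrough_iff rfl).1 (φ.bottom j _ ((edgeThrough_iff (q := bottomPt j) rfl).2 rfl))
  · exact (edgeThrough_iff rfl).1 (φ.top j _ ((edgeThrough_iff (q := topPt j) rfl).2 rfl))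

theorem label_ends (x : T₁.EndIdx) :
    T₁.label (endPt x).1 = T₂.label (endPt (φ.ends x)).1 :=
  φ.label _ _ (φ.edgeOf_ends x).symm

/-- There are orientations of the edges of the two networks that agree at their ends. -/
theorem exists_colorings : ∃ o₁ o₂, T₁.edgeWiring.Coloring o₁ ∧ T₂.edgeWiring.Coloring o₂ ∧
    ∀ x, o₂ (endPt (φ.ends x)) = o₁ (endPt x) := by
  obtain ⟨o₁, h₁⟩ := T₁.edgeWiring.exists_coloring
  obtain ⟨o, h⟩ := T₂.edgeWiring.exists_coloring
  classical
  -- On an edge with two ends either orientation takes different values at them. If the orientations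
  -- in the two networks disagree at one end, they disagree at both, and reversing the edge repairs
  -- both.
  let bad : T₂.Edge → Prop := fun e =>
    ∃ x, T₂.edgeOf (endPt (φ.ends x)) = e ∧ o (endPt (φ.ends x)) ≠ o₁ (endPt x)
  have hconst : ∀ {p q}, T₂.edgeWiring.Conn p q → T₂.edgeOf p = T₂.edgeOf q :=
    fun h => edgeOf_eq_iff.2 h
  refine ⟨o₁, fun p => if bad (T₂.edgeOf p) then !o p else o p, h₁, ⟨?_, ?_⟩, ?_⟩
  · intro p
    simp only [← hconst (Wiring.conn_a p), h.a p]
    split_ifs <;> rfl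
  · intro p hp
    simp only [← hconst (Wiring.conn_b p), h.b p hp]
    split_ifs <;> rfl
  · intro x
    simp only
    split_ifs with hb
    · obtain ⟨y, hy, hne⟩ := hb
      by_cases hxy : y = x
      · subst hxy
        revert hne
        cases o (endPt (φ.ends y)) <;> cases o₁ (endPt y) <;> simp
      · have e2 := h.ends_ne ((edge_end_iff _).2 ⟨_, rfl⟩) ((edge_end_iff _).2 ⟨_, rfl⟩)
          (fun hh => hxy (φ.ends.injective (endPt_injective hh))) (edgeOf_eq_iff.1 hy)
        have hy' := hy
        rw [edgeOf_ends, edgeOf_ends] at hy'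
        have e1 := h₁.ends_ne ((edge_end_iff _).2 ⟨y, rfl⟩) ((edge_end_iff _).2 ⟨x, rfl⟩)
          (fun hh => hxy (endPt_injective hh)) (edgeOf_eq_iff.1 (φ.edge.injective hy'))
        revert e1 e2 hne
        cases o (endPt (φ.ends y)) <;> cases o₁ (endPt y) <;> cases o (endPt (φ.ends x)) <;>
          cases o₁ (endPt x) <;> simp
    · by_contra hne
      exact hb ⟨x, rfl, hne⟩

end TopEquiv

end Spin

/-! ### Transport of orientations along a correspondence of expansions -/

namespace Spin

open Finset SpinNet

variable {A B : List ℕ}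

namespace SpinNet

variable {T : SpinNet A B} {σ : T.Expansion}

theorem segment_coloring {o : T.EdgePoint → Bool} (ho : T.edgeWiring.Coloring o) :
    (T.segmentWiring σ).Coloring fun p => o p.toEdgePoint where
  a p := ho.a p.toEdgePoint
  b p hp := by
    rw [toEdgePoint_b]
    refine ho.b _ fun h => hp ?_
    rw [segment_end_iff, ← edge_end_iff]
    exact h

theorem strand_b_of_segment_b {p : T.StrandPoint} (hp : (T.segmentWiring σ).b p ≠ p) :
    (T.strandWiring σ).b p = (T.segmentWiring σ).b p :=
  strand_b_eq p fun v c h => hp ((segment_end_iff p).2 ⟨.inl (v, c), h⟩)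

theorem coloring_segment {o : T.StrandPoint → Bool} (ho : (T.strandWiring σ).Coloring o) :
    (T.segmentWiring σ).Coloring o where
  a p := ho.a p
  b p hp := by
    rw [← strand_b_of_segment_b hp]
    exact ho.b p (by rwa [strand_b_of_segment_b hp])

theorem strand_conn_of_segment {p q : T.StrandPoint} (h : (T.segmentWiring σ).Conn p q) :
    (T.strandWiring σ).Conn p q := by
  unfold Wiring.Conn at h
  induction h with
  | refl => exact Wiring.Conn.refl _
  | @tail y z h1 h2 ih =>
    refine ih.trans ?_
    rcases h2 with rfl | rfl
    · exact (T.strandWiring σ).conn_a y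
    · by_cases hy : (T.segmentWiring σ).b y = y
      · rw [hy]
        exact Wiring.Conn.refl _
      · rw [← strand_b_of_segment_b hy]
        exact Wiring.conn_b _

/-- A segment ends at most once at each end of an edge. -/
theorem eq_of_segmentOf_eq {p q : T.StrandPoint} {x : T.EndIdx} (hp : p.toEdgePoint = endPt x)
    (hq : q.toEdgePoint = endPt x) (h : T.segmentOf σ p = T.segmentOf σ q) : p = q := by
  by_contra hne
  -- An orientation of the edges induces one of the segments. It takes different values at two
  -- distinct ends of one segment, but only one value at a given end of an edge.
  obtain ⟨o, ho⟩ := T.edgeWiring.exists_coloring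
  have := (segment_coloring (σ := σ) ho).ends_ne ((segment_end_iff p).2 ⟨x, hp.symm⟩)
    ((segment_end_iff q).2 ⟨x, hq.symm⟩) hne (segmentOf_eq_iff.1 h)
  simp [hp, hq] at this

/-- The difference of an orientation of the strands and an orientation of the edges does not change
along a segment. -/
theorem xor_eq_of_segmentOf_eq {o : T.StrandPoint → Bool} (ho : (T.strandWiring σ).Coloring o)
    {oE : T.EdgePoint → Bool} (hE : T.edgeWiring.Coloring oE) {p q : T.StrandPoint}
    (h : T.segmentOf σ p = T.segmentOf σ q) :
    xor (o p) (oE p.toEdgePoint) = xor (o q) (oE q.toEdgePoint) := by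
  have h1 := coloring_segment ho
  have h2 := segment_coloring (σ := σ) hE
  have h3 := segmentOf_eq_iff.1 h
  unfold Wiring.Conn at h3
  induction h3 with
  | refl => rfl
  | @tail y z h4 h5 ih =>
    rw [ih (segmentOf_eq_iff.2 h4)]
    rcases h5 with rfl | rfl
    · rw [h1.a, h2.a]
      simp
    · by_cases hy : (T.segmentWiring σ).b y = y
      · rw [hy]
      · rw [h1.b y hy, h2.b y hy]
        simp

end SpinNet

variable {T₁ T₂ : SpinNet A B}

/-- A strand is a chain of segments joined at vertices, and each joint is preserved. The hypothesis
asks for one implication only and leaves the vertex free, so that the lemma applies to a lift and to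
its inverse. -/
theorem conn_transport {σ₁ : T₁.Expansion} {σ₂ : T₂.Expansion} (e : T₁.Segment σ₁ ≃ T₂.Segment σ₂)
    (he : ∀ v c c' S S', T₁.Joined σ₁ v c c' S S' → ∃ w d d', T₂.Joined σ₂ w d d' (e S) (e S'))
    {p q : T₁.StrandPoint} (h : (T₁.strandWiring σ₁).Conn p q) {p' q' : T₂.StrandPoint}
    (hp : T₂.segmentOf σ₂ p' = e (T₁.segmentOf σ₁ p))
    (hq : T₂.segmentOf σ₂ q' = e (T₁.segmentOf σ₁ q)) : (T₂.strandWiring σ₂).Conn p' q' := by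
  have same : ∀ {r s : T₂.StrandPoint}, T₂.segmentOf σ₂ r = T₂.segmentOf σ₂ s →
      (T₂.strandWiring σ₂).Conn r s := fun h => strand_conn_of_segment (segmentOf_eq_iff.1 h)
  unfold Wiring.Conn at h
  induction h generalizing q' with
  | refl => exact same (hp.trans hq.symm)
  | @tail y z h1 h2 ih =>
    obtain ⟨y', hy'⟩ := segment_out (e (T₁.segmentOf σ₁ y))
    refine (ih hy').trans ?_
    have hsame : T₁.segmentOf σ₁ y = T₁.segmentOf σ₁ z → (T₂.strandWiring σ₂).Conn y' q' := by
      intro h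
      exact same (by rw [hy', hq, h])
    rcases h2 with rfl | rfl
    · exact hsame (segmentOf_eq_iff.2 ((T₁.segmentWiring σ₁).conn_a y))
    · by_cases hc : ∃ v c, cornerPt v c = y.toEdgePoint
      · obtain ⟨v, c, hvc⟩ := hc
        obtain ⟨c', -, hc'⟩ := exists_corner_b (σ := σ₁) hvc.symm
        obtain ⟨w, d, d', hJ⟩ := he v c c' _ _ (joined_iff.2 ⟨y, hvc.symm, hc', rfl, rfl⟩)
        obtain ⟨r, -, -, hr, hr'⟩ := joined_iff.1 hJ
        exact (same (hy'.trans hr.symm)).trans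
          (((T₂.strandWiring σ₂).conn_b r).trans (same (hr'.trans hq.symm)))
      · push Not at hc
        refine hsame (segmentOf_eq_iff.2 ?_)
        rw [strand_b_eq y hc]
        exact Wiring.conn_b y

namespace TopEquiv

namespace Lift

variable {φ : TopEquiv T₁ T₂} {σ₁ : T₁.Expansion} {σ₂ : T₂.Expansion} (Λ : φ.Lift σ₁ σ₂)

/-- The points `q` and `q'` are corresponding ends of corresponding segments. -/
def Corr (x : T₁.EndIdx) (q : T₁.StrandPoint) (q' : T₂.StrandPoint) : Prop :=
  q.toEdgePoint = endPt x ∧ q'.toEdgePoint = endPt (φ.ends x) ∧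
    T₂.segmentOf σ₂ q' = Λ.segment (T₁.segmentOf σ₁ q)

theorem Corr.unique_right {x : T₁.EndIdx} {q : T₁.StrandPoint} {r r' : T₂.StrandPoint}
    (h : Λ.Corr x q r) (h' : Λ.Corr x q r') : r = r' :=
  eq_of_segmentOf_eq h.2.1 h'.2.1 (h.2.2.trans h'.2.2.symm)

theorem Corr.unique_left {x : T₁.EndIdx} {q q' : T₁.StrandPoint} {r : T₂.StrandPoint}
    (h : Λ.Corr x q r) (h' : Λ.Corr x q' r) : q = q' :=
  eq_of_segmentOf_eq h.1 h'.1 (Λ.segment.injective (h.2.2.symm.trans h'.2.2))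

theorem exists_corr_corner {v : T₁.Vertex} {c c' : Fin 3} {q : T₁.StrandPoint}
    (hq : q.toEdgePoint = cornerPt v c)
    (hq' : ((T₁.strandWiring σ₁).b q).toEdgePoint = cornerPt v c') :
    ∃ r, Λ.Corr (.inl (v, c)) q r ∧
      Λ.Corr (.inl (v, c')) ((T₁.strandWiring σ₁).b q) ((T₂.strandWiring σ₂).b r) := by
  obtain ⟨r, h1, h2, h3, h4⟩ := joined_iff.1
    ((Λ.joined v c c' _ _).1 (joined_iff.2 ⟨q, hq, hq', rfl, rfl⟩))
  exact ⟨r, ⟨hq, h1, h3⟩, hq', h2, h4⟩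

theorem exists_corr_corner' {v : T₁.Vertex} {c c' : Fin 3} {r : T₂.StrandPoint}
    (hr : r.toEdgePoint = cornerPt (φ.vertex v) (φ.corner v c))
    (hr' : ((T₂.strandWiring σ₂).b r).toEdgePoint = cornerPt (φ.vertex v) (φ.corner v c')) :
    ∃ q, Λ.Corr (.inl (v, c)) q r ∧
      Λ.Corr (.inl (v, c')) ((T₁.strandWiring σ₁).b q) ((T₂.strandWiring σ₂).b r) := by
  obtain ⟨q, h1, h2, h3, h4⟩ := joined_iff.1
    ((Λ.joined v c c' (Λ.segment.symm (T₂.segmentOf σ₂ r))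
      (Λ.segment.symm (T₂.segmentOf σ₂ ((T₂.strandWiring σ₂).b r)))).2
      (joined_iff.2 ⟨r, hr, hr', by simp, by simp⟩))
  exact ⟨q, ⟨h1, hr, by rw [h3]; simp⟩, h2, hr', by rw [h4]; simp⟩

theorem exists_corr_bottom {j : Fin A.length} {q : T₁.StrandPoint}
    (hq : q.toEdgePoint = bottomPt j) :
    ∃ r, Λ.Corr (.inr (.inl j)) q r ∧ r.1 = q.1 := by
  have h0 := congrArg Subtype.val hq
  have h1 : q.1 = (0, (j.1, q.1.2.2)) :=
    Prod.ext (congrArg Prod.fst h0 : q.toEdgePoint.1.1 = 0)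
      (Prod.ext (congrArg Prod.snd h0 : q.toEdgePoint.1.2 = j.1) rfl)
  obtain ⟨r, hr, hS⟩ := Λ.bottom j q.1.2.2 (T₁.segmentOf σ₁ q) ⟨q, h1, rfl⟩
  refine ⟨r, ⟨hq, Subtype.ext ?_, hS⟩, hr.trans h1.symm⟩
  rw [toEdgePoint_val, hr]
  rfl

theorem exists_corr_top {j : Fin B.length} {q : T₁.StrandPoint} (hq : q.toEdgePoint = topPt j) :
    ∃ r, Λ.Corr (.inr (.inr j)) q r ∧ r.1.1 = T₂.topLine ∧ r.1.2 = q.1.2 := by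
  have h0 := congrArg Subtype.val hq
  have h1 : q.1 = (T₁.topLine, (j.1, q.1.2.2)) :=
    Prod.ext (congrArg Prod.fst h0 : q.toEdgePoint.1.1 = T₁.topLine)
      (Prod.ext (congrArg Prod.snd h0 : q.toEdgePoint.1.2 = j.1) rfl)
  obtain ⟨r, hr, hS⟩ := Λ.top j q.1.2.2 (T₁.segmentOf σ₁ q) ⟨q, h1, rfl⟩
  refine ⟨r, ⟨hq, Subtype.ext ?_, hS⟩, congrArg Prod.fst hr, ?_⟩
  · rw [toEdgePoint_val, hr]
    rfl
  · rw [hr]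
    exact (congrArg Prod.snd h1).symm

theorem exists_corr {x : T₁.EndIdx} {q : T₁.StrandPoint} (hq : q.toEdgePoint = endPt x) :
    ∃ r, Λ.Corr x q r := by
  rcases x with ⟨v, c⟩ | j | j
  · obtain ⟨c', -, hc'⟩ := exists_corner_b (σ := σ₁) hq
    exact (Λ.exists_corr_corner hq hc').imp fun r h => h.1
  · exact (Λ.exists_corr_bottom hq).imp fun r h => h.1
  · exact (Λ.exists_corr_top hq).imp fun r h => h.1

/-- Orientations of the strands of one expansion are transported to the other one. -/
theorem exists_transport {o₁ : T₁.StrandPoint → Bool} (h₁ : (T₁.strandWiring σ₁).Coloring o₁)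
    {e₁ : T₁.EdgePoint → Bool} {e₂ : T₂.EdgePoint → Bool} (he₁ : T₁.edgeWiring.Coloring e₁)
    (he₂ : T₂.edgeWiring.Coloring e₂) (hee : ∀ x, e₂ (endPt (φ.ends x)) = e₁ (endPt x)) :
    ∃ o₂, (T₂.strandWiring σ₂).Coloring o₂ ∧ ∀ x q r, Λ.Corr x q r → o₂ r = o₁ q := by
  choose rep hrep using fun S : T₂.Segment σ₂ => segment_out (σ := σ₁) (Λ.segment.symm S)
  -- Whether a strand runs with or against the orientation of its edge is constant along a segment.
  -- This bit is carried over and combined with the orientation of the edges of `T₂`.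
  let o₂ : T₂.StrandPoint → Bool := fun r =>
    xor (xor (o₁ (rep (T₂.segmentOf σ₂ r))) (e₁ (rep (T₂.segmentOf σ₂ r)).toEdgePoint))
      (e₂ r.toEdgePoint)
  have key : ∀ x q r, Λ.Corr x q r → o₂ r = o₁ q := by
    intro x q r h
    have h1 : T₁.segmentOf σ₁ (rep (T₂.segmentOf σ₂ r)) = T₁.segmentOf σ₁ q := by
      rw [hrep, h.2.2]
      simp
    simp only [o₂]
    rw [xor_eq_of_segmentOf_eq h₁ he₁ h1, h.1, h.2.1, hee]
    simp
  have hconst : ∀ {p q}, (T₂.segmentWiring σ₂).Conn p q → T₂.segmentOf σ₂ p = T₂.segmentOf σ₂ q :=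
    fun h => segmentOf_eq_iff.2 h
  have h2 := segment_coloring (σ := σ₂) he₂
  refine ⟨o₂, ⟨?_, ?_⟩, key⟩
  · intro p
    change o₂ ((T₂.segmentWiring σ₂).a p) = _
    simp only [o₂]
    rw [← hconst (Wiring.conn_a p), h2.a]
    simp
  · intro p hp
    by_cases hc : ∃ w d, cornerPt w d = p.toEdgePoint
    · obtain ⟨w, d, hwd⟩ := hc
      obtain ⟨d', -, hd'⟩ := exists_corner_b (σ := σ₂) hwd.symm
      obtain ⟨⟨v, c⟩, hvc⟩ := φ.cornerEquiv.surjective (w, d)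
      obtain ⟨rfl, rfl⟩ := Prod.ext_iff.1 hvc
      obtain ⟨c', rfl⟩ := (φ.corner v).surjective d'
      obtain ⟨q, hq, hq'⟩ := Λ.exists_corr_corner' hwd.symm hd'
      rw [key _ _ _ hq, key _ _ _ hq']
      refine h₁.b q fun hqb => ?_
      have := hq.1
      rw [← hqb, hq'.1] at this
      have hcc := endPt_injective this
      have : c' = c := by simpa using hcc
      subst this
      exact hp (eq_of_segmentOf_eq (σ := σ₂) hq'.2.1 hq.2.1 (by rw [hq'.2.2, hq.2.2, hqb]))
    · push Not at hc
      have hb := strand_b_eq (σ := σ₂) p hc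
      rw [hb] at hp ⊢
      simp only [o₂]
      rw [← hconst (Wiring.conn_b p), h2.b p hp]
      simp

end Lift

end TopEquiv

open Classical in
/-- The number of strands that run from the corner `c` to the corner `c'` of a vertex. -/
noncomputable def SpinNet.thruCount (T : SpinNet A B) (σ : T.Expansion) (o : T.StrandPoint → Bool)
    (v : T.Vertex) (c c' : Fin 3) : ℕ :=
  (univ.filter fun q : T.StrandPoint => q.toEdgePoint = cornerPt v c ∧
    ((T.strandWiring σ).b q).toEdgePoint = cornerPt v c' ∧ o q = false).card

namespace TopEquiv.Lift

variable {φ : TopEquiv T₁ T₂} {σ₁ : T₁.Expansion} {σ₂ : T₂.Expansion}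

/-- `Corr` matches the points at corresponding corners; it respects the joining at the vertex and
the directions. -/
theorem thruCount_eq (Λ : φ.Lift σ₁ σ₂) {o₁ : T₁.StrandPoint → Bool} {o₂ : T₂.StrandPoint → Bool}
    (h : ∀ x q r, Λ.Corr x q r → o₂ r = o₁ q) (v : T₁.Vertex) (c c' : Fin 3) :
    T₁.thruCount σ₁ o₁ v c c' = T₂.thruCount σ₂ o₂ (φ.vertex v) (φ.corner v c) (φ.corner v c') := by
  classical
  -- `choose!` needs a default value. If `T₂` has no strand point, both sets are empty.
  cases isEmpty_or_nonempty T₂.StrandPoint with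
  | inl hem =>
    unfold thruCount
    rw [card_eq_zero.2 (eq_empty_of_forall_notMem fun q hq => ?_),
      card_eq_zero.2 (eq_empty_of_forall_notMem fun q hq => hem.elim q)]
    simp only [mem_filter, mem_univ, true_and] at hq
    exact hem.elim (Λ.exists_corr_corner hq.1 hq.2.1).choose
  | inr hne =>
  choose! g hg hg' using fun (q : T₁.StrandPoint) (hq : q.toEdgePoint = cornerPt v c ∧
    ((T₁.strandWiring σ₁).b q).toEdgePoint = cornerPt v c') => Λ.exists_corr_corner hq.1 hq.2
  unfold thruCount
  refine card_bij (fun q _ => g q) ?_ ?_ ?_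
  · intro q hq
    simp only [mem_filter, mem_univ, true_and] at hq ⊢
    have h1 := hg q ⟨hq.1, hq.2.1⟩
    have h2 := hg' q ⟨hq.1, hq.2.1⟩
    exact ⟨h1.2.1, h2.2.1, (h _ _ _ h1).trans hq.2.2⟩
  · intro q hq q' hq' heq
    simp only [mem_filter, mem_univ, true_and] at hq hq'
    have h1 := hg q ⟨hq.1, hq.2.1⟩
    have h2 := hg q' ⟨hq'.1, hq'.2.1⟩
    rw [← heq] at h2
    exact Corr.unique_left Λ h1 h2
  · intro r hr
    simp only [mem_filter, mem_univ, true_and] at hr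
    obtain ⟨q, hq, hq'⟩ := Λ.exists_corr_corner' hr.1 hr.2.1
    have h1 := hg q ⟨hq.1, hq'.1⟩
    refine ⟨q, ?_, Corr.unique_right Λ h1 hq⟩
    simp only [mem_filter, mem_univ, true_and]
    exact ⟨hq.1, hq'.1, (h _ _ _ hq).symm.trans hr.2.2⟩

/-- The points `q` and `r` are the same free end. -/
def SameFree (q : T₁.StrandPoint) (r : T₂.StrandPoint) : Prop :=
  ((q.1.1 = 0 ∧ r.1.1 = 0) ∨ (q.1.1 = T₁.topLine ∧ r.1.1 = T₂.topLine)) ∧ q.1.2 = r.1.2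

theorem exists_sameFree (Λ : φ.Lift σ₁ σ₂) {q : T₁.StrandPoint}
    (hq : (T₁.strandDrawing σ₁).b q = q) : ∃ r x, Λ.Corr x q r ∧ SameFree q r := by
  rcases (T₁.strandWiring_end_iff σ₁ q).1 hq with h | h
  · have hj := q.2.1
    rw [h, T₁.line_zero] at hj
    have : q.toEdgePoint = bottomPt ⟨_, hj⟩ := Subtype.ext (Prod.ext h rfl)
    obtain ⟨r, hr, hr'⟩ := Λ.exists_corr_bottom this
    exact ⟨r, _, hr, .inl ⟨h, by rw [hr', h]⟩, by rw [hr']⟩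
  · have hj := q.2.1
    rw [h, T₁.line_top] at hj
    have : q.toEdgePoint = topPt ⟨_, hj⟩ := Subtype.ext (Prod.ext h rfl)
    obtain ⟨r, hr, hr', hr''⟩ := Λ.exists_corr_top this
    exact ⟨r, _, hr, .inr ⟨h, hr'⟩, hr''.symm⟩

theorem _root_.Spin.SpinNet.label_zero (T : SpinNet A B) (j : ℕ) : T.label (0, j) = A.getD j 0 := by
  rw [SpinNet.label, T.line_zero]

theorem _root_.Spin.SpinNet.label_top (T : SpinNet A B) (j : ℕ) : T.label (T.topLine, j) = B.getD j 0 := by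
  rw [SpinNet.label, T.line_top]

theorem exists_sameFree' (Λ : φ.Lift σ₁ σ₂) {r : T₂.StrandPoint}
    (hr : (T₂.strandDrawing σ₂).b r = r) :
    ∃ q x, Λ.Corr x q r ∧ SameFree q r ∧ (T₁.strandDrawing σ₁).b q = q := by
  have hplace := r.2
  rcases (T₂.strandWiring_end_iff σ₂ r).1 hr with h | h
  · have hq : T₁.IsPlace (0, r.1.2) := by
      refine ⟨?_, ?_⟩
      · have := hplace.1
        rw [h, T₂.line_zero] at this
        rwa [T₁.line_zero]
      · have := hplace.2
        rw [h, label_zero] at this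
        rwa [label_zero]
    obtain ⟨r', x, hr', hs⟩ := Λ.exists_sameFree (q := ⟨_, hq⟩)
      ((T₁.strandWiring_end_iff σ₁ _).2 (.inl rfl))
    have : r' = r := by
      refine Subtype.ext (Prod.ext ?_ hs.2.symm)
      rcases hs.1 with h1 | h1
      · exact h1.2.trans h.symm
      · have ht := T₁.topLine_odd
        have h2 : 0 = T₁.topLine := h1.1
        omega
    subst this
    exact ⟨_, x, hr', hs, (T₁.strandWiring_end_iff σ₁ _).2 (.inl rfl)⟩
  · have hq : T₁.IsPlace (T₁.topLine, r.1.2) := by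
      refine ⟨?_, ?_⟩
      · have := hplace.1
        rw [h, T₂.line_top] at this
        rwa [T₁.line_top]
      · have := hplace.2
        rw [h, label_top] at this
        rwa [label_top]
    obtain ⟨r', x, hr', hs⟩ := Λ.exists_sameFree (q := ⟨_, hq⟩)
      ((T₁.strandWiring_end_iff σ₁ _).2 (.inr rfl))
    have : r' = r := by
      refine Subtype.ext (Prod.ext ?_ hs.2.symm)
      rcases hs.1 with h1 | h1
      · have ht := T₁.topLine_odd
        have h2 : T₁.topLine = 0 := h1.1
        omega
      · exact h1.2.trans h.symm
    subst this
    exact ⟨_, x, hr', hs, (T₁.strandWiring_end_iff σ₁ _).2 (.inr rfl)⟩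

theorem SameFree.b_eq {q : T₁.StrandPoint} {r : T₂.StrandPoint} (h : SameFree q r) :
    (T₂.strandDrawing σ₂).b r = r :=
  (T₂.strandWiring_end_iff σ₂ r).2 (h.1.imp And.right And.right)

theorem SameFree.line_iff {q q' : T₁.StrandPoint} {r r' : T₂.StrandPoint} (h : SameFree q r)
    (h' : SameFree q' r') : q.1.1 = q'.1.1 ↔ r.1.1 = r'.1.1 := by
  have h1 := T₁.topLine_odd
  have h2 := T₂.topLine_odd
  have := h.1
  have := h'.1
  omega

theorem SameFree.line_mod {q : T₁.StrandPoint} {r : T₂.StrandPoint} (h : SameFree q r) :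
    r.1.1 % 2 = q.1.1 % 2 := by
  have h1 := T₁.topLine_odd
  have h2 := T₂.topLine_odd
  have := h.1
  omega

theorem conn_iff (Λ : φ.Lift σ₁ σ₂) {q q' : T₁.StrandPoint} {r r' : T₂.StrandPoint}
    (h : T₂.segmentOf σ₂ r = Λ.segment (T₁.segmentOf σ₁ q))
    (h' : T₂.segmentOf σ₂ r' = Λ.segment (T₁.segmentOf σ₁ q')) :
    (T₁.strandDrawing σ₁).Conn q q' ↔ (T₂.strandDrawing σ₂).Conn r r' := by
  constructor
  · intro hc
    exact conn_transport Λ.segment (fun v c c' S S' hJ => ⟨_, _, _, (Λ.joined v c c' S S').1 hJ⟩)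
      hc h h'
  · intro hc
    refine conn_transport Λ.segment.symm (fun w d d' S S' hJ => ?_) hc (by simp [h]) (by simp [h'])
    obtain ⟨v, rfl⟩ := φ.vertex.surjective w
    obtain ⟨c, rfl⟩ := (φ.corner v).surjective d
    obtain ⟨c', rfl⟩ := (φ.corner v).surjective d'
    exact ⟨v, c, c', (Λ.joined _ _ _ _ _).2 (by simpa using hJ)⟩

/-- The count involves only the places of the free ends, their directions, and which of them are
connected by strands; all of this is preserved. The meaning of `down` at a free end is preserved
too, because the bottom line is `0` and both top lines are odd. -/
theorem allEndPairs_eq (Λ : φ.Lift σ₁ σ₂) {o₁ : T₁.StrandPoint → Bool} {o₂ : T₂.StrandPoint → Bool}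
    (h : ∀ x q r, Λ.Corr x q r → o₂ r = o₁ q) :
    (T₁.strandDrawing σ₁).allEndPairs o₁ = (T₂.strandDrawing σ₂).allEndPairs o₂ := by
  classical
  cases isEmpty_or_nonempty T₂.StrandPoint with
  | inl hem =>
    unfold Drawing.allEndPairs
    rw [card_eq_zero.2 (eq_empty_of_forall_notMem fun q hq => ?_),
      card_eq_zero.2 (eq_empty_of_forall_notMem fun q hq => hem.elim q.1)]
    simp only [mem_filter, mem_univ, true_and] at hq
    exact hem.elim (Λ.exists_sameFree hq.2.1).choose
  | inr hne =>
  have hx : ∀ q : T₁.StrandPoint, (T₁.strandDrawing σ₁).b q = q →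
      ∃ r, (∃ x, Λ.Corr x q r) ∧ SameFree q r := by
    intro q hq
    obtain ⟨r, x, h1, h2⟩ := Λ.exists_sameFree hq
    exact ⟨r, ⟨x, h1⟩, h2⟩
  choose! g hg0 hg' using hx
  have hg : ∀ (q : T₁.StrandPoint) (hq : (T₁.strandDrawing σ₁).b q = q),
      Λ.Corr (hg0 q hq).choose q (g q) := fun q hq => (hg0 q hq).choose_spec
  have hdown : ∀ q x r, Λ.Corr x q r → SameFree q r →
      (T₂.strandDrawing σ₂).down o₂ r = (T₁.strandDrawing σ₁).down o₁ q := by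
    intro q x r hc hs
    have h1 : (T₂.strandDrawing σ₂).line r % 2 = (T₁.strandDrawing σ₁).line q % 2 := hs.line_mod
    rw [Drawing.down, Drawing.down, h1, h _ _ _ hc]
  have hlt : ∀ q q' r r', SameFree q r → SameFree q' r' →
      ((T₂.strandDrawing σ₂).lt r r' ↔ (T₁.strandDrawing σ₁).lt q q') := by
    intro q q' r r' hs hs'
    change LeftOf r.1.2 r'.1.2 ↔ LeftOf q.1.2 q'.1.2
    rw [hs.2, hs'.2]
  unfold Drawing.allEndPairs
  refine card_bij (fun q _ => (g q.1, g q.2)) ?_ ?_ ?_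
  · rintro ⟨q, q'⟩ hq
    simp only [mem_filter, mem_univ, true_and] at hq ⊢
    obtain ⟨h1, h2, h3, h4, h5, h6⟩ := hq
    refine ⟨(Λ.conn_iff (hg q h2).2.2 (hg q' h3).2.2).1 h1, (hg' q h2).b_eq, (hg' q' h3).b_eq,
      ((hg' q h2).line_iff (hg' q' h3)).1 h4, (hlt _ _ _ _ (hg' q h2) (hg' q' h3)).2 h5, ?_⟩
    rw [hdown _ _ _ (hg q h2) (hg' q h2), h6]
  · rintro ⟨q, q'⟩ hq ⟨p, p'⟩ hp heq
    simp only [mem_filter, mem_univ, true_and] at hq hp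
    simp only [Prod.mk.injEq] at heq
    have inj : ∀ q p, (T₁.strandDrawing σ₁).b q = q → (T₁.strandDrawing σ₁).b p = p →
        g q = g p → q = p := by
      intro q p hq hp he
      have h1 := hg' q hq
      have h2 := hg' p hp
      rw [he] at h1
      exact Subtype.ext (Prod.ext ((h1.line_iff h2).2 rfl) (h1.2.trans h2.2.symm))
    rw [inj q p hq.2.1 hp.2.1 heq.1, inj q' p' hq.2.2.1 hp.2.2.1 heq.2]
  · rintro ⟨r, r'⟩ hr
    simp only [mem_filter, mem_univ, true_and] at hr
    obtain ⟨h1, h2, h3, h4, h5, h6⟩ := hr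
    obtain ⟨q, x, hc, hs, hq⟩ := Λ.exists_sameFree' h2
    obtain ⟨q', x', hc', hs', hq'⟩ := Λ.exists_sameFree' h3
    have uniq : ∀ q r, (T₁.strandDrawing σ₁).b q = q → SameFree q r → g q = r := by
      intro q r hq hs
      have h1 := hg' q hq
      exact Subtype.ext (Prod.ext ((h1.line_iff hs).1 rfl) (h1.2.symm.trans hs.2))
    refine ⟨(q, q'), ?_, by simp only [uniq q r hq hs, uniq q' r' hq' hs']⟩
    simp only [mem_filter, mem_univ, true_and]
    refine ⟨(Λ.conn_iff hc.2.2 hc'.2.2).2 h1, hq, hq', (hs.line_iff hs').2 h4,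
      (hlt _ _ _ _ hs hs').1 h5, ?_⟩
    rw [← hdown _ _ _ hc hs, h6]

end TopEquiv.Lift

end Spin

/-! ### Flows, and the parity of the cups and caps of edges -/

namespace Spin

open Finset SpinNet

open Classical in
-- The sum of `u` over all points vanishes because `a` reverses the sign. Grouped by `b`, the
-- monotone arcs cancel, and each turn leaves twice the value at the end selected by `L`.
theorem Wiring.sum_turns {X : Type} [Fintype X] (W : Wiring X) (u : X → ℤ) (L : X → Prop)
    (ha : ∀ p, u (W.a p) = -u p)
    (hb : ∀ p, W.b p ≠ p → (u (W.b p) = -u p ∧ ¬ L p ∧ ¬ L (W.b p)) ∨ (u (W.b p) = u p ∧ (L p ↔ ¬ L (W.b p))))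
    (hL : ∀ p, L p → W.b p ≠ p) :
    ∑ p ∈ univ.filter (fun p => W.b p = p), u p + 2 * ∑ p ∈ univ.filter L, u p = 0 := by
  have h0 : ∑ p, u p = 0 := by
    refine sum_involution (fun p _ => W.a p) ?_ ?_ ?_ ?_
    · intro p _
      rw [ha]
      ring
    · intro p _ _
      exact W.a_ne p
    · simp
    · intro p _
      exact W.a_a p
  have h1 : ∑ p ∈ univ.filter (fun p => ¬ W.b p = p), (u p - if L p then 2 * u p else 0) = 0 := by
    refine sum_involution (fun p _ => W.b p) ?_ ?_ ?_ ?_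
    · intro p hp
      simp only [mem_filter, mem_univ, true_and] at hp
      rcases hb p hp with ⟨h1, h2, h3⟩ | ⟨h1, h2⟩
      · rw [if_neg h2, if_neg h3, h1]
        ring
      · by_cases h : L p
        · rw [if_pos h, if_neg (h2.1 h), h1]
          ring
        · rw [if_neg h, if_pos (by tauto), h1]
          ring
    · intro p hp _
      simpa using hp
    · intro p hp
      simp only [mem_filter, mem_univ, true_and] at hp ⊢
      rw [W.b_b]
      exact fun h => hp h.symm
    · intro p _
      exact W.b_b p
  have h2 : univ.filter (fun p => ¬ W.b p = p ∧ L p) = univ.filter L :=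
    filter_congr fun p _ => ⟨fun h => h.2, fun h => ⟨hL p h, h⟩⟩
  rw [sum_sub_distrib, sub_eq_zero, ← sum_filter, filter_filter, h2, ← mul_sum] at h1
  rw [← h1, sum_filter_add_sum_filter_not, h0]

variable {A B : List ℕ}

namespace SpinNet

variable {T : SpinNet A B} {σ : T.Expansion}

theorem edge_line_b {p : T.EdgePoint} (hp : T.edgeWiring.b p ≠ p) :
    T.label (T.edgeWiring.b p).1 = T.label p.1 ∧
    (((T.edgeWiring.b p).1.1 = p.1.1 ∧ (T.edgeWiring.b p).1.2 ≠ p.1.2) ∨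
      (T.edgeWiring.b p).1.1 % 2 ≠ p.1.1 % 2) := by
  rcases position_cases p with ⟨-, h⟩ | ⟨h, s, e, hs, he, hv, hh, hadm, -, -⟩
  · exact absurd h hp
  have hb := edgeWiring_b p
  rw [he, T.sliceMate_position _ hs] at hb
  have hne : (T.edgeWiring.b p).1 ≠ p.1 := fun h => hp (Subtype.ext h)
  have hlab : ∀ e, T.label (position h e) = s.lab e.1 e.2 := by
    intro e
    rw [label, show (position h e).1 = h + e.1.toNat from rfl, T.line_slice hs]
    rfl
  rw [hb, he] at hne ⊢
  rw [hlab, hlab]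
  have h1 : s.lab (s.edgeMate e).1 (s.edgeMate e).2 = s.lab e.1 e.2 := by
    rcases s.edgeMate_mem hv with h | h | h
    · rw [h.2]
    · exact (s.edgeArcs_prop h).lab_eq.symm
    · exact (s.edgeArcs_prop h).lab_eq
  refine ⟨h1, ?_⟩
  generalize s.edgeMate e = g at hne
  obtain ⟨t, x⟩ := e
  obtain ⟨t', x'⟩ := g
  cases t <;> cases t' <;> simp [position] at hne ⊢ <;> first | exact hne | omega

theorem edge_line_a (p : T.EdgePoint) :
    T.label (T.edgeWiring.a p).1 = T.label p.1 ∧ (T.edgeWiring.a p).1.1 % 2 ≠ p.1.1 % 2 := by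
  refine ⟨T.label_oppLine _ _, ?_⟩
  change oppLine p.1.1 % 2 ≠ _
  unfold oppLine
  split_ifs <;> omega

/-- The left end of a cup or cap of an edge. -/
def EdgeTurn (p : T.EdgePoint) : Prop := T.edgeWiring.b p ≠ p ∧
  (T.edgeWiring.b p).1.1 = p.1.1 ∧ p.1.2 < (T.edgeWiring.b p).1.2

variable (T) in
/-- For every point of an edge, a number of its strands that are directed along the edge away from
the slice that contains the point, in a way that is constant along each edge. -/
structure IsFlow (G : T.EdgePoint → ℕ) : Prop where
  a : ∀ p, G (T.edgeWiring.a p) + G p = T.label p.1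
  b : ∀ p, T.edgeWiring.b p ≠ p → G (T.edgeWiring.b p) + G p = T.label p.1

theorem IsFlow.le {G : T.EdgePoint → ℕ} (hG : T.IsFlow G) (p : T.EdgePoint) : G p ≤ T.label p.1 := by
  have := hG.a p
  omega

/-- The number of strands that run downwards. -/
def downs (G : T.EdgePoint → ℕ) (p : T.EdgePoint) : ℕ :=
  if p.1.1 % 2 = 1 then G p else T.label p.1 - G p

open Classical in
/-- The number of strands that run downwards at the left ends of the cups and caps of edges. -/
noncomputable def turnDowns (G : T.EdgePoint → ℕ) : ℕ :=
  ∑ p ∈ univ.filter (EdgeTurn (T := T)), downs G p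

/-- The difference of two flows along the orientations of the edges. -/
def flowDiff (e : T.EdgePoint → Bool) (G G' : T.EdgePoint → ℕ) (p : T.EdgePoint) : ℤ :=
  if e p then (G p : ℤ) - G' p else (G' p : ℤ) - G p

theorem flowDiff_a {e : T.EdgePoint → Bool} (he : T.edgeWiring.Coloring e) {G G' : T.EdgePoint → ℕ}
    (hG : T.IsFlow G) (hG' : T.IsFlow G') (p : T.EdgePoint) :
    flowDiff e G G' (T.edgeWiring.a p) = flowDiff e G G' p := by
  have h1 := hG.a p
  have h2 := hG'.a p
  unfold flowDiff
  rw [he.a]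
  cases e p <;> simp <;> omega

theorem flowDiff_b {e : T.EdgePoint → Bool} (he : T.edgeWiring.Coloring e) {G G' : T.EdgePoint → ℕ}
    (hG : T.IsFlow G) (hG' : T.IsFlow G') {p : T.EdgePoint} (hp : T.edgeWiring.b p ≠ p) :
    flowDiff e G G' (T.edgeWiring.b p) = flowDiff e G G' p := by
  have h1 := hG.b p hp
  have h2 := hG'.b p hp
  unfold flowDiff
  rw [he.b p hp]
  cases e p <;> simp <;> omega

theorem flowDiff_cast (e : T.EdgePoint → Bool) (G G' : T.EdgePoint → ℕ) (p : T.EdgePoint) :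
    ((flowDiff e G G' p : ℤ) : ZMod 2) = G p + G' p := by
  unfold flowDiff
  have h : ∀ x : ZMod 2, -x = x := by decide
  split_ifs <;> push_cast <;> rw [sub_eq_add_neg, h]
  rw [add_comm]

theorem downs_cast {e : T.EdgePoint → Bool} {G G' : T.EdgePoint → ℕ}
    (hG : T.IsFlow G) (hG' : T.IsFlow G') (p : T.EdgePoint) :
    (downs G p : ZMod 2) + downs G' p = (flowDiff e G G' p : ℤ) := by
  rw [flowDiff_cast]
  unfold downs
  split_ifs
  · rfl
  · rw [Nat.cast_sub (hG.le p), Nat.cast_sub (hG'.le p)]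
    have h : ∀ x y z : ZMod 2, x - y + (x - z) = y + z := by decide
    exact h _ _ _

open Classical in
theorem sum_ends_eq {M : Type*} [AddCommMonoid M] (u : T.EdgePoint → M) :
    ∑ p ∈ univ.filter (fun p => T.edgeWiring.b p = p), u p =
      (∑ v : T.Vertex, ∑ c : Fin 3, u (cornerPt v c)) +
        (∑ j, u (bottomPt j) + ∑ j, u (topPt j)) := by
  have h : univ.filter (fun p => T.edgeWiring.b p = p) =
      univ.map ⟨endPt (T := T), endPt_injective⟩ := by
    ext p
    simp [edge_end_iff]
  rw [h, sum_map, Fintype.sum_sum_type, Fintype.sum_sum_type, Fintype.sum_prod_type]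
  rfl

/-- The parity of the cups and caps, in terms of the ends of edges. -/
theorem turnDowns_eq {e : T.EdgePoint → Bool} (he : T.edgeWiring.Coloring e)
    {G G' : T.EdgePoint → ℕ} (hG : T.IsFlow G) (hG' : T.IsFlow G') :
    (turnDowns G : ZMod 2) + turnDowns G' =
      (((((∑ v : T.Vertex, ∑ c : Fin 3, flowDiff e G G' (cornerPt v c)) +
        (∑ j, flowDiff e G G' (bottomPt j) + ∑ j, flowDiff e G G' (topPt j))) / 2 : ℤ)) : ZMod 2) +
      (∑ v : T.Vertex, ∑ c : Fin 3,
        (if (cornerPt v c).1.1 % 2 = 1 then (G (cornerPt v c) + G' (cornerPt v c) : ZMod 2) else 0)) +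
      ∑ j : Fin B.length, (G (topPt (T := T) j) + G' (topPt j) : ZMod 2) := by
  classical
  set H := flowDiff e G G' with hH
  -- The summand is `H` on even lines and `-H` on odd lines. As `H` is constant along edges, this
  -- alternates along monotone arcs and agrees at the two ends of a turn.
  have main := T.edgeWiring.sum_turns
    (fun p => H p - 2 * if p.1.1 % 2 = 1 then H p else 0) (EdgeTurn (T := T)) ?_ ?_ (fun p h => h.1)
  · rw [sum_sub_distrib, ← mul_sum, ← sum_ends_eq] at *
    -- The identity has to be halved over the integers before it is reduced modulo two; it shows
    -- that the sum of `H` over the ends is even.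
    have h2 : (∑ p ∈ univ.filter (fun p => T.edgeWiring.b p = p), H p) / 2 =
        ∑ p ∈ univ.filter (fun p => T.edgeWiring.b p = p), (if p.1.1 % 2 = 1 then H p else 0) -
        ∑ p ∈ univ.filter (EdgeTurn (T := T)), (H p - 2 * if p.1.1 % 2 = 1 then H p else 0) := by
      omega
    have h3 : (turnDowns G : ZMod 2) + turnDowns G' =
        ((∑ p ∈ univ.filter (EdgeTurn (T := T)),
          (H p - 2 * if p.1.1 % 2 = 1 then H p else 0) : ℤ) : ZMod 2) := by
      unfold turnDowns
      push_cast
      rw [← sum_add_distrib]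
      refine sum_congr rfl fun p _ => ?_
      have two : (2 : ZMod 2) = 0 := rfl
      rw [downs_cast (e := e) hG hG', two, zero_mul, sub_zero]
    have h4 : ((∑ p ∈ univ.filter (fun p => T.edgeWiring.b p = p),
        (if p.1.1 % 2 = 1 then H p else 0) : ℤ) : ZMod 2) = (∑ v : T.Vertex, ∑ c : Fin 3,
        (if (cornerPt v c).1.1 % 2 = 1 then (G (cornerPt v c) + G' (cornerPt v c) : ZMod 2) else 0)) +
      ∑ j : Fin B.length, (G (topPt (T := T) j) + G' (topPt j) : ZMod 2) := by
      have ht : ∀ j : Fin B.length, (topPt (T := T) j).1.1 % 2 = 1 := fun j => T.topLine_odd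
      have hb : ∀ j : Fin A.length, ¬ (bottomPt (T := T) j).1.1 % 2 = 1 := fun j => by
        simp [bottomPt]
      rw [sum_ends_eq]
      simp only [ht, hb, if_true, if_false, sum_const_zero, zero_add]
      push_cast
      simp only [hH, flowDiff_cast]
    rw [h3, h2, Int.cast_sub, h4]
    have h5 : ∀ x y : ZMod 2, y = x - y + x := by decide
    rw [add_assoc]
    exact h5 _ _
  · intro p
    have h1 := (edge_line_a p).2
    simp only [hH, flowDiff_a he hG hG']
    rcases Nat.mod_two_eq_zero_or_one p.1.1 with h | h <;>
      rcases Nat.mod_two_eq_zero_or_one (T.edgeWiring.a p).1.1 with h' | h' <;> simp [h, h'] at h1 ⊢ <;>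
      ring
  · intro p hp
    simp only [hH, flowDiff_b he hG hG' hp]
    rcases (edge_line_b hp).2 with ⟨h1, h2⟩ | h1
    · right
      refine ⟨by rw [h1], ?_⟩
      have hp' : T.edgeWiring.b (T.edgeWiring.b p) ≠ T.edgeWiring.b p := by
        rw [Wiring.b_b]
        exact fun h => hp h.symm
      unfold EdgeTurn
      rw [Wiring.b_b]
      constructor
      · rintro ⟨-, -, h⟩ ⟨-, -, h'⟩
        omega
      · intro h
        refine ⟨hp, h1, ?_⟩
        by_contra h'
        exact h ⟨fun h => hp h.symm, h1.symm, by omega⟩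
    · left
      refine ⟨?_, fun h => h1 (by rw [h.2.1]), fun h => h1 ?_⟩
      swap
      · have := h.2.1
        rw [Wiring.b_b] at this
        rw [this]
      rcases Nat.mod_two_eq_zero_or_one p.1.1 with h | h <;>
        rcases Nat.mod_two_eq_zero_or_one (T.edgeWiring.b p).1.1 with h' | h' <;>
        simp [h, h'] at h1 ⊢ <;> ring

/-! ### The flow of an orientation of the strands -/

open Classical in
/-- The number of strands at a point of an edge with a given orientation. -/
noncomputable def count (o : T.StrandPoint → Bool) (t : Bool) (p : T.EdgePoint) : ℕ :=
  (univ.filter fun q : T.StrandPoint => q.toEdgePoint = p ∧ o q = t).card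

theorem count_add (o : T.StrandPoint → Bool) (p : T.EdgePoint) :
    count o true p + count o false p = T.label p.1 := by
  classical
  have h : (univ.filter fun q : T.StrandPoint => q.toEdgePoint = p) =
      univ.map ⟨strandPt p, strandPt_injective p⟩ := by
    ext q
    simp only [mem_filter, mem_univ, true_and, mem_map, Function.Embedding.coeFn_mk]
    constructor
    · rintro rfl
      exact exists_strandPt q
    · rintro ⟨i, rfl⟩
      exact toEdgePoint_strandPt p i
  have h2 := congrArg card h
  rw [card_map, card_univ, Fintype.card_fin] at h2
  rw [← h2, count, count, ← filter_filter, ← filter_filter]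
  have h3 := card_filter_add_card_filter_not (s := univ.filter fun q : T.StrandPoint => q.toEdgePoint = p)
    (fun q => o q = true)
  simpa using h3

theorem count_of_equiv {o : T.StrandPoint → Bool} {p p' : T.EdgePoint} (g : T.StrandPoint → T.StrandPoint)
    (hg : ∀ q, q.toEdgePoint = p → (g q).toEdgePoint = p' ∧ g (g q) = q ∧ o (g q) = !o q)
    (hg' : ∀ q, q.toEdgePoint = p' → (g q).toEdgePoint = p ∧ g (g q) = q) (t : Bool) :
    count o t p = count o (!t) p' := by
  classical
  unfold count
  refine card_bij' (fun q _ => g q) (fun q _ => g q) ?_ ?_ ?_ ?_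
  · intro q hq
    simp only [mem_filter, mem_univ, true_and] at hq ⊢
    exact ⟨(hg q hq.1).1, by rw [(hg q hq.1).2.2, hq.2]⟩
  · intro q hq
    simp only [mem_filter, mem_univ, true_and] at hq ⊢
    have h1 := hg' q hq.1
    refine ⟨h1.1, ?_⟩
    have h2 := (hg _ h1.1).2.2
    rw [h1.2, hq.2] at h2
    simpa using h2.symm
  · intro q hq
    simp only [mem_filter, mem_univ, true_and] at hq
    exact (hg q hq.1).2.1
  · intro q hq
    simp only [mem_filter, mem_univ, true_and] at hq
    exact (hg' q hq.1).2

theorem isFlow_count {o : T.StrandPoint → Bool} (ho : (T.strandWiring σ).Coloring o) :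
    T.IsFlow (count o true) := by
  have hs := coloring_segment ho
  constructor
  · intro p
    rw [← count_add o p, add_comm, Nat.add_left_cancel_iff]
    refine (count_of_equiv (T.segmentWiring σ).a ?_ ?_ false).symm
    · rintro q rfl
      exact ⟨rfl, Wiring.a_a _ q, hs.a q⟩
    · intro q hq
      refine ⟨?_, Wiring.a_a _ q⟩
      rw [toEdgePoint_a, hq, Wiring.a_a]
  · intro p hp
    rw [← count_add o p, add_comm, Nat.add_left_cancel_iff]
    refine (count_of_equiv (T.segmentWiring σ).b ?_ ?_ false).symm
    · rintro q rfl
      refine ⟨toEdgePoint_b q, Wiring.b_b _ q, hs.b q fun h => hp ?_⟩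
      rw [← toEdgePoint_b (σ := σ), h]
    · intro q hq
      refine ⟨?_, Wiring.b_b _ q⟩
      rw [toEdgePoint_b, hq, Wiring.b_b]

theorem downs_count (o : T.StrandPoint → Bool) (p : T.EdgePoint) :
    downs (count o true) p = count o (decide (p.1.1 % 2 = 1)) p := by
  have := count_add o p
  unfold downs
  split_ifs with h <;> simp [h]
  omega

theorem corner_line (v : T.Vertex) : (cornerPt v 0).1.1 = (cornerPt v 1).1.1 ∧
    (cornerPt v 2).1.1 % 2 ≠ (cornerPt v 0).1.1 % 2 ∧ (cornerPt v 1).1.2 = (cornerPt v 0).1.2 + 1 := by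
  obtain ⟨t, a, b, c, hs⟩ := v.slice.exists_vertex v.isVertex
  have h : ∀ k, (cornerPt v k).1 = position v.layer
      (![(t, v.slice.left.length), (t, v.slice.left.length + 1), (!t, v.slice.left.length)] k) := by
    intro k
    rw [← v.slice.corner_eq hs]
    rfl
  rw [h, h, h]
  cases t <;> simp [position] <;> omega

/-- A strand turns along a cup or cap of its edge, or at a vertex between the two edges on the same
side, which are the corners `0` and `1`. -/
theorem turnL_iff (q : T.StrandPoint) : (T.strandDrawing σ).TurnL q ↔
    EdgeTurn q.toEdgePoint ∨ ∃ v, q.toEdgePoint = cornerPt v 0 ∧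
      ((T.strandWiring σ).b q).toEdgePoint = cornerPt v 1 := by
  have hb : (T.strandDrawing σ).b q = (T.strandWiring σ).b q := rfl
  have hline : ∀ q, (T.strandDrawing σ).line q = q.toEdgePoint.1.1 := fun q => rfl
  have hlt : ∀ q r, (T.strandDrawing σ).lt q r ↔ (q.toEdgePoint.1.2 < r.toEdgePoint.1.2 ∨
    (q.toEdgePoint.1.2 = r.toEdgePoint.1.2 ∧ q.1.2.2 < r.1.2.2)) := fun q r => Iff.rfl
  unfold Drawing.TurnL
  rw [hb, hline, hline, hlt]
  by_cases hc : ∃ v c, cornerPt v c = q.toEdgePoint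
  · obtain ⟨v, c, hvc⟩ := hc
    obtain ⟨c', hne, hc'⟩ := exists_corner_b (σ := σ) hvc.symm
    have h1 : ¬ EdgeTurn q.toEdgePoint := fun h =>
      h.1 ((edge_end_iff _).2 ⟨.inl (v, c), hvc⟩)
    have h2 : (T.strandWiring σ).b q ≠ q := by
      intro h
      rw [h, ← hvc] at hc'
      exact hne (cornerPt_injective hc').2.symm
    obtain ⟨l1, l2, l3⟩ := corner_line v
    have h3 : (∃ w, q.toEdgePoint = cornerPt w 0 ∧
        ((T.strandWiring σ).b q).toEdgePoint = cornerPt w 1) ↔ c = 0 ∧ c' = 1 := by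
      constructor
      · rintro ⟨w, h, h'⟩
        exact ⟨(cornerPt_injective (hvc.trans h)).2, (cornerPt_injective (hc'.symm.trans h')).2⟩
      · rintro ⟨rfl, rfl⟩
        exact ⟨v, hvc.symm, hc'⟩
    rw [or_iff_right h1, h3, hc', ← hvc]
    simp only [ne_eq, h2, not_false_eq_true, true_and]
    have h4 : ∀ k : Fin 3, k = 0 ∨ k = 1 ∨ k = 2 := by decide
    by_cases h01 : c = 0 ∧ c' = 1
    · obtain ⟨rfl, rfl⟩ := h01
      exact ⟨fun _ => ⟨rfl, rfl⟩, fun _ => ⟨l1.symm, .inl (by omega)⟩⟩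
    · refine ⟨fun ⟨hl, hp⟩ => ?_, fun h => absurd h h01⟩
      exfalso
      rcases h4 c with rfl | rfl | rfl <;> rcases h4 c' with rfl | rfl | rfl <;>
        first | exact hne rfl | exact h01 ⟨rfl, rfl⟩ | omega
  · push Not at hc
    have h1 : ¬ ∃ w, q.toEdgePoint = cornerPt w 0 ∧
        ((T.strandWiring σ).b q).toEdgePoint = cornerPt w 1 := by
      rintro ⟨w, h, -⟩
      exact hc w 0 h.symm
    rw [or_iff_left h1, strand_b_eq q hc, toEdgePoint_b]
    have h2 : (T.segmentWiring σ).b q = q ↔ T.edgeWiring.b q.toEdgePoint = q.toEdgePoint := by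
      rw [segment_end_iff, edge_end_iff]
    unfold EdgeTurn
    rw [ne_eq, h2]
    refine and_congr_right fun hne => and_congr_right fun hl => ?_
    rcases (edge_line_b hne).2 with h | h
    · omega
    · exact absurd (by rw [hl]) h

open Classical in
/-- The number of strands that turn back at a vertex whose left end is directed downwards. -/
noncomputable def vertexDowns (T : SpinNet A B) (σ : T.Expansion) (o : T.StrandPoint → Bool)
    (v : T.Vertex) : ℕ :=
  (univ.filter fun q : T.StrandPoint => (q.toEdgePoint = cornerPt v 0 ∧
    ((T.strandWiring σ).b q).toEdgePoint = cornerPt v 1) ∧ (T.strandDrawing σ).down o q = true).card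

/-- This separates the part of the sign that depends only on the flow of the orientation from the
strands that turn back at vertices. -/
theorem downTurns_split (o : T.StrandPoint → Bool) : (T.strandDrawing σ).downTurns o =
    turnDowns (count o true) + ∑ v, T.vertexDowns σ o v := by
  classical
  have h1 : turnDowns (count o true) = (univ.filter fun q : T.StrandPoint =>
      EdgeTurn q.toEdgePoint ∧ (T.strandDrawing σ).down o q = true).card := by
    rw [card_eq_sum_card_fiberwise (f := StrandPoint.toEdgePoint)
      (t := univ.filter (EdgeTurn (T := T)))]
    · unfold turnDowns
      refine sum_congr rfl fun p hp => ?_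
      simp only [mem_filter, mem_univ, true_and] at hp
      rw [downs_count, count, filter_filter]
      congr 1
      refine filter_congr fun q _ => ?_
      constructor
      · rintro ⟨rfl, h⟩
        refine ⟨⟨hp, ?_⟩, rfl⟩
        rw [Drawing.down, h]
        exact beq_self_eq_true _
      · rintro ⟨⟨-, h⟩, rfl⟩
        exact ⟨rfl, (by simpa [Drawing.down] using h :
          o q = decide ((T.strandDrawing σ).line q % 2 = 1))⟩
    · intro q hq
      simp only [coe_filter, mem_univ, true_and, Set.mem_ofPred_eq] at hq ⊢
      exact hq.1
  have h2 : ∑ v, T.vertexDowns σ o v = (univ.filter fun q : T.StrandPoint =>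
      (∃ v, q.toEdgePoint = cornerPt v 0 ∧ ((T.strandWiring σ).b q).toEdgePoint = cornerPt v 1) ∧
        (T.strandDrawing σ).down o q = true).card := by
    rw [filter_congr (q := fun q => q ∈ univ.biUnion fun v : T.Vertex =>
      univ.filter fun q : T.StrandPoint => (q.toEdgePoint = cornerPt v 0 ∧
        ((T.strandWiring σ).b q).toEdgePoint = cornerPt v 1) ∧ (T.strandDrawing σ).down o q = true)
      (fun q _ => by simp)]
    rw [filter_mem_eq_inter, univ_inter, card_biUnion]
    · rfl
    · intro v _ w _ hvw
      rw [Function.onFun, disjoint_left]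
      intro q hq hq'
      simp only [mem_filter, mem_univ, true_and] at hq hq'
      exact hvw (cornerPt_injective (hq.1.1.symm.trans hq'.1.1)).1
  rw [h1, h2, ← card_union_of_disjoint]
  · unfold Drawing.downTurns
    congr 1
    ext q
    simp only [mem_filter, mem_union, mem_univ, true_and, turnL_iff]
    tauto
  · rw [disjoint_left]
    intro q hq hq'
    simp only [mem_filter, mem_univ, true_and] at hq hq'
    obtain ⟨⟨v, h, -⟩, -⟩ := hq'
    exact hq.1.1 ((edge_end_iff _).2 ⟨.inl (v, 0), h.symm⟩)

end SpinNet

end Spin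

namespace Spin

open Finset SpinNet

/-! ### Signs -/

/-- The sign with a given parity. -/
def sgn (x : ZMod 2) : ℂ := if x = 0 then 1 else -1

theorem sgn_zero : sgn 0 = 1 := if_pos rfl

theorem sgn_one : sgn 1 = -1 := if_neg (by decide)

theorem sgn_add (x y : ZMod 2) : sgn (x + y) = sgn x * sgn y := by
  have h : ∀ x : ZMod 2, x = 0 ∨ x = 1 := by decide
  rcases h x with rfl | rfl <;> rcases h y with rfl | rfl <;> simp [sgn_zero, sgn_one]
  exact sgn_zero

theorem sgn_mul_self (x : ZMod 2) : sgn x * sgn x = 1 := by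
  rw [← sgn_add, show x + x = 0 by revert x; decide, sgn_zero]

theorem sgn_natCast (n : ℕ) : sgn n = (-1) ^ n := by
  induction n with
  | zero => simp [sgn_zero]
  | succ n ih => rw [Nat.cast_succ, sgn_add, ih, pow_succ, sgn_one]

theorem sgn_sum {ι : Type*} (s : Finset ι) (f : ι → ZMod 2) :
    sgn (∑ i ∈ s, f i) = ∏ i ∈ s, sgn (f i) := by
  classical
  induction s using Finset.induction_on with
  | empty => simp [sgn_zero]
  | insert a s ha ih => rw [sum_insert ha, prod_insert ha, sgn_add, ih]

/-! ### The symmetric amplitude of a vertex -/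

/-- The signed number of ways to direct the strands at a vertex, when `z c` of them run between the
corners `c` and `c + 1`, and `G c` of them have to be directed outwards at the corner `c`. -/
def vertexSum (z G : Fin 3 → ℕ) : ℂ :=
  ∑ f ∈ Fintype.piFinset fun c => range (z c + 1),
    if ∀ c, G (c + 1) + f (c + 1) = f c + z (c + 1) then
      (-1) ^ (∑ c, f c) * ∏ c, ((z c).choose (f c) : ℂ) else 0

/-- The three conditions on `f` add up to `∑ G = ∑ z`: each strand through the vertex leaves it at
one corner. -/
theorem vertexSum_eq_zero {z G : Fin 3 → ℕ} (h : ∑ c, G c ≠ ∑ c, z c) : vertexSum z G = 0 := by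
  refine sum_eq_zero fun f _ => if_neg fun hf => h ?_
  have h0 := hf 0
  have h1 := hf 1
  have h2 := hf 2
  simp only [Fin.sum_univ_three]
  simp only [Fin.isValue, zero_add, show (1 + 1 : Fin 3) = 2 from rfl,
    show (2 + 1 : Fin 3) = 0 from rfl] at h0 h1 h2
  omega

theorem vertexSum_rotate (z G : Fin 3 → ℕ) (e : Equiv.Perm (Fin 3)) (he : ∀ c, e (c + 1) = e c + 1) :
    vertexSum (fun c => z (e c)) (fun c => G (e c)) = vertexSum z G := by
  unfold vertexSum
  refine sum_bij' (fun f _ => fun c => f (e.symm c)) (fun f _ => fun c => f (e c)) ?_ ?_ ?_ ?_ ?_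
  · intro f hf
    simp only [Fintype.mem_piFinset] at hf ⊢
    intro c
    simpa using hf (e.symm c)
  · intro f hf
    simp only [Fintype.mem_piFinset] at hf ⊢
    intro c
    exact hf (e c)
  · intro f _
    simp
  · intro f _
    simp
  · intro f _
    have h1 : (∀ c, G (e (c + 1)) + f (c + 1) = f c + z (e (c + 1))) ↔
        ∀ c, G (c + 1) + f (e.symm (c + 1)) = f (e.symm c) + z (c + 1) := by
      constructor
      · intro h c
        have := h (e.symm c)
        simp only [he, Equiv.apply_symm_apply] at this
        rw [← this]
        congr 2
        rw [Equiv.symm_apply_eq, he, Equiv.apply_symm_apply]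
      · intro h c
        have := h (e c)
        rw [← he] at this
        simpa using this
    have h2 : ∑ c, f (e.symm c) = ∑ c, f c := Equiv.sum_comp e.symm f
    have h3 : ∏ c, ((z c).choose (f (e.symm c)) : ℂ) = ∏ c, ((z (e c)).choose (f c) : ℂ) := by
      rw [← Equiv.prod_comp e]
      simp
    simp only [h1, h2, h3]

/-- Under a reflection the strands that were directed from a corner to the next one are directed to
the previous one. So `f` is replaced by `z - f`, which keeps the binomial coefficients and changes
the sign by the parity of `∑ z`. -/
theorem vertexSum_reflect (z G : Fin 3 → ℕ) (e : Equiv.Perm (Fin 3)) (he : ∀ c, e (c + 1) + 1 = e c) :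
    vertexSum (fun c => z (e (c + 1))) (fun c => G (e c)) = (-1) ^ (∑ c, z c) * vertexSum z G := by
  unfold vertexSum
  rw [mul_sum]
  set d : Equiv.Perm (Fin 3) := (Equiv.addRight 1).trans e with hd
  have hdc : ∀ c, d c = e (c + 1) := fun c => rfl
  have hde : ∀ c, d (c + 1) + 1 = d c := fun c => he (c + 1)
  have hsymm : ∀ c, d.symm (c + 1) + 1 = d.symm c := by
    intro c
    rw [eq_comm, Equiv.symm_apply_eq]
    have := hde (d.symm (c + 1))
    rw [Equiv.apply_symm_apply] at this
    exact (add_right_cancel this).symm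
  refine sum_bij' (fun f _ => fun c => z c - f (d.symm c)) (fun f _ => fun c => z (d c) - f (d c))
    ?_ ?_ ?_ ?_ ?_
  · intro f hf
    simp only [Fintype.mem_piFinset, mem_range] at hf ⊢
    intro c
    omega
  · intro f hf
    simp only [Fintype.mem_piFinset, mem_range] at hf ⊢
    intro c
    rw [← hdc]
    omega
  · intro f hf
    simp only [Fintype.mem_piFinset, mem_range] at hf
    funext c
    have := hf c
    rw [← hdc] at this
    simp only [Equiv.symm_apply_apply]
    omega
  · intro f hf
    simp only [Fintype.mem_piFinset, mem_range] at hf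
    funext c
    have := hf c
    simp only [Equiv.apply_symm_apply]
    omega
  · intro f hf
    simp only [Fintype.mem_piFinset, mem_range] at hf
    have hle : ∀ c, f (d.symm c) ≤ z c := by
      intro c
      have := hf (d.symm c)
      rw [← hdc, Equiv.apply_symm_apply] at this
      omega
    have h1 : (∀ c, G (e (c + 1)) + f (c + 1) = f c + z (e (c + 1 + 1))) ↔
        ∀ c, G (c + 1) + (z (c + 1) - f (d.symm (c + 1))) = z c - f (d.symm c) + z (c + 1) := by
      constructor
      · intro h c
        have h2 := h (d.symm (c + 1))
        have h3 : e (d.symm c) = c + 1 := by rw [← hsymm, ← hdc, Equiv.apply_symm_apply]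
        rw [hsymm, h3, ← hdc, Equiv.apply_symm_apply] at h2
        have := hle c
        have := hle (c + 1)
        omega
      · intro h c
        have h2 := h (d (c + 1))
        rw [hde, Equiv.symm_apply_apply, Equiv.symm_apply_apply] at h2
        rw [← hdc, ← hdc]
        have h3 := hle (d c)
        have h4 := hle (d (c + 1))
        rw [Equiv.symm_apply_apply] at h3 h4
        omega
    have h2 : (-1 : ℂ) ^ (∑ c, f c) =
        (-1) ^ (∑ c, z c) * (-1) ^ (∑ c, (z c - f (d.symm c))) := by
      rw [← pow_add, ← Equiv.sum_comp d.symm f, ← sum_add_distrib]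
      refine neg_one_pow_congr ?_
      have : ∑ c, (z c + (z c - f (d.symm c))) + ∑ c, f (d.symm c) = 2 * ∑ c, z c := by
        rw [← sum_add_distrib, mul_sum]
        refine sum_congr rfl fun c _ => ?_
        have := hle c
        omega
      rw [Nat.even_iff, Nat.even_iff]
      omega
    have h3 : ∏ c, ((z (e (c + 1))).choose (f c) : ℂ) =
        ∏ c, ((z c).choose (z c - f (d.symm c)) : ℂ) := by
      rw [← Equiv.prod_comp d.symm]
      refine prod_congr rfl fun c _ => ?_
      rw [← hdc, Equiv.apply_symm_apply, Nat.choose_symm (hle c)]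
    simp only [h1, h2, h3]
    split_ifs
    · ring
    · simp

/-- The number of strands that run between the corners `c` and `c + 1` of a vertex. -/
def thruAt (n : Fin 3 → ℕ) (c : Fin 3) : ℕ := thru (n (c + 2)) (n c) (n (c + 1))

theorem perm_three (e : Equiv.Perm (Fin 3)) :
    (∀ c, e (c + 1) = e c + 1) ∨ ∀ c, e (c + 1) + 1 = e c := by
  revert e
  decide

theorem thruAt_rotate {e : Equiv.Perm (Fin 3)} (he : ∀ c, e (c + 1) = e c + 1) {n n' : Fin 3 → ℕ}
    (hn : ∀ c, n' (e c) = n c) (c : Fin 3) : thruAt n' (e c) = thruAt n c := by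
  unfold thruAt
  rw [show e c + 2 = e c + 1 + 1 by rw [add_assoc]; rfl, ← he, ← he, hn, hn, hn, add_assoc]
  rfl

theorem thruAt_reflect {e : Equiv.Perm (Fin 3)} (he : ∀ c, e (c + 1) + 1 = e c) {n n' : Fin 3 → ℕ}
    (hn : ∀ c, n' (e c) = n c) (c : Fin 3) : thruAt n' (e (c + 1)) = thruAt n c := by
  have h4 := he (c + 2)
  rw [show c + 2 + 1 = c by rw [add_assoc]; exact add_zero c] at h4
  unfold thruAt
  rw [he, show e (c + 1) + 2 = e (c + 2) by rw [← h4, ← he c, add_assoc]; rfl, hn, hn, hn, thru, thru,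
    Nat.add_comm (n c)]

/-- The amplitude of a vertex, relative to a state with `f c c'` strands from the corner `c` to the
corner `c'`, does not depend on the numbering of the corners. -/
theorem vertexSum_symm (e : Equiv.Perm (Fin 3)) {n n' G G' : Fin 3 → ℕ} {f f' : Fin 3 → Fin 3 → ℕ}
    (hn : ∀ c, n' (e c) = n c) (hG : ∀ c, G' (e c) = G c) (hf : ∀ c c', f' (e c) (e c') = f c c')
    (hz : ∀ c, f c (c + 1) + f (c + 1) c = thruAt n c) :
    vertexSum (thruAt n) G * (-1) ^ (∑ c, f c (c + 1)) =
      vertexSum (thruAt n') G' * (-1) ^ (∑ c, f' c (c + 1)) := by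
  obtain rfl : n = fun c => n' (e c) := funext fun c => (hn c).symm
  obtain rfl : G = fun c => G' (e c) := funext fun c => (hG c).symm
  rcases perm_three e with he | he
  · have h1 : thruAt (fun c => n' (e c)) = fun c => thruAt n' (e c) :=
      funext fun c => (thruAt_rotate he (fun _ => rfl) c).symm
    rw [h1, vertexSum_rotate _ _ e he, ← Equiv.sum_comp e fun c => f' c (c + 1)]
    simp only [← he, hf]
  · have h1 : thruAt (fun c => n' (e c)) = fun c => thruAt n' (e (c + 1)) :=
      funext fun c => (thruAt_reflect he (fun _ => rfl) c).symm
    -- For a reflection, `f'` counts in cyclic order the strands that run against those counted by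
    -- `f`. Together they are all the strands, so the sign of the reference state changes exactly as
    -- the sum does.
    have h5 : (-1 : ℂ) ^ (∑ c, f c (c + 1)) =
        (-1) ^ (∑ c, thruAt n' c) * (-1) ^ (∑ c, f' c (c + 1)) := by
      rw [← pow_add]
      refine neg_one_pow_congr ?_
      have h6 : ∑ c, f' c (c + 1) = ∑ c, f (c + 1) c := by
        rw [← Equiv.sum_comp ((Equiv.addRight 1).trans e) fun c => f' c (c + 1)]
        refine sum_congr rfl fun c _ => ?_
        change f' (e (c + 1)) (e (c + 1) + 1) = _
        rw [he, hf]
      have h7 : ∑ c, thruAt n' c = ∑ c, (f c (c + 1) + f (c + 1) c) := by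
        rw [← Equiv.sum_comp ((Equiv.addRight 1).trans e) (thruAt n')]
        refine sum_congr rfl fun c _ => ?_
        rw [hz, h1]
        rfl
      rw [h6, h7, sum_add_distrib, Nat.even_iff, Nat.even_iff]
      omega
    have h6 : (-1 : ℂ) ^ (∑ c, thruAt n' c) * (-1) ^ (∑ c, thruAt n' c) = 1 := by
      rw [← mul_pow]; simp
    rw [h1, vertexSum_reflect _ _ e he, h5]
    linear_combination (vertexSum (thruAt n') G' * (-1) ^ (∑ c, f' c (c + 1))) * h6

/-- The norm of a vector in the basis of weight vectors of a symmetric power. -/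
noncomputable def rt (n m : ℕ) : ℂ := (Real.sqrt (n.choose m) : ℝ)

theorem rt_mul_self (n m : ℕ) : rt n m * rt n m = n.choose m := by
  unfold rt
  rw [← Complex.ofReal_mul, Real.mul_self_sqrt (by positivity)]
  simp

theorem rt_ne_zero {n m : ℕ} (h : m ≤ n) : rt n m ≠ 0 := by
  intro h0
  have := rt_mul_self n m
  rw [h0, mul_zero, eq_comm, Nat.cast_eq_zero, Nat.choose_eq_zero_iff] at this
  omega

variable {A B : List ℕ}

namespace SpinNet

variable {T : SpinNet A B} {σ : T.Expansion}

open Classical in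
-- A strand through the vertex is counted at its other end instead, where it has the opposite
-- colour.
theorem thruCount_flip {o : T.StrandPoint → Bool} (ho : (T.strandWiring σ).Coloring o) (v : T.Vertex)
    {c c' : Fin 3} (hc : c ≠ c') : T.thruCount σ o v c c' =
      (univ.filter fun q : T.StrandPoint => q.toEdgePoint = cornerPt v c' ∧
        ((T.strandWiring σ).b q).toEdgePoint = cornerPt v c ∧ o q = true).card := by
  classical
  unfold thruCount
  have hne : ∀ {q : T.StrandPoint} {c c'}, c ≠ c' → q.toEdgePoint = cornerPt v c →
      ((T.strandWiring σ).b q).toEdgePoint = cornerPt v c' → (T.strandWiring σ).b q ≠ q := by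
    intro q c c' hc h1 h2 h3
    rw [h3, h1] at h2
    exact hc (cornerPt_injective h2).2
  refine card_bij' (fun q _ => (T.strandWiring σ).b q) (fun q _ => (T.strandWiring σ).b q) ?_ ?_ ?_ ?_
  · intro q hq
    simp only [mem_filter, mem_univ, true_and] at hq ⊢
    exact ⟨hq.2.1, by rw [Wiring.b_b]; exact hq.1, by
      rw [ho.b q (hne hc hq.1 hq.2.1), hq.2.2]; rfl⟩
  · intro q hq
    simp only [mem_filter, mem_univ, true_and] at hq ⊢
    exact ⟨hq.2.1, by rw [Wiring.b_b]; exact hq.1, by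
      rw [ho.b q (hne hc.symm hq.1 hq.2.1), hq.2.2]; rfl⟩
  · intro q _
    exact Wiring.b_b _ q
  · intro q _
    exact Wiring.b_b _ q

open Classical in
theorem count_corner {o : T.StrandPoint → Bool} (v : T.Vertex) (c : Fin 3) (t : Bool) :
    count o t (cornerPt v c) =
      (univ.filter fun q : T.StrandPoint => q.toEdgePoint = cornerPt v c ∧
        ((T.strandWiring σ).b q).toEdgePoint = cornerPt v (c + 1) ∧ o q = t).card +
      (univ.filter fun q : T.StrandPoint => q.toEdgePoint = cornerPt v c ∧
        ((T.strandWiring σ).b q).toEdgePoint = cornerPt v (c + 2) ∧ o q = t).card := by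
  classical
  rw [← card_union_of_disjoint]
  · unfold count
    congr 1
    ext q
    simp only [mem_filter, mem_union, mem_univ, true_and]
    constructor
    · rintro ⟨h1, h2⟩
      obtain ⟨c', hc', h3⟩ := exists_corner_b (σ := σ) h1
      have : c' = c + 1 ∨ c' = c + 2 := by clear h1 h3; revert c c'; decide
      rcases this with rfl | rfl
      · exact .inl ⟨h1, h3, h2⟩
      · exact .inr ⟨h1, h3, h2⟩
    · tauto
  · rw [disjoint_left]
    intro q hq hq'
    simp only [mem_filter, mem_univ, true_and] at hq hq'
    have := (cornerPt_injective (hq.2.1.symm.trans hq'.2.1)).2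
    exact absurd this ((by decide : ∀ c : Fin 3, c + 1 ≠ c + 2) c)

theorem count_corner_true {o : T.StrandPoint → Bool} (ho : (T.strandWiring σ).Coloring o)
    (v : T.Vertex) (c : Fin 3) : count o true (cornerPt v (c + 1)) =
      T.thruCount σ o v c (c + 1) + T.thruCount σ o v (c + 1 + 1) (c + 1) := by
  have h2 : c + 1 + 2 = c := by revert c; decide
  rw [count_corner (σ := σ), h2, add_comm]
  rw [thruCount_flip ho v (by revert c; decide), thruCount_flip ho v (by revert c; decide)]

theorem count_corner_false (o : T.StrandPoint → Bool) (σ : T.Expansion)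
    (v : T.Vertex) (c : Fin 3) : count o false (cornerPt v (c + 1)) =
      T.thruCount σ o v (c + 1) c + T.thruCount σ o v (c + 1) (c + 1 + 1) := by
  have h2 : c + 1 + 2 = c := by revert c; decide
  rw [count_corner (σ := σ), h2, add_comm]
  rfl

/-- The labels of the edges at a vertex. -/
def cornerLabel (v : T.Vertex) (c : Fin 3) : ℕ := T.label (cornerPt v c).1

/-- Each label is the sum of the two bundles that meet at the corner. The three linear equations
determine the bundles. -/
theorem thruCount_add {o : T.StrandPoint → Bool} (ho : (T.strandWiring σ).Coloring o) (v : T.Vertex)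
    (c : Fin 3) : T.thruCount σ o v c (c + 1) + T.thruCount σ o v (c + 1) c =
      thruAt (cornerLabel v) c := by
  have h : ∀ c, cornerLabel v (c + 1) =
      T.thruCount σ o v c (c + 1) + T.thruCount σ o v (c + 1 + 1) (c + 1) +
        (T.thruCount σ o v (c + 1) c + T.thruCount σ o v (c + 1) (c + 1 + 1)) := by
    intro c
    rw [← count_corner_true ho, ← count_corner_false, count_add]
    rfl
  have e1 : ∀ c : Fin 3, c + 1 + 1 = c + 2 := by decide
  have e2 : ∀ c : Fin 3, c + 2 + 1 = c := by decide
  have h0 := h c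
  have h1 := h (c + 1)
  have h2 := h (c + 2)
  simp only [e1, e2] at h0 h1 h2
  unfold thruAt thru
  omega

/-- If the corner `0` is on an odd line, the vertex lies above it, and running downwards there means
leaving the vertex, that is, coming from the corner `1`. On an even line it means entering the
vertex. -/
theorem vertexDowns_eq {o : T.StrandPoint → Bool} (ho : (T.strandWiring σ).Coloring o)
    (v : T.Vertex) : T.vertexDowns σ o v = if (cornerPt v 0).1.1 % 2 = 1 then
      T.thruCount σ o v 1 0 else T.thruCount σ o v 0 1 := by
  classical
  have h : ∀ q : T.StrandPoint, q.toEdgePoint = cornerPt v 0 →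
      ((T.strandDrawing σ).down o q = true ↔ o q = decide ((cornerPt v 0).1.1 % 2 = 1)) := by
    intro q hq
    rw [← hq, Drawing.down]
    exact beq_iff_eq
  have h2 : T.vertexDowns σ o v = (univ.filter fun q : T.StrandPoint =>
      q.toEdgePoint = cornerPt v 0 ∧ ((T.strandWiring σ).b q).toEdgePoint = cornerPt v 1 ∧
        o q = decide ((cornerPt v 0).1.1 % 2 = 1)).card := by
    unfold vertexDowns
    congr 1
    refine filter_congr fun q _ => ?_
    rw [and_assoc]
    exact and_congr_right fun hq => and_congr_right fun _ => h q hq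
  rw [h2]
  split_ifs with h3
  · rw [thruCount_flip ho v (by decide)]
    congr 1
    refine filter_congr fun q _ => ?_
    rw [decide_eq_true h3]
  · unfold thruCount
    congr 1
    refine filter_congr fun q _ => ?_
    rw [decide_eq_false h3]

/-- The parity that distinguishes the amplitude of a vertex in the drawing from the symmetric one. -/
def vertexParity (v : T.Vertex) (G : T.EdgePoint → ℕ) : ZMod 2 :=
  G (cornerPt v 2) + thruAt (cornerLabel v) 2 +
    if (cornerPt v 0).1.1 % 2 = 1 then (thruAt (cornerLabel v) 0 : ZMod 2) else 0

/-- All parities that depend on the way the vertex is drawn are collected: that of the amplitude,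
that of the reference strands that turn back, and the odd-line terms of `turnDowns_eq`. They add up
to the number of reference strands in the cyclic direction, whichever side the two edges are on. If
they are below, the balance `hG` of the flow at the vertex is needed. -/
theorem vertexParity_eq {o : T.StrandPoint → Bool} (ho : (T.strandWiring σ).Coloring o)
    (v : T.Vertex) {G : T.EdgePoint → ℕ}
    (hG : ∑ c, G (cornerPt v c) = ∑ c, thruAt (cornerLabel v) c) :
    vertexParity v G + T.vertexDowns σ o v + (∑ c : Fin 3, if (cornerPt v c).1.1 % 2 = 1 then
      (G (cornerPt v c) + count o true (cornerPt v c) : ZMod 2) else 0) =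
        ((∑ c, T.thruCount σ o v c (c + 1) : ℕ) : ZMod 2) := by
  obtain ⟨l1, l2, -⟩ := corner_line v
  have z := thruCount_add ho v
  have z0 := z 0
  have z1 := z 1
  have z2 := z 2
  have g := count_corner_true ho v
  have g0 := g 0
  have g1 := g 1
  have g2 := g 2
  have e1 : (1 + 1 : Fin 3) = 2 := rfl
  have e2 : (2 + 1 : Fin 3) = 0 := rfl
  have e0 : (0 + 1 : Fin 3) = 1 := rfl
  simp only [Fin.sum_univ_three, vertexParity, vertexDowns_eq ho, ← l1, e0, e1, e2] at *
  have hG' := congrArg (fun n : ℕ => (n : ZMod 2)) hG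
  simp only [← z0, ← z1, ← z2, g0, g1, g2] at hG' ⊢
  push_cast at hG' ⊢
  generalize (T.thruCount σ o v 0 1 : ZMod 2) = f0 at *
  generalize (T.thruCount σ o v 1 0 : ZMod 2) = h0 at *
  generalize (T.thruCount σ o v 1 2 : ZMod 2) = f1 at *
  generalize (T.thruCount σ o v 2 1 : ZMod 2) = h1 at *
  generalize (T.thruCount σ o v 2 0 : ZMod 2) = f2 at *
  generalize (T.thruCount σ o v 0 2 : ZMod 2) = h2 at *
  generalize (G (cornerPt v 0) : ZMod 2) = x0 at *
  generalize (G (cornerPt v 1) : ZMod 2) = x1 at *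
  generalize (G (cornerPt v 2) : ZMod 2) = x2 at *
  have two : (2 : ZMod 2) = 0 := rfl
  split_ifs with h3 h4 h4
  · omega
  · linear_combination hG' + (2 * h0 + h2 + h1 + f2 + f0) * two
  · linear_combination (x2 + h2) * two
  · omega

/-- The amplitude of a vertex. -/
noncomputable def vertexAmp (v : T.Vertex) (G : T.EdgePoint → ℕ) : ℂ :=
  sgn (vertexParity v G) * vertexSum (thruAt (cornerLabel v)) (fun c => G (cornerPt v c)) /
    ∏ c, rt (cornerLabel v c) (G (cornerPt v c))

/-- The amplitude of a flow. -/
noncomputable def flowAmp (G : T.EdgePoint → ℕ) : ℂ :=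
  sgn (turnDowns G) * ∏ v : T.Vertex, vertexAmp v G

/-- The drawing drops out here: on the right there are only quantities at the ends of edges and at
vertices, relative to the reference orientation `o`. The cups and caps of edges are removed by
`turnDowns_eq`, the turns at vertices by `vertexParity_eq`. -/
theorem flowAmp_mul {o : T.StrandPoint → Bool} (ho : (T.strandWiring σ).Coloring o)
    {e : T.EdgePoint → Bool} (he : T.edgeWiring.Coloring e) {G : T.EdgePoint → ℕ} (hG : T.IsFlow G) :
    flowAmp G * sgn ((T.strandDrawing σ).downTurns o) =
      sgn (((((∑ v : T.Vertex, ∑ c : Fin 3, flowDiff e G (count o true) (cornerPt v c)) +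
        (∑ j, flowDiff e G (count o true) (bottomPt j) +
          ∑ j, flowDiff e G (count o true) (topPt j))) / 2 : ℤ)) : ZMod 2) *
      sgn (∑ j : Fin B.length, (G (topPt (T := T) j) + count o true (topPt (T := T) j) : ZMod 2)) *
      ∏ v : T.Vertex, (vertexSum (thruAt (cornerLabel v)) (fun c => G (cornerPt v c)) *
        (-1) ^ (∑ c, T.thruCount σ o v c (c + 1)) /
          ∏ c, rt (cornerLabel v c) (G (cornerPt v c))) := by
  have h1 := turnDowns_eq he hG (isFlow_count ho)
  rw [downTurns_split, Nat.cast_add, sgn_add, flowAmp]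
  have h2 : sgn (turnDowns G) * sgn (turnDowns (count o true)) =
      sgn (turnDowns G + turnDowns (count o true)) := (sgn_add _ _).symm
  rw [h1, sgn_add, sgn_add, sgn_sum univ (fun v : T.Vertex => _)] at h2
  have h3 : ∏ v : T.Vertex, (vertexSum (thruAt (cornerLabel v)) (fun c => G (cornerPt v c)) *
        (-1) ^ (∑ c, T.thruCount σ o v c (c + 1)) /
          ∏ c, rt (cornerLabel v c) (G (cornerPt v c))) =
      (∏ v : T.Vertex, vertexAmp v G) * sgn ((∑ v, T.vertexDowns σ o v : ℕ) : ZMod 2) *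
        ∏ v : T.Vertex, sgn (∑ c : Fin 3, if (cornerPt v c).1.1 % 2 = 1 then
          (G (cornerPt v c) + count o true (cornerPt v c) : ZMod 2) else 0) := by
    rw [Nat.cast_sum, sgn_sum, ← prod_mul_distrib, ← prod_mul_distrib]
    refine prod_congr rfl fun v _ => ?_
    -- At a vertex where the flow is not balanced the parities are not related, but both factors
    -- vanish.
    by_cases hv : ∑ c, G (cornerPt v c) = ∑ c, thruAt (cornerLabel v) c
    · have h4 := vertexParity_eq ho v hv
      rw [← sgn_natCast, ← h4, sgn_add, sgn_add, vertexAmp]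
      ring
    · rw [vertexAmp, vertexSum_eq_zero hv]
      simp
  rw [h3]
  linear_combination ((∏ v : T.Vertex, vertexAmp v G) *
    sgn ((∑ v, T.vertexDowns σ o v : ℕ) : ZMod 2)) * h2

end SpinNet

end Spin

/-! ### Invariance of the amplitude of a flow -/

namespace Spin

open Finset SpinNet

variable {A B : List ℕ} {T₁ T₂ : SpinNet A B} {φ : TopEquiv T₁ T₂} {σ₁ : T₁.Expansion}
  {σ₂ : T₂.Expansion}

namespace TopEquiv.Lift

/-- Matching strands by `Corr` is injective and gives an inequality for each of the two colours.
Both counts add up to the same label, so the inequalities are equalities. -/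
theorem count_eq (Λ : φ.Lift σ₁ σ₂) {o₁ : T₁.StrandPoint → Bool} {o₂ : T₂.StrandPoint → Bool}
    (h : ∀ x q r, Λ.Corr x q r → o₂ r = o₁ q) (x : T₁.EndIdx) :
    count o₂ true (endPt (φ.ends x)) = count o₁ true (endPt x) := by
  classical
  have hle : ∀ t, count o₁ t (endPt x) ≤ count o₂ t (endPt (φ.ends x)) := by
    intro t
    have hex : ∀ q : {q : T₁.StrandPoint // q.toEdgePoint = endPt x}, ∃ r, Λ.Corr x q.1 r :=
      fun q => Λ.exists_corr q.2
    choose f hf using hex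
    unfold count
    refine card_le_card_of_forall_subsingleton (fun q r => Λ.Corr x q r) ?_ ?_
    · intro q hq
      simp only [mem_filter, mem_univ, true_and] at hq
      have := hf ⟨q, hq.1⟩
      refine ⟨f ⟨q, hq.1⟩, ?_, this⟩
      simp only [mem_filter, mem_univ, true_and]
      exact ⟨this.2.1, by rw [h _ _ _ this, hq.2]⟩
    · intro r _ q hq q' hq'
      exact Corr.unique_left Λ hq.2 hq'.2
  have h1 := hle true
  have h2 := hle false
  have h3 := count_add o₁ (endPt x)
  have h4 := count_add o₂ (endPt (φ.ends x))
  have h5 := φ.label_ends x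
  omega

/-- Corresponding flows have the same amplitudes up to the sign of the expansions. -/
theorem flowAmp_eq (Λ : φ.Lift σ₁ σ₂) {e₁ : T₁.EdgePoint → Bool} {e₂ : T₂.EdgePoint → Bool}
    (he₁ : T₁.edgeWiring.Coloring e₁) (he₂ : T₂.edgeWiring.Coloring e₂)
    (hee : ∀ x, e₂ (endPt (φ.ends x)) = e₁ (endPt x)) {G₁ : T₁.EdgePoint → ℕ}
    {G₂ : T₂.EdgePoint → ℕ} (hG₁ : T₁.IsFlow G₁) (hG₂ : T₂.IsFlow G₂)
    (hG : ∀ x, G₂ (endPt (φ.ends x)) = G₁ (endPt x)) :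
    flowAmp G₁ * sgn (T₁.kinks σ₁ + T₁.crossedExtrema σ₁) =
      flowAmp G₂ * sgn (T₂.kinks σ₂ + T₂.crossedExtrema σ₂) := by
  obtain ⟨o₁, ho₁⟩ := (T₁.strandWiring σ₁).exists_coloring
  obtain ⟨o₂, ho₂, hoo⟩ := Λ.exists_transport ho₁ he₁ he₂ hee
  have a₁ := flowAmp_mul ho₁ he₁ hG₁
  have a₂ := flowAmp_mul ho₂ he₂ hG₂
  have d₁ := T₁.downTurns_eq ho₁
  have d₂ := T₂.downTurns_eq ho₂
  have hP := Λ.allEndPairs_eq hoo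
  have hcount := Λ.count_eq hoo
  have hH : ∀ x, flowDiff e₂ G₂ (count o₂ true) (endPt (φ.ends x)) =
      flowDiff e₁ G₁ (count o₁ true) (endPt x) := by
    intro x
    unfold flowDiff
    rw [hee, hG, hcount]
  have hlab : ∀ v c, cornerLabel (φ.vertex v) (φ.corner v c) = cornerLabel v c :=
    fun v c => (φ.label_ends (.inl (v, c))).symm
  have hGc : ∀ v c, G₂ (cornerPt (φ.vertex v) (φ.corner v c)) = G₁ (cornerPt v c) :=
    fun v c => hG (.inl (v, c))
  have b1 : ∑ v : T₁.Vertex, ∑ c : Fin 3, flowDiff e₁ G₁ (count o₁ true) (cornerPt v c) =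
      ∑ v : T₂.Vertex, ∑ c : Fin 3, flowDiff e₂ G₂ (count o₂ true) (cornerPt v c) := by
    refine Fintype.sum_equiv φ.vertex _ _ fun v => ?_
    exact Fintype.sum_equiv (φ.corner v) _ _ fun c => (hH (.inl (v, c))).symm
  have b2 : ∑ j, flowDiff e₁ G₁ (count o₁ true) (bottomPt j) =
      ∑ j, flowDiff e₂ G₂ (count o₂ true) (bottomPt j) :=
    sum_congr rfl fun j _ => (hH (.inr (.inl j))).symm
  have b3 : ∑ j, flowDiff e₁ G₁ (count o₁ true) (topPt j) =
      ∑ j, flowDiff e₂ G₂ (count o₂ true) (topPt j) :=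
    sum_congr rfl fun j _ => (hH (.inr (.inr j))).symm
  have b4 : ∑ j, (G₁ (topPt (T := T₁) j) + count o₁ true (topPt (T := T₁) j) : ZMod 2) =
      ∑ j, (G₂ (topPt (T := T₂) j) + count o₂ true (topPt (T := T₂) j) : ZMod 2) :=
    sum_congr rfl fun j _ => by
      have h1 := hG (.inr (.inr j))
      have h2 := hcount (.inr (.inr j))
      change G₂ (topPt j) = G₁ (topPt j) at h1
      change count o₂ true (topPt j) = count o₁ true (topPt j) at h2
      rw [h1, h2]
  have b5 : ∏ v : T₁.Vertex, (vertexSum (thruAt (cornerLabel v)) (fun c => G₁ (cornerPt v c)) *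
        (-1) ^ (∑ c, T₁.thruCount σ₁ o₁ v c (c + 1)) /
          ∏ c, rt (cornerLabel v c) (G₁ (cornerPt v c))) =
      ∏ v : T₂.Vertex, (vertexSum (thruAt (cornerLabel v)) (fun c => G₂ (cornerPt v c)) *
        (-1) ^ (∑ c, T₂.thruCount σ₂ o₂ v c (c + 1)) /
          ∏ c, rt (cornerLabel v c) (G₂ (cornerPt v c))) := by
    refine Fintype.prod_equiv φ.vertex _ _ fun v => ?_
    congr 1
    · refine vertexSum_symm (φ.corner v) (hlab v) (hGc v)
        (fun c c' => (Λ.thruCount_eq hoo v c c').symm) (thruCount_add ho₁ v)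
    · exact Fintype.prod_equiv (φ.corner v) _ _ fun c => by rw [hlab, hGc]
  -- The right sides of the two instances of `flowAmp_mul` agree. The signs of the references are
  -- replaced by Whitney's formula, and the common factor from the end pairs cancels.
  rw [b1, b2, b3, b4, b5, ← a₂, d₁, d₂, hP, sgn_add, sgn_add (T₂.kinks σ₂ + T₂.crossedExtrema σ₂)] at a₁
  have hs := sgn_mul_self ((T₂.strandDrawing σ₂).allEndPairs o₂)
  linear_combination sgn ((T₂.strandDrawing σ₂).allEndPairs o₂) * a₁ -
    (flowAmp G₁ * sgn (T₁.kinks σ₁ + T₁.crossedExtrema σ₁) -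
      flowAmp G₂ * sgn (T₂.kinks σ₂ + T₂.crossedExtrema σ₂)) * hs

end TopEquiv.Lift

end Spin

namespace Spin

open Finset

/-! ### Weights of words -/

/-- The number of letters `1`. -/
def ones {n : ℕ} (u : Fin n → Fin 2) : ℕ := ∑ i, (u i).val

theorem ones_eq_card {n : ℕ} (u : Fin n → Fin 2) : ones u = (univ.filter fun i => u i = 1).card := by
  rw [card_filter]
  refine sum_congr rfl fun i _ => ?_
  generalize u i = a
  revert a
  decide

theorem ones_le {n : ℕ} (u : Fin n → Fin 2) : ones u ≤ n := by
  rw [ones_eq_card]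
  exact (card_le_univ _).trans (by simp)

theorem card_ones (n k : ℕ) :
    (univ.filter fun u : Fin n → Fin 2 => ones u = k).card = n.choose k := by
  have h : (powersetCard k (univ : Finset (Fin n))).card = n.choose k := by
    rw [card_powersetCard, card_univ, Fintype.card_fin]
  rw [← h]
  refine card_bij' (fun u _ => univ.filter fun i => u i = 1) (fun s _ => fun i => if i ∈ s then 1 else 0)
    ?_ ?_ ?_ ?_
  · intro u hu
    simp only [mem_filter, mem_univ, true_and, ones_eq_card] at hu
    simpa [mem_powersetCard] using hu
  · intro s hs
    simp only [mem_powersetCard] at hs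
    simpa [ones_eq_card] using hs.2
  · intro u _
    funext i
    have : ∀ a : Fin 2, (if a = 1 then (1 : Fin 2) else 0) = a := by decide
    simpa using this (u i)
  · intro s _
    ext i
    simp

theorem sum_letters {ι : Type*} [Fintype ι] [DecidableEq ι] (n : ι → ℕ) (F : (ι → ℕ) → ℂ) :
    ∑ u : (b : ι) → Fin (n b) → Fin 2, F (fun b => ones (u b)) =
      ∑ t ∈ Fintype.piFinset fun b => range (n b + 1), (∏ b, ((n b).choose (t b) : ℂ)) * F t := by
  rw [← sum_fiberwise_of_maps_to (g := fun (u : (b : ι) → Fin (n b) → Fin 2) b => ones (u b))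
    (t := Fintype.piFinset fun b => range (n b + 1))]
  · refine sum_congr rfl fun t _ => ?_
    have h : (univ.filter fun u : (b : ι) → Fin (n b) → Fin 2 => (fun b => ones (u b)) = t) =
        Fintype.piFinset fun b => univ.filter fun u : Fin (n b) → Fin 2 => ones u = t b := by
      ext u
      simp [funext_iff]
    rw [sum_congr rfl (g := fun _ => F t), sum_const, h, Fintype.card_piFinset, nsmul_eq_mul]
    · simp only [card_ones]
      push_cast
      rfl
    · intro u hu
      simp only [mem_filter, mem_univ, true_and] at hu
      rw [hu]
  · intro u _
    simp only [Fintype.mem_piFinset, mem_range]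
    exact fun b => Nat.lt_succ_of_le (ones_le _)

/-- The weights of the words: the number of letters `1` on every edge. -/
abbrev Wt (A : List ℕ) : Type := (j : Fin A.length) → Fin (A[j] + 1)

variable {A : List ℕ}

/-- The weight of a word. -/
def Word.wt (x : Word A) : Wt A := fun j => ⟨ones (x j), Nat.lt_succ_of_le (ones_le _)⟩

/-- The norm of the sum of the words with a given weight. -/
noncomputable def norm (μ : Wt A) : ℂ := ∏ j, rt A[j] (μ j)

theorem norm_ne_zero (μ : Wt A) : norm μ ≠ 0 :=
  prod_ne_zero_iff.2 fun j _ => rt_ne_zero (Nat.le_of_lt_succ (μ j).2)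

theorem card_wt (μ : Wt A) : ((univ.filter fun x : Word A => x.wt = μ).card : ℂ) = norm μ * norm μ := by
  have h : (univ.filter fun x : Word A => x.wt = μ) =
      Fintype.piFinset fun j => univ.filter fun u : Fin A[j] → Fin 2 => ones u = μ j := by
    ext u
    simp [funext_iff, Word.wt, Fin.ext_iff]
  rw [h, Fintype.card_piFinset, norm, ← prod_mul_distrib]
  simp only [card_ones, rt_mul_self]
  push_cast
  rfl

theorem ones_comp {n : ℕ} (u : Fin n → Fin 2) (e : Equiv.Perm (Fin n)) : ones (fun i => u (e i)) = ones u :=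
  Equiv.sum_comp e fun i => (u i).val

theorem Word.wt_permute (σ : EdgePerm A) (x : Word A) : (x.permute σ).wt = x.wt := by
  funext j
  exact Fin.ext (ones_comp (x j) (σ j))

theorem exists_perm_of_ones_eq {n : ℕ} {u v : Fin n → Fin 2} (h : ones u = ones v) :
    ∃ e : Equiv.Perm (Fin n), ∀ i, u (e i) = v i := by
  rw [ones_eq_card, ones_eq_card] at h
  have hc : Fintype.card {i // v i = 1} = Fintype.card {i // u i = 1} := by
    rw [Fintype.card_subtype, Fintype.card_subtype, h]
  let e := (Fintype.equivOfCardEq hc)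
  refine ⟨e.extendSubtype, fun i => ?_⟩
  have hb : ∀ a : Fin 2, a ≠ 1 → a = 0 := by decide
  by_cases hi : v i = 1
  · rw [hi]
    exact e.extendSubtype_mem i hi
  · rw [hb _ hi]
    exact hb _ (e.extendSubtype_not_mem i hi)

/-- Words of the same weight differ by a permutation of the strands of each edge. -/
theorem eq_of_wt_eq {f : Word A → ℂ} (hf : f ∈ SymTensor A) {x y : Word A} (h : x.wt = y.wt) :
    f x = f y := by
  choose σ hσ using fun j => exists_perm_of_ones_eq (congrArg Fin.val (congrFun h j))
  rw [← hf σ x]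
  congr 1
  funext j i
  exact hσ j i

/-- The coefficient of a tensor at a weight, in an orthonormal basis of the symmetric tensors. -/
noncomputable def coeff (f : Word A → ℂ) (μ : Wt A) : ℂ :=
  (∑ x ∈ univ.filter fun x : Word A => x.wt = μ, f x) / norm μ

theorem eq_coeff {f : Word A → ℂ} (hf : f ∈ SymTensor A) (x : Word A) :
    f x = coeff f x.wt / norm x.wt := by
  have h : ∑ y ∈ univ.filter fun y : Word A => y.wt = x.wt, f y = norm x.wt * norm x.wt * f x := by
    rw [sum_congr rfl (g := fun _ => f x), sum_const, nsmul_eq_mul, card_wt]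
    intro y hy
    exact eq_of_wt_eq hf (mem_filter.1 hy).2
  have := norm_ne_zero x.wt
  rw [coeff, h]
  field_simp

theorem coeff_injective {f g : SymTensor A} (h : coeff f.1 = coeff g.1) : f = g := by
  refine Subtype.ext (funext fun x => ?_)
  rw [eq_coeff f.2, eq_coeff g.2, h]

theorem coeff_smul (c : ℂ) (f : Word A → ℂ) (μ : Wt A) : coeff (c • f) μ = c * coeff f μ := by
  simp only [coeff, Pi.smul_apply, smul_eq_mul, ← mul_sum]
  ring

theorem symmetrize_apply (f : Word A → ℂ) (x : Word A) : (symmetrize A f).1 x =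
    (Fintype.card (EdgePerm A) : ℂ)⁻¹ * ∑ σ : EdgePerm A, f (x.permute σ) := rfl

theorem sum_permute (f : Word A → ℂ) (μ : Wt A) (σ : EdgePerm A) :
    ∑ x ∈ univ.filter fun x : Word A => x.wt = μ, f (x.permute σ) =
      ∑ x ∈ univ.filter fun x : Word A => x.wt = μ, f x := by
  refine sum_bij' (fun x _ => x.permute σ) (fun x _ => x.permute fun j => (σ j).symm) ?_ ?_ ?_ ?_ ?_
  · intro x hx
    simpa [Word.wt_permute] using hx
  · intro x hx
    simpa [Word.wt_permute] using hx
  · intro x _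
    funext j i
    simp [Word.permute]
  · intro x _
    funext j i
    simp [Word.permute]
  · intro x _
    rfl

/-- Permuting the strands within edges permutes the words of a given weight. In the weight basis the
symmetrizers are therefore invisible. -/
theorem coeff_symmetrize (f : Word A → ℂ) : coeff (symmetrize A f).1 = coeff f := by
  funext μ
  have hc : (Fintype.card (EdgePerm A) : ℂ) ≠ 0 := Nat.cast_ne_zero.2 Fintype.card_ne_zero
  unfold coeff
  congr 1
  simp only [symmetrize_apply]
  rw [← mul_sum, sum_comm, sum_congr rfl fun σ _ => sum_permute f μ σ, sum_const, card_univ,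
    nsmul_eq_mul, ← mul_assoc, inv_mul_cancel₀ hc, one_mul]

/-- The sum of the matrix entries of a slice over the words with given weights. -/
noncomputable def Slice.strandSum (s : Slice) (ν : Wt (s.ends true)) (μ : Wt (s.ends false)) : ℂ :=
  ∑ y ∈ univ.filter fun y : Word (s.ends true) => y.wt = ν,
    ∑ x ∈ univ.filter fun x : Word (s.ends false) => x.wt = μ, (s.strandArcs.map (arcWeight x y)).prod

/-- The matrix entry of a slice between two weights. -/
noncomputable def Slice.entry (s : Slice) (ν : Wt (s.ends true)) (μ : Wt (s.ends false)) : ℂ :=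
  s.strandSum ν μ / (norm ν * norm μ)

theorem Slice.coeff_fn (s : Slice) (f : SymTensor (s.ends false)) (ν : Wt (s.ends true)) :
    coeff (s.fn f).1 ν = ∑ μ, s.entry ν μ * coeff f.1 μ := by
  have h1 : s.fn f = symmetrize (s.ends true) (s.strandMap f.1) := rfl
  rw [h1, coeff_symmetrize, coeff]
  have h2 : ∀ y, s.strandMap f.1 y = ∑ μ, ∑ x ∈ univ.filter fun x : Word (s.ends false) => x.wt = μ,
      (s.strandArcs.map (arcWeight x y)).prod * (coeff f.1 μ / norm μ) := by
    intro y
    have h3 : s.strandMap f.1 y = ∑ x, (s.strandArcs.map (arcWeight x y)).prod * f.1 x := rfl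
    rw [h3, ← sum_fiberwise univ Word.wt]
    refine sum_congr rfl fun μ _ => sum_congr rfl fun x hx => ?_
    rw [eq_coeff f.2, (mem_filter.1 hx).2]
  simp only [h2, entry, strandSum]
  rw [sum_comm, sum_div]
  refine sum_congr rfl fun μ _ => ?_
  have n1 := norm_ne_zero μ
  have n2 := norm_ne_zero ν
  simp only [← sum_mul]
  field_simp

end Spin

namespace Spin

open Finset

/-! ### Sums over the letters at the ends of arcs -/

/-- The letters at both ends of arcs, determined by the letters at their first ends. -/
def extendLetters {X K : Type*} (e : K × Bool ≃ X) (turn : K → Prop) [DecidablePred turn]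
    (u : K → Fin 2) (x : X) : Fin 2 :=
  if (e.symm x).2 = true ∧ turn (e.symm x).1 then (u (e.symm x).1).rev else u (e.symm x).1

/-- The weight of an arc vanishes unless the letter at its second end is the one forced by the
first: the same letter on a monotone arc, the other letter on a turn, where `eps` then is the sign
of the first letter. -/
theorem sum_arcs {X K : Type*} [Fintype X] [DecidableEq X] [Fintype K] [DecidableEq K]
    (e : K × Bool ≃ X) (turn : K → Prop) [DecidablePred turn] (F : (X → Fin 2) → ℂ) :
    ∑ φ : X → Fin 2, (∏ k, if turn k then eps (φ (e (k, false))) (φ (e (k, true))) else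
      if φ (e (k, false)) = φ (e (k, true)) then 1 else 0) * F φ =
    ∑ u : K → Fin 2, (∏ k, if turn k then (-1) ^ (u k).val else 1) * F (extendLetters e turn u) := by
  have h0 : ∀ u k, extendLetters e turn u (e (k, false)) = u k := by
    intro u k
    simp [extendLetters]
  have h1 : ∀ u k, extendLetters e turn u (e (k, true)) = if turn k then (u k).rev else u k := by
    intro u k
    simp [extendLetters]
  symm
  refine sum_of_injOn (extendLetters e turn) ?_ (fun _ _ => mem_coe.2 (mem_univ _)) ?_ ?_
  · intro u _ v _ h
    funext k
    rw [← h0 u, h, h0]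
  · intro φ _ hφ
    refine mul_eq_zero_of_left ?_ _
    by_contra hne
    rw [← ne_eq, prod_ne_zero_iff] at hne
    refine hφ ⟨fun k => φ (e (k, false)), mem_coe.2 (mem_univ _), funext fun x => ?_⟩
    obtain ⟨⟨k, c⟩, rfl⟩ := e.surjective x
    have h := hne k (mem_univ _)
    cases c
    · rw [h0]
    · rw [h1]
      split_ifs at h ⊢ with ht he
      · generalize φ (e (k, false)) = a at *
        generalize φ (e (k, true)) = b at *
        revert h
        fin_cases a <;> fin_cases b <;> simp [eps]
      · exact he
      · exact absurd rfl h
  · intro u _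
    congr 1
    refine prod_congr rfl fun k _ => ?_
    rw [h0, h1]
    split_ifs
    · generalize u k = a
      fin_cases a <;> simp [eps]
    · rfl
    · exact absurd rfl ‹_›

theorem List.prod_map_range {M : Type*} [CommMonoid M] (f : ℕ → M) (n : ℕ) :
    ((List.range n).map f).prod = ∏ i ∈ range n, f i := by
  induction n with
  | zero => rfl
  | succ n ih => rw [List.range_succ, List.map_append, List.prod_append, ih, prod_range_succ]; simp

theorem List.prod_map_flatMap {α β M : Type*} [CommMonoid M] (l : List α) (F : α → List β) (g : β → M) :
    ((l.flatMap F).map g).prod = (l.map fun a => ((F a).map g).prod).prod := by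
  induction l with
  | nil => rfl
  | cons a l ih => simp [ih]

/-! ### Bundles of parallel strands -/

/-- The numbers of strands in the at most three bundles of a piece. -/
def Piece.size : Piece → Fin 3 → ℕ
  | .turn _ n => ![n, 0, 0]
  | .cross a b => ![a, b, 0]
  | .vertex _ a b c => ![thru b a c, thru c a b, thru a b c]

/-- The strands in the bundles of a piece. -/
def Piece.arc (l : ℕ) : Piece → Fin 3 → ℕ → Arc (ℕ × ℕ)
  | .turn s n, _, i => ((s, (l, i)), (s, (l + 1, n - 1 - i)))
  | .cross _ _, k, i => ![((false, (l, i)), (true, (l + 1, i))), ((false, (l + 1, i)), (true, (l, i))),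
      ((false, (l, i)), (true, (l + 1, i)))] k
  | .vertex s a b c, k, i => ![legArc s (l, i) (l, i),
      ((s, (l, thru b a c + i)), (s, (l + 1, thru c a b - 1 - i))),
      legArc s (l + 1, thru c a b + i) (l, thru b a c + i)] k

theorem Piece.prod_strandArcs {M : Type*} [CommMonoid M] (P : Piece) (l : ℕ) (g : Arc (ℕ × ℕ) → M) :
    ((P.strandArcs l).map g).prod = ∏ k, ∏ i ∈ range (P.size k), g (P.arc l k i) := by
  rw [Fin.prod_univ_three]
  cases P <;> simp [strandArcs, size, arc, List.prod_map_range, mul_assoc, Function.comp_def]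

theorem Piece.mem_strandArcs (P : Piece) (l : ℕ) (x : Arc (ℕ × ℕ)) :
    x ∈ P.strandArcs l ↔ ∃ k, ∃ i < P.size k, x = P.arc l k i := by
  cases P <;> simp [strandArcs, size, arc, Fin.exists_fin_succ, eq_comm]

/-- The places of the edges that contain the ends of an arc. -/
def arcEnds (a : Arc (ℕ × ℕ)) : Arc ℕ := ((a.1.1, a.1.2.1), (a.2.1, a.2.2.1))

namespace Slice

variable (s : Slice)

/-- The bundles of parallel strands in a slice. -/
abbrev Bundle : Type := (Fin s.left.length ⊕ Fin s.right.length) ⊕ Fin 3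

/-- The number of strands in a bundle. -/
def size : s.Bundle → ℕ :=
  Sum.elim (Sum.elim (fun j => s.left.getD j 0) (fun j => s.right.getD j 0)) s.piece.size

/-- The strands in a bundle. -/
def arc : s.Bundle → ℕ → Arc (ℕ × ℕ) :=
  Sum.elim (Sum.elim (fun j i => ((false, (j, i)), (true, (j, i))))
    (fun j i => ((false, (s.left.length + s.width false + j, i)),
      (true, (s.left.length + s.width true + j, i))))) (s.piece.arc s.left.length)

theorem prod_strandArcs {M : Type*} [CommMonoid M] (g : Arc (ℕ × ℕ) → M) :
    (s.strandArcs.map g).prod = ∏ b, ∏ i ∈ range (s.size b), g (s.arc b i) := by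
  rw [strandArcs, List.map_append, List.prod_append, Piece.prod_strandArcs, sideStrandArcs,
    List.map_append, List.prod_append, List.prod_map_flatMap, List.prod_map_flatMap,
    List.prod_map_range, List.prod_map_range, Fintype.prod_sum_type, Fintype.prod_sum_type]
  simp only [List.map_map, List.prod_map_range]
  rw [← Fin.prod_univ_eq_prod_range, ← Fin.prod_univ_eq_prod_range]
  rfl

theorem mem_strandArcs_iff (x : Arc (ℕ × ℕ)) : x ∈ s.strandArcs ↔ ∃ b, ∃ i < s.size b, x = s.arc b i := by
  rw [strandArcs, List.mem_append, Piece.mem_strandArcs, mem_sideStrandArcs, Sum.exists, Sum.exists]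
  refine or_congr_left (or_congr ?_ ?_)
  · constructor
    · rintro ⟨j, hj, i, hi, rfl⟩
      exact ⟨⟨j, hj⟩, i, hi, rfl⟩
    · rintro ⟨j, i, hi, rfl⟩
      exact ⟨j, j.2, i, hi, rfl⟩
  · constructor
    · rintro ⟨j, hj, i, hi, rfl⟩
      exact ⟨⟨j, hj⟩, i, hi, rfl⟩
    · rintro ⟨j, i, hi, rfl⟩
      exact ⟨j, j.2, i, hi, rfl⟩

/-- The edges at the ends of a bundle. -/
def bundleEnds (b : s.Bundle) : Arc ℕ := arcEnds (s.arc b 0)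

theorem arcEnds_arc (b : s.Bundle) (i : ℕ) : arcEnds (s.arc b i) = s.bundleEnds b := by
  unfold bundleEnds
  rcases b with (j | j) | k
  · rfl
  · rfl
  · change arcEnds (s.piece.arc _ k i) = arcEnds (s.piece.arc _ k 0)
    cases s.piece with
    | turn t n => rfl
    | cross a b => fin_cases k <;> rfl
    | vertex t a b c => cases t <;> fin_cases k <;> rfl

theorem arc_injective {b b' : s.Bundle} {i i' : ℕ} (hi : i < s.size b) (hi' : i' < s.size b')
    (h : s.arc b i = s.arc b' i') : b = b' ∧ i = i' := by
  have hpiece : ∀ k i, i < s.piece.size k →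
      s.left.length ≤ (s.piece.arc s.left.length k i).1.2.1 ∧ (s.piece.arc s.left.length k i).1.2.1 <
        s.left.length + s.width (s.piece.arc s.left.length k i).1.1 := by
    intro k i hi
    unfold width
    cases hs : s.piece with
    | turn t n => simp [Piece.arc, Piece.ends]
    | cross a b =>
      rw [hs] at hi
      fin_cases k <;> simp [Piece.arc, Piece.ends, Piece.size] at hi ⊢
    | vertex t a b c => cases t <;> fin_cases k <;> simp [Piece.arc, Piece.ends, legArc]
  rcases b with (j | j) | k <;> rcases b' with (j' | j') | k'
  · simp only [arc, Sum.elim_inl, Prod.mk.injEq] at h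
    exact ⟨by rw [Fin.ext h.1.2.1], h.1.2.2⟩
  · simp only [arc, Sum.elim_inl, Sum.elim_inr, Prod.mk.injEq] at h
    omega
  · have h1 := hpiece k' i' hi'
    change ((false, (j.val, i)), (true, (j.val, i))) = s.piece.arc s.left.length k' i' at h
    rw [← h] at h1
    have h2 := h1.1
    simp only at h2
    omega
  · simp only [arc, Sum.elim_inl, Sum.elim_inr, Prod.mk.injEq] at h
    omega
  · simp only [arc, Sum.elim_inl, Sum.elim_inr, Prod.mk.injEq] at h
    exact ⟨by rw [show j = j' from Fin.ext (by omega)], h.1.2.2⟩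
  · have h1 := hpiece k' i' hi'
    change ((false, (s.left.length + s.width false + j.val, i)),
      (true, (s.left.length + s.width true + j.val, i))) = s.piece.arc s.left.length k' i' at h
    rw [← h] at h1
    have h2 := h1.2
    simp only at h2
    omega
  · have h1 := hpiece k i hi
    change s.piece.arc s.left.length k i = ((false, (j'.val, i')), (true, (j'.val, i'))) at h
    rw [h] at h1
    have h2 := h1.1
    simp only at h2
    omega
  · have h1 := hpiece k i hi
    change s.piece.arc s.left.length k i = ((false, (s.left.length + s.width false + j'.val, i')),
      (true, (s.left.length + s.width true + j'.val, i'))) at h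
    rw [h] at h1
    have h2 := h1.2
    simp only at h2
    omega
  · change s.piece.arc s.left.length k i = s.piece.arc s.left.length k' i' at h
    change i < s.piece.size k at hi
    change i' < s.piece.size k' at hi'
    clear hpiece
    cases hs : s.piece with
    | turn t n =>
      rw [hs] at h hi hi'
      fin_cases k <;> fin_cases k' <;> simp [Piece.arc, Piece.size] at h hi hi' ⊢
      exact h.1
    | cross a b =>
      rw [hs] at h hi hi'
      fin_cases k <;> fin_cases k' <;> simp [Piece.arc, Piece.size] at h hi hi' ⊢ <;> exact h
    | vertex t a b c =>
      rw [hs] at h hi hi'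
      cases t <;> fin_cases k <;> fin_cases k' <;>
        simp [Piece.arc, Piece.size, legArc] at h hi hi' ⊢ <;> omega

end Slice

end Spin

/-! ### Matrix entries as sums over bundles of parallel strands -/

namespace Spin

open Finset

theorem sum_rev {n : ℕ} (u : Fin n → Fin 2) : ∑ i, (u i).rev.val = n - ones u := by
  have h : ∑ i, (u i).rev.val + ones u = n := by
    rw [ones, ← sum_add_distrib, sum_congr rfl (g := fun _ => 1)]
    · simp
    · intro i _
      have := (u i).2
      simp only [Fin.val_rev]
      omega
  omega

/-- The weight on a given edge. -/
def Wt.get {A : List ℕ} (μ : Wt A) (j : ℕ) : ℕ := if h : j < A.length then (μ ⟨j, h⟩).val else 0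

theorem Wt.get_of_lt {A : List ℕ} (μ : Wt A) {j : ℕ} (h : j < A.length) : μ.get j = μ ⟨j, h⟩ :=
  dif_pos h

theorem Wt.get_le {A : List ℕ} (μ : Wt A) (j : ℕ) : μ.get j ≤ A.getD j 0 := by
  unfold get
  split_ifs with h
  · rw [List.getD_eq_getElem _ _ h]
    exact Nat.le_of_lt_succ (μ ⟨j, h⟩).2
  · exact Nat.zero_le _

theorem Wt.ext_get {A : List ℕ} {μ ν : Wt A} (h : ∀ j < A.length, μ.get j = ν.get j) : μ = ν := by
  funext j
  have := h j j.2
  rw [get_of_lt _ j.2, get_of_lt _ j.2] at this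
  exact Fin.ext this

namespace Slice

variable (s : Slice)

/-- The places of strands on the two lines that bound a slice. -/
abbrev Place : Type := {p : Bool × ℕ × ℕ // s.StrandValid p}

variable {s}

theorem arc_prop (hadm : s.piece.Admissible) {b : s.Bundle} {i : ℕ} (hi : i < s.size b) :
    s.StrandArcProp (s.arc b i) :=
  s.strandArcs_prop hadm ((s.mem_strandArcs_iff _).2 ⟨b, i, hi, rfl⟩)

/-- The ends of the strands in a slice. -/
noncomputable def arcEquiv (hadm : s.piece.Admissible) :
    (Σ b : s.Bundle, Fin (s.size b)) × Bool ≃ s.Place :=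
  Equiv.ofBijective (fun k => if k.2 then ⟨(s.arc k.1.1 k.1.2).2, (arc_prop hadm k.1.2.2).valid_snd⟩
    else ⟨(s.arc k.1.1 k.1.2).1, (arc_prop hadm k.1.2.2).valid_fst⟩) <| by
  -- If the first end of one arc were the second end of another, the arcs would be the same with
  -- opposite directions. This is impossible, as arcs are listed from left to right or from the
  -- bottom to the top.
  have hne : ∀ {a a' : Arc (ℕ × ℕ)}, s.StrandArcProp a → s.StrandArcProp a' → a.1 ≠ a'.2 := by
    intro a a' h h' he
    have h2 : a.2 = a'.1 := by rw [← h.mate_fst, he, h'.mate_snd]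
    by_cases ht : a.1.1 = a.2.1
    · have h3 := h.lt ht
      have h4 := h'.lt (by rw [← h2, ← he, ht])
      rw [← h2, ← he] at h4
      unfold LeftOf at h3 h4
      omega
    · have h3 := h.up ht
      have h4 := h'.up (by rw [← h2, ← he]; exact fun h => ht h.symm)
      rw [← h2] at h4
      exact ht (h3.trans h4.symm)
  have hinj : ∀ {k k' : Σ b : s.Bundle, Fin (s.size b)}, s.arc k.1 k.2 = s.arc k'.1 k'.2 → k = k' := by
    rintro ⟨b, i⟩ ⟨b', i'⟩ h
    obtain ⟨rfl, h2⟩ := s.arc_injective i.2 i'.2 h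
    rw [Fin.ext h2]
  constructor
  · rintro ⟨k, c⟩ ⟨k', c'⟩ h
    have p := arc_prop hadm k.2.2
    have p' := arc_prop hadm k'.2.2
    cases c <;> cases c' <;> simp only [if_true, if_false, Bool.false_eq_true, Subtype.mk.injEq] at h
    · rw [hinj (Prod.ext h (by rw [← p.mate_fst, h, p'.mate_fst]))]
    · exact absurd h (hne p p')
    · exact absurd h.symm (hne p' p)
    · rw [hinj (Prod.ext (by rw [← p.mate_snd, h, p'.mate_snd]) h)]
  · intro p
    rcases s.strandMate_mem hadm p.2 with h | h
    · obtain ⟨b, i, hi, hb⟩ := (s.mem_strandArcs_iff _).1 h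
      exact ⟨(⟨b, i, hi⟩, false), Subtype.ext (congrArg Prod.fst hb).symm⟩
    · obtain ⟨b, i, hi, hb⟩ := (s.mem_strandArcs_iff _).1 h
      exact ⟨(⟨b, i, hi⟩, true), Subtype.ext (congrArg Prod.snd hb).symm⟩

theorem arcEquiv_false (hadm : s.piece.Admissible) (k : Σ b : s.Bundle, Fin (s.size b)) :
    (arcEquiv hadm (k, false)).1 = (s.arc k.1 k.2).1 := rfl

theorem arcEquiv_true (hadm : s.piece.Admissible) (k : Σ b : s.Bundle, Fin (s.size b)) :
    (arcEquiv hadm (k, true)).1 = (s.arc k.1 k.2).2 := rfl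

theorem strandValid_of_lt {t : Bool} {j : ℕ} (hj : j < (s.ends t).length) {i : ℕ}
    (hi : i < (s.ends t)[j]) : s.StrandValid (t, j, i) :=
  ⟨hj, by rw [lab, List.getD_eq_getElem _ _ hj]; exact hi⟩

/-- The letters on the two lines that bound a slice. -/
def letters (w : Word (s.ends true) × Word (s.ends false)) (p : s.Place) : Fin 2 :=
  if p.1.1 then w.1.letter p.1.2 else w.2.letter p.1.2

theorem letter_of_lt {A : List ℕ} (x : Word A) {j i : ℕ} (hj : j < A.length) (hi : i < A[j]) :
    x.letter (j, i) = x ⟨j, hj⟩ ⟨i, hi⟩ := by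
  unfold Word.letter
  rw [dif_pos hj, dif_pos hi]

theorem letters_true (w : Word (s.ends true) × Word (s.ends false)) (j : Fin (s.ends true).length)
    (i : Fin (s.ends true)[j]) : letters w ⟨(true, j, i), strandValid_of_lt j.2 i.2⟩ = w.1 j i :=
  letter_of_lt w.1 j.2 i.2

theorem letters_false (w : Word (s.ends true) × Word (s.ends false)) (j : Fin (s.ends false).length)
    (i : Fin (s.ends false)[j]) : letters w ⟨(false, j, i), strandValid_of_lt j.2 i.2⟩ = w.2 j i :=
  letter_of_lt w.2 j.2 i.2

variable (s) in
/-- Words on the two lines that bound a slice. -/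
noncomputable def lettersEquiv : Word (s.ends true) × Word (s.ends false) ≃ (s.Place → Fin 2) where
  toFun := letters
  invFun φ := (fun j i => φ ⟨(true, j, i), strandValid_of_lt j.2 i.2⟩,
    fun j i => φ ⟨(false, j, i), strandValid_of_lt j.2 i.2⟩)
  left_inv w := by
    refine Prod.ext ?_ ?_
    · funext j i
      exact letters_true w j i
    · funext j i
      exact letters_false w j i
  right_inv φ := by
    funext p
    obtain ⟨⟨t, j, i⟩, hj, hi⟩ := p
    have hi' : i < (s.ends t)[j] := by
      rw [lab, List.getD_eq_getElem _ _ hj] at hi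
      exact hi
    cases t
    · exact letters_false _ ⟨j, hj⟩ ⟨i, hi'⟩
    · exact letters_true _ ⟨j, hj⟩ ⟨i, hi'⟩

variable [Fintype s.Place]

/-- The number of letters `1` on an edge. -/
def edgeOnes (φ : s.Place → Fin 2) (E : Bool × ℕ) : ℕ :=
  ∑ p, if (p.1.1, p.1.2.1) = E then (φ p).val else 0

theorem edgeOnes_eq (φ : s.Place → Fin 2) {t : Bool} {j : ℕ} (hj : j < (s.ends t).length) :
    edgeOnes φ (t, j) = ones fun i : Fin (s.ends t)[j] => φ ⟨(t, j, i), strandValid_of_lt hj i.2⟩ := by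
  unfold edgeOnes ones
  symm
  refine sum_of_injOn (fun i : Fin (s.ends t)[j] => (⟨(t, j, i), strandValid_of_lt hj i.2⟩ : s.Place))
    ?_ (fun _ _ => mem_coe.2 (mem_univ _)) ?_ ?_
  · intro i _ i' _ h
    exact Fin.ext (congrArg (fun p : s.Place => p.1.2.2) h)
  · rintro ⟨⟨t', j', i⟩, hj', hi⟩ - h
    refine if_neg fun he => h ?_
    simp only [Prod.mk.injEq] at he
    obtain ⟨rfl, rfl⟩ := he
    rw [lab, List.getD_eq_getElem _ _ hj] at hi
    exact ⟨⟨i, hi⟩, mem_coe.2 (mem_univ _), rfl⟩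
  · intro i _
    rw [if_pos rfl]

/-- The weights on the two lines that bound a slice. -/
def weights (ν : Wt (s.ends true)) (μ : Wt (s.ends false)) (E : Bool × ℕ) : ℕ :=
  if E.1 then ν.get E.2 else μ.get E.2

theorem wt_eq_iff (w : Word (s.ends true) × Word (s.ends false)) (ν : Wt (s.ends true))
    (μ : Wt (s.ends false)) : (w.1.wt = ν ∧ w.2.wt = μ) ↔
      ∀ E, s.EdgeValid E → edgeOnes (s.lettersEquiv w) E = weights ν μ E := by
  have h : ∀ E, s.EdgeValid E → edgeOnes (s.lettersEquiv w) E = weights w.1.wt w.2.wt E := by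
    rintro ⟨t, j⟩ hj
    rw [edgeOnes_eq _ hj]
    cases t
    · refine Eq.trans ?_ (Wt.get_of_lt w.2.wt hj).symm
      exact congrArg ones (funext fun i => letters_false w ⟨j, hj⟩ i)
    · refine Eq.trans ?_ (Wt.get_of_lt w.1.wt hj).symm
      exact congrArg ones (funext fun i => letters_true w ⟨j, hj⟩ i)
  constructor
  · rintro ⟨rfl, rfl⟩
    exact h
  · intro h'
    refine ⟨Wt.ext_get fun j hj => ?_, Wt.ext_get fun j hj => ?_⟩
    · exact (h (true, j) hj).symm.trans (h' (true, j) hj)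
    · exact (h (false, j) hj).symm.trans (h' (false, j) hj)

/-- A bundle of cups or caps. -/
def IsTurn (b : s.Bundle) : Prop := (s.bundleEnds b).1.1 = (s.bundleEnds b).2.1

instance : DecidablePred (s.IsTurn) := fun b =>
  inferInstanceAs (Decidable ((s.bundleEnds b).1.1 = (s.bundleEnds b).2.1))

/-- The weight of an edge, given the numbers of letters `1` at the first ends in each bundle. -/
def bundleOnes (t : s.Bundle → ℕ) (E : Bool × ℕ) : ℕ :=
  ∑ b, ((if (s.bundleEnds b).1 = E then t b else 0) +
    if (s.bundleEnds b).2 = E then (if IsTurn b then s.size b - t b else t b) else 0)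

theorem edgeOnes_extendLetters (hadm : s.piece.Admissible)
    (u : (Σ b : s.Bundle, Fin (s.size b)) → Fin 2) (E : Bool × ℕ) :
    edgeOnes (extendLetters (arcEquiv hadm) (fun k => IsTurn k.1) u) E =
      bundleOnes (fun b => ones fun i => u ⟨b, i⟩) E := by
  unfold edgeOnes bundleOnes
  rw [← (arcEquiv hadm).sum_comp, Fintype.sum_prod_type, Fintype.sum_sigma]
  refine sum_congr rfl fun b _ => ?_
  have h0 : ∀ i : Fin (s.size b), ((arcEquiv hadm (⟨b, i⟩, false)).1.1,
      (arcEquiv hadm (⟨b, i⟩, false)).1.2.1) = (s.bundleEnds b).1 := by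
    intro i
    rw [arcEquiv_false, ← s.arcEnds_arc b i]
    rfl
  have h1 : ∀ i : Fin (s.size b), ((arcEquiv hadm (⟨b, i⟩, true)).1.1,
      (arcEquiv hadm (⟨b, i⟩, true)).1.2.1) = (s.bundleEnds b).2 := by
    intro i
    rw [arcEquiv_true, ← s.arcEnds_arc b i]
    rfl
  simp only [Fintype.sum_bool, h0, h1, extendLetters, Equiv.symm_apply_apply]
  rw [sum_add_distrib, add_comm]
  congr 1
  · by_cases h : (s.bundleEnds b).1 = E
    · simp [ones, h]
    · simp [h]
  · by_cases h : (s.bundleEnds b).2 = E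
    · by_cases ht : IsTurn b
      · simp only [ht, h, and_self, if_true]
        exact sum_rev _
      · simp only [ht, h, and_false, if_true, if_false]
        rfl
    · simp [h]

theorem arcWeight_arc (hadm : s.piece.Admissible) (w : Word (s.ends true) × Word (s.ends false))
    (k : Σ b : s.Bundle, Fin (s.size b)) : arcWeight w.2 w.1 (s.arc k.1 k.2) =
      if IsTurn k.1 then eps (s.lettersEquiv w (arcEquiv hadm (k, false)))
        (s.lettersEquiv w (arcEquiv hadm (k, true)))
      else if s.lettersEquiv w (arcEquiv hadm (k, false)) = s.lettersEquiv w (arcEquiv hadm (k, true))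
        then 1 else 0 := by
  have h : IsTurn k.1 ↔ (s.arc k.1 k.2).1.1 = (s.arc k.1 k.2).2.1 := by
    unfold IsTurn
    rw [← s.arcEnds_arc k.1 k.2]
    rfl
  simp only [h]
  rfl

/-- The sum over two words is a sum over letters at all places, hence over letters at the first ends
of arcs by `sum_arcs`. The summand depends only on the number of letters `1` in each bundle, and
`sum_letters` replaces the words by these numbers, with binomial coefficients as multiplicities. -/
theorem strandSum_eq (hadm : s.piece.Admissible) (ν : Wt (s.ends true)) (μ : Wt (s.ends false)) :
    s.strandSum ν μ = ∑ t ∈ Fintype.piFinset fun b => range (s.size b + 1),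
      (∏ b, ((s.size b).choose (t b) : ℂ)) * ((∏ b, if IsTurn b then (-1) ^ t b else 1) *
        open Classical in
        if ∀ E, s.EdgeValid E → bundleOnes t E = weights ν μ E then 1 else 0) := by
  classical
  have h1 : s.strandSum ν μ = ∑ w : Word (s.ends true) × Word (s.ends false),
      (s.strandArcs.map (arcWeight w.2 w.1)).prod *
        if ∀ E, s.EdgeValid E → edgeOnes (s.lettersEquiv w) E = weights ν μ E then 1 else 0 := by
    unfold strandSum
    rw [← sum_product', ← filter_product, sum_filter, univ_product_univ]
    refine sum_congr rfl fun w _ => ?_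
    simp only [wt_eq_iff]
    split_ifs <;> simp
  have h2 : ∀ w : Word (s.ends true) × Word (s.ends false),
      (s.strandArcs.map (arcWeight w.2 w.1)).prod = ∏ k : Σ b : s.Bundle, Fin (s.size b),
      if IsTurn k.1 then eps (s.lettersEquiv w (arcEquiv hadm (k, false)))
        (s.lettersEquiv w (arcEquiv hadm (k, true)))
      else if s.lettersEquiv w (arcEquiv hadm (k, false)) = s.lettersEquiv w (arcEquiv hadm (k, true))
        then 1 else 0 := by
    intro w
    rw [prod_strandArcs, Fintype.prod_sigma]
    refine prod_congr rfl fun b _ => ?_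
    rw [← Fin.prod_univ_eq_prod_range]
    exact prod_congr rfl fun i _ => arcWeight_arc hadm w ⟨b, i⟩
  rw [h1]
  simp only [h2]
  rw [s.lettersEquiv.sum_comp fun φ => (∏ k : Σ b : s.Bundle, Fin (s.size b),
      if IsTurn k.1 then eps (φ (arcEquiv hadm (k, false))) (φ (arcEquiv hadm (k, true)))
      else if φ (arcEquiv hadm (k, false)) = φ (arcEquiv hadm (k, true)) then (1 : ℂ) else 0) *
        if ∀ E, s.EdgeValid E → edgeOnes φ E = weights ν μ E then 1 else 0,
    sum_arcs (arcEquiv hadm) (fun k => IsTurn k.1)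
      (fun φ => if ∀ E, s.EdgeValid E → edgeOnes φ E = weights ν μ E then 1 else 0),
    ← sum_letters, ← (Equiv.piCurry fun (b : s.Bundle) (_ : Fin (s.size b)) => Fin 2).sum_comp]
  refine sum_congr rfl fun u _ => ?_
  simp only [edgeOnes_extendLetters]
  congr 1
  rw [Fintype.prod_sigma]
  refine prod_congr rfl fun b _ => ?_
  split_ifs
  · rw [prod_pow_eq_pow_sum]
    rfl
  · simp

end Slice

end Spin

/-! ### Splitting off the vertical edges of a slice -/

namespace Spin

open Finset

namespace Slice

variable {s : Slice}

theorem bundleEnds_left (j : Fin s.left.length) :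
    s.bundleEnds (.inl (.inl j)) = ((false, j.val), (true, j.val)) := rfl

theorem bundleEnds_right (j : Fin s.right.length) : s.bundleEnds (.inl (.inr j)) =
    ((false, s.left.length + s.width false + j), (true, s.left.length + s.width true + j)) := rfl

theorem bundleEnds_piece (k : Fin 3) :
    s.bundleEnds (.inr k) = arcEnds (s.piece.arc s.left.length k 0) := rfl

theorem not_isTurn_side (x : Fin s.left.length ⊕ Fin s.right.length) : ¬ s.IsTurn (.inl x) := by
  rcases x with j | j <;> simp [IsTurn, bundleEnds_left, bundleEnds_right]

theorem bundleEnds_piece_mem {k : Fin 3} (hk : s.size (.inr k) ≠ 0) :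
    (s.left.length ≤ (s.bundleEnds (.inr k)).1.2 ∧
      (s.bundleEnds (.inr k)).1.2 < s.left.length + s.width (s.bundleEnds (.inr k)).1.1) ∧
    (s.left.length ≤ (s.bundleEnds (.inr k)).2.2 ∧
      (s.bundleEnds (.inr k)).2.2 < s.left.length + s.width (s.bundleEnds (.inr k)).2.1) := by
  rw [bundleEnds_piece]
  change s.piece.size k ≠ 0 at hk
  unfold width
  cases hs : s.piece with
  | turn t n => simp [Piece.arc, Piece.ends, arcEnds]
  | cross a b =>
    rw [hs] at hk
    fin_cases k <;> simp [Piece.arc, Piece.ends, Piece.size, arcEnds] at hk ⊢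
  | vertex t a b c => cases t <;> fin_cases k <;> simp [Piece.arc, Piece.ends, legArc, arcEnds]

/-- The contribution of a bundle to the weight of an edge. -/
def bundleTerm (t : s.Bundle → ℕ) (E : Bool × ℕ) (b : s.Bundle) : ℕ :=
  (if (s.bundleEnds b).1 = E then t b else 0) +
    if (s.bundleEnds b).2 = E then (if IsTurn b then s.size b - t b else t b) else 0

theorem bundleOnes_eq_sum (t : s.Bundle → ℕ) (E : Bool × ℕ) : bundleOnes t E =
    (∑ j, bundleTerm t E (.inl (.inl j)) + ∑ j, bundleTerm t E (.inl (.inr j))) +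
      ∑ k, bundleTerm t E (.inr k) := by
  rw [← Fintype.sum_sum_type fun x : Fin s.left.length ⊕ Fin s.right.length => bundleTerm t E (.inl x),
    ← Fintype.sum_sum_type]
  rfl

variable {t : s.Bundle → ℕ}

theorem bundleTerm_left (j : Fin s.left.length) (E : Bool × ℕ) :
    bundleTerm t E (.inl (.inl j)) = if j.val = E.2 then t (.inl (.inl j)) else 0 := by
  obtain ⟨c, i⟩ := E
  unfold bundleTerm
  rw [if_neg (not_isTurn_side _), bundleEnds_left]
  cases c <;> simp

theorem bundleTerm_right (j : Fin s.right.length) (E : Bool × ℕ) : bundleTerm t E (.inl (.inr j)) =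
    if s.left.length + s.width E.1 + j.val = E.2 then t (.inl (.inr j)) else 0 := by
  obtain ⟨c, i⟩ := E
  unfold bundleTerm
  rw [if_neg (not_isTurn_side _), bundleEnds_right]
  cases c <;> simp

theorem bundleTerm_piece (ht : ∀ b, t b ≤ s.size b) (k : Fin 3) {E : Bool × ℕ}
    (hE : E.2 < s.left.length ∨ s.left.length + s.width E.1 ≤ E.2) : bundleTerm t E (.inr k) = 0 := by
  unfold bundleTerm
  by_cases hk : s.size (.inr k) = 0
  · have := ht (.inr k)
    have h0 : t (.inr k) = 0 := by omega
    simp [hk, h0]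
  · obtain ⟨h1, h2⟩ := bundleEnds_piece_mem hk
    rw [if_neg, if_neg]
    · rintro rfl
      omega
    · rintro rfl
      omega

theorem bundleOnes_left (ht : ∀ b, t b ≤ s.size b) (c : Bool) (j : Fin s.left.length) :
    bundleOnes t (c, j.val) = t (.inl (.inl j)) := by
  rw [bundleOnes_eq_sum]
  simp only [bundleTerm_piece ht _ (.inl (show (c, j.val).2 < _ from j.2)), bundleTerm_left,
    bundleTerm_right]
  simp only [← Fin.ext_iff, sum_ite_eq', mem_univ, if_true, sum_const_zero, add_zero,
    Nat.add_eq_left]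
  refine sum_eq_zero fun i _ => if_neg ?_
  have := j.2
  omega

theorem bundleOnes_right (ht : ∀ b, t b ≤ s.size b) (c : Bool) (j : Fin s.right.length) :
    bundleOnes t (c, s.left.length + s.width c + j.val) = t (.inl (.inr j)) := by
  rw [bundleOnes_eq_sum]
  simp only [bundleTerm_piece ht _ (.inr (show _ ≤ (c, s.left.length + s.width c + j.val).2 by simp)),
    bundleTerm_left, bundleTerm_right]
  simp only [add_right_inj, ← Fin.ext_iff, sum_ite_eq', mem_univ, if_true, sum_const_zero, add_zero,
    Nat.add_eq_right]
  refine sum_eq_zero fun i _ => if_neg ?_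
  have := i.2
  omega

theorem bundleOnes_piece {c : Bool} {k : ℕ} (hk : k < s.width c) :
    bundleOnes t (c, s.left.length + k) = ∑ i, bundleTerm t (c, s.left.length + k) (.inr i) := by
  rw [bundleOnes_eq_sum]
  simp only [bundleTerm_left, bundleTerm_right, Nat.add_eq_right]
  rw [sum_eq_zero, sum_eq_zero, zero_add]
  · intro i _
    rw [if_neg (by omega)]
  · intro i _
    rw [if_neg (by omega)]

/-- The weights agree on the two ends of the vertical edges of a slice. -/
def SideCompat (s : Slice) (w : Bool × ℕ → ℕ) : Prop :=
  (∀ j : Fin s.left.length, w (false, j) = w (true, j)) ∧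
    ∀ j : Fin s.right.length, w (false, s.left.length + s.width false + j) =
      w (true, s.left.length + s.width true + j)

/-- The number of strands with letter `1` in the bundles of vertical edges. -/
def sideOnes (w : Bool × ℕ → ℕ) : Fin s.left.length ⊕ Fin s.right.length → ℕ :=
  Sum.elim (fun j => w (false, j)) (fun j => w (false, s.left.length + s.width false + j))

/-- A vertical edge is met by no other bundle than its own, and so its number of letters `1` is
forced at both ends. The conditions that remain concern the piece alone. -/
theorem bundle_cond_iff (ht : ∀ b, t b ≤ s.size b) (w : Bool × ℕ → ℕ) :
    (∀ E, s.EdgeValid E → bundleOnes t E = w E) ↔ s.SideCompat w ∧ (∀ x, t (.inl x) = sideOnes w x) ∧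
      ∀ c, ∀ k < s.width c, bundleOnes t (c, s.left.length + k) = w (c, s.left.length + k) := by
  have hv : ∀ c j, s.EdgeValid (c, j) ↔ j < s.left.length + s.width c + s.right.length := by
    intro c j
    rw [EdgeValid, ends_length]
  constructor
  · intro h
    have hl : ∀ c (j : Fin s.left.length), t (.inl (.inl j)) = w (c, j) := fun c j => by
      rw [← bundleOnes_left ht c j]
      exact h _ ((hv _ _).2 (by have := j.2; omega))
    have hr : ∀ c (j : Fin s.right.length),
        t (.inl (.inr j)) = w (c, s.left.length + s.width c + j) := fun c j => by
      rw [← bundleOnes_right ht c j]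
      exact h _ ((hv _ _).2 (by have := j.2; omega))
    refine ⟨⟨fun j => (hl false j).symm.trans (hl true j), fun j =>
      (hr false j).symm.trans (hr true j)⟩, ?_, fun c k hk => h _ ((hv _ _).2 (by omega))⟩
    rintro (j | j)
    · exact hl false j
    · exact hr false j
  · rintro ⟨⟨h1, h2⟩, h3, h4⟩ ⟨c, j⟩ hj
    rw [hv] at hj
    rcases lt_or_ge j s.left.length with hl | hl
    · rw [bundleOnes_left ht c ⟨j, hl⟩, h3]
      cases c
      · rfl
      · exact h1 ⟨j, hl⟩
    · rcases lt_or_ge j (s.left.length + s.width c) with hm | hm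
      · obtain ⟨k, rfl⟩ := Nat.exists_eq_add_of_le hl
        exact h4 c k (by omega)
      · obtain ⟨k, rfl⟩ := Nat.exists_eq_add_of_le hm
        rw [bundleOnes_right ht c ⟨k, by omega⟩, h3]
        cases c
        · rfl
        · exact h2 ⟨k, by omega⟩

variable (s) in
/-- The contribution of a bundle of a piece to the weight of an edge. -/
def pieceTerm (t : Fin 3 → ℕ) (E : Bool × ℕ) (k : Fin 3) : ℕ :=
  (if (arcEnds (s.piece.arc s.left.length k 0)).1 = E then t k else 0) +
    if (arcEnds (s.piece.arc s.left.length k 0)).2 = E then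
      (if (arcEnds (s.piece.arc s.left.length k 0)).1.1 = (arcEnds (s.piece.arc s.left.length k 0)).2.1
        then s.piece.size k - t k else t k) else 0

variable (s) in
/-- The numbers of letters `1` in the bundles of a piece produce the given weights. -/
def PieceCond (w : Bool × ℕ → ℕ) (t : Fin 3 → ℕ) : Prop :=
  ∀ c, ∀ k < s.width c, ∑ i, s.pieceTerm t (c, s.left.length + k) i = w (c, s.left.length + k)

variable (s) in
open Classical in
/-- The contribution of the piece to the sum of the matrix entries of a slice. -/
noncomputable def pieceSum (w : Bool × ℕ → ℕ) : ℂ :=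
  ∑ t ∈ Fintype.piFinset fun k => range (s.piece.size k + 1), (∏ k, ((s.piece.size k).choose (t k) : ℂ)) *
    ((∏ k, if (arcEnds (s.piece.arc s.left.length k 0)).1.1 =
      (arcEnds (s.piece.arc s.left.length k 0)).2.1 then (-1) ^ t k else 1) *
        if s.PieceCond w t then 1 else 0)

variable (s) in
/-- The numbers of words on the vertical edges with given weights. -/
noncomputable def sideNorm (w : Bool × ℕ → ℕ) : ℂ :=
  ∏ x, ((s.size (.inl x)).choose (sideOnes (s := s) w x) : ℂ)

theorem weights_le (ν : Wt (s.ends true)) (μ : Wt (s.ends false)) (E : Bool × ℕ) :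
    weights ν μ E ≤ s.lab E.1 E.2 := by
  obtain ⟨c, j⟩ := E
  cases c
  · exact μ.get_le j
  · exact ν.get_le j

theorem size_side_left (j : Fin s.left.length) (c : Bool) : s.size (.inl (.inl j)) = s.lab c j :=
  (s.lab_left j.2).symm

theorem size_side_right (j : Fin s.right.length) (c : Bool) :
    s.size (.inl (.inr j)) = s.lab c (s.left.length + s.width c + j) := s.lab_right.symm

theorem sideOnes_le (ν : Wt (s.ends true)) (μ : Wt (s.ends false))
    (x : Fin s.left.length ⊕ Fin s.right.length) : sideOnes (weights ν μ) x ≤ s.size (.inl x) := by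
  rcases x with j | j
  · rw [size_side_left j false]
    exact weights_le ν μ (false, j)
  · rw [size_side_right j false]
    exact weights_le ν μ (false, _)

open Classical in
-- The numbers in the vertical bundles are determined by the weights. Each vertical edge contributes
-- one binomial coefficient, and only the bundles of the piece are summed over.
theorem strandSum_eq_pieceSum (hadm : s.piece.Admissible) (ν : Wt (s.ends true)) (μ : Wt (s.ends false)) :
    s.strandSum ν μ = if s.SideCompat (weights ν μ) then
      s.sideNorm (weights ν μ) * s.pieceSum (weights ν μ) else 0 := by
  have : Fintype s.Place := Fintype.ofEquiv _ (arcEquiv hadm)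
  rw [strandSum_eq hadm]
  have hle : ∀ t ∈ Fintype.piFinset fun b => range (s.size b + 1), ∀ b, t b ≤ s.size b := by
    intro t ht b
    have := Fintype.mem_piFinset.1 ht b
    rw [mem_range] at this
    omega
  split_ifs with hside
  · rw [pieceSum, mul_sum]
    symm
    refine sum_of_injOn (fun t => Sum.elim (sideOnes (weights ν μ)) t) ?_ ?_ ?_ ?_
    · intro t _ t' _ h
      funext k
      exact congrFun h (.inr k)
    · intro t ht
      rw [mem_coe, Fintype.mem_piFinset] at ht ⊢
      rintro (x | k)
      · exact mem_range.2 (Nat.lt_succ_of_le (sideOnes_le ν μ x))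
      · exact ht k
    · intro t ht h
      rw [if_neg, mul_zero, mul_zero]
      rw [bundle_cond_iff (hle t ht)]
      rintro ⟨-, h2, -⟩
      refine h ⟨fun k => t (.inr k), ?_, ?_⟩
      · rw [mem_coe, Fintype.mem_piFinset] at *
        exact fun k => ht (.inr k)
      · funext b
        rcases b with x | k
        · exact (h2 x).symm
        · rfl
    · intro t ht
      have ht' : ∀ b, (Sum.elim (sideOnes (weights ν μ)) t : s.Bundle → ℕ) b ≤ s.size b := by
        rintro (x | k)
        · exact sideOnes_le ν μ x
        · have := Fintype.mem_piFinset.1 ht k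
          rw [mem_range] at this
          exact Nat.le_of_lt_succ this
      have h1 : s.PieceCond (weights ν μ) t ↔ ∀ E, s.EdgeValid E →
          bundleOnes (s := s) (Sum.elim (sideOnes (weights ν μ)) t) E = weights ν μ E := by
        rw [bundle_cond_iff ht']
        constructor
        · intro h
          refine ⟨hside, fun x => rfl, fun c k hk => ?_⟩
          rw [bundleOnes_piece hk]
          exact h c k hk
        · rintro ⟨-, -, h⟩ c k hk
          rw [← h c k hk, bundleOnes_piece hk]
          rfl
      simp only [h1]
      rw [Fintype.prod_sum_type, Fintype.prod_sum_type (f := fun b : s.Bundle => ite _ _ _)]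
      have h2 : ∏ x : Fin s.left.length ⊕ Fin s.right.length, (if s.IsTurn (.inl x) then
          (-1 : ℂ) ^ (Sum.elim (sideOnes (weights ν μ)) t : s.Bundle → ℕ) (.inl x) else 1) = 1 :=
        prod_eq_one fun x _ => if_neg (not_isTurn_side x)
      rw [h2, one_mul, mul_assoc]
      rfl
  · refine sum_eq_zero fun t ht => ?_
    rw [if_neg, mul_zero, mul_zero]
    rw [bundle_cond_iff (hle t ht)]
    exact fun h => hside h.1

variable (s) in
/-- The norm of the weight vectors at the piece of a slice. -/
noncomputable def pieceNorm (w : Bool × ℕ → ℕ) (c : Bool) : ℂ :=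
  ∏ k ∈ range (s.width c), rt (s.lab c (s.left.length + k)) (w (c, s.left.length + k))

theorem norm_eq {c : Bool} (μ : Wt (s.ends c)) {w : Bool × ℕ → ℕ}
    (hw : ∀ j, w (c, j) = μ.get j) : norm μ =
      (∏ j : Fin s.left.length, rt (s.lab c j) (w (c, j))) * s.pieceNorm w c *
        ∏ j : Fin s.right.length, rt (s.lab c (s.left.length + s.width c + j))
          (w (c, s.left.length + s.width c + j)) := by
  have h : norm μ = ∏ j ∈ range (s.ends c).length, rt (s.lab c j) (w (c, j)) := by
    rw [← Fin.prod_univ_eq_prod_range, norm]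
    refine prod_congr rfl fun j _ => ?_
    rw [hw, μ.get_of_lt j.2, lab, List.getD_eq_getElem _ _ j.2]
    rfl
  rw [h, ends_length, prod_range_add, prod_range_add, pieceNorm,
    ← Fin.prod_univ_eq_prod_range (n := s.left.length),
    ← Fin.prod_univ_eq_prod_range (n := s.right.length)]

/-- A vertical edge has equal weights below and above; the product of its two norms is the binomial
coefficient that it contributes to the sum. In an orthonormal basis vertical edges therefore act as
the identity. -/
theorem norm_mul_norm {ν : Wt (s.ends true)} {μ : Wt (s.ends false)} (h : s.SideCompat (weights ν μ)) :
    norm ν * norm μ = s.sideNorm (weights ν μ) *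
      (s.pieceNorm (weights ν μ) true * s.pieceNorm (weights ν μ) false) := by
  rw [norm_eq (w := weights ν μ) ν fun j => rfl, norm_eq (w := weights ν μ) μ fun j => rfl, sideNorm,
    Fintype.prod_sum_type]
  have h1 : ∏ j : Fin s.left.length, (((s.size (.inl (.inl j))).choose
      (sideOnes (s := s) (weights ν μ) (.inl j)) : ℕ) : ℂ) =
      (∏ j : Fin s.left.length, rt (s.lab true j) (weights ν μ (true, j))) *
        ∏ j : Fin s.left.length, rt (s.lab false j) (weights ν μ (false, j)) := by
    rw [← prod_mul_distrib]
    refine prod_congr rfl fun j _ => ?_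
    rw [← h.1, ← size_side_left j true, ← size_side_left j false, rt_mul_self]
    rfl
  have h2 : ∏ j : Fin s.right.length, (((s.size (.inl (.inr j))).choose
      (sideOnes (s := s) (weights ν μ) (.inr j)) : ℕ) : ℂ) =
      (∏ j : Fin s.right.length, rt (s.lab true (s.left.length + s.width true + j))
          (weights ν μ (true, s.left.length + s.width true + j))) *
        ∏ j : Fin s.right.length, rt (s.lab false (s.left.length + s.width false + j))
          (weights ν μ (false, s.left.length + s.width false + j)) := by
    rw [← prod_mul_distrib]
    refine prod_congr rfl fun j _ => ?_
    rw [← h.2, ← size_side_right j true, ← size_side_right j false, rt_mul_self]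
    rfl
  rw [h1, h2]
  ring

open Classical in
theorem entry_eq_pieceSum (hadm : s.piece.Admissible) (ν : Wt (s.ends true)) (μ : Wt (s.ends false)) :
    s.entry ν μ = if s.SideCompat (weights ν μ) then s.pieceSum (weights ν μ) /
      (s.pieceNorm (weights ν μ) true * s.pieceNorm (weights ν μ) false) else 0 := by
  rw [entry, strandSum_eq_pieceSum hadm]
  split_ifs with h
  · have h1 : norm ν * norm μ ≠ 0 := mul_ne_zero (norm_ne_zero ν) (norm_ne_zero μ)
    rw [norm_mul_norm h] at h1 ⊢
    have h2 := left_ne_zero_of_mul h1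
    rw [mul_div_mul_left _ _ h2]
  · rw [zero_div]

end Slice

end Spin

/-! ### Amplitudes of cups, caps and crossings -/

namespace Spin

open Finset

theorem rt_symm {n m : ℕ} (h : m ≤ n) : rt n (n - m) = rt n m := by
  rw [rt, rt, Nat.choose_symm h]

theorem sum_piFinset_three (z : Fin 3 → ℕ) (F : (Fin 3 → ℕ) → ℂ) :
    ∑ t ∈ Fintype.piFinset fun k => range (z k + 1), F t =
      ∑ x ∈ range (z 0 + 1), ∑ y ∈ range (z 1 + 1), ∑ u ∈ range (z 2 + 1), F ![x, y, u] := by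
  simp only [← sum_product']
  refine sum_bij' (fun t _ => (t 0, t 1, t 2)) (fun x _ => ![x.1, x.2.1, x.2.2]) ?_ ?_ ?_ ?_ ?_
  · intro t ht
    rw [Fintype.mem_piFinset] at ht
    simp only [mem_product]
    exact ⟨ht 0, ht 1, ht 2⟩
  · rintro ⟨x, y, u⟩ h
    simp only [mem_product] at h
    rw [Fintype.mem_piFinset]
    intro k
    fin_cases k
    · exact h.1
    · exact h.2.1
    · exact h.2.2
  · intro t _
    funext k
    fin_cases k <;> rfl
  · intro x _
    rfl
  · intro t _
    congr 1
    funext k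
    fin_cases k <;> rfl

namespace Slice

variable {s : Slice}

theorem pieceCond_turn {t : Bool} {n : ℕ} (hs : s.piece = .turn t n) {w : Bool × ℕ → ℕ} {x : ℕ} :
    s.PieceCond w ![x, 0, 0] ↔ x = w (t, s.left.length) ∧ n - x = w (t, s.left.length + 1) := by
  have hw : ∀ c, s.width c = if c = t then 2 else 0 := by
    intro c
    rw [width, hs, Piece.ends]
    split_ifs <;> rfl
  unfold PieceCond
  have h0 : ∑ i, s.pieceTerm ![x, 0, 0] (t, s.left.length) i = x := by
    simp [pieceTerm, hs, Fin.sum_univ_three, Piece.arc, arcEnds, Piece.size]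
  have h1 : ∑ i, s.pieceTerm ![x, 0, 0] (t, s.left.length + 1) i = n - x := by
    simp [pieceTerm, hs, Fin.sum_univ_three, Piece.arc, arcEnds, Piece.size]
  constructor
  · intro h
    have e0 := h t 0 (by simp [hw])
    have e1 := h t 1 (by simp [hw])
    rw [add_zero] at e0
    exact ⟨h0.symm.trans e0, h1.symm.trans e1⟩
  · rintro ⟨e0, e1⟩ c k hk
    rw [hw] at hk
    split_ifs at hk with hc
    · subst hc
      interval_cases k
      · exact h0.trans e0
      · exact h1.trans e1
    · omega

theorem pieceCond_cross {a b : ℕ} (hs : s.piece = .cross a b) {w : Bool × ℕ → ℕ} {x y : ℕ} :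
    s.PieceCond w ![x, y, 0] ↔ (x = w (false, s.left.length) ∧ x = w (true, s.left.length + 1)) ∧
      y = w (false, s.left.length + 1) ∧ y = w (true, s.left.length) := by
  have hw : ∀ c, s.width c = 2 := by
    intro c
    rw [width, hs, Piece.ends]
    split_ifs <;> rfl
  unfold PieceCond
  have h0 : ∑ i, s.pieceTerm ![x, y, 0] (false, s.left.length) i = x := by
    simp [pieceTerm, hs, Fin.sum_univ_three, Piece.arc, arcEnds, Piece.size]
  have h1 : ∑ i, s.pieceTerm ![x, y, 0] (false, s.left.length + 1) i = y := by
    simp [pieceTerm, hs, Fin.sum_univ_three, Piece.arc, arcEnds, Piece.size]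
  have h2 : ∑ i, s.pieceTerm ![x, y, 0] (true, s.left.length) i = y := by
    simp [pieceTerm, hs, Fin.sum_univ_three, Piece.arc, arcEnds, Piece.size]
  have h3 : ∑ i, s.pieceTerm ![x, y, 0] (true, s.left.length + 1) i = x := by
    simp [pieceTerm, hs, Fin.sum_univ_three, Piece.arc, arcEnds, Piece.size]
  constructor
  · intro h
    have e0 := h false 0 (by simp [hw])
    have e1 := h false 1 (by simp [hw])
    have e2 := h true 0 (by simp [hw])
    have e3 := h true 1 (by simp [hw])
    rw [add_zero] at e0 e2
    exact ⟨⟨h0.symm.trans e0, h3.symm.trans e3⟩, h1.symm.trans e1, h2.symm.trans e2⟩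
  · rintro ⟨⟨e0, e3⟩, e1, e2⟩ c k hk
    rw [hw] at hk
    cases c <;> interval_cases k
    · exact h0.trans e0
    · exact h1.trans e1
    · exact h2.trans e2
    · exact h3.trans e3

theorem pieceCond_vertex {t : Bool} {a b c : ℕ} (hs : s.piece = .vertex t a b c) {w : Bool × ℕ → ℕ}
    {x : Fin 3 → ℕ} : s.PieceCond w x ↔ x 0 + x 1 = w (t, s.left.length) ∧
      thru c a b - x 1 + x 2 = w (t, s.left.length + 1) ∧ x 0 + x 2 = w (!t, s.left.length) := by
  obtain ⟨-, -, -, hw, hw'⟩ := s.vertex_lab hs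
  unfold PieceCond
  have h0 : ∑ i, s.pieceTerm x (t, s.left.length) i = x 0 + x 1 := by
    cases t <;> simp [pieceTerm, hs, Fin.sum_univ_three, Piece.arc, arcEnds, Piece.size, legArc]
  have h1 : ∑ i, s.pieceTerm x (t, s.left.length + 1) i = thru c a b - x 1 + x 2 := by
    cases t <;> simp [pieceTerm, hs, Fin.sum_univ_three, Piece.arc, arcEnds, Piece.size, legArc]
  have h2 : ∑ i, s.pieceTerm x (!t, s.left.length) i = x 0 + x 2 := by
    cases t <;> simp [pieceTerm, hs, Fin.sum_univ_three, Piece.arc, arcEnds, Piece.size, legArc]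
  constructor
  · intro h
    have e0 := h t 0 (by simp [hw])
    have e1 := h t 1 (by simp [hw])
    have e2 := h (!t) 0 (by simp [hw'])
    rw [add_zero] at e0 e2
    exact ⟨h0.symm.trans e0, h1.symm.trans e1, h2.symm.trans e2⟩
  · rintro ⟨e0, e1, e2⟩ d k hk
    by_cases hd : d = t
    · subst hd
      rw [hw] at hk
      interval_cases k
      · exact h0.trans e0
      · exact h1.trans e1
    · obtain rfl : d = !t := by revert hd; cases d <;> cases t <;> simp
      rw [hw'] at hk
      interval_cases k
      exact h2.trans e2

variable (s) in
/-- The labels at the corners of a vertex. -/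
def cornerLab (c : Fin 3) : ℕ := s.lab (s.corner c).1 (s.corner c).2

variable (s) in
/-- The numbers of strands directed outwards at the corners of a vertex. -/
def cornerOut (w : Bool × ℕ → ℕ) (c : Fin 3) : ℕ :=
  if (s.corner c).1 then s.cornerLab c - w (s.corner c) else w (s.corner c)

variable (s) in
/-- The amplitude of a piece. -/
noncomputable def amp (w : Bool × ℕ → ℕ) : ℂ :=
  match s.piece with
  | .turn t _ => (-1) ^ w (t, s.left.length)
  | .cross _ _ => 1
  | .vertex t _ _ _ => sgn (s.cornerOut w 2 + thruAt s.cornerLab 2 +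
      if t = false then (thruAt s.cornerLab 0 : ZMod 2) else 0) *
        vertexSum (thruAt s.cornerLab) (s.cornerOut w) / ∏ c, rt (s.cornerLab c) (s.cornerOut w c)

variable (s) in
/-- The weights agree along the edges in a slice. -/
def Compat (w : Bool × ℕ → ℕ) : Prop := ∀ a ∈ s.edgeArcs,
  if a.1.1 = a.2.1 then w a.1 + w a.2 = s.lab a.1.1 a.1.2 else w a.1 = w a.2

/-- A single term survives. Its binomial coefficient is cancelled by the norms of the complementary
weights at the two ends, which are equal by `rt_symm`. -/
theorem pieceSum_turn {t : Bool} {n : ℕ} (hs : s.piece = .turn t n) {w : Bool × ℕ → ℕ}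
    (hw : ∀ E, w E ≤ s.lab E.1 E.2) : s.pieceSum w / (s.pieceNorm w true * s.pieceNorm w false) =
      if w (t, s.left.length) + w (t, s.left.length + 1) = n then s.amp w else 0 := by
  have hwid : ∀ c, s.width c = if c = t then 2 else 0 := by
    intro c
    rw [width, hs, Piece.ends]
    split_ifs <;> rfl
  have l0 : s.lab t s.left.length = n := by
    rw [s.lab_piece_zero (by simp [hwid]), hs]
    simp [Piece.ends]
  have l1 : s.lab t (s.left.length + 1) = n := by
    rw [s.lab_piece (by simp [hwid]), hs]
    simp [Piece.ends]
  have h0 := hw (t, s.left.length)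
  have h1 := hw (t, s.left.length + 1)
  simp only [l0, l1] at h0 h1
  have hN : s.pieceNorm w true * s.pieceNorm w false =
      rt n (w (t, s.left.length)) * rt n (w (t, s.left.length + 1)) := by
    cases t <;> simp [pieceNorm, hwid, prod_range_succ, l0, l1]
  have hS : s.pieceSum w = ∑ x ∈ range (n + 1), (n.choose x : ℂ) * ((-1) ^ x *
      if x = w (t, s.left.length) ∧ n - x = w (t, s.left.length + 1) then 1 else 0) := by
    rw [pieceSum, sum_piFinset_three]
    simp [hs, Piece.size, Piece.arc, arcEnds, Fin.prod_univ_three, pieceCond_turn hs]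
  have hA : s.amp w = (-1) ^ w (t, s.left.length) := by
    rw [amp, hs]
  rw [hN, hS, hA]
  split_ifs with hc
  · rw [sum_eq_single (w (t, s.left.length))]
    · rw [if_pos ⟨rfl, by omega⟩, ← hc, show w (t, s.left.length + 1) =
        w (t, s.left.length) + w (t, s.left.length + 1) - w (t, s.left.length) by omega,
        show w (t, s.left.length) + (w (t, s.left.length) + w (t, s.left.length + 1) - w (t, s.left.length)) =
          w (t, s.left.length) + w (t, s.left.length + 1) by omega, rt_symm (by omega), rt_mul_self]
      have : (((w (t, s.left.length) + w (t, s.left.length + 1)).choose (w (t, s.left.length)) : ℕ) : ℂ) ≠ 0 :=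
        Nat.cast_ne_zero.2 (Nat.choose_pos (by omega)).ne'
      field_simp
    · intro x _ hx
      rw [if_neg (fun h => hx h.1), mul_zero, mul_zero]
    · intro h
      exact absurd (mem_range.2 (by omega)) h
  · rw [sum_eq_zero, zero_div]
    intro x hx
    rw [mem_range] at hx
    rw [if_neg (by omega), mul_zero, mul_zero]

theorem pieceSum_cross {a b : ℕ} (hs : s.piece = .cross a b) {w : Bool × ℕ → ℕ}
    (hw : ∀ E, w E ≤ s.lab E.1 E.2) : s.pieceSum w / (s.pieceNorm w true * s.pieceNorm w false) =
      if w (false, s.left.length) = w (true, s.left.length + 1) ∧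
        w (false, s.left.length + 1) = w (true, s.left.length) then s.amp w else 0 := by
  have hwid : ∀ c, s.width c = 2 := by
    intro c
    rw [width, hs, Piece.ends]
    split_ifs <;> rfl
  have l0 : ∀ c, s.lab c s.left.length = if c then b else a := by
    intro c
    rw [s.lab_piece_zero (by simp [hwid]), hs]
    cases c <;> simp [Piece.ends]
  have l1 : ∀ c, s.lab c (s.left.length + 1) = if c then a else b := by
    intro c
    rw [s.lab_piece (by simp [hwid]), hs]
    cases c <;> simp [Piece.ends]
  have h0 := hw (false, s.left.length)
  have h1 := hw (false, s.left.length + 1)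
  simp only [l0, l1] at h0 h1
  simp only [Bool.false_eq_true, if_false] at h0 h1
  have hN : s.pieceNorm w true * s.pieceNorm w false =
      (rt b (w (true, s.left.length)) * rt a (w (true, s.left.length + 1))) *
        (rt a (w (false, s.left.length)) * rt b (w (false, s.left.length + 1))) := by
    simp [pieceNorm, hwid, prod_range_succ, l0, l1]
  have hS : s.pieceSum w = ∑ x ∈ range (a + 1), ∑ y ∈ range (b + 1), (a.choose x : ℂ) * b.choose y *
      if (x = w (false, s.left.length) ∧ x = w (true, s.left.length + 1)) ∧
      y = w (false, s.left.length + 1) ∧ y = w (true, s.left.length) then 1 else 0 := by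
    rw [pieceSum, sum_piFinset_three]
    simp [hs, Piece.size, Piece.arc, arcEnds, Fin.prod_univ_three, pieceCond_cross hs]
  have hA : s.amp w = 1 := by
    rw [amp, hs]
  rw [hN, hS, hA]
  split_ifs with hc
  · rw [sum_eq_single (w (false, s.left.length)), sum_eq_single (w (false, s.left.length + 1))]
    · rw [if_pos ⟨⟨rfl, hc.1⟩, rfl, hc.2⟩, ← hc.1, ← hc.2]
      have n1 := rt_ne_zero h0
      have n2 := rt_ne_zero h1
      rw [← rt_mul_self, ← rt_mul_self]
      field_simp
    · intro y _ hy
      rw [if_neg (fun h => hy h.2.1), mul_zero]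
    · intro h
      exact absurd (mem_range.2 (by omega)) h
    · intro x _ hx
      exact sum_eq_zero fun y _ => by rw [if_neg (fun h => hx h.1.1), mul_zero]
    · intro h
      exact absurd (mem_range.2 (by omega)) h
  · rw [sum_eq_zero, zero_div]
    intro x _
    refine sum_eq_zero fun y _ => ?_
    rw [if_neg, mul_zero]
    rintro ⟨⟨rfl, h2⟩, rfl, h3⟩
    exact hc ⟨h2, h3⟩

end Slice

end Spin

/-! ### Amplitudes of vertices -/

namespace Spin

open Finset

theorem vertexSum_cond_iff (z G f : Fin 3 → ℕ) : (∀ c, G (c + 1) + f (c + 1) = f c + z (c + 1)) ↔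
    G 1 + f 1 = f 0 + z 1 ∧ G 2 + f 2 = f 1 + z 2 ∧ G 0 + f 0 = f 2 + z 0 := by
  constructor
  · intro h
    exact ⟨h 0, h 1, h 2⟩
  · rintro ⟨h0, h1, h2⟩ c
    fin_cases c
    · exact h0
    · exact h1
    · exact h2

/-- The sum over the strands at a vertex with two edges below and one above. -/
theorem vertexSum_eq_of_lower {Z z G w : Fin 3 → ℕ} (hz : z 0 = Z 1 ∧ z 1 = Z 2 ∧ z 2 = Z 0)
    (hG : G 0 = w 0 ∧ G 1 = w 1 ∧ G 2 + w 2 = Z 0 + Z 2) :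
    ∑ x ∈ Fintype.piFinset fun k => range (Z k + 1), (∏ k, ((Z k).choose (x k) : ℂ)) * ((-1) ^ x 1 *
      if x 0 + x 1 = w 0 ∧ Z 1 - x 1 + x 2 = w 1 ∧ x 0 + x 2 = w 2 then 1 else 0) =
    (-1) ^ (G 2 + z 2 + z 0) * vertexSum z G := by
  unfold vertexSum
  rw [mul_sum]
  -- `x` counts downward strands at the first corner of each bundle, `f` strands from a corner to
  -- the next one. With two edges below, the strands from the corner `0` to `1` start upwards, those
  -- from `1` to `2` run upwards, and those from `2` to `0` run downwards.
  refine sum_bij' (fun x _ => ![Z 1 - x 1, Z 2 - x 2, x 0]) (fun f _ => ![f 2, Z 1 - f 0, Z 2 - f 1])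
    ?_ ?_ ?_ ?_ ?_
  · intro x hx
    simp only [Fintype.mem_piFinset, mem_range, Fin.forall_fin_succ, Fin.isValue, Matrix.cons_val_zero,
      Matrix.cons_val_succ, IsEmpty.forall_iff, and_true, Fin.succ_zero_eq_one, Fin.succ_one_eq_two] at hx ⊢
    omega
  · intro x hx
    simp only [Fintype.mem_piFinset, mem_range, Fin.forall_fin_succ, Fin.isValue, Matrix.cons_val_zero,
      Matrix.cons_val_succ, IsEmpty.forall_iff, and_true, Fin.succ_zero_eq_one, Fin.succ_one_eq_two] at hx ⊢
    omega
  · intro x hx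
    have h := fun k => mem_range.1 (Fintype.mem_piFinset.1 hx k)
    have h1 := h 1
    have h2 := h 2
    funext k
    fin_cases k <;> simp <;> omega
  · intro x hx
    have h := fun k => mem_range.1 (Fintype.mem_piFinset.1 hx k)
    have h1 := h 0
    have h2 := h 1
    funext k
    fin_cases k <;> simp <;> omega
  · intro x hx
    have h := fun k => mem_range.1 (Fintype.mem_piFinset.1 hx k)
    have h0 := h 0
    have h1 := h 1
    have h2 := h 2
    simp only [vertexSum_cond_iff]
    simp only [Fin.sum_univ_three, Fin.prod_univ_three, Matrix.cons_val_zero, Matrix.cons_val_one,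
      Matrix.cons_val, hz.1, hz.2.1, hz.2.2]
    by_cases hc : x 0 + x 1 = w 0 ∧ Z 1 - x 1 + x 2 = w 1 ∧ x 0 + x 2 = w 2
    · rw [if_pos hc, if_pos (by omega), Nat.choose_symm (by omega), Nat.choose_symm (by omega),
        neg_one_pow_congr (n := G 2 + Z 0 + Z 1 + (Z 1 - x 1 + (Z 2 - x 2) + x 0))
          (by rw [Nat.even_iff, Nat.even_iff]; omega), pow_add]
      ring
    · rw [if_neg hc, if_neg (by omega)]
      simp

/-- The sum over the strands at a vertex with two edges above and one below. -/
theorem vertexSum_eq_of_upper {Z z G w : Fin 3 → ℕ} (hz : z 0 = Z 1 ∧ z 1 = Z 2 ∧ z 2 = Z 0)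
    (hG : G 0 + w 0 = Z 0 + Z 1 ∧ G 1 + w 1 = Z 1 + Z 2 ∧ G 2 = w 2) :
    ∑ x ∈ Fintype.piFinset fun k => range (Z k + 1), (∏ k, ((Z k).choose (x k) : ℂ)) * ((-1) ^ x 1 *
      if x 0 + x 1 = w 0 ∧ Z 1 - x 1 + x 2 = w 1 ∧ x 0 + x 2 = w 2 then 1 else 0) =
    (-1) ^ (G 2 + z 2) * vertexSum z G := by
  unfold vertexSum
  rw [mul_sum]
  -- With two edges above all these directions are reversed.
  refine sum_bij' (fun x _ => ![x 1, x 2, Z 0 - x 0]) (fun f _ => ![Z 0 - f 2, f 0, f 1])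
    ?_ ?_ ?_ ?_ ?_
  · intro x hx
    simp only [Fintype.mem_piFinset, mem_range, Fin.forall_fin_succ, Fin.isValue, Matrix.cons_val_zero,
      Matrix.cons_val_succ, IsEmpty.forall_iff, and_true, Fin.succ_zero_eq_one, Fin.succ_one_eq_two] at hx ⊢
    omega
  · intro x hx
    simp only [Fintype.mem_piFinset, mem_range, Fin.forall_fin_succ, Fin.isValue, Matrix.cons_val_zero,
      Matrix.cons_val_succ, IsEmpty.forall_iff, and_true, Fin.succ_zero_eq_one, Fin.succ_one_eq_two] at hx ⊢
    omega
  · intro x hx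
    have h := fun k => mem_range.1 (Fintype.mem_piFinset.1 hx k)
    have h1 := h 0
    funext k
    fin_cases k <;> simp <;> omega
  · intro x hx
    have h := fun k => mem_range.1 (Fintype.mem_piFinset.1 hx k)
    have h1 := h 2
    funext k
    fin_cases k <;> simp <;> omega
  · intro x hx
    have h := fun k => mem_range.1 (Fintype.mem_piFinset.1 hx k)
    have h0 := h 0
    have h1 := h 1
    have h2 := h 2
    simp only [vertexSum_cond_iff]
    simp only [Fin.sum_univ_three, Fin.prod_univ_three, Matrix.cons_val_zero, Matrix.cons_val_one,
      Matrix.cons_val, hz.1, hz.2.1, hz.2.2]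
    by_cases hc : x 0 + x 1 = w 0 ∧ Z 1 - x 1 + x 2 = w 1 ∧ x 0 + x 2 = w 2
    · rw [if_pos hc, if_pos (by omega), Nat.choose_symm (by omega),
        neg_one_pow_congr (n := G 2 + Z 0 + (x 1 + x 2 + (Z 0 - x 0)))
          (by rw [Nat.even_iff, Nat.even_iff]; omega), pow_add]
      ring
    · rw [if_neg hc, if_neg (by omega)]
      simp

namespace Slice

variable {s : Slice}

/-- Downwards means outwards for an edge below the vertex and inwards for an edge above it. Hence
the outward numbers are the weights or their complements, which does not affect the norms, and the
two drawings of a vertex lead to the same `vertexSum` with different parities. -/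
theorem pieceSum_vertex {t : Bool} {a b c : ℕ} (hs : s.piece = .vertex t a b c)
    (hadm : AdmissibleTriple a b c) {w : Bool × ℕ → ℕ} (hw : ∀ E, w E ≤ s.lab E.1 E.2) :
    s.pieceSum w / (s.pieceNorm w true * s.pieceNorm w false) = s.amp w := by
  obtain ⟨la, lb, lc, wt, wt'⟩ := s.vertex_lab hs
  obtain ⟨ha, hb, hc⟩ := hadm.thru_add
  have k0 : s.cornerLab 0 = a := by rw [cornerLab, s.corner_eq hs]; exact la
  have k1 : s.cornerLab 1 = b := by rw [cornerLab, s.corner_eq hs]; exact lb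
  have k2 : s.cornerLab 2 = c := by rw [cornerLab, s.corner_eq hs]; exact lc
  have h0 := hw (t, s.left.length)
  have h1 := hw (t, s.left.length + 1)
  have h2 := hw (!t, s.left.length)
  simp only [la, lb, lc] at h0 h1 h2
  have hN : s.pieceNorm w true * s.pieceNorm w false =
      rt a (w (t, s.left.length)) * rt b (w (t, s.left.length + 1)) * rt c (w (!t, s.left.length)) := by
    cases t
    · simp only [Bool.not_false] at *
      simp [pieceNorm, wt, wt', prod_range_succ, la, lb, lc, mul_comm]
    · simp only [Bool.not_true] at *
      simp [pieceNorm, wt, wt', prod_range_succ, la, lb, lc]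
  have hS : s.pieceSum w = ∑ x ∈ Fintype.piFinset fun k => range (s.piece.size k + 1),
      (∏ k, ((s.piece.size k).choose (x k) : ℂ)) * ((-1) ^ x 1 *
      if x 0 + x 1 = ![w (t, s.left.length), w (t, s.left.length + 1), w (!t, s.left.length)] 0 ∧
        s.piece.size 1 - x 1 + x 2 =
          ![w (t, s.left.length), w (t, s.left.length + 1), w (!t, s.left.length)] 1 ∧
        x 0 + x 2 = ![w (t, s.left.length), w (t, s.left.length + 1), w (!t, s.left.length)] 2
          then 1 else 0) := by
    rw [pieceSum]
    refine sum_congr rfl fun x _ => ?_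
    simp only [pieceCond_vertex hs]
    congr 1
    rw [Fin.prod_univ_three, hs]
    cases t <;> simp [Piece.arc, arcEnds, legArc, Piece.size]
  have hz : thruAt s.cornerLab 0 = s.piece.size 1 ∧ thruAt s.cornerLab 1 = s.piece.size 2 ∧
      thruAt s.cornerLab 2 = s.piece.size 0 := by
    rw [hs]
    unfold thruAt
    refine ⟨?_, ?_, ?_⟩
    · change thru (s.cornerLab 2) (s.cornerLab 0) (s.cornerLab 1) = thru c a b
      rw [k0, k1, k2]
    · change thru (s.cornerLab 0) (s.cornerLab 1) (s.cornerLab 2) = thru a b c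
      rw [k0, k1, k2]
    · change thru (s.cornerLab 1) (s.cornerLab 2) (s.cornerLab 0) = thru b a c
      rw [k0, k1, k2, thru, thru, add_comm]
  have z0 : s.piece.size 0 = thru b a c := by rw [hs]; rfl
  have z1 : s.piece.size 1 = thru c a b := by rw [hs]; rfl
  have z2 : s.piece.size 2 = thru a b c := by rw [hs]; rfl
  have g0 : s.cornerOut w 0 = if t then a - w (t, s.left.length) else w (t, s.left.length) := by
    rw [cornerOut, k0, s.corner_eq hs]
    rfl
  have g1 : s.cornerOut w 1 = if t then b - w (t, s.left.length + 1) else w (t, s.left.length + 1) := by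
    rw [cornerOut, k1, s.corner_eq hs]
    rfl
  have g2 : s.cornerOut w 2 = if !t then c - w (!t, s.left.length) else w (!t, s.left.length) := by
    rw [cornerOut, k2, s.corner_eq hs]
    rfl
  have hR : rt a (w (t, s.left.length)) * rt b (w (t, s.left.length + 1)) * rt c (w (!t, s.left.length)) =
      ∏ c, rt (s.cornerLab c) (s.cornerOut w c) := by
    rw [Fin.prod_univ_three, k0, k1, k2, g0, g1, g2]
    cases t
    · simp only [Bool.not_false, if_true, Bool.false_eq_true, if_false] at h2 ⊢
      rw [rt_symm h2]
    · simp only [Bool.not_true, if_true, Bool.false_eq_true, if_false] at h0 h1 ⊢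
      rw [rt_symm h0, rt_symm h1]
  rw [hN, hR, hS, amp, hs]
  simp only
  congr 1
  cases t
  · rw [← hs, vertexSum_eq_of_lower (G := s.cornerOut w) hz, ← sgn_natCast]
    · simp
    · simp only [Bool.not_false, if_true, Bool.false_eq_true, if_false] at *
      refine ⟨g0, g1, ?_⟩
      simp only [Matrix.cons_val]
      omega
  · rw [← hs, vertexSum_eq_of_upper (G := s.cornerOut w) hz, ← sgn_natCast]
    · simp
    · simp only [Bool.not_true, if_true, Bool.false_eq_true, if_false] at *
      simp only [Matrix.cons_val]
      omega

open Classical in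
/-- The matrix entries of a slice. -/
theorem entry_eq_amp (hadm : s.piece.Admissible) (ν : Wt (s.ends true)) (μ : Wt (s.ends false)) :
    s.entry ν μ = if s.Compat (weights ν μ) then s.amp (weights ν μ) else 0 := by
  have hw := weights_le ν μ
  rw [entry_eq_pieceSum hadm]
  have hside : s.SideCompat (weights ν μ) ↔ ∀ x ∈ s.sideEdgeArcs,
      if x.1.1 = x.2.1 then weights ν μ x.1 + weights ν μ x.2 = s.lab x.1.1 x.1.2
        else weights ν μ x.1 = weights ν μ x.2 := by
    simp only [mem_sideEdgeArcs]
    constructor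
    · rintro ⟨h1, h2⟩ x (⟨j, hj, rfl⟩ | ⟨j, hj, rfl⟩)
      · exact h1 ⟨j, hj⟩
      · exact h2 ⟨j, hj⟩
    · intro h
      exact ⟨fun j => h _ (.inl ⟨j, j.2, rfl⟩), fun j => h _ (.inr ⟨j, j.2, rfl⟩)⟩
  have hcomp : s.Compat (weights ν μ) ↔ s.SideCompat (weights ν μ) ∧
      ∀ x ∈ s.piece.edgeArcs s.left.length, if x.1.1 = x.2.1 then
        weights ν μ x.1 + weights ν μ x.2 = s.lab x.1.1 x.1.2
        else weights ν μ x.1 = weights ν μ x.2 := by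
    rw [hside, Compat, edgeArcs]
    simp only [List.mem_append, or_imp, forall_and]
  rw [hcomp]
  by_cases h : s.SideCompat (weights ν μ)
  · simp only [h, if_true, true_and]
    cases hs : s.piece with
    | turn t n =>
      have l0 : s.lab t s.left.length = n := by
        rw [s.lab_piece_zero (by simp [width, hs, Piece.ends]), hs]
        simp [Piece.ends]
      rw [pieceSum_turn hs hw]
      simp [Piece.edgeArcs, l0]
    | cross a b =>
      rw [pieceSum_cross hs hw]
      simp [Piece.edgeArcs]
    | vertex t a b c =>
      rw [pieceSum_vertex hs (by rwa [hs] at hadm) hw]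
      simp [Piece.edgeArcs]
  · simp [h]

end Slice

end Spin

namespace Spin

open Finset

namespace SpinNet

/-! ### The state sum -/

/-- The states of a network: weights between any two slices, and at both ends. -/
def States : {A B : List ℕ} → SpinNet A B → Type
  | _, _, .nil A => Wt A
  | _, _, .cons s _ T => Wt (s.ends false) × T.States

noncomputable instance instFintypeStates : {A B : List ℕ} → (T : SpinNet A B) → Fintype T.States
  | _, _, .nil A => inferInstanceAs (Fintype (Wt A))
  | _, _, .cons s _ T =>
      have := instFintypeStates T
      inferInstanceAs (Fintype (Wt (s.ends false) × T.States))

/-- The weights of a state at the bottom. -/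
def bottom : {A B : List ℕ} → (T : SpinNet A B) → T.States → Wt A
  | _, _, .nil _, m => m
  | _, _, .cons _ _ _, m => m.1

/-- The weights of a state at the top. -/
def top : {A B : List ℕ} → (T : SpinNet A B) → T.States → Wt B
  | _, _, .nil _, m => m
  | _, _, .cons _ _ T, m => T.top m.2

/-- The contribution of a state to the function of a network. -/
noncomputable def stateAmp : {A B : List ℕ} → (T : SpinNet A B) → T.States → ℂ
  | _, _, .nil _, _ => 1
  | _, _, .cons s _ T, m => s.entry (T.bottom m.2) m.1 * T.stateAmp m.2

theorem coeff_fn {A B : List ℕ} (T : SpinNet A B) (f : SymTensor A) (ν : Wt B) :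
    coeff (T.fn f).1 ν =
      ∑ m : T.States, if T.top m = ν then T.stateAmp m * coeff f.1 (T.bottom m) else 0 := by
  induction T with
  | nil A =>
    change coeff f.1 ν = ∑ m : Wt A, if m = ν then 1 * coeff f.1 m else 0
    simp
  | cons s hs T ih =>
    change coeff (T.fn (s.fn f)).1 ν = ∑ m : Wt (s.ends false) × T.States,
      if T.top m.2 = ν then s.entry (T.bottom m.2) m.1 * T.stateAmp m.2 * coeff f.1 m.1 else 0
    rw [ih, Fintype.sum_prod_type, sum_comm]
    refine sum_congr rfl fun m _ => ?_
    split_ifs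
    · rw [s.coeff_fn, mul_sum]
      refine sum_congr rfl fun μ _ => ?_
      ring
    · simp

/-- The weight of a state at a place on a line. -/
def downsAt : {A B : List ℕ} → (T : SpinNet A B) → T.States → ℕ → ℕ → ℕ
  | A, _, .nil _, m, _, j => Wt.get (A := A) m j
  | _, _, .cons _ _ _, m, 0, j => m.1.get j
  | _, _, .cons _ _ _, m, 1, j => m.1.get j
  | _, _, .cons _ _ T, m, h + 2, j => T.downsAt m.2 h j

theorem downsAt_zero {A B : List ℕ} (T : SpinNet A B) (m : T.States) (j : ℕ) :
    T.downsAt m 0 j = (T.bottom m).get j := by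
  cases T <;> rfl

theorem downsAt_top {A B : List ℕ} (T : SpinNet A B) (m : T.States) (j : ℕ) :
    T.downsAt m T.topLine j = (T.top m).get j := by
  induction T with
  | nil A => rfl
  | cons s hs T ih =>
    rw [topLine_cons]
    exact ih m.2

theorem downsAt_oppLine {A B : List ℕ} (T : SpinNet A B) (m : T.States) (h j : ℕ) :
    T.downsAt m (oppLine h) j = T.downsAt m h j := by
  induction T generalizing h with
  | nil A => rfl
  | cons s hs T ih =>
    rcases h with _ | _ | h
    · rfl
    · rfl
    · have : oppLine (h + 2) = oppLine h + 2 := by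
        unfold oppLine
        split_ifs <;> omega
      rw [this]
      exact ih m.2 h

theorem downsAt_le {A B : List ℕ} (T : SpinNet A B) (m : T.States) {h : ℕ} (hh : h ≤ T.topLine) (j : ℕ) :
    T.downsAt m h j ≤ T.label (h, j) := by
  induction T generalizing h with
  | nil A =>
    rw [topLine_nil] at hh
    interval_cases h <;> exact Wt.get_le (A := A) m j
  | cons s hs T ih =>
    rw [topLine_cons] at hh
    rcases h with _ | _ | h
    · exact m.1.get_le j
    · exact m.1.get_le j
    · exact ih m.2 (h := h) (by omega)

theorem states_ext {A B : List ℕ} (T : SpinNet A B) {m m' : T.States} (H : ∀ h, h < T.topLine →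
    ∀ j < (T.lines.getD h []).length, T.downsAt m h j = T.downsAt m' h j) : m = m' := by
  induction T with
  | nil A => exact Wt.ext_get (H 0 (by rw [topLine_nil]; omega))
  | cons s hs T ih =>
    rw [topLine_cons] at H
    refine Prod.ext (Wt.ext_get (H 0 (by omega))) (ih fun h hh => H (h + 2) (by omega))

/-- The state with given weights. -/
def ofDowns : {A B : List ℕ} → (T : SpinNet A B) → (ℕ → ℕ → ℕ) → T.States
  -- The minimum only serves to stay within the range of weights; it has no effect on values that do
  -- not exceed the labels.
  | _, _, .nil A, d => fun j : Fin A.length => (⟨min (d 0 j) A[j], by omega⟩ : Fin (A[j] + 1))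
  | _, _, .cons s _ T, d => (fun j => ⟨min (d 0 j) (s.ends false)[j], by omega⟩,
      T.ofDowns fun h => d (h + 2))

theorem downsAt_ofDowns {A B : List ℕ} (T : SpinNet A B) {d : ℕ → ℕ → ℕ} {h : ℕ} (hh : h % 2 = 0)
    (ht : h < T.topLine) {j : ℕ} (hj : j < (T.lines.getD h []).length) (hd : d h j ≤ T.label (h, j)) :
    T.downsAt (T.ofDowns d) h j = d h j := by
  induction T generalizing h d with
  | nil A =>
    rw [topLine_nil] at ht
    obtain rfl : h = 0 := by omega
    refine (Wt.get_of_lt (A := A) _ hj).trans ?_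
    refine min_eq_left ?_
    rw [label, line_zero] at hd
    exact hd.trans_eq (List.getD_eq_getElem _ _ hj)
  | cons s hs T ih =>
    rw [topLine_cons] at ht
    rcases h with _ | _ | h
    · refine (Wt.get_of_lt _ hj).trans ?_
      refine min_eq_left ?_
      rw [label, line_zero] at hd
      exact hd.trans_eq (List.getD_eq_getElem _ _ hj)
    · omega
    · exact ih (d := fun h => d (h + 2)) (h := h) (by omega) (by omega) hj hd

/-- The weights of a state on the two lines that bound a layer. -/
def layerWeights {A B : List ℕ} (T : SpinNet A B) (m : T.States) (h : ℕ) (E : Bool × ℕ) : ℕ :=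
  T.downsAt m (h + E.1.toNat) E.2

open Classical in
/-- The contribution of a layer to the amplitude of a state. -/
noncomputable def layerAmp {A B : List ℕ} (T : SpinNet A B) (m : T.States) (h : ℕ) : ℂ :=
  match T.sliceAt h with
  | none => 1
  | some s => if s.Compat (T.layerWeights m h) then s.amp (T.layerWeights m h) else 0

theorem stateAmp_eq_prod {A B : List ℕ} (T : SpinNet A B) (m : T.States) :
    T.stateAmp m = ∏ h ∈ range T.topLine, T.layerAmp m h := by
  classical
  induction T with
  | nil A =>
    rw [topLine_nil, prod_range_one]
    rfl
  | cons s hs T ih =>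
    rw [topLine_cons, prod_range_succ', prod_range_succ', stateAmp, ih, s.entry_eq_amp hs]
    have h0 : (SpinNet.cons s hs T).layerAmp m 0 = 1 := rfl
    have hw : (SpinNet.cons s hs T).layerWeights m 1 = Slice.weights (T.bottom m.2) m.1 := by
      funext E
      obtain ⟨c, j⟩ := E
      cases c
      · rfl
      · exact T.downsAt_zero m.2 j
    have h1 : (SpinNet.cons s hs T).layerAmp m 1 = if s.Compat (Slice.weights (T.bottom m.2) m.1) then
        s.amp (Slice.weights (T.bottom m.2) m.1) else 0 := by
      rw [← hw]
      rfl
    have h2 : ∀ h, (SpinNet.cons s hs T).layerAmp m (h + 1 + 1) = T.layerAmp m.2 h := by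
      intro h
      have hw : (SpinNet.cons s hs T).layerWeights m (h + 1 + 1) = T.layerWeights m.2 h := by
        funext E
        unfold layerWeights
        rw [show h + 1 + 1 + E.1.toNat = h + E.1.toNat + 2 by omega]
        rfl
      unfold layerAmp
      rw [hw]
      rfl
    rw [h0, h1, mul_one, mul_comm]
    simp only [h2]

end SpinNet

end Spin

/-! ### States as flows -/

namespace Spin

open Finset

variable {A B : List ℕ}

theorem Slice.edgeArcs_turn (s : Slice) {x : Arc ℕ} (hx : x ∈ s.edgeArcs) (h : x.1.1 = x.2.1) :
    ∃ n, s.piece = .turn x.1.1 n ∧ x.1.2 = s.left.length := by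
  rw [edgeArcs, List.mem_append] at hx
  rcases hx with hx | hx
  · have := s.sideEdgeArcs_prop hx
    rw [this.2.1, this.2.2] at h
    cases h
  · obtain ⟨L, P, R⟩ := s
    cases P with
    | turn t n =>
      simp only [Piece.edgeArcs, List.mem_singleton] at hx
      subst hx
      exact ⟨n, rfl, rfl⟩
    | cross a b =>
      simp only [Piece.edgeArcs, List.mem_cons, List.not_mem_nil, or_false] at hx
      rcases hx with rfl | rfl <;> cases h
    | vertex t a b c => simp [Piece.edgeArcs] at hx

namespace SpinNet

variable {T : SpinNet A B}

/-- The flow of a state. -/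
def flowOf (m : T.States) (p : T.EdgePoint) : ℕ :=
  if p.1.1 % 2 = 1 then T.downsAt m p.1.1 p.1.2 else T.label p.1 - T.downsAt m p.1.1 p.1.2

theorem downs_flowOf (m : T.States) (p : T.EdgePoint) :
    downs (flowOf m) p = T.downsAt m p.1.1 p.1.2 := by
  have := T.downsAt_le m (T.line_le p.2) p.1.2
  unfold downs flowOf
  split_ifs
  · rfl
  · change T.downsAt m p.1.1 p.1.2 ≤ T.label p.1 at this
    omega

theorem label_position {h : ℕ} {s : Slice} (hs : T.sliceAt h = some s) (E : Bool × ℕ) :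
    T.label (position h E) = s.lab E.1 E.2 := by
  rw [label, show (position h E).1 = h + E.1.toNat from rfl, T.line_slice hs]
  rfl

theorem flowOf_position (m : T.States) {h : ℕ} {s : Slice} (hs : T.sliceAt h = some s) {p : T.EdgePoint}
    {E : Bool × ℕ} (hp : p.1 = position h E) : flowOf m p =
      if E.1 then s.lab E.1 E.2 - T.layerWeights m h E else T.layerWeights m h E := by
  have hh := (T.sliceAt_lt hs).1
  have h1 := T.label_position hs E
  rw [← hp] at h1
  unfold flowOf
  rw [h1, hp]
  obtain ⟨c, j⟩ := E
  cases c
  · rw [if_pos (show (position h (false, j)).1 % 2 = 1 from hh)]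
    rfl
  · rw [if_neg (show ¬ (position h (true, j)).1 % 2 = 1 by
      change ¬ (h + 1) % 2 = 1
      omega)]
    rfl

theorem layerWeights_le (m : T.States) {h : ℕ} {s : Slice} (hs : T.sliceAt h = some s) (E : Bool × ℕ) :
    T.layerWeights m h E ≤ s.lab E.1 E.2 := by
  have h1 := T.sliceAt_lt hs
  have h2 := Bool.toNat_le E.1
  refine (T.downsAt_le m (by omega) E.2).trans_eq (T.label_position hs E)

theorem flowOf_a (m : T.States) (p : T.EdgePoint) :
    flowOf m (T.edgeWiring.a p) + flowOf m p = T.label p.1 := by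
  obtain ⟨h1, h2⟩ := edge_line_a p
  have h3 := T.downsAt_le m (T.line_le p.2) p.1.2
  change _ ≤ T.label p.1 at h3
  have h4 : T.downsAt m (T.edgeWiring.a p).1.1 (T.edgeWiring.a p).1.2 = T.downsAt m p.1.1 p.1.2 :=
    T.downsAt_oppLine m p.1.1 p.1.2
  unfold flowOf
  rw [h1, h4]
  split_ifs <;> omega

/-- Weights agree along a monotone arc and add up to the label along a turn. In terms of directions
away from the slice both conditions say that the numbers at the two ends add up to the label.
Permutation layers impose nothing, since a state has the same weights on both of their lines. -/
theorem isFlow_flowOf_iff (m : T.States) : T.IsFlow (flowOf m) ↔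
    ∀ h s, T.sliceAt h = some s → s.Compat (T.layerWeights m h) := by
  constructor
  · intro hG h s hs a ha
    have hpr := s.edgeArcs_prop ha
    let p : T.EdgePoint := ⟨position h a.1, (T.edgeValid_iff hs _).2 hpr.valid_fst⟩
    have hb : (T.edgeWiring.b p).1 = position h a.2 := by
      rw [edgeWiring_b, T.sliceMate_position _ hs, hpr.mate_fst]
    have hne : T.edgeWiring.b p ≠ p := by
      intro h'
      rw [h'] at hb
      have := (T.sliceAt_lt hs).1
      exact hpr.ne (position_injective this this hb).2
    have h1 := hG.b p hne
    have h2 := layerWeights_le m hs a.1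
    have h3 := layerWeights_le m hs a.2
    rw [flowOf_position m hs hb, flowOf_position m hs (p := p) rfl, T.label_position hs] at h1
    rw [← hpr.lab_eq] at h1 h3
    cases h4 : a.1.1 <;> cases h5 : a.2.1 <;> simp [h4, h5] at h1 h2 h3 ⊢ <;> omega
  · intro hc
    refine ⟨flowOf_a m, fun p hp => ?_⟩
    rcases position_cases p with ⟨-, h⟩ | ⟨h, s, E, hs, hE, hv, hh, hadm, -, -⟩
    · exact absurd h hp
    have hb := edgeWiring_b p
    rw [hE, T.sliceMate_position _ hs] at hb
    have h2 := layerWeights_le m hs E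
    have h3 := layerWeights_le m hs (s.edgeMate E)
    rw [flowOf_position m hs hb, flowOf_position m hs hE, hE, T.label_position hs]
    rcases s.edgeMate_mem hv with h4 | h4 | h4
    · refine absurd (Subtype.ext (hb.trans ?_)) hp
      rw [h4.2, hE]
    · have h5 := hc h s hs _ h4
      have h6 := (s.edgeArcs_prop h4).lab_eq
      simp only at h5 h6
      rw [← h6] at h3 ⊢
      cases h7 : E.1 <;> cases h8 : (s.edgeMate E).1 <;> simp [h7, h8] at h2 h3 h5 ⊢ <;> omega
    · have h5 := hc h s hs _ h4
      have h6 := (s.edgeArcs_prop h4).lab_eq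
      simp only at h5 h6
      rw [h6] at h3 h5 ⊢
      cases h7 : E.1 <;> cases h8 : (s.edgeMate E).1 <;> simp [h7, h8] at h2 h3 h5 ⊢ <;> omega

theorem edgeTurn_iff {h : ℕ} {s : Slice} (hs : T.sliceAt h = some s) {p : T.EdgePoint}
    {E : Bool × ℕ} (hE : p.1 = position h E) :
    EdgeTurn p ↔ ∃ n, s.piece = .turn E.1 n ∧ E.2 = s.left.length := by
  have hh := (T.sliceAt_lt hs).1
  have hb := edgeWiring_b p
  rw [hE, T.sliceMate_position _ hs] at hb
  have hv : s.EdgeValid E := by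
    have := p.2
    rw [hE] at this
    exact (T.edgeValid_iff hs E).1 this
  constructor
  · rintro ⟨hne, hl, hlt⟩
    have hside : E.1 = (s.edgeMate E).1 := by
      rw [hb, hE] at hl
      simp only [position, Nat.add_left_cancel_iff] at hl
      revert hl
      cases E.1 <;> cases (s.edgeMate E).1 <;> simp
    rcases s.edgeMate_mem hv with h4 | h4 | h4
    · refine absurd (Subtype.ext (hb.trans ?_)) hne
      rw [h4.2, hE]
    · exact s.edgeArcs_turn h4 hside
    · have := (s.edgeArcs_prop h4).lt hside.symm
      rw [hb, hE] at hlt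
      change E.2 < (s.edgeMate E).2 at hlt
      simp only at this
      omega
  · rintro ⟨n, hn, hl⟩
    have hmem : ((E.1, s.left.length), (E.1, s.left.length + 1)) ∈ s.edgeArcs := by
      rw [Slice.edgeArcs, hn]
      simp [Piece.edgeArcs]
    have hm := (s.edgeArcs_prop hmem).mate_fst
    rw [show ((E.1, s.left.length) : Bool × ℕ) = E from Prod.ext rfl hl.symm] at hm
    rw [hm] at hb
    refine ⟨fun h' => ?_, ?_, ?_⟩
    · have h1 := hb
      rw [h', hE] at h1
      have := congrArg Prod.snd h1
      simp only [position] at this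
      omega
    · rw [hb, hE]
      rfl
    · rw [hb, hE]
      simp only [position]
      omega

/-- The number of strands with letter `1` at the left end of the cup or cap of an edge in a layer. -/
def turnNum (T : SpinNet A B) (m : T.States) (h : ℕ) : ℕ :=
  match T.sliceAt h with
  | some ⟨L, .turn t _, _⟩ => T.layerWeights m h (t, L.length)
  | _ => 0

/-- The amplitude of the vertex in a layer. -/
noncomputable def vertexNum (T : SpinNet A B) (m : T.States) (h : ℕ) : ℂ :=
  match T.sliceAt h with
  | some ⟨L, .vertex t a b c, R⟩ => Slice.amp ⟨L, .vertex t a b c, R⟩ (T.layerWeights m h)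
  | _ => 1

/-- A slice contains at most one cup or cap of an edge, so the sum over left ends of turns is a sum
over layers. -/
theorem turnDowns_flowOf (m : T.States) :
    turnDowns (flowOf m) = ∑ h ∈ range T.topLine, T.turnNum m h := by
  classical
  unfold turnDowns
  refine sum_of_injOn (fun p => sliceLayer p.1.1) ?_ ?_ ?_ ?_
  · intro p hp q hq hpq
    simp only [coe_filter, mem_univ, true_and, Set.mem_ofPred_eq] at hp hq
    rcases position_cases p with ⟨-, h⟩ | ⟨h, s, E, hs, hE, hv, hh, hadm, -, -⟩
    · exact absurd h hp.1
    rcases position_cases q with ⟨-, h'⟩ | ⟨h', s', E', hs', hE', hv', hh', hadm', -, -⟩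
    · exact absurd h' hq.1
    simp only [hE, hE', (sliceLayer_position hh E).1, (sliceLayer_position hh' E').1] at hpq
    subst hpq
    obtain rfl : s = s' := Option.some.inj (hs.symm.trans hs')
    obtain ⟨n, hn, hl⟩ := (edgeTurn_iff hs hE).1 hp
    obtain ⟨n', hn', hl'⟩ := (edgeTurn_iff hs hE').1 hq
    rw [hn] at hn'
    simp only [Piece.turn.injEq] at hn'
    refine Subtype.ext ?_
    rw [hE, hE', show E = E' from Prod.ext hn'.1 (hl.trans hl'.symm)]
  · intro p hp
    simp only [coe_filter, mem_univ, true_and, Set.mem_ofPred_eq] at hp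
    rcases position_cases p with ⟨-, h⟩ | ⟨h, s, E, hs, hE, hv, hh, hadm, -, -⟩
    · exact absurd h hp.1
    have := T.sliceAt_lt hs
    simp only [hE, (sliceLayer_position hh E).1, coe_range, Set.mem_Iio]
    omega
  · intro h _ hn
    unfold turnNum
    split
    · next L t n R hs =>
      refine absurd ?_ hn
      have hv : (⟨L, .turn t n, R⟩ : Slice).EdgeValid (t, L.length) := by
        simp [Slice.EdgeValid, Slice.ends, Piece.ends]
      let p : T.EdgePoint := ⟨position h (t, L.length), (T.edgeValid_iff hs _).2 hv⟩
      refine ⟨p, ?_, (sliceLayer_position (T.sliceAt_lt hs).1 (t, L.length)).1⟩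
      simp only [coe_filter, mem_univ, true_and, Set.mem_ofPred_eq]
      exact (edgeTurn_iff hs (p := p) rfl).2 ⟨n, rfl, rfl⟩
    · rfl
  · intro p hp
    simp only [mem_filter, mem_univ, true_and] at hp
    rcases position_cases p with ⟨-, h⟩ | ⟨h, s, E, hs, hE, hv, hh, hadm, -, -⟩
    · exact absurd h hp.1
    obtain ⟨n, hn, hl⟩ := (edgeTurn_iff hs hE).1 hp
    obtain ⟨L, P, R⟩ := s
    simp only at hn hl
    subst hn
    rw [downs_flowOf, hE, (sliceLayer_position hh E).1, turnNum, hs]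
    simp only [← hl]
    rfl

theorem vertexAmp_flowOf (m : T.States) (v : T.Vertex) :
    vertexAmp v (flowOf m) = v.slice.amp (T.layerWeights m v.layer) := by
  obtain ⟨t, a, b, c, hs⟩ := v.slice.exists_vertex v.isVertex
  have hlab : cornerLabel v = v.slice.cornerLab := by
    funext c
    exact T.label_position v.sliceAt_eq _
  have hG : ∀ c, flowOf m (cornerPt v c) = v.slice.cornerOut (T.layerWeights m v.layer) c := by
    intro c
    exact flowOf_position m v.sliceAt_eq rfl
  have hpar : (cornerPt v 0).1.1 % 2 = 1 ↔ t = false := by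
    have h1 : (cornerPt v 0).1 = position v.layer (t, v.slice.left.length) := by
      change position v.layer (v.slice.corner 0) = _
      rw [v.slice.corner_eq hs]
      rfl
    have := (T.sliceAt_lt v.sliceAt_eq).1
    rw [h1]
    cases t <;> simp [position] <;> omega
  unfold vertexAmp vertexParity Slice.amp
  simp only [hlab, hG, hpar, hs]

theorem prod_vertexAmp_flowOf (m : T.States) :
    ∏ v : T.Vertex, vertexAmp v (flowOf m) = ∏ h ∈ range T.topLine, T.vertexNum m h := by
  classical
  refine prod_of_injOn (fun v => v.layer) ?_ ?_ ?_ ?_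
  · intro v _ w _ h
    exact Vertex.eq_of_layer h
  · intro v _
    have := T.sliceAt_lt v.sliceAt_eq
    simp only [coe_range, Set.mem_Iio]
    omega
  · intro h _ hn
    unfold vertexNum
    split
    · next L t a b c R hs =>
      exact absurd ⟨⟨h, _, hs, trivial⟩, mem_coe.2 (mem_univ _), rfl⟩ hn
    · rfl
  · intro v _
    rw [vertexAmp_flowOf, vertexNum]
    obtain ⟨h, s, hs, hv⟩ := v
    obtain ⟨L, P, R⟩ := s
    simp only [hs]
    cases P with
    | vertex t a b c => rfl
    | _ => exact hv.elim

open Classical in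
/-- The amplitude of a state. -/
theorem stateAmp_eq (m : T.States) :
    T.stateAmp m = if T.IsFlow (flowOf m) then flowAmp (flowOf m) else 0 := by
  rw [stateAmp_eq_prod]
  split_ifs with hm
  · rw [isFlow_flowOf_iff] at hm
    rw [flowAmp, turnDowns_flowOf, prod_vertexAmp_flowOf, sgn_natCast, ← prod_pow_eq_pow_sum,
      ← prod_mul_distrib]
    refine prod_congr rfl fun h _ => ?_
    unfold layerAmp turnNum vertexNum
    cases hs : T.sliceAt h with
    | none => simp
    | some s =>
      simp only [if_pos (hm h s hs)]
      obtain ⟨L, P, R⟩ := s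
      cases P with
      | turn t n => simp [Slice.amp]
      | cross a b => simp [Slice.amp]
      | vertex t a b c => simp
  · rw [isFlow_flowOf_iff] at hm
    push Not at hm
    obtain ⟨h, s, hs, hc⟩ := hm
    have := T.sliceAt_lt hs
    refine prod_eq_zero (mem_range.2 (show h < T.topLine by omega)) ?_
    rw [layerAmp, hs]
    exact if_neg hc

/-- Every flow belongs to a state. -/
theorem exists_flowOf {G : T.EdgePoint → ℕ} (hG : T.IsFlow G) : ∃ m : T.States, flowOf m = G := by
  classical
  let d : ℕ → ℕ → ℕ := fun h j =>
    if hp : j < (T.lines.getD h []).length then downs G ⟨(h, j), hp⟩ else 0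
  have hd : ∀ p : T.EdgePoint, d p.1.1 p.1.2 = downs G p := fun p => dif_pos p.2
  have hle : ∀ p, downs G p ≤ T.label p.1 := by
    intro p
    have := hG.le p
    unfold downs
    split_ifs <;> omega
  -- A state is built from its values on even lines; an odd line carries the weights of the even
  -- line below it.
  have heven : ∀ p : T.EdgePoint, p.1.1 % 2 = 0 → T.downsAt (T.ofDowns d) p.1.1 p.1.2 = downs G p := by
    intro p hp
    rw [← hd]
    refine T.downsAt_ofDowns hp ?_ p.2 ?_
    · have h1 := T.line_le p.2
      have h2 := T.topLine_odd
      omega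
    · rw [hd]
      exact hle p
  have hall : ∀ p : T.EdgePoint, T.downsAt (T.ofDowns d) p.1.1 p.1.2 = downs G p := by
    intro p
    rcases Nat.mod_two_eq_zero_or_one p.1.1 with hp | hp
    · exact heven p hp
    · obtain ⟨h1, h2⟩ := edge_line_a p
      have h3 := heven (T.edgeWiring.a p) (by omega)
      have h4 := hG.a p
      rw [downs, if_neg (by omega), h1] at h3
      rw [downs, if_pos hp, ← T.downsAt_oppLine]
      refine Eq.trans h3 ?_
      omega
  refine ⟨T.ofDowns d, funext fun p => ?_⟩
  have h1 := hall p
  have h2 := hG.le p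
  unfold flowOf
  rw [h1]
  unfold downs
  split_ifs <;> omega

theorem flowOf_injective : Function.Injective (flowOf (T := T)) := by
  intro m m' h
  refine T.states_ext fun k hk j hj => ?_
  let p : T.EdgePoint := ⟨(k, j), hj⟩
  have h1 := downs_flowOf m p
  rw [h, downs_flowOf m'] at h1
  exact h1.symm

end SpinNet

end Spin

/-! ### Transport of flows, and the equality of the functions -/

namespace Spin

open Finset

variable {A B : List ℕ}

namespace SpinNet

section

variable {T : SpinNet A B}

/-- The number of strands of a flow that are directed along the orientation of the edge. -/
def outNum (e : T.EdgePoint → Bool) (G : T.EdgePoint → ℕ) (p : T.EdgePoint) : ℕ :=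
  if e p then G p else T.label p.1 - G p

/-- The number of strands of a flow that are directed along the orientation of an edge. -/
noncomputable def edgeNum (e : T.EdgePoint → Bool) (G : T.EdgePoint → ℕ) (E : T.Edge) : ℕ :=
  outNum e G (edge_out E).choose

/-- The flow with a given number of strands directed along the orientation of each edge. -/
def edgeFlow (e : T.EdgePoint → Bool) (J : T.Edge → ℕ) (p : T.EdgePoint) : ℕ :=
  if e p then J (T.edgeOf p) else T.label p.1 - J (T.edgeOf p)

variable {e : T.EdgePoint → Bool}

/-- Along every arc the orientation changes its colour and the flow passes to the complement in the
label, so the number of strands directed with the edge stays the same. -/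
theorem outNum_eq (he : T.edgeWiring.Coloring e) {G : T.EdgePoint → ℕ} (hG : T.IsFlow G)
    {p q : T.EdgePoint} (h : T.edgeOf p = T.edgeOf q) : outNum e G p = outNum e G q := by
  have h1 := edgeOf_eq_iff.1 h
  unfold Wiring.Conn at h1
  induction h1 with
  | refl => rfl
  | @tail y z h2 h3 ih =>
    rw [ih (edgeOf_eq_iff.2 h2)]
    have h4 := hG.le y
    unfold outNum
    rcases h3 with rfl | rfl
    · have h5 := hG.a y
      rw [he.a, (edge_line_a y).1]
      cases e y <;> simp <;> omega
    · by_cases hy : T.edgeWiring.b y = y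
      · rw [hy]
      · have h5 := hG.b y hy
        rw [he.b y hy, (edge_line_b hy).1]
        cases e y <;> simp <;> omega

theorem outNum_le {G : T.EdgePoint → ℕ} (hG : T.IsFlow G) (p : T.EdgePoint) :
    outNum e G p ≤ T.label p.1 := by
  have := hG.le p
  unfold outNum
  split_ifs <;> omega

theorem edgeNum_edgeOf (he : T.edgeWiring.Coloring e) {G : T.EdgePoint → ℕ} (hG : T.IsFlow G)
    (p : T.EdgePoint) : edgeNum e G (T.edgeOf p) = outNum e G p :=
  outNum_eq he hG (edge_out (T.edgeOf p)).choose_spec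

theorem edgeFlow_edgeNum (he : T.edgeWiring.Coloring e) {G : T.EdgePoint → ℕ} (hG : T.IsFlow G) :
    edgeFlow e (edgeNum e G) = G := by
  funext p
  have := hG.le p
  unfold edgeFlow
  rw [edgeNum_edgeOf he hG]
  unfold outNum
  split_ifs <;> omega

theorem isFlow_edgeFlow (he : T.edgeWiring.Coloring e) {J : T.Edge → ℕ}
    (hJ : ∀ p, J (T.edgeOf p) ≤ T.label p.1) : T.IsFlow (edgeFlow e J) where
  a p := by
    have h1 := hJ p
    unfold edgeFlow
    rw [he.a, (edge_line_a p).1, ← edgeOf_eq_iff.2 (Wiring.conn_a p)]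
    cases e p <;> simp <;> omega
  b p hp := by
    have h1 := hJ p
    unfold edgeFlow
    rw [he.b p hp, (edge_line_b hp).1, ← edgeOf_eq_iff.2 (Wiring.conn_b p)]
    cases e p <;> simp <;> omega

theorem edgeNum_edgeFlow (he : T.edgeWiring.Coloring e) {J : T.Edge → ℕ}
    (hJ : ∀ p, J (T.edgeOf p) ≤ T.label p.1) : edgeNum e (edgeFlow e J) = J := by
  funext E
  obtain ⟨p, rfl⟩ := edge_out E
  have h1 := hJ p
  rw [edgeNum_edgeOf he (isFlow_edgeFlow he hJ)]
  unfold outNum edgeFlow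
  split_ifs <;> omega

theorem bottom_get (m : T.States) {j : ℕ} (hj : j < A.length) :
    (T.bottom m).get j = A.getD j 0 - flowOf m (bottomPt ⟨j, hj⟩) := by
  rw [← T.downsAt_zero, ← T.label_zero]
  exact (downs_flowOf m (bottomPt ⟨j, hj⟩)).symm

theorem top_get (m : T.States) {j : ℕ} (hj : j < B.length) :
    (T.top m).get j = flowOf m (topPt ⟨j, hj⟩) := by
  rw [← T.downsAt_top]
  refine (downs_flowOf m (topPt ⟨j, hj⟩)).symm.trans ?_
  exact if_pos T.topLine_odd

end

section

variable {T₁ T₂ : SpinNet A B} {e₁ : T₁.EdgePoint → Bool} {e₂ : T₂.EdgePoint → Bool}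

/-- The transport of a flow along a bijection of the edges. -/
noncomputable def moveFlow (e₁ : T₁.EdgePoint → Bool) (e₂ : T₂.EdgePoint → Bool)
    (ψ : T₂.Edge ≃ T₁.Edge) (G : T₁.EdgePoint → ℕ) : T₂.EdgePoint → ℕ :=
  edgeFlow e₂ fun E => edgeNum e₁ G (ψ E)

variable {ψ : T₂.Edge ≃ T₁.Edge} {G : T₁.EdgePoint → ℕ}

theorem edgeNum_le (he₁ : T₁.edgeWiring.Coloring e₁)
    (hψ : ∀ p q, T₁.edgeOf p = ψ (T₂.edgeOf q) → T₁.label p.1 = T₂.label q.1) (hG : T₁.IsFlow G)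
    (q : T₂.EdgePoint) : edgeNum e₁ G (ψ (T₂.edgeOf q)) ≤ T₂.label q.1 := by
  obtain ⟨p, hp⟩ := edge_out (ψ (T₂.edgeOf q))
  rw [← hp, edgeNum_edgeOf he₁ hG, ← hψ p q hp]
  exact outNum_le hG p

theorem isFlow_moveFlow (he₁ : T₁.edgeWiring.Coloring e₁) (he₂ : T₂.edgeWiring.Coloring e₂)
    (hψ : ∀ p q, T₁.edgeOf p = ψ (T₂.edgeOf q) → T₁.label p.1 = T₂.label q.1) (hG : T₁.IsFlow G) :
    T₂.IsFlow (moveFlow e₁ e₂ ψ G) :=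
  isFlow_edgeFlow he₂ (edgeNum_le he₁ hψ hG)

theorem moveFlow_moveFlow (he₁ : T₁.edgeWiring.Coloring e₁) (he₂ : T₂.edgeWiring.Coloring e₂)
    (hψ : ∀ p q, T₁.edgeOf p = ψ (T₂.edgeOf q) → T₁.label p.1 = T₂.label q.1) (hG : T₁.IsFlow G) :
    moveFlow e₂ e₁ ψ.symm (moveFlow e₁ e₂ ψ G) = G := by
  unfold moveFlow
  rw [edgeNum_edgeFlow he₂ (edgeNum_le he₁ hψ hG)]
  simp only [Equiv.apply_symm_apply]
  exact edgeFlow_edgeNum he₁ hG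

theorem moveFlow_eq (he₁ : T₁.edgeWiring.Coloring e₁) (hG : T₁.IsFlow G) {p : T₁.EdgePoint}
    {q : T₂.EdgePoint} (hpq : T₁.edgeOf p = ψ (T₂.edgeOf q)) (hl : T₁.label p.1 = T₂.label q.1)
    (he : e₂ q = e₁ p) : moveFlow e₁ e₂ ψ G q = G p := by
  conv_rhs => rw [← edgeFlow_edgeNum he₁ hG]
  simp only [moveFlow, edgeFlow, he, hpq, hl]

end

end SpinNet

open SpinNet

namespace TopEquiv

variable {T₁ T₂ : SpinNet A B} {φ : TopEquiv T₁ T₂} {σ₁ : T₁.Expansion} {σ₂ : T₂.Expansion}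

open Classical in
theorem _root_.Spin.SpinNet.coeff_fn_eq_sum_flow (T : SpinNet A B) (f : SymTensor A) (ν : Wt B) :
    coeff (T.fn f).1 ν = ∑ m ∈ univ.filter fun m : T.States => T.IsFlow (flowOf m),
      if T.top m = ν then flowAmp (flowOf m) * coeff f.1 (T.bottom m) else 0 := by
  rw [T.coeff_fn, sum_filter]
  refine sum_congr rfl fun m _ => ?_
  rw [stateAmp_eq]
  split_ifs <;> simp

theorem _root_.Spin.sgn_eq_pow (k₁ k₂ x₁ x₂ : ℕ) :
    sgn (k₁ + x₁ : ZMod 2) * sgn (k₂ + x₂ : ZMod 2) = (-1) ^ (k₁ + k₂ + (x₁ + x₂)) := by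
  rw [← sgn_add, ← sgn_natCast]
  congr 1
  push_cast
  ring

/-- The functions of equivalent networks are the same up to the sign of corresponding expansions. -/
theorem Lift.fn_eq (Λ : φ.Lift σ₁ σ₂) :
    T₁.fn = (-1 : ℂ) ^ ((T₁.kinks σ₁ + T₂.kinks σ₂) +
      (T₁.crossedExtrema σ₁ + T₂.crossedExtrema σ₂)) • T₂.fn := by
  classical
  obtain ⟨e₁, e₂, he₁, he₂, hee⟩ := φ.exists_colorings
  have hψ : ∀ p q, T₁.edgeOf p = φ.edge.symm (T₂.edgeOf q) → T₁.label p.1 = T₂.label q.1 :=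
    fun p q h => φ.label p q ((Equiv.eq_symm_apply _).1 h)
  have hψ' : ∀ p q, T₂.edgeOf p = φ.edge.symm.symm (T₁.edgeOf q) → T₂.label p.1 = T₁.label q.1 :=
    fun p q h => (φ.label q p h.symm).symm
  have hends : ∀ {G : T₁.EdgePoint → ℕ}, T₁.IsFlow G → ∀ x,
      moveFlow e₁ e₂ φ.edge.symm G (endPt (φ.ends x)) = G (endPt x) := by
    intro G hG x
    refine moveFlow_eq he₁ hG ?_ (φ.label_ends x) (hee x)
    rw [φ.edgeOf_ends, Equiv.symm_apply_apply]
  -- The number of strands directed along each edge is carried over by `φ`. This matches the states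
  -- that are flows, which are the only ones that contribute.
  choose g hg using fun m : {m : T₁.States // T₁.IsFlow (flowOf m)} =>
    exists_flowOf (isFlow_moveFlow he₁ he₂ hψ m.2)
  refine LinearMap.ext fun f => coeff_injective (funext fun ν => ?_)
  rw [LinearMap.smul_apply, Submodule.coe_smul, coeff_smul,
    T₁.coeff_fn_eq_sum_flow, T₂.coeff_fn_eq_sum_flow, mul_sum]
  refine sum_bij (fun m hm => g ⟨m, (mem_filter.1 hm).2⟩) ?_ ?_ ?_ ?_
  · intro m hm
    simp only [mem_filter, mem_univ, true_and] at hm ⊢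
    rw [hg]
    exact isFlow_moveFlow he₁ he₂ hψ hm
  · intro m hm m' hm' h
    simp only [mem_filter, mem_univ, true_and] at hm hm'
    refine flowOf_injective ?_
    rw [← moveFlow_moveFlow he₁ he₂ hψ hm, ← moveFlow_moveFlow he₁ he₂ hψ hm', ← hg ⟨m, hm⟩, h,
      hg ⟨m', hm'⟩]
  · intro m₂ hm₂
    simp only [mem_filter, mem_univ, true_and] at hm₂
    have hflow := isFlow_moveFlow he₂ he₁ hψ' hm₂
    obtain ⟨m₁, hm₁⟩ := exists_flowOf hflow
    rw [← hm₁] at hflow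
    refine ⟨m₁, by simpa using hflow, flowOf_injective ?_⟩
    rw [hg]
    simp only [hm₁]
    exact moveFlow_moveFlow he₂ he₁ hψ' hm₂
  · intro m hm
    simp only [mem_filter, mem_univ, true_and] at hm
    have hx := hends hm
    rw [← hg ⟨m, hm⟩] at hx
    have hfl : T₂.IsFlow (flowOf (g ⟨m, hm⟩)) := by
      rw [hg]
      exact isFlow_moveFlow he₁ he₂ hψ hm
    have h1 := Λ.flowAmp_eq he₁ he₂ hee hm hfl hx
    generalize g ⟨m, hm⟩ = m' at h1 hx
    -- Flows agree at the free ends, hence corresponding states have the same weights there and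
    -- enter the same matrix entry of the two functions.
    have hb : T₂.bottom m' = T₁.bottom m := by
      refine Wt.ext_get fun j hj => ?_
      rw [bottom_get _ hj, bottom_get _ hj]
      congr 1
      exact hx (.inr (.inl ⟨j, hj⟩))
    have ht : T₂.top m' = T₁.top m := by
      refine Wt.ext_get fun j hj => ?_
      rw [top_get _ hj, top_get _ hj]
      exact hx (.inr (.inr ⟨j, hj⟩))
    rw [hb, ht, ← sgn_eq_pow]
    split_ifs
    · have h2 := sgn_mul_self (T₁.kinks σ₁ + T₁.crossedExtrema σ₁ : ZMod 2)
      linear_combination coeff f.1 (T₁.bottom m) *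
        (sgn (T₁.kinks σ₁ + T₁.crossedExtrema σ₁ : ZMod 2) * h1 - flowAmp (flowOf m) * h2)
    · simp

end TopEquiv

end Spin

/-! ### Existence of corresponding expansions -/

namespace Spin

open Finset SpinNet

/-- A number below `n`, or its mirror image. -/
def flipIdx (o : Bool) (n k : ℕ) : ℕ := if o then n - 1 - k else k

theorem flipIdx_lt {o : Bool} {n k : ℕ} (h : k < n) : flipIdx o n k < n := by
  unfold flipIdx
  split_ifs <;> omega

theorem flipIdx_flipIdx (o o' : Bool) {n k : ℕ} (h : k < n) :
    flipIdx o n (flipIdx o' n k) = flipIdx (xor o o') n k := by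
  cases o <;> cases o' <;> simp [flipIdx] <;> omega

theorem flipIdx_inj {o : Bool} {n k k' : ℕ} (h : k < n) (h' : k' < n)
    (hk : flipIdx o n k = flipIdx o n k') : k = k' := by
  cases o <;> simp [flipIdx] at hk <;> omega

/-- Whether two strands are joined at a vertex with labels `n`, if the strands at each corner are
numbered counterclockwise around the vertex. -/
def VertexJoins (n : Fin 3 → ℕ) (c c' : Fin 3) (k k' : ℕ) : Prop :=
  (c' = c + 1 ∧ k + k' + 1 = n c ∧ k' < thruAt n c) ∨
    (c = c' + 1 ∧ k + k' + 1 = n c' ∧ k < thruAt n c')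

/-- Counting the strands at the corner `2` from the right makes the three corners alike: the last
strands at a corner are joined, in reversed order, to the first strands at the next corner. -/
theorem vertexArcs_iff (l : ℕ) (t : Bool) {a b d : ℕ} (hadm : AdmissibleTriple a b d) {c c' : Fin 3}
    {i i' : ℕ} {n : Fin 3 → ℕ} (hn : n = ![a, b, d]) {e : Fin 3 → Bool × ℕ}
    (he : e = ![(t, l), (t, l + 1), (!t, l)]) (hi : i < n c) (hi' : i' < n c') :
    ((((e c).1, (e c).2, i), ((e c').1, (e c').2, i')) ∈ (Piece.vertex t a b d).strandArcs l ∨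
      (((e c').1, (e c').2, i'), ((e c).1, (e c).2, i)) ∈ (Piece.vertex t a b d).strandArcs l) ↔
    VertexJoins n c c' (flipIdx (decide (c = 2)) (n c) i) (flipIdx (decide (c' = 2)) (n c') i') := by
  subst hn he
  obtain ⟨e1, e2, e3⟩ := hadm.thru_add
  have z0 : thruAt ![a, b, d] 0 = thru d a b := rfl
  have z1 : thruAt ![a, b, d] 1 = thru a b d := rfl
  have z2 : thruAt ![a, b, d] 2 = thru b a d := by
    change thru b d a = _
    rw [thru, thru, Nat.add_comm]
  rw [Slice.mem_vertexArcs, Slice.mem_vertexArcs]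
  generalize thru b a d = x at *
  generalize thru a b d = y at *
  generalize thru d a b = z at *
  fin_cases t <;> fin_cases c <;> fin_cases c' <;>
    simp [legArc, VertexJoins, flipIdx, z0, z1, z2] at hi hi' ⊢ <;>
    first
    | omega
    | exact ⟨by rintro ⟨j, hj, h1, h2⟩; omega, fun h => ⟨i - x, by omega⟩⟩
    | exact ⟨by rintro ⟨j, hj, h1, h2⟩; omega, fun h => ⟨i' - x, by omega⟩⟩

/-- Rotations respect the cyclic rule. A reflection exchanges the next and the previous corner, and
reversing the numbering exchanges first and last strands, so that the rule is restored. -/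
theorem vertexJoins_perm (e : Equiv.Perm (Fin 3)) {n n' : Fin 3 → ℕ} (hn : ∀ c, n' (e c) = n c)
    {c c' : Fin 3} {k k' : ℕ} (hk : k < n c) (hk' : k' < n c') :
    VertexJoins n' (e c) (e c') (flipIdx (decide (e 1 ≠ e 0 + 1)) (n c) k)
      (flipIdx (decide (e 1 ≠ e 0 + 1)) (n c') k') ↔ VertexJoins n c c' k k' := by
  unfold VertexJoins
  rcases perm_three e with he | he
  · have h0 : decide (e 1 ≠ e 0 + 1) = false := by simpa using he 0
    rw [h0]
    simp only [flipIdx, Bool.false_eq_true, if_false, ← he, e.injective.eq_iff, hn,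
      thruAt_rotate he hn]
  · have h0 : decide (e 1 ≠ e 0 + 1) = true := by
      have h1 : e 1 + 1 = e 0 := he 0
      rw [decide_eq_true_iff, ← h1]
      generalize e 1 = x
      revert x
      decide
    have h2 : ∀ {c c' : Fin 3}, e c = e c' + 1 ↔ c' = c + 1 := by
      intro c c'
      rw [← he c, add_left_inj, e.injective.eq_iff, eq_comm]
    simp only [h0, flipIdx, if_true, h2, hn]
    rw [or_comm]
    refine or_congr (and_congr_right ?_) (and_congr_right ?_)
    · rintro rfl
      rw [thruAt_reflect he hn]
      omega
    · rintro rfl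
      rw [thruAt_reflect he hn]
      omega

variable {A B : List ℕ}

namespace SpinNet

variable {T : SpinNet A B} {w : ℕ × ℕ → Bool}

theorem label_eq_of_edgeOf {p q : T.EdgePoint} (h : T.edgeOf p = T.edgeOf q) :
    T.label p.1 = T.label q.1 := by
  have h1 := edgeOf_eq_iff.1 h
  unfold Wiring.Conn at h1
  induction h1 with
  | refl => rfl
  | @tail y z h2 h3 ih =>
    rw [ih (edgeOf_eq_iff.2 h2)]
    rcases h3 with rfl | rfl
    · exact (edge_line_a y).1.symm
    · by_cases hy : T.edgeWiring.b y = y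
      · rw [hy]
      · exact (edge_line_b hy).1.symm

/-- The number of a strand within its edge, counted from the left, or from the right where `w` says
so. -/
def rank (w : ℕ × ℕ → Bool) (q : T.StrandPoint) : ℕ :=
  flipIdx (w q.toEdgePoint.1) (T.label q.toEdgePoint.1) q.1.2.2

theorem rank_lt (q : T.StrandPoint) : rank w q < T.label q.toEdgePoint.1 := flipIdx_lt q.2.2

theorem exists_rank (p : T.EdgePoint) {k : ℕ} (hk : k < T.label p.1) :
    ∃ q : T.StrandPoint, q.toEdgePoint = p ∧ rank w q = k := by
  refine ⟨strandPt p ⟨flipIdx (w p.1) _ k, flipIdx_lt hk⟩, rfl, ?_⟩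
  change flipIdx (w p.1) (T.label p.1) (flipIdx (w p.1) (T.label p.1) k) = k
  rw [flipIdx_flipIdx _ _ hk, Bool.xor_self]
  rfl

theorem eq_of_rank_eq {q r : T.StrandPoint} (h : q.toEdgePoint = r.toEdgePoint)
    (hr : rank w q = rank w r) : q = r := by
  have h1 := congrArg Subtype.val h
  rw [toEdgePoint_val, toEdgePoint_val] at h1
  have h2 := r.2.2
  unfold rank at hr
  rw [h] at hr
  have h3 : q.1.2.2 < T.label r.toEdgePoint.1 := h ▸ q.2.2
  have h4 := flipIdx_inj h3 h2 hr
  exact Subtype.ext (Prod.ext (congrArg Prod.fst h1 :) (Prod.ext (congrArg Prod.snd h1 :) h4))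

variable (T w) in
/-- The expansion that reverses the order of the strands between places where `w` differs. -/
def flipExpansion : T.Expansion :=
  T.ofPerms fun h j => if xor (w (h, j)) (w (h + 1, j)) then Fin.revPerm else 1

theorem app_flip {L : List ℕ} {σ : EdgePerm L} {j i : ℕ} {o : Bool} (hj : j < L.length)
    (hi : i < L.getD j 0) (hσ : σ ⟨j, hj⟩ = if o then Fin.revPerm else 1) :
    EdgePerm.app σ (j, i) = flipIdx o (L.getD j 0) i := by
  have h2 : L.getD j 0 = L[j] := by simp [hj]
  rw [h2] at hi ⊢
  rw [EdgePerm.app_of_lt σ hj hi, hσ]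
  cases o
  · rfl
  · simp [flipIdx]
    omega

/-- The permutation reverses the order of the strands exactly where the side from which they are
counted changes. -/
theorem rank_a_of_even {q : T.StrandPoint} (hq : q.1.1 % 2 = 0) :
    rank w ((T.segmentWiring (T.flipExpansion w)).a q) = rank w q := by
  have hle := T.line_le q.2.1
  have hodd := T.topLine_odd
  have h1 : ((T.segmentWiring (T.flipExpansion w)).a q).1 = (q.1.1 + 1, q.1.2.1,
      flipIdx (xor (w (q.1.1, q.1.2.1)) (w (q.1.1 + 1, q.1.2.1))) (T.label (q.1.1, q.1.2.1)) q.1.2.2) := by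
    change T.permMate _ q.1 = _
    unfold permMate
    rw [if_pos hq, oppLine, if_pos hq]
    refine Prod.ext rfl (Prod.ext rfl ?_)
    refine app_flip q.2.1 q.2.2 ?_
    rw [flipExpansion, permAt_ofPerms T _ hq (by omega)]
  have h2 : T.label (q.1.1 + 1, q.1.2.1) = T.label (q.1.1, q.1.2.1) := by
    rw [← T.label_oppLine q.1.1, oppLine, if_pos hq]
  unfold rank
  rw [toEdgePoint_val, toEdgePoint_val, h1]
  simp only
  rw [h2, flipIdx_flipIdx _ _ q.2.2]
  congr 1
  cases w (q.1.1, q.1.2.1) <;> cases w (q.1.1 + 1, q.1.2.1) <;> rfl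

theorem rank_a (q : T.StrandPoint) :
    rank w ((T.segmentWiring (T.flipExpansion w)).a q) = rank w q := by
  rcases Nat.mod_two_eq_zero_or_one q.1.1 with hq | hq
  · exact rank_a_of_even hq
  · have h1 : ((T.segmentWiring (T.flipExpansion w)).a q).1.1 % 2 = 0 := by
      change oppLine q.1.1 % 2 = 0
      unfold oppLine
      split_ifs <;> omega
    have h2 := rank_a_of_even (w := w) h1
    rwa [Wiring.a_a, eq_comm] at h2

variable (T) in
/-- The places where the order of the strands is counted from the right are compatible with the cups
and caps of edges. -/
def FlipRule (w : ℕ × ℕ → Bool) : Prop := ∀ p : T.EdgePoint, T.edgeWiring.b p ≠ p →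
  w (T.edgeWiring.b p).1 = xor (w p.1) (decide ((T.edgeWiring.b p).1.1 = p.1.1))

/-- A cup or cap of an edge is expanded into nested strands and reverses their order; there
`FlipRule` changes the side of counting. Elsewhere neither changes. -/
theorem rank_b (hw : T.FlipRule w) {σ : T.Expansion} (q : T.StrandPoint) :
    rank w ((T.segmentWiring σ).b q) = rank w q := by
  by_cases hb : T.edgeWiring.b q.toEdgePoint = q.toEdgePoint
  · rw [(segment_end_iff q).2 ((edge_end_iff _).1 hb)]
  have hrule := hw _ hb
  have hlab := (edge_line_b hb).1
  unfold rank
  rw [toEdgePoint_b, hrule, hlab]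
  rcases position_cases q.toEdgePoint with ⟨-, h⟩ | ⟨h, s, E, hs, hE, hv, hh, hadm, -, -⟩
  · exact absurd h hb
  have hq : q.1 = position h (E.1, E.2, q.1.2.2) :=
    Prod.ext (congrArg Prod.fst hE :) (Prod.ext (congrArg Prod.snd hE :) rfl)
  have h1 := segmentWiring_b (σ := σ) q
  have h2 := edgeWiring_b q.toEdgePoint
  rw [hE, T.sliceMate_position _ hs] at h2
  rw [hq, T.sliceMate_position _ hs] at h1
  have hnc : ¬ s.IsCorner E := by
    intro hc
    rw [edgeMate_of_isCorner hc, ← hE] at h2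
    exact hb (Subtype.ext h2)
  have h3 : ((T.segmentWiring σ).b q).1.2.2 =
      if (s.edgeMate E).1 = E.1 then s.lab E.1 E.2 - 1 - q.1.2.2 else q.1.2.2 := by
    rw [h1, Slice.segmentMate, if_neg hnc]
    rfl
  have h4 : (T.edgeWiring.b q.toEdgePoint).1.1 = q.toEdgePoint.1.1 ↔ (s.edgeMate E).1 = E.1 := by
    rw [h2, hE]
    simp only [position, Nat.add_left_cancel_iff]
    cases (s.edgeMate E).1 <;> cases E.1 <;> simp
  have h5 : T.label q.toEdgePoint.1 = s.lab E.1 E.2 := by rw [hE, T.label_position hs]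
  have h6 : q.1.2.2 < s.lab E.1 E.2 := h5 ▸ q.2.2
  rw [h3, h5]
  by_cases h7 : (s.edgeMate E).1 = E.1
  · rw [if_pos h7, decide_eq_true (h4.2 h7)]
    cases w q.toEdgePoint.1 <;> simp [flipIdx] <;> omega
  · rw [if_neg h7, decide_eq_false (fun h => h7 (h4.1 h)), Bool.xor_false]

theorem rank_eq_of_segmentOf (hw : T.FlipRule w) {q r : T.StrandPoint}
    (h : T.segmentOf (T.flipExpansion w) q = T.segmentOf _ r) : rank w q = rank w r := by
  have h1 := segmentOf_eq_iff.1 h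
  unfold Wiring.Conn at h1
  induction h1 with
  | refl => rfl
  | @tail y z h2 h3 ih =>
    rw [ih (segmentOf_eq_iff.2 h2)]
    rcases h3 with rfl | rfl
    · exact (rank_a y).symm
    · exact (rank_b hw y).symm

theorem exists_segment_over (σ : T.Expansion) (q : T.StrandPoint) {p : T.EdgePoint}
    (h : T.edgeOf q.toEdgePoint = T.edgeOf p) :
    ∃ r : T.StrandPoint, r.toEdgePoint = p ∧ T.segmentOf σ q = T.segmentOf σ r := by
  have h1 := edgeOf_eq_iff.1 h
  unfold Wiring.Conn at h1
  induction h1 with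
  | refl => exact ⟨q, rfl, rfl⟩
  | @tail y z h2 h3 ih =>
    obtain ⟨r, rfl, hr⟩ := ih (edgeOf_eq_iff.2 h2)
    rcases h3 with rfl | rfl
    · exact ⟨_, toEdgePoint_a (σ := σ) r, hr.trans (segmentOf_eq_iff.2 (Wiring.conn_a r))⟩
    · exact ⟨_, toEdgePoint_b (σ := σ) r, hr.trans (segmentOf_eq_iff.2 (Wiring.conn_b r))⟩

/-- The rank is constant along a segment, and a segment passes over every point of its edge. So in
these expansions a segment is the same as an edge together with a rank. -/
theorem segmentOf_eq_iff_rank (hw : T.FlipRule w) {q r : T.StrandPoint} :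
    T.segmentOf (T.flipExpansion w) q = T.segmentOf _ r ↔
      T.edgeOf q.toEdgePoint = T.edgeOf r.toEdgePoint ∧ rank w q = rank w r := by
  constructor
  · intro h
    exact ⟨edgeOf_eq_iff.2 (segment_conn_edge (segmentOf_eq_iff.1 h)), rank_eq_of_segmentOf hw h⟩
  · rintro ⟨h1, h2⟩
    obtain ⟨r', hr', h3⟩ := exists_segment_over (T.flipExpansion w) q h1
    rw [h3, eq_of_rank_eq (w := w) hr' ((rank_eq_of_segmentOf hw h3).symm.trans h2)]

/-- The rule relates only the two ends of an arc in a slice, and the ends of edges are on no such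
arc. Their values are free; elsewhere it is enough to mark the left end of every cup and cap. -/
theorem exists_flipRule (f : T.EndIdx → Bool) : ∃ w, T.FlipRule w ∧ ∀ x, w (endPt x).1 = f x := by
  classical
  let w : ℕ × ℕ → Bool := fun y => if h : ∃ x : T.EndIdx, (endPt x).1 = y then f h.choose else
    decide (∃ p : T.EdgePoint, p.1 = y ∧ EdgeTurn p)
  have hw : ∀ p : T.EdgePoint, T.edgeWiring.b p ≠ p → w p.1 = decide (EdgeTurn p) := by
    intro p hp
    have h1 : ¬ ∃ x : T.EndIdx, (endPt x).1 = p.1 := by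
      rintro ⟨x, hx⟩
      exact hp ((edge_end_iff p).2 ⟨x, Subtype.ext hx⟩)
    simp only [w]
    rw [dif_neg h1]
    congr 1
    refine propext ⟨?_, fun h => ⟨p, rfl, h⟩⟩
    rintro ⟨q, hq, h⟩
    rwa [Subtype.ext hq] at h
  refine ⟨w, fun p hp => ?_, fun x => ?_⟩
  · have hbb : T.edgeWiring.b (T.edgeWiring.b p) = p := T.edgeWiring.b_b p
    have hp' : T.edgeWiring.b (T.edgeWiring.b p) ≠ T.edgeWiring.b p := by
      rw [hbb]
      exact hp.symm
    have h1 := (edge_line_b hp).2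
    rw [hw p hp, hw _ hp']
    unfold EdgeTurn
    rw [hbb]
    by_cases h2 : (T.edgeWiring.b p).1.1 = p.1.1
    · rcases h1 with h1 | h1
      · by_cases h3 : p.1.2 < (T.edgeWiring.b p).1.2
        · simp [h2, h3, hp, hp.symm, not_lt.2 h3.le]
        · have h4 : (T.edgeWiring.b p).1.2 < p.1.2 := by omega
          simp [h2, h3, h4, hp, hp.symm]
      · rw [h2] at h1
        exact absurd rfl h1
    · simp [h2, Ne.symm h2, eq_comm]
  · have h : ∃ y : T.EndIdx, (endPt y).1 = (endPt x).1 := ⟨x, rfl⟩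
    simp only [w]
    rw [dif_pos h, endPt_injective (Subtype.ext h.choose_spec)]

theorem cornerLabel_eq {v : T.Vertex} {t : Bool} {a b d : ℕ} (hs : v.slice.piece = .vertex t a b d) :
    cornerLabel v = ![a, b, d] := by
  obtain ⟨la, lb, lc, -, -⟩ := v.slice.vertex_lab hs
  funext c
  refine (T.label_position v.sliceAt_eq _).trans ?_
  rw [v.slice.corner_eq hs]
  fin_cases c
  · exact la
  · exact lb
  · exact lc

theorem joined_iff_vertexJoins {σ : T.Expansion} {v : T.Vertex} {c c' : Fin 3} {S S' : T.Segment σ} :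
    T.Joined σ v c c' S S' ↔ ∃ r r' : T.StrandPoint, r.toEdgePoint = cornerPt v c ∧
      r'.toEdgePoint = cornerPt v c' ∧ T.segmentOf σ r = S ∧ T.segmentOf σ r' = S' ∧
      VertexJoins (cornerLabel v) c c' (flipIdx (decide (c = 2)) (cornerLabel v c) r.1.2.2)
        (flipIdx (decide (c' = 2)) (cornerLabel v c') r'.1.2.2) := by
  obtain ⟨t, a, b, d, hs⟩ := v.slice.exists_vertex v.isVertex
  have hadm := T.sliceAt_admissible v.sliceAt_eq
  rw [hs] at hadm
  have key : ∀ {r r' : T.StrandPoint}, r.toEdgePoint = cornerPt v c → r'.toEdgePoint = cornerPt v c' →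
      _ := fun {r r'} hr hr' => vertexArcs_iff v.slice.left.length t hadm (cornerLabel_eq hs)
        (funext fun c => v.slice.corner_eq hs c) (show r.1.2.2 < cornerLabel v c by
          rw [cornerLabel, ← hr]; exact r.2.2) (show r'.1.2.2 < cornerLabel v c' by
          rw [cornerLabel, ← hr']; exact r'.2.2)
  rw [← hs] at key
  constructor
  · rintro ⟨p, p', hpp, h1, h2, ⟨r, hr, hS⟩, ⟨r', hr', hS'⟩⟩
    have e1 : r.toEdgePoint = cornerPt v c := by
      refine Subtype.ext ?_
      rw [toEdgePoint_val, hr]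
      change _ = position v.layer (v.slice.corner c)
      rw [← h1]
      rfl
    have e2 : r'.toEdgePoint = cornerPt v c' := by
      refine Subtype.ext ?_
      rw [toEdgePoint_val, hr']
      change _ = position v.layer (v.slice.corner c')
      rw [← h2]
      rfl
    refine ⟨r, r', e1, e2, hS, hS', (key e1 e2).1 ?_⟩
    rw [← h1, ← h2, hr, hr']
    exact hpp
  · rintro ⟨r, r', e1, e2, hS, hS', hJ⟩
    have h1 := congrArg Subtype.val e1
    have h2 := congrArg Subtype.val e2
    refine ⟨_, _, (key e1 e2).2 hJ, rfl, rfl, ⟨r, ?_, hS⟩, ⟨r', ?_, hS'⟩⟩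
    · exact Prod.ext (congrArg Prod.fst h1 :) (Prod.ext (congrArg Prod.snd h1 :) rfl)
    · exact Prod.ext (congrArg Prod.fst h2 :) (Prod.ext (congrArg Prod.snd h2 :) rfl)

/-- The value of `w` at the corners is the correction of `vertexArcs_iff` at the corner `2`,
combined with a common reversal `o` of the numbering at all three corners. -/
theorem joined_iff_rank (hw : T.FlipRule w) {v : T.Vertex} {o : Bool}
    (hv : ∀ c, w (cornerPt v c).1 = xor (decide (c = 2)) o) {c c' : Fin 3} {q q' : T.StrandPoint} :
    T.Joined (T.flipExpansion w) v c c' (T.segmentOf _ q) (T.segmentOf _ q') ↔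
      T.edgeOf q.toEdgePoint = T.edgeOf (cornerPt v c) ∧
      T.edgeOf q'.toEdgePoint = T.edgeOf (cornerPt v c') ∧
      VertexJoins (cornerLabel v) c c' (flipIdx o (cornerLabel v c) (rank w q))
        (flipIdx o (cornerLabel v c') (rank w q')) := by
  have key : ∀ {r : T.StrandPoint} {c : Fin 3}, r.toEdgePoint = cornerPt v c →
      flipIdx o (cornerLabel v c) (rank w r) =
        flipIdx (decide (c = 2)) (cornerLabel v c) r.1.2.2 := by
    intro r c hr
    have h1 : r.1.2.2 < cornerLabel v c := by
      rw [cornerLabel, ← hr]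
      exact r.2.2
    unfold rank
    rw [hr, hv]
    refine (flipIdx_flipIdx _ _ h1).trans ?_
    congr 1
    cases o <;> simp
  rw [joined_iff_vertexJoins]
  constructor
  · rintro ⟨r, r', h1, h2, hS, hS', hJ⟩
    rw [segmentOf_eq_iff_rank hw] at hS hS'
    rw [← key h1, ← key h2, hS.2, hS'.2] at hJ
    exact ⟨by rw [← hS.1, h1], by rw [← hS'.1, h2], hJ⟩
  · rintro ⟨h1, h2, hJ⟩
    obtain ⟨r, hr, hrk⟩ := exists_rank (w := w) (cornerPt v c)
      ((rank_lt (w := w) q).trans_eq (label_eq_of_edgeOf h1))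
    obtain ⟨r', hr', hrk'⟩ := exists_rank (w := w) (cornerPt v c')
      ((rank_lt (w := w) q').trans_eq (label_eq_of_edgeOf h2))
    refine ⟨r, r', hr, hr', (segmentOf_eq_iff_rank hw).2 ⟨by rw [hr, h1], hrk⟩,
      (segmentOf_eq_iff_rank hw).2 ⟨by rw [hr', h2], hrk'⟩, ?_⟩
    rwa [← key hr, ← key hr', hrk, hrk']

end SpinNet

namespace TopEquiv

variable {T₁ T₂ : SpinNet A B} (φ : TopEquiv T₁ T₂)

/-- The bijection follows `φ` on edges and keeps the rank. -/
theorem exists_segmentEquiv {w₁ w₂ : ℕ × ℕ → Bool} (h₁ : T₁.FlipRule w₁) (h₂ : T₂.FlipRule w₂) :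
    ∃ ψ : T₁.Segment (T₁.flipExpansion w₁) ≃ T₂.Segment (T₂.flipExpansion w₂), ∀ q r,
      ψ (T₁.segmentOf _ q) = T₂.segmentOf _ r ↔
        φ.edge (T₁.edgeOf q.toEdgePoint) = T₂.edgeOf r.toEdgePoint ∧ rank w₁ q = rank w₂ r := by
  choose rep hrep using fun S : T₁.Segment (T₁.flipExpansion w₁) => segment_out S
  have hex : ∀ q : T₁.StrandPoint, ∃ r : T₂.StrandPoint,
      φ.edge (T₁.edgeOf q.toEdgePoint) = T₂.edgeOf r.toEdgePoint ∧ rank w₁ q = rank w₂ r := by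
    intro q
    obtain ⟨p, hp⟩ := edge_out (φ.edge (T₁.edgeOf q.toEdgePoint))
    obtain ⟨r, rfl, hr⟩ := exists_rank (w := w₂) p
      ((rank_lt (w := w₁) q).trans_eq (φ.label _ _ hp.symm))
    exact ⟨r, hp.symm, hr.symm⟩
  choose g hg using hex
  have key : ∀ q r, T₂.segmentOf (T₂.flipExpansion w₂) (g (rep (T₁.segmentOf _ q))) = T₂.segmentOf _ r ↔
      φ.edge (T₁.edgeOf q.toEdgePoint) = T₂.edgeOf r.toEdgePoint ∧ rank w₁ q = rank w₂ r := by
    intro q r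
    obtain ⟨h3, h4⟩ := (segmentOf_eq_iff_rank h₁).1 (hrep (T₁.segmentOf _ q))
    obtain ⟨h5, h6⟩ := hg (rep (T₁.segmentOf (T₁.flipExpansion w₁) q))
    rw [segmentOf_eq_iff_rank h₂, ← h5, ← h6, h3, h4]
  refine ⟨Equiv.ofBijective (fun S => T₂.segmentOf _ (g (rep S))) ⟨?_, ?_⟩, key⟩
  · intro S S' h
    obtain ⟨q, rfl⟩ := segment_out S
    obtain ⟨q', rfl⟩ := segment_out S'
    obtain ⟨r, hr⟩ := segment_out (T₂.segmentOf (T₂.flipExpansion w₂) (g (rep (T₁.segmentOf _ q'))))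
    have h3 := (key q r).1 (Eq.trans h hr.symm)
    have h4 := (key q' r).1 hr.symm
    exact (segmentOf_eq_iff_rank h₁).2
      ⟨φ.edge.injective (h3.1.trans h4.1.symm), h3.2.trans h4.2.symm⟩
  · intro S
    obtain ⟨r, rfl⟩ := segment_out S
    obtain ⟨p, hp⟩ := edge_out (φ.edge.symm (T₂.edgeOf r.toEdgePoint))
    have hp' : φ.edge (T₁.edgeOf p) = T₂.edgeOf r.toEdgePoint := by rw [hp, Equiv.apply_symm_apply]
    obtain ⟨q, rfl, hq⟩ := exists_rank (w := w₁) p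
      ((rank_lt (w := w₂) r).trans_eq (φ.label _ _ hp').symm)
    exact ⟨T₁.segmentOf _ q, (key q r).2 ⟨hp', hq⟩⟩

/-- Equivalent networks have corresponding expansions. -/
theorem exists_lift : ∃ (σ₁ : T₁.Expansion) (σ₂ : T₂.Expansion), Nonempty (φ.Lift σ₁ σ₂) := by
  -- This records whether `φ` reverses the cyclic order of the corners at `v`. If so, the strands at
  -- the corresponding vertex of `T₂` are counted in the other direction. At the free ends both
  -- networks count from the left, so that the free ends of strands are respected.
  let o : T₁.Vertex → Bool := fun v => decide (φ.corner v 1 ≠ φ.corner v 0 + 1)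
  obtain ⟨w₁, h₁, he₁⟩ := T₁.exists_flipRule (Sum.elim (fun x => decide (x.2 = 2)) fun _ => false)
  obtain ⟨w₂, h₂, he₂⟩ := T₂.exists_flipRule
    (Sum.elim (fun x => xor (decide (x.2 = 2)) (o (φ.vertex.symm x.1))) fun _ => false)
  obtain ⟨ψ, hψ⟩ := φ.exists_segmentEquiv h₁ h₂
  have hfree : ∀ (x : Fin A.length ⊕ Fin B.length) {q : T₁.StrandPoint} {r : T₂.StrandPoint},
      q.toEdgePoint = endPt (.inr x) → r.toEdgePoint = endPt (.inr x) → q.1.2.2 = r.1.2.2 →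
      T₂.segmentOf _ r = ψ (T₁.segmentOf _ q) := by
    intro x q r hq hr hi
    refine ((hψ q r).2 ⟨?_, ?_⟩).symm
    · rw [hq, hr]
      exact (φ.edgeOf_ends (.inr x)).symm
    · unfold rank
      rw [hq, hr, he₁, he₂]
      exact hi
  refine ⟨T₁.flipExpansion w₁, T₂.flipExpansion w₂, ⟨⟨ψ, fun p q h => ((hψ p q).1 h).1, ?_, ?_, ?_⟩⟩⟩
  · rintro j i S ⟨q, hq, rfl⟩
    have h3 := q.2
    rw [hq] at h3
    simp only [T₁.line_zero, T₁.label_zero] at h3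
    refine ⟨⟨(0, j, i), ?_⟩, rfl, hfree (.inl ⟨j, h3.1⟩) ?_ ?_ ?_⟩
    · simpa only [T₂.line_zero, T₂.label_zero] using h3
    · refine Subtype.ext ?_
      rw [toEdgePoint_val, hq]
      rfl
    · rfl
    · rw [hq]
  · rintro j i S ⟨q, hq, rfl⟩
    have h3 := q.2
    rw [hq] at h3
    simp only [T₁.line_top, T₁.label_top] at h3
    refine ⟨⟨(T₂.topLine, j, i), ?_⟩, rfl, hfree (.inr ⟨j, h3.1⟩) ?_ ?_ ?_⟩
    · simpa only [T₂.line_top, T₂.label_top] using h3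
    · refine Subtype.ext ?_
      rw [toEdgePoint_val, hq]
      rfl
    · rfl
    · rw [hq]
  · intro v c c' S S'
    obtain ⟨q, rfl⟩ := segment_out S
    obtain ⟨q', rfl⟩ := segment_out S'
    obtain ⟨r, hr⟩ := segment_out (ψ (T₁.segmentOf _ q))
    obtain ⟨r', hr'⟩ := segment_out (ψ (T₁.segmentOf _ q'))
    obtain ⟨h3, h4⟩ := (hψ q r).1 hr.symm
    obtain ⟨h5, h6⟩ := (hψ q' r').1 hr'.symm
    have hv₁ : ∀ c, w₁ (cornerPt v c).1 = xor (decide (c = 2)) false := fun c => by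
      rw [Bool.xor_false]
      exact he₁ (.inl (v, c))
    have hv₂ : ∀ c, w₂ (cornerPt (φ.vertex v) c).1 = xor (decide (c = 2)) (o v) := fun c => by
      refine (he₂ (.inl (φ.vertex v, c))).trans ?_
      simp
    have hedge : ∀ c, T₂.edgeOf (cornerPt (φ.vertex v) (φ.corner v c)) =
        φ.edge (T₁.edgeOf (cornerPt v c)) := fun c => φ.edgeOf_ends (.inl (v, c))
    have hlab : ∀ c, cornerLabel (φ.vertex v) (φ.corner v c) = cornerLabel v c :=
      fun c => (φ.label_ends (.inl (v, c))).symm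
    rw [← hr, ← hr', joined_iff_rank h₁ hv₁, joined_iff_rank h₂ hv₂, ← h3, ← h5, hedge, hedge,
      φ.edge.injective.eq_iff, φ.edge.injective.eq_iff, hlab, hlab, ← h4, ← h6]
    refine and_congr_right fun h7 => and_congr_right fun h8 => ?_
    -- The reversal chosen at the vertex is exactly the one that `vertexJoins_perm` requires.
    exact (vertexJoins_perm (φ.corner v) hlab ((rank_lt (w := w₁) q).trans_eq (label_eq_of_edgeOf h7))
      ((rank_lt (w := w₁) q').trans_eq (label_eq_of_edgeOf h8))).symm

end TopEquiv

end Spin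

theorem propositionp {A B : List ℕ} (T₁ T₂ : Spin.SpinNet A B) (φ : Spin.TopEquiv T₁ T₂) :
    (∃ (σ₁ : T₁.Expansion) (σ₂ : T₂.Expansion), Nonempty (φ.Lift σ₁ σ₂)) ∧
    ∀ (σ₁ : T₁.Expansion) (σ₂ : T₂.Expansion), Nonempty (φ.Lift σ₁ σ₂) →
      T₁.fn = (-1 : ℂ) ^ ((T₁.kinks σ₁ + T₂.kinks σ₂) +
        (T₁.crossedExtrema σ₁ + T₂.crossedExtrema σ₂)) • T₂.fn := by
  exact ⟨φ.exists_lift, fun σ₁ σ₂ ⟨Λ⟩ => Λ.fn_eq⟩
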